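/- Let $\mathcal V$ be a cosmos, that is, a complete and cocomplete symmetric monoidal closed category with tensor product $\otimes$ and unit $\mathbf 1$; let $\bar{\mathcal V}$ denote $\mathcal V$ regarded as a $\mathcal V$-category. Let $\mathcal C=(\mathcal C,\boxtimes,I)$ be a small monoidal $\mathcal V$-category, and let $\mathcal M,\mathcal N$ be small left $\mathcal C$-module $\mathcal V$-categories with actions $\boxdot_{\mathcal M}\colon\mathcal C\otimes\mathcal M\to\mathcal M$ and $\boxdot_{\mathcal N}\colon\mathcal C\otimes\mathcal N\to\mathcal N$ (with coherent invertible associators and unitors; $\mathcal C$ is not assumed rigid). A profunctor $F\colon\mathcal A\nrightarrow\mathcal B$ is a $\mathcal V$-functor $\mathcal B^{\mathrm{op}}\otimes\mathcal A\to\bar{\mathcal V}$, with composition $(G\bullet F)(c,a)=\int^{b}G(c,b)\otimes F(b,a)$ and identity $\mathrm{Id}_{\mathcal A}(a,a')=\mathcal A(a,a')$. The profunctors $\mathcal A\nrightarrow\mathcal B$ form the $\mathcal V$-category $\mathbf{Prof}(\mathcal A,\mathcal B)=[\mathcal B^{\mathrm{op}}\otimes\mathcal A,\bar{\mathcal V}]$,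 whose hom-objects $\mathrm{nat}(P,Q)$ are ends. A $\mathcal V$-functor $H\colon\mathcal A\to\mathcal B$ induces $H_*\colon\mathcal A\nrightarrow\mathcal B$, $H_*(b,a)=\mathcal B(b,Ha)$, and $H^*\colon\mathcal B\nrightarrow\mathcal A$, $H^*(a,b)=\mathcal B(Ha,b)$. A promonad on $\mathcal B$ is a profunctor $T\colon\mathcal B\nrightarrow\mathcal B$ with an associative and unital multiplication $\mu\colon T\bullet T\Rightarrow T$ and unit $\eta\colon\mathrm{Id}_{\mathcal B}\Rightarrow T$. Its Eilenberg–Moore (Kleisli) $\mathcal V$-category $\widetilde T$ has the objects of $\mathcal B$, hom-objects $\widetilde T(a,b)=T(a,b)$, composition induced by $\mu$ and identities induced by $\eta$. Let $\mathcal M\mathbb H_{\mathcal C}\mathcal N$ be the promonad on $\mathcal M^{\mathrm{op}}\otimes\mathcal N$ with $$\mathcal M\mathbb H_{\mathcal C}\mathcal N\big((m,n),(m',n')\big)=\int^{c\in\mathcal C}\mathcal N(n,\,c\boxdot_{\mathcal N}n')\otimes\mathcal M(c\boxdot_{\mathcal M}m',\,m),$$ whose multiplication sends the summands of $c$ and $d$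 to the summand of $c\boxtimes d$, by applying $c\boxdot-$ to the hom-objects of the second factor, composing, and using the associators of the modules, and whose unit is the map from $\mathcal M(m',m)\otimes\mathcal N(n,n')$ into the summand $c=I$ given by the unitors of the modules. Let $\widetilde{\mathcal M\mathbb H_{\mathcal C}\mathcal N}$ be its Eilenberg–Moore $\mathcal V$-category; so its objects are the pairs $(m,n)$ and its hom-object from $(m,n)$ to $(m',n')$ is the coend displayed above. Consider the following three $\mathcal V$-categories. 1. $\mathbf{LMod}_{\mathcal M\Omega_{\mathcal C}\mathcal N}$, the modules over the renormalization algebra. An object is a profunctor $P\colon\mathcal M\nrightarrow\mathcal N$ with a homomorphism $\kappa\colon(\boxdot_{\mathcal N})_*\bullet(\mathrm{Id}_{\mathcal C}\otimes P)\bullet(\boxdot_{\mathcal M})^*\Rightarrow P$ whose components $\mathcal N(n,c\boxdot n')\otimes P(n',m')\otimes\mathcal M(c\boxdot m',m)\to P(n,m)$ are associative with respect to $\boxtimes$ and unital with respect to $I$. The hom-object from $(P,\kappa)$ to $(Q,\kappa')$ is the equalizer of the two canonical maps $\mathrm{nat}(P,Q)\rightrightarrows\mathrm{nat}\big((\boxdot_{\mathcal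 N})_*\bullet(\mathrm{Id}_{\mathcal C}\otimes P)\bullet(\boxdot_{\mathcal M})^*,\,Q\big)$. 2. $\mathbf{LMod}_{\mathcal M\mathbb H_{\mathcal C}\mathcal N}(*)$, the left modules over the promonad $T=\mathcal M\mathbb H_{\mathcal C}\mathcal N$ from the unit $\mathcal V$-category $*$. An object is a profunctor $P\colon *\nrightarrow\mathcal M^{\mathrm{op}}\otimes\mathcal N$ with an associative and unital action $\kappa\colon T\bullet P\Rightarrow P$. The hom-object from $(P,\kappa)$ to $(Q,\kappa')$ is the equalizer of the two canonical maps $\mathrm{nat}(P,Q)\rightrightarrows\mathrm{nat}(T\bullet P,Q)$. 3. ${}_{\mathcal C}\mathbf{Prof}^{\mathrm{lax}}(\mathcal M,\mathcal N)$, the lax $\mathcal C$-module profunctors. An object is a profunctor $F\colon\mathcal M\nrightarrow\mathcal N$ with a homomorphism $\beta\colon(\boxdot_{\mathcal N})_*\bullet(\mathrm{Id}_{\mathcal C}\otimes F)\Rightarrow F\bullet(\boxdot_{\mathcal M})_*$ compatible with the associators and unitors of the modules. The hom-object from $(F,\beta)$ to $(G,\gamma)$ is the equalizer of the two canonical maps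 $\mathrm{nat}(F,G)\rightrightarrows\mathrm{nat}\big((\boxdot_{\mathcal N})_*\bullet(\mathrm{Id}_{\mathcal C}\otimes F),\,G\bullet(\boxdot_{\mathcal M})_*\big)$. **Theorem.** Each of these three $\mathcal V$-categories, and likewise $\mathbf{Prof}(*,\widetilde{\mathcal M\mathbb H_{\mathcal C}\mathcal N})$, is equivalent as a $\mathcal V$-category to the presheaf $\mathcal V$-category $$\big[\widetilde{\mathcal M\mathbb H_{\mathcal C}\mathcal N}{}^{\mathrm{op}},\bar{\mathcal V}\big].$$ The equivalences are compatible with evaluation: for all $m\in\mathcal M$ and $n\in\mathcal N$, following them by the evaluation of presheaves at $(m,n)$ gives a $\mathcal V$-functor isomorphic to the one which sends, respectively, $(P,\kappa)$ to $P(n,m)$, $(P,\kappa)$ to $P((m,n),*)$, $(F,\beta)$ to $F(n,m)$, and $P$ to $P((m,n),*)$. -/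

import Mathlib

set_option linter.unusedSectionVars false

open CategoryTheory MonoidalCategory Limits MonoidalClosed BraidedCategory Opposite

universe u w v v'

noncomputable section

namespace KK

section Basics

variable {V : Type w} [Category.{u} V] [MonoidalCategory V]
variable {C : Type v} [EnrichedCategory V C]

/-- Postcomposition with an element `e : 𝟙 ⟶ C(b, c)`. -/
def post {b c : C} (a : C) (e : 𝟙_ V ⟶ (b ⟶[V] c)) : (a ⟶[V] b) ⟶ (a ⟶[V] c) :=
  (ρ_ _).inv ≫ _ ◁ e ≫ eComp V a b c

/-- Precomposition with an element `e : 𝟙 ⟶ C(a, b)`. -/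
def pre {a b : C} (c : C) (e : 𝟙_ V ⟶ (a ⟶[V] b)) : (b ⟶[V] c) ⟶ (a ⟶[V] c) :=
  (λ_ _).inv ≫ e ▷ _ ≫ eComp V a b c

/-- Composition in the underlying category. -/
def cmp {a b c : C} (e : 𝟙_ V ⟶ (a ⟶[V] b)) (f : 𝟙_ V ⟶ (b ⟶[V] c)) : 𝟙_ V ⟶ (a ⟶[V] c) :=
  (λ_ _).inv ≫ (e ⊗ₘ f) ≫ eComp V a b c

variable {a b c d : C}

@[simp] lemma post_id : post (V := V) a (eId V b) = 𝟙 _ := by simp [post]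
@[simp] lemma pre_id : pre (V := V) b (eId V a) = 𝟙 _ := by simp [pre]

lemma comp_post (e : 𝟙_ V ⟶ (c ⟶[V] d)) :
    eComp V a b c ≫ post a e = _ ◁ post b e ≫ eComp V a b d := by
  simp only [post, MonoidalCategory.whiskerLeft_comp, Category.assoc]
  rw [rightUnitor_inv_naturality_assoc, ← MonoidalCategory.whisker_exchange_assoc, ← e_assoc']
  simp

lemma comp_pre (e : 𝟙_ V ⟶ (a ⟶[V] b)) :
    eComp V b c d ≫ pre d e = pre c e ▷ _ ≫ eComp V a c d := by
  simp only [pre, comp_whiskerRight, Category.assoc]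
  rw [leftUnitor_inv_naturality_assoc, MonoidalCategory.whisker_exchange_assoc, ← e_assoc]
  simp [e_assoc']

lemma post_pre_comp (e : 𝟙_ V ⟶ (b ⟶[V] c)) :
    post a e ▷ _ ≫ eComp V a c d = _ ◁ pre d e ≫ eComp V a b d := by
  simp only [pre, post, comp_whiskerRight, MonoidalCategory.whiskerLeft_comp, Category.assoc]
  rw [← e_assoc]
  simp

lemma cmp_eq_post (e : 𝟙_ V ⟶ (a ⟶[V] b)) (f : 𝟙_ V ⟶ (b ⟶[V] c)) : cmp e f = e ≫ post a f := by
  simp only [cmp, post, MonoidalCategory.tensorHom_def, Category.assoc, unitors_inv_equal,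
    rightUnitor_inv_naturality_assoc]

lemma cmp_eq_pre (e : 𝟙_ V ⟶ (a ⟶[V] b)) (f : 𝟙_ V ⟶ (b ⟶[V] c)) : cmp e f = f ≫ pre c e := by
  simp only [cmp, pre, MonoidalCategory.tensorHom_def', Category.assoc,
    leftUnitor_inv_naturality_assoc]

lemma pre_post (e : 𝟙_ V ⟶ (a ⟶[V] b)) (f : 𝟙_ V ⟶ (c ⟶[V] d)) :
    pre c e ≫ post a f = post b f ≫ pre d e := by
  simp only [pre, Category.assoc, comp_post]
  rw [leftUnitor_inv_naturality_assoc, MonoidalCategory.whisker_exchange_assoc]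

lemma post_post (e : 𝟙_ V ⟶ (b ⟶[V] c)) (f : 𝟙_ V ⟶ (c ⟶[V] d)) :
    post a e ≫ post a f = post a (cmp e f) := by
  rw [cmp_eq_post]
  simp only [post.eq_1 a e, post.eq_1 a (e ≫ _), Category.assoc, comp_post,
    MonoidalCategory.whiskerLeft_comp]

lemma pre_pre (e : 𝟙_ V ⟶ (b ⟶[V] c)) (f : 𝟙_ V ⟶ (a ⟶[V] b)) :
    pre d e ≫ pre d f = pre d (cmp f e) := by
  rw [cmp_eq_pre]
  simp only [pre.eq_1 d e, pre.eq_1 d (e ≫ _), Category.assoc, comp_pre, comp_whiskerRight]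

end Basics

section Tensor

variable {V : Type w} [Category.{u} V] [MonoidalCategory V] [SymmetricCategory V]

lemma tensor_left_unit {A B X Y X' Y' : V} (a : 𝟙_ V ⟶ A) (b : 𝟙_ V ⟶ B)
    (f : A ⊗ X ⟶ X') (g : B ⊗ Y ⟶ Y') :
    (λ_ (X ⊗ Y)).inv ≫ ((λ_ (𝟙_ V)).inv ≫ (a ⊗ₘ b)) ▷ (X ⊗ Y) ≫ tensorμ _ _ _ _ ≫ (f ⊗ₘ g) =
      ((λ_ X).inv ≫ a ▷ X ≫ f) ⊗ₘ ((λ_ Y).inv ≫ b ▷ Y ≫ g) := by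
  have h : (λ_ (X ⊗ Y)).inv ≫ (λ_ (𝟙_ V)).inv ▷ (X ⊗ Y) ≫ tensorμ (𝟙_ V) (𝟙_ V) X Y =
      (λ_ X).inv ⊗ₘ (λ_ Y).inv := by
    rw [Iso.inv_comp_eq, tensor_left_unitality X Y]
    simp
  rw [comp_whiskerRight, Category.assoc, tensorμ_natural_left_assoc, reassoc_of% h]
  simp only [tensorHom_comp_tensorHom]

lemma tensor_right_unit {A B X Y X' Y' : V} (a : 𝟙_ V ⟶ A) (b : 𝟙_ V ⟶ B)
    (f : X ⊗ A ⟶ X') (g : Y ⊗ B ⟶ Y') :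
    (ρ_ (X ⊗ Y)).inv ≫ (X ⊗ Y) ◁ ((λ_ (𝟙_ V)).inv ≫ (a ⊗ₘ b)) ≫ tensorμ _ _ _ _ ≫ (f ⊗ₘ g) =
      ((ρ_ X).inv ≫ X ◁ a ≫ f) ⊗ₘ ((ρ_ Y).inv ≫ Y ◁ b ≫ g) := by
  have h : (ρ_ (X ⊗ Y)).inv ≫ (X ⊗ Y) ◁ (λ_ (𝟙_ V)).inv ≫ tensorμ X Y (𝟙_ V) (𝟙_ V) =
      (ρ_ X).inv ⊗ₘ (ρ_ Y).inv := by
    rw [Iso.inv_comp_eq, tensor_right_unitality X Y]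
    simp
  rw [MonoidalCategory.whiskerLeft_comp, Category.assoc, tensorμ_natural_right_assoc,
    reassoc_of% h]
  simp only [tensorHom_comp_tensorHom]

lemma tensor_assoc {A A' B B' X X' Y Y' Z Z' T T' : V} (f : A ⊗ B ⟶ X) (f' : A' ⊗ B' ⟶ X')
    (g : B ⊗ Y ⟶ Z) (g' : B' ⊗ Y' ⟶ Z') (h : X ⊗ Y ⟶ T) (h' : X' ⊗ Y' ⟶ T')
    (k : A ⊗ Z ⟶ T) (k' : A' ⊗ Z' ⟶ T')
    (e : f ▷ _ ≫ h = (α_ _ _ _).hom ≫ _ ◁ g ≫ k)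
    (e' : f' ▷ _ ≫ h' = (α_ _ _ _).hom ≫ _ ◁ g' ≫ k') :
    (tensorμ _ _ _ _ ≫ (f ⊗ₘ f')) ▷ _ ≫ tensorμ _ _ _ _ ≫ (h ⊗ₘ h') =
      (α_ _ _ _).hom ≫ _ ◁ (tensorμ _ _ _ _ ≫ (g ⊗ₘ g')) ≫ tensorμ _ _ _ _ ≫ (k ⊗ₘ k') := by
  rw [comp_whiskerRight, MonoidalCategory.whiskerLeft_comp]
  simp only [Category.assoc]
  rw [tensorμ_natural_left_assoc, tensorμ_natural_right_assoc,
    ← reassoc_of% (tensor_associativity A A' B B' Y Y')]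
  simp only [tensorHom_comp_tensorHom, e, e']

/-- The tensor product of two `V`-categories. -/
instance tensorVCat (C D : Type u) [EnrichedCategory V C] [EnrichedCategory V D] :
    EnrichedCategory V (C × D) where
  Hom p q := (p.1 ⟶[V] q.1) ⊗ (p.2 ⟶[V] q.2)
  id p := (λ_ _).inv ≫ (eId V p.1 ⊗ₘ eId V p.2)
  comp p q r := tensorμ _ _ _ _ ≫ (eComp V p.1 q.1 r.1 ⊗ₘ eComp V p.2 q.2 r.2)
  id_comp p q := by rw [tensor_left_unit]; simp
  comp_id p q := by rw [tensor_right_unit]; simp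
  assoc p q r s := by
    rw [Iso.inv_comp_eq]
    exact tensor_assoc _ _ _ _ _ _ _ _ (e_assoc' ..).symm (e_assoc' ..).symm

/-- The unit `V`-category: one object, with hom-object the tensor unit. -/
instance unitVCat : EnrichedCategory V PUnit.{u + 1} where
  Hom _ _ := 𝟙_ V
  id _ := 𝟙 _
  comp _ _ _ := (λ_ _).hom
  id_comp _ _ := by simp
  comp_id _ _ := by simp [unitors_equal]
  assoc _ _ _ _ := by simp [unitors_equal]

variable (V) in
/-- An isomorphism in (the underlying category of) a `V`-category. -/
structure VIso {C : Type*} [EnrichedCategory V C] (a b : C) where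
  hom : 𝟙_ V ⟶ (a ⟶[V] b)
  inv : 𝟙_ V ⟶ (b ⟶[V] a)
  hom_inv : cmp hom inv = eId V a
  inv_hom : cmp inv hom = eId V b

/-- A `V`-natural isomorphism between `V`-functors. -/
structure VNatIso {C D : Type*} [EnrichedCategory V C] [EnrichedCategory V D]
    (F G : EnrichedFunctor V C D) where
  iso (a : C) : VIso V (F.obj a) (G.obj a)
  naturality (a b : C) : F.map a b ≫ post _ (iso b).hom = G.map a b ≫ pre _ (iso a).hom

/-- A `V`-functor is an equivalence if it is fully faithful (an isomorphism on hom-objects)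
and essentially surjective. -/
structure IsVEquivalence {C D : Type*} [EnrichedCategory V C] [EnrichedCategory V D]
    (F : EnrichedFunctor V C D) : Prop where
  full_faithful (a b : C) : IsIso (F.map a b)
  ess_surj (d : D) : ∃ c : C, Nonempty (VIso V (F.obj c) d)

/-- The element `f ⊗ g` of a hom-object of a tensor product of `V`-categories. -/
def pairEl {C D : Type u} [EnrichedCategory V C] [EnrichedCategory V D] {p q : C × D}
    (f : 𝟙_ V ⟶ (p.1 ⟶[V] q.1)) (g : 𝟙_ V ⟶ (p.2 ⟶[V] q.2)) : 𝟙_ V ⟶ (p ⟶[V] q) :=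
  (λ_ _).inv ≫ (f ⊗ₘ g)

/-- The image under a `V`-functor of an element of a hom-object. -/
abbrev mapEl {C D : Type*} [EnrichedCategory V C] [EnrichedCategory V D]
    (F : EnrichedFunctor V C D) {a b : C} (f : 𝟙_ V ⟶ (a ⟶[V] b)) :
    𝟙_ V ⟶ (F.obj a ⟶[V] F.obj b) := f ≫ F.map a b

end Tensor

section Monoidal

variable (V : Type w) [Category.{u} V] [MonoidalCategory V] [SymmetricCategory V]

/-- A monoidal `V`-category: a `V`-functor `C ⊗ C ⟶ C`, a unit object, and `V`-natural
associator and unitors satisfying the pentagon and triangle identities. -/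
class MonoidalVCat (C : Type u) [EnrichedCategory V C] where
  mul : EnrichedFunctor V (C × C) C
  one : C
  assoc (x y z : C) : VIso V (mul.obj (mul.obj (x, y), z)) (mul.obj (x, mul.obj (y, z)))
  lunit (x : C) : VIso V (mul.obj (one, x)) x
  runit (x : C) : VIso V (mul.obj (x, one)) x
  assoc_natural (x x' y y' z z' : C) :
    mul.map (x, y) (x', y') ▷ (z ⟶[V] z') ≫
        mul.map (mul.obj (x, y), z) (mul.obj (x', y'), z') ≫ post _ (assoc x' y' z').hom =
      (α_ (x ⟶[V] x') (y ⟶[V] y') (z ⟶[V] z')).hom ≫ (x ⟶[V] x') ◁ mul.map (y, z) (y', z') ≫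
        mul.map (x, mul.obj (y, z)) (x', mul.obj (y', z')) ≫ pre _ (assoc x y z).hom
  lunit_natural (x x' : C) :
    (λ_ _).inv ≫ eId V one ▷ (x ⟶[V] x') ≫ mul.map (one, x) (one, x') ≫ post _ (lunit x').hom =
      pre _ (lunit x).hom
  runit_natural (x x' : C) :
    (ρ_ _).inv ≫ (x ⟶[V] x') ◁ eId V one ≫ mul.map (x, one) (x', one) ≫ post _ (runit x').hom =
      pre _ (runit x).hom
  pentagon (w x y z : C) :
    cmp (mapEl mul (pairEl (p := (_, z)) (q := (_, z)) (assoc w x y).hom (eId V z)))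
      (cmp (assoc w (mul.obj (x, y)) z).hom
        (mapEl mul (pairEl (p := (w, _)) (q := (w, _)) (eId V w) (assoc x y z).hom))) =
    cmp (assoc (mul.obj (w, x)) y z).hom (assoc w x (mul.obj (y, z))).hom
  triangle (x y : C) :
    cmp (assoc x one y).hom
      (mapEl mul (pairEl (p := (x, _)) (q := (x, _)) (eId V x) (lunit y).hom)) =
    mapEl mul (pairEl (p := (_, y)) (q := (_, y)) (runit x).hom (eId V y))

/-- The tensor product functor of a monoidal `V`-category. -/
abbrev mulF (C : Type u) [EnrichedCategory V C] [MonoidalVCat V C] : EnrichedFunctor V (C × C) C :=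
  MonoidalVCat.mul

/-- The tensor product of two objects. -/
abbrev tmul {C : Type u} [EnrichedCategory V C] [MonoidalVCat V C] (x y : C) : C :=
  (mulF V C).obj (x, y)

/-- The unit object. -/
abbrev tone (C : Type u) [EnrichedCategory V C] [MonoidalVCat V C] : C := MonoidalVCat.one V

/-- A left module `V`-category over a monoidal `V`-category `C`. -/
class LeftModule (C : Type u) [EnrichedCategory V C] [MonoidalVCat V C]
    (M : Type u) [EnrichedCategory V M] where
  act : EnrichedFunctor V (C × M) M
  assoc (x y : C) (m : M) :
    VIso V (act.obj (tmul V x y, m)) (act.obj (x, act.obj (y, m)))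
  unit (m : M) : VIso V (act.obj (tone V C, m)) m
  assoc_natural (x x' y y' : C) (m m' : M) :
    (mulF V C).map (x, y) (x', y') ▷ (m ⟶[V] m') ≫
        act.map (tmul V x y, m) (tmul V x' y', m') ≫
        post _ (assoc x' y' m').hom =
      (α_ (x ⟶[V] x') (y ⟶[V] y') (m ⟶[V] m')).hom ≫ (x ⟶[V] x') ◁ act.map (y, m) (y', m') ≫
        act.map (x, act.obj (y, m)) (x', act.obj (y', m')) ≫ pre _ (assoc x y m).hom
  unit_natural (m m' : M) :
    (λ_ _).inv ≫ eId V (tone V C) ▷ (m ⟶[V] m') ≫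
        act.map (tone V C, m) (tone V C, m') ≫ post _ (unit m').hom =
      pre _ (unit m).hom
  pentagon (x y z : C) (m : M) :
    cmp (mapEl act (pairEl (p := (_, m)) (q := (_, m)) (MonoidalVCat.assoc x y z).hom (eId V m)))
      (cmp (assoc x (tmul V y z) m).hom
        (mapEl act (pairEl (p := (x, _)) (q := (x, _)) (eId V x) (assoc y z m).hom))) =
    cmp (assoc (tmul V x y) z m).hom (assoc x y (act.obj (z, m))).hom
  triangle (x : C) (m : M) :
    cmp (assoc x (tone V C) m).hom
      (mapEl act (pairEl (p := (x, _)) (q := (x, _)) (eId V x) (unit m).hom)) =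
    mapEl act (pairEl (p := (_, m)) (q := (_, m)) (MonoidalVCat.runit x).hom (eId V m))

end Monoidal

section Coend

variable {V : Type w} [Category.{u} V] [MonoidalCategory V] [SymmetricCategory V]
  [MonoidalClosed V] [HasLimits V] [HasColimits V]

variable {D : Type u} {H : D → D → V} {G F : D → V}

/-- The coend `∫^d G(d) ⊗ F(d)` of a family `G` with a right action of the hom-objects `H(d, d')`
and a family `F` with a left action, as a coequalizer. -/
def coend (r : ∀ d d', G d ⊗ H d d' ⟶ G d') (l : ∀ d d', H d d' ⊗ F d' ⟶ F d) : V :=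
  coequalizer
    (Sigma.desc fun p : D × D => r p.1 p.2 ▷ F p.2 ≫ Sigma.ι (fun d => G d ⊗ F d) p.2)
    (Sigma.desc fun p : D × D => (α_ (G p.1) (H p.1 p.2) (F p.2)).hom ≫ G p.1 ◁ l p.1 p.2 ≫
      Sigma.ι (fun d => G d ⊗ F d) p.1)

namespace coend

variable (r : ∀ d d', G d ⊗ H d d' ⟶ G d') (l : ∀ d d', H d d' ⊗ F d' ⟶ F d)

/-- The coprojection. -/
def ι (d : D) : G d ⊗ F d ⟶ coend r l :=
  Sigma.ι (fun d => G d ⊗ F d) d ≫ coequalizer.π _ _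

lemma w (d d' : D) :
    r d d' ▷ F d' ≫ ι r l d' = (α_ _ _ _).hom ≫ G d ◁ l d d' ≫ ι r l d := by
  have h := congrArg (fun t => Sigma.ι (fun p : D × D => (G p.1 ⊗ H p.1 p.2) ⊗ F p.2) (d, d') ≫ t)
    (coequalizer.condition
      (Sigma.desc fun p : D × D => r p.1 p.2 ▷ F p.2 ≫ Sigma.ι (fun d => G d ⊗ F d) p.2)
      (Sigma.desc fun p : D × D => (α_ (G p.1) (H p.1 p.2) (F p.2)).hom ≫ G p.1 ◁ l p.1 p.2 ≫
        Sigma.ι (fun d => G d ⊗ F d) p.1))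
  simp only [Sigma.ι_desc_assoc, Category.assoc] at h
  simp only [ι]
  exact h

variable {r l}

/-- The universal property of the coend. -/
def desc {X : V} (f : ∀ d, G d ⊗ F d ⟶ X)
    (h : ∀ d d', r d d' ▷ F d' ≫ f d' = (α_ _ _ _).hom ≫ G d ◁ l d d' ≫ f d) :
    coend r l ⟶ X :=
  coequalizer.desc (Sigma.desc f) (by
    ext p
    simp [h])

@[simp] lemma ι_desc {X : V} (f : ∀ d, G d ⊗ F d ⟶ X) (h) (d : D) :
    ι r l d ≫ desc f h = f d := by
  exact ((Category.assoc _ _ _).trans (congrArg (_ ≫ ·) (coequalizer.π_desc _ _))).trans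
    (Sigma.ι_desc _ _)

@[simp] lemma ι_desc_assoc {X Y : V} (f : ∀ d, G d ⊗ F d ⟶ X) (h) (d : D) (k : X ⟶ Y) :
    ι r l d ≫ desc f h ≫ k = f d ≫ k := by
  rw [← Category.assoc, ι_desc]

lemma ext {X : V} {f g : coend r l ⟶ X} (h : ∀ d, ι r l d ≫ f = ι r l d ≫ g) : f = g := by
  apply coequalizer.hom_ext
  apply Sigma.hom_ext
  intro d
  exact ((Category.assoc _ _ _).symm.trans (h d)).trans (Category.assoc _ _ _)

lemma ext_left {K X : V} {f g : K ⊗ coend r l ⟶ X}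
    (h : ∀ d, K ◁ ι r l d ≫ f = K ◁ ι r l d ≫ g) : f = g := by
  apply curry_injective
  apply ext
  intro d
  rw [← curry_natural_left, ← curry_natural_left, h]

lemma ext_right {K X : V} {f g : coend r l ⊗ K ⟶ X}
    (h : ∀ d, ι r l d ▷ K ≫ f = ι r l d ▷ K ≫ g) : f = g := by
  rw [← cancel_epi (β_ K _).hom]
  apply ext_left
  intro d
  rw [braiding_naturality_right_assoc, braiding_naturality_right_assoc, h]

lemma ext_mid {K L X : V} {f g : (K ⊗ coend r l) ⊗ L ⟶ X}
    (h : ∀ d, (K ◁ ι r l d) ▷ L ≫ f = (K ◁ ι r l d) ▷ L ≫ g) : f = g := by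
  rw [← cancel_epi (α_ K _ L).inv]
  apply curry_injective
  apply ext_right
  intro d
  rw [← curry_natural_left, ← curry_natural_left, associator_inv_naturality_middle_assoc,
    associator_inv_naturality_middle_assoc, h]

/-- The universal property of `K ⊗ ∫^d G(d) ⊗ F(d)`. -/
def descL {K X : V} (f : ∀ d, K ⊗ (G d ⊗ F d) ⟶ X)
    (h : ∀ d d', K ◁ r d d' ▷ F d' ≫ f d' =
      K ◁ (α_ _ _ _).hom ≫ K ◁ G d ◁ l d d' ≫ f d) :
    K ⊗ coend r l ⟶ X :=
  uncurry (desc (fun d => curry (f d)) (fun d d' => by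
    rw [← curry_natural_left, ← curry_natural_left, ← curry_natural_left, h]))

@[simp] lemma ι_descL {K X : V} (f : ∀ d, K ⊗ (G d ⊗ F d) ⟶ X) (h) (d : D) :
    K ◁ ι r l d ≫ descL f h = f d := by
  rw [descL, ← uncurry_natural_left, ι_desc, uncurry_curry]

@[simp] lemma ι_descL_assoc {K X Y : V} (f : ∀ d, K ⊗ (G d ⊗ F d) ⟶ X) (h) (d : D) (k : X ⟶ Y) :
    K ◁ ι r l d ≫ descL f h ≫ k = f d ≫ k := by
  rw [← Category.assoc, ι_descL]

/-- The universal property of `(∫^d G(d) ⊗ F(d)) ⊗ K`. -/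
def descR {K X : V} (f : ∀ d, (G d ⊗ F d) ⊗ K ⟶ X)
    (h : ∀ d d', r d d' ▷ F d' ▷ K ≫ f d' =
      (α_ _ _ _).hom ▷ K ≫ (G d ◁ l d d') ▷ K ≫ f d) :
    coend r l ⊗ K ⟶ X :=
  (β_ _ _).hom ≫ descL (fun d => (β_ _ _).hom ≫ f d) (fun d d' => by
    simp only [braiding_naturality_right_assoc, h])

@[simp] lemma ι_descR {K X : V} (f : ∀ d, (G d ⊗ F d) ⊗ K ⟶ X) (h) (d : D) :
    ι r l d ▷ K ≫ descR f h = f d := by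
  rw [descR, braiding_naturality_left_assoc, ι_descL, SymmetricCategory.symmetry_assoc]

@[simp] lemma ι_descR_assoc {K X Y : V} (f : ∀ d, (G d ⊗ F d) ⊗ K ⟶ X) (h) (d : D) (k : X ⟶ Y) :
    ι r l d ▷ K ≫ descR f h ≫ k = f d ≫ k := by
  rw [← Category.assoc, ι_descR]

end coend

end Coend

section Prof

variable (V : Type w) [Category.{u} V] [MonoidalCategory V]

/-- A `V`-profunctor `F : C ⇸ D`, given by objects `F(d, c)` with a left action of the hom-objects
of `D` and a right action of the hom-objects of `C`, both unital and associative and commuting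
with each other. -/
structure Prof (C D : Type u) [EnrichedCategory V C] [EnrichedCategory V D] where
  obj : D → C → V
  lact (d d' : D) (c : C) : (d ⟶[V] d') ⊗ obj d' c ⟶ obj d c
  ract (d : D) (c c' : C) : obj d c ⊗ (c ⟶[V] c') ⟶ obj d c'
  lact_id (d : D) (c : C) : (λ_ _).inv ≫ eId V d ▷ _ ≫ lact d d c = 𝟙 _
  ract_id (d : D) (c : C) : (ρ_ _).inv ≫ _ ◁ eId V c ≫ ract d c c = 𝟙 _
  lact_comp (d d' d'' : D) (c : C) :
    eComp V d d' d'' ▷ _ ≫ lact d d'' c = (α_ _ _ _).hom ≫ _ ◁ lact d' d'' c ≫ lact d d' c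
  ract_comp (d : D) (c c' c'' : C) :
    ract d c c' ▷ _ ≫ ract d c' c'' = (α_ _ _ _).hom ≫ _ ◁ eComp V c c' c'' ≫ ract d c c''
  comm (d d' : D) (c c' : C) :
    lact d d' c ▷ _ ≫ ract d c c' = (α_ _ _ _).hom ≫ _ ◁ ract d' c c' ≫ lact d d' c'

end Prof

namespace Prof
variable {V : Type w} [Category.{u} V] [MonoidalCategory V]
variable {A B C D : Type u} [EnrichedCategory V A] [EnrichedCategory V B] [EnrichedCategory V C]
  [EnrichedCategory V D]

lemma comm' (F : Prof V C D) (d d' : D) (c c' : C) :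
    _ ◁ F.ract d' c c' ≫ F.lact d d' c' = (α_ _ _ _).inv ≫ F.lact d d' c ▷ _ ≫ F.ract d c c' := by
  rw [F.comm, Iso.inv_hom_id_assoc]

lemma lact_comp' (F : Prof V C D) (d d' d'' : D) (c : C) :
    _ ◁ F.lact d' d'' c ≫ F.lact d d' c =
      (α_ _ _ _).inv ≫ eComp V d d' d'' ▷ _ ≫ F.lact d d'' c := by
  rw [F.lact_comp, Iso.inv_hom_id_assoc]

/-- The profunctor `H_* : C ⇸ D` represented by a `V`-functor, `H_*(d, c) = D(d, H c)`. -/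
def companion (H : EnrichedFunctor V C D) : Prof V C D where
  obj d c := d ⟶[V] H.obj c
  lact d d' c := eComp V d d' _
  ract d c c' := _ ◁ H.map c c' ≫ eComp V _ _ _
  lact_id d c := e_id_comp ..
  ract_id d c := by
    rw [← MonoidalCategory.whiskerLeft_comp_assoc, H.map_id, e_comp_id]
  lact_comp d d' d'' c := (e_assoc' ..).symm
  ract_comp d c c' c'' := by
    rw [← MonoidalCategory.whiskerLeft_comp_assoc, H.map_comp, comp_whiskerRight]
    simp only [Category.assoc, MonoidalCategory.whiskerLeft_comp]
    rw [← MonoidalCategory.whisker_exchange_assoc, ← e_assoc']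
    simp [MonoidalCategory.tensorHom_def]
  comm d d' c c' := by
    rw [← MonoidalCategory.whisker_exchange_assoc, ← e_assoc']
    simp

/-- The profunctor `H^* : D ⇸ C` corepresented by a `V`-functor, `H^*(c, d) = D(H c, d)`. -/
def conjoint (H : EnrichedFunctor V C D) : Prof V D C where
  obj c d := H.obj c ⟶[V] d
  lact c c' d := H.map c c' ▷ _ ≫ eComp V _ _ _
  ract c d d' := eComp V _ _ _
  lact_id c d := by
    rw [← comp_whiskerRight_assoc, H.map_id, e_id_comp]
  ract_id c d := e_comp_id ..
  lact_comp c c' c'' d := by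
    rw [← comp_whiskerRight_assoc, H.map_comp, comp_whiskerRight]
    simp only [Category.assoc, MonoidalCategory.whiskerLeft_comp]
    rw [MonoidalCategory.whisker_exchange_assoc, ← e_assoc]
    simp [MonoidalCategory.tensorHom_def', e_assoc']
  ract_comp c d d' d'' := (e_assoc' ..).symm
  comm c c' d d' := by
    rw [comp_whiskerRight, Category.assoc, ← e_assoc']
    simp [MonoidalCategory.whisker_exchange_assoc]

section tensor
variable [SymmetricCategory V]

/-- The tensor product of profunctors, `(F ⊗ G)((b, d), (a, c)) = F(b, a) ⊗ G(d, c)`. -/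
def tensor (F : Prof V A B) (G : Prof V C D) : Prof V (A × C) (B × D) where
  obj q p := F.obj q.1 p.1 ⊗ G.obj q.2 p.2
  lact q q' p := tensorμ _ _ _ _ ≫ (F.lact q.1 q'.1 p.1 ⊗ₘ G.lact q.2 q'.2 p.2)
  ract q p p' := tensorμ _ _ _ _ ≫ (F.ract q.1 p.1 p'.1 ⊗ₘ G.ract q.2 p.2 p'.2)
  lact_id q p := (tensor_left_unit _ _ _ _).trans (by simp [F.lact_id, G.lact_id])
  ract_id q p := (tensor_right_unit _ _ _ _).trans (by simp [F.ract_id, G.ract_id])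
  lact_comp _ _ _ _ := tensor_assoc _ _ _ _ _ _ _ _ (F.lact_comp ..) (G.lact_comp ..)
  ract_comp _ _ _ _ := tensor_assoc _ _ _ _ _ _ _ _ (F.ract_comp ..) (G.ract_comp ..)
  comm _ _ _ _ := tensor_assoc _ _ _ _ _ _ _ _ (F.comm ..) (G.comm ..)

end tensor

/-- The identity profunctor, `Id_C(c, c') = C(c, c')`. -/
def id (C : Type u) [EnrichedCategory V C] : Prof V C C where
  obj c c' := c ⟶[V] c'
  lact c c' c'' := eComp V c c' c''
  ract c c' c'' := eComp V c c' c''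
  lact_id _ _ := e_id_comp ..
  ract_id _ _ := e_comp_id ..
  lact_comp _ _ _ _ := (e_assoc' ..).symm
  ract_comp _ _ _ _ := (e_assoc' ..).symm
  comm _ _ _ _ := (e_assoc' ..).symm

section comp
variable [SymmetricCategory V] [MonoidalClosed V] [HasLimits V] [HasColimits V]

/-- The object `(G • F)(c, a) = ∫^b G(c, b) ⊗ F(b, a)`. -/
def compObj (G : Prof V B C) (F : Prof V A B) (c : C) (a : A) : V :=
  coend (G.ract c) (fun b b' => F.lact b b' a)

/-- The coprojection into the composite. -/
def compι (G : Prof V B C) (F : Prof V A B) (c : C) (b : B) (a : A) :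
    G.obj c b ⊗ F.obj b a ⟶ compObj G F c a :=
  coend.ι (G.ract c) (fun b b' => F.lact b b' a) b

lemma compι_w (G : Prof V B C) (F : Prof V A B) (c : C) (b b' : B) (a : A) :
    G.ract c b b' ▷ F.obj b' a ≫ compι G F c b' a =
      (α_ _ _ _).hom ≫ G.obj c b ◁ F.lact b b' a ≫ compι G F c b a :=
  coend.w (G.ract c) (fun b b' => F.lact b b' a) b b'

/-- The left action on a composite. -/
def compL (G : Prof V B C) (F : Prof V A B) (c c' : C) (a : A) :
    (c ⟶[V] c') ⊗ compObj G F c' a ⟶ compObj G F c a :=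
  coend.descL (fun b => (α_ _ _ _).inv ≫ G.lact c c' b ▷ _ ≫ compι G F c b a)
    (fun b b' => by
      rw [associator_inv_naturality_middle_assoc, ← comp_whiskerRight_assoc, G.comm']
      simp only [comp_whiskerRight, Category.assoc]
      rw [compι_w, associator_inv_naturality_right_assoc, MonoidalCategory.whisker_exchange_assoc]
      monoidal)

/-- The right action on a composite. -/
def compR (G : Prof V B C) (F : Prof V A B) (c : C) (a a' : A) :
    compObj G F c a ⊗ (a ⟶[V] a') ⟶ compObj G F c a' :=
  coend.descR (fun b => (α_ _ _ _).hom ≫ _ ◁ F.ract b a a' ≫ compι G F c b a')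
    (fun b b' => by
      rw [associator_naturality_left_assoc, ← MonoidalCategory.whisker_exchange_assoc, compι_w,
        associator_naturality_middle_assoc, ← MonoidalCategory.whiskerLeft_comp_assoc, F.comm]
      monoidal)

lemma compι_compL (G : Prof V B C) (F : Prof V A B) (c c' : C) (b : B) (a : A) :
    (c ⟶[V] c') ◁ compι G F c' b a ≫ compL G F c c' a =
      (α_ _ _ _).inv ≫ G.lact c c' b ▷ _ ≫ compι G F c b a :=
  coend.ι_descL ..

lemma compι_compR (G : Prof V B C) (F : Prof V A B) (c : C) (b : B) (a a' : A) :
    compι G F c b a ▷ _ ≫ compR G F c a a' = (α_ _ _ _).hom ≫ _ ◁ F.ract b a a' ≫ compι G F c b a' :=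
  coend.ι_descR ..

lemma comp_ext {G : Prof V B C} {F : Prof V A B} {c : C} {a : A} {X : V}
    {f g : compObj G F c a ⟶ X} (h : ∀ b, compι G F c b a ≫ f = compι G F c b a ≫ g) : f = g :=
  coend.ext h

lemma comp_ext_left {G : Prof V B C} {F : Prof V A B} {c : C} {a : A} {K X : V}
    {f g : K ⊗ compObj G F c a ⟶ X} (h : ∀ b, K ◁ compι G F c b a ≫ f = K ◁ compι G F c b a ≫ g) :
    f = g :=
  coend.ext_left h

lemma comp_ext_right {G : Prof V B C} {F : Prof V A B} {c : C} {a : A} {K X : V}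
    {f g : compObj G F c a ⊗ K ⟶ X} (h : ∀ b, compι G F c b a ▷ K ≫ f = compι G F c b a ▷ K ≫ g) :
    f = g :=
  coend.ext_right h

lemma comp_ext_mid {G : Prof V B C} {F : Prof V A B} {c : C} {a : A} {K L X : V}
    {f g : (K ⊗ compObj G F c a) ⊗ L ⟶ X}
    (h : ∀ b, (K ◁ compι G F c b a) ▷ L ≫ f = (K ◁ compι G F c b a) ▷ L ≫ g) : f = g :=
  coend.ext_mid h

/-- The composite `G • F : A ⇸ C` of `F : A ⇸ B` and `G : B ⇸ C`,
`(G • F)(c, a) = ∫^b G(c, b) ⊗ F(b, a)`. -/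
def comp (G : Prof V B C) (F : Prof V A B) : Prof V A C where
  obj := compObj G F
  lact := compL G F
  ract := compR G F
  lact_id c a := comp_ext fun b => by
    rw [leftUnitor_inv_naturality_assoc, MonoidalCategory.whisker_exchange_assoc, compι_compL,
      Category.comp_id]
    conv_rhs => rw [← Category.id_comp (compι G F c b a), ← id_whiskerRight, ← G.lact_id]
    monoidal
  ract_id c a := comp_ext fun b => by
    rw [rightUnitor_inv_naturality_assoc, ← MonoidalCategory.whisker_exchange_assoc, compι_compR,
      Category.comp_id]
    conv_rhs => rw [← Category.id_comp (compι G F c b a), ← MonoidalCategory.whiskerLeft_id,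
      ← F.ract_id]
    monoidal
  lact_comp c c' c'' a := comp_ext_left fun b => by
    rw [MonoidalCategory.whisker_exchange_assoc, compι_compL, associator_naturality_right_assoc,
      ← MonoidalCategory.whiskerLeft_comp_assoc, compι_compL]
    simp only [MonoidalCategory.whiskerLeft_comp, Category.assoc, compι_compL]
    rw [associator_inv_naturality_left_assoc, ← comp_whiskerRight_assoc, G.lact_comp]
    monoidal
  ract_comp c a a' a'' := by
    rw [← cancel_epi (α_ _ _ _).inv]
    refine comp_ext_right fun b => ?_
    rw [associator_inv_naturality_left_assoc, ← comp_whiskerRight_assoc, compι_compR,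
      Iso.inv_hom_id_assoc, ← MonoidalCategory.whisker_exchange_assoc, compι_compR,
      associator_naturality_right_assoc, ← MonoidalCategory.whiskerLeft_comp_assoc,
      Iso.eq_inv_comp _ |>.mpr (F.ract_comp b a a' a'').symm]
    simp only [comp_whiskerRight, Category.assoc, compι_compR]
    monoidal
  comm c c' a a' := comp_ext_mid fun b => by
    rw [← comp_whiskerRight_assoc, compι_compL, associator_naturality_middle_assoc,
      ← MonoidalCategory.whiskerLeft_comp_assoc, compι_compR]
    simp only [MonoidalCategory.whiskerLeft_comp, comp_whiskerRight, Category.assoc, compι_compL,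
      compι_compR]
    rw [associator_naturality_left_assoc, ← MonoidalCategory.whisker_exchange_assoc]
    monoidal

end comp
end Prof

section Rs
variable {V : Type w} [Category.{u} V] [MonoidalCategory V] [SymmetricCategory V]

/-- The symmetry `(A ⊗ B) ⊗ C ⟶ (A ⊗ C) ⊗ B`. -/
def rs (A B C : V) : (A ⊗ B) ⊗ C ⟶ (A ⊗ C) ⊗ B :=
  (α_ _ _ _).hom ≫ A ◁ (β_ B C).hom ≫ (α_ _ _ _).inv

lemma rs_nat_right {A B C C' : V} (f : C ⟶ C') :
    (A ⊗ B) ◁ f ≫ rs A B C' = rs A B C ≫ (A ◁ f) ▷ B := by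
  simp only [rs, Category.assoc]
  rw [associator_naturality_right_assoc, ← MonoidalCategory.whiskerLeft_comp_assoc,
    braiding_naturality_right]
  monoidal

lemma rs_nat_left {A A' B C : V} (f : A ⟶ A') :
    f ▷ B ▷ C ≫ rs A' B C = rs A B C ≫ f ▷ C ▷ B := by
  simp only [rs, Category.assoc]
  rw [associator_naturality_left_assoc, ← MonoidalCategory.whisker_exchange_assoc]
  monoidal

lemma rs_nat_mid {A B B' C : V} (f : B ⟶ B') :
    (A ◁ f) ▷ C ≫ rs A B' C = rs A B C ≫ (A ⊗ C) ◁ f := by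
  simp only [rs, Category.assoc]
  rw [associator_naturality_middle_assoc, ← MonoidalCategory.whiskerLeft_comp_assoc,
    braiding_naturality_left]
  monoidal

lemma rs_tensor (A B C D : V) :
    rs A B (C ⊗ D) = (α_ _ _ _).inv ≫ rs A B C ▷ D ≫ rs (A ⊗ C) B D ≫ (α_ _ _ _).hom ▷ B := by
  simp only [rs, braiding_tensor_right_hom]
  monoidal

lemma rs_unit (A B : V) : rs A B (𝟙_ V) = (ρ_ _).hom ≫ (ρ_ A).inv ▷ B := by
  simp only [rs, braiding_tensorUnit_right]
  monoidal

lemma rs_braid {A B X Y Z : V} (f : A ⊗ X ⟶ Y) (g : B ⊗ Y ⟶ Z) :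
    rs A B X ≫ f ▷ B ≫ (β_ _ _).hom ≫ g =
      (β_ A B).hom ▷ X ≫ (α_ _ _ _).hom ≫ B ◁ f ≫ g := by
  rw [braiding_naturality_left_assoc]
  simp only [rs, braiding_tensor_left_hom, Category.assoc, Iso.inv_hom_id_assoc]
  rw [← MonoidalCategory.whiskerLeft_comp_assoc, SymmetricCategory.symmetry]
  monoidal

end Rs

section Act
variable (V : Type w) [Category.{u} V] [MonoidalCategory V]
variable {J I : Type u} (s t : I → J) (K : I → V)

/-- Families of objects with a family of unary operations parametrized by objects of `V`. -/
structure Act where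
  obj : J → V
  act (i : I) : obj (s i) ⊗ K i ⟶ obj (t i)

namespace Act
variable {V s t K}
variable [SymmetricCategory V] [MonoidalClosed V] [HasLimits V]

/-- The first of the two maps whose equalizer is the end. -/
def homL (P Q : Act V s t K) : (∏ᶜ fun j => (ihom (P.obj j)).obj (Q.obj j)) ⟶
    ∏ᶜ fun i => (ihom (P.obj (s i) ⊗ K i)).obj (Q.obj (t i)) :=
  Limits.Pi.lift fun i => curry (P.act i ▷ _ ≫ uncurry (Limits.Pi.π (fun j => (ihom (P.obj j)).obj (Q.obj j)) (t i)))

/-- The second of the two maps whose equalizer is the end. -/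
def homR (P Q : Act V s t K) : (∏ᶜ fun j => (ihom (P.obj j)).obj (Q.obj j)) ⟶
    ∏ᶜ fun i => (ihom (P.obj (s i) ⊗ K i)).obj (Q.obj (t i)) :=
  Limits.Pi.lift fun i => curry (rs _ _ _ ≫ uncurry (Limits.Pi.π (fun j => (ihom (P.obj j)).obj (Q.obj j)) (s i)) ▷ K i ≫ Q.act i)

/-- The end of the objects `[P j, Q j]`: the object of families commuting with the operations,
as an equalizer of two maps between products of internal homs. -/
def hom (P Q : Act V s t K) : V := equalizer (homL P Q) (homR P Q)

/-- The inclusion of the end into the product. -/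
def homι (P Q : Act V s t K) : hom P Q ⟶ ∏ᶜ fun j => (ihom (P.obj j)).obj (Q.obj j) :=
  equalizer.ι _ _

/-- The evaluation of the universal family. -/
def ev (P Q : Act V s t K) (j : J) : P.obj j ⊗ hom P Q ⟶ Q.obj j :=
  uncurry (homι P Q ≫ Limits.Pi.π _ j)

lemma act_ev (P Q : Act V s t K) (i : I) :
    P.act i ▷ hom P Q ≫ ev P Q (t i) = rs _ _ _ ≫ ev P Q (s i) ▷ K i ≫ Q.act i := by
  have h₀ : homι P Q ≫ homL P Q = homι P Q ≫ homR P Q := equalizer.condition _ _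
  have h := congrArg (fun f => uncurry (f ≫ Limits.Pi.π
    (fun i => (ihom (P.obj (s i) ⊗ K i)).obj (Q.obj (t i))) i)) h₀
  simp only [homL, homR, Category.assoc, Limits.Pi.lift_π, uncurry_natural_left,
    uncurry_curry] at h
  simp only [ev, uncurry_natural_left]
  rw [← MonoidalCategory.whisker_exchange_assoc, h, reassoc_of% rs_nat_right,
    comp_whiskerRight_assoc]

/-- The universal property of the hom-object. -/
def lift {P Q : Act V s t K} {X : V} (φ : ∀ j, P.obj j ⊗ X ⟶ Q.obj j)
    (h : ∀ i, P.act i ▷ X ≫ φ (t i) = rs _ _ _ ≫ φ (s i) ▷ K i ≫ Q.act i) : X ⟶ hom P Q :=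
  equalizer.lift (Limits.Pi.lift fun j => curry (φ j)) (by
    apply Limits.Pi.hom_ext
    intro i
    apply uncurry_injective
    simp only [homL, homR, Category.assoc, Limits.Pi.lift_π, uncurry_natural_left, uncurry_curry]
    rw [MonoidalCategory.whisker_exchange_assoc, reassoc_of% rs_nat_right, ← uncurry_natural_left,
      ← comp_whiskerRight_assoc, ← uncurry_natural_left, Limits.Pi.lift_π, Limits.Pi.lift_π,
      uncurry_curry, uncurry_curry, h])

lemma lift_ev {P Q : Act V s t K} {X : V} (φ : ∀ j, P.obj j ⊗ X ⟶ Q.obj j) (h) (j : J) :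
    P.obj j ◁ lift φ h ≫ ev P Q j = φ j := by
  have h₀ : lift φ h ≫ homι P Q = Limits.Pi.lift fun j => curry (φ j) := equalizer.lift_ι _ _
  rw [ev, ← uncurry_natural_left, reassoc_of% h₀, Limits.Pi.lift_π, uncurry_curry]

lemma hom_ext {P Q : Act V s t K} {X : V} {f g : X ⟶ hom P Q}
    (h : ∀ j, P.obj j ◁ f ≫ ev P Q j = P.obj j ◁ g ≫ ev P Q j) : f = g := by
  have : f ≫ homι P Q = g ≫ homι P Q := by
    apply Limits.Pi.hom_ext
    intro j
    have := h j
    rw [ev, ← uncurry_natural_left, ← uncurry_natural_left] at this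
    rw [Category.assoc, Category.assoc, uncurry_injective this]
  exact equalizer.hom_ext this

/-- Identities. -/
def idm (P : Act V s t K) : 𝟙_ V ⟶ hom P P :=
  lift (fun j => (ρ_ _).hom) (fun i => by simp [rs_unit])

/-- Composition. -/
def compm (P Q R : Act V s t K) : hom P Q ⊗ hom Q R ⟶ hom P R :=
  lift (fun j => (α_ _ _ _).inv ≫ ev P Q j ▷ _ ≫ ev Q R j) (fun i => by
    rw [associator_inv_naturality_left_assoc, ← comp_whiskerRight_assoc, act_ev]
    simp only [comp_whiskerRight, Category.assoc]
    rw [act_ev, reassoc_of% rs_nat_left, rs_tensor]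
    monoidal)

lemma idm_ev (P : Act V s t K) (j : J) : P.obj j ◁ idm P ≫ ev P P j = (ρ_ _).hom := lift_ev ..

lemma compm_ev (P Q R : Act V s t K) (j : J) :
    P.obj j ◁ compm P Q R ≫ ev P R j = (α_ _ _ _).inv ≫ ev P Q j ▷ _ ≫ ev Q R j := lift_ev ..

instance : EnrichedCategory V (Act V s t K) where
  Hom := hom
  id := idm
  comp := compm
  id_comp P Q := hom_ext fun j => by
    simp only [MonoidalCategory.whiskerLeft_comp, Category.assoc, compm_ev]
    rw [associator_inv_naturality_middle_assoc, ← comp_whiskerRight_assoc, idm_ev]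
    simp
  comp_id P Q := hom_ext fun j => by
    simp only [MonoidalCategory.whiskerLeft_comp, Category.assoc, compm_ev]
    rw [associator_inv_naturality_right_assoc, MonoidalCategory.whisker_exchange_assoc, idm_ev]
    simp
  assoc P Q R S := hom_ext fun j => by
    simp only [MonoidalCategory.whiskerLeft_comp, Category.assoc, compm_ev]
    rw [associator_inv_naturality_middle_assoc, ← comp_whiskerRight_assoc, compm_ev,
      associator_inv_naturality_right_assoc, MonoidalCategory.whisker_exchange_assoc, compm_ev]
    monoidal

end Act
end Act

section Induced
variable {V : Type w} [Category.{u} V] [MonoidalCategory V]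

/-- The `V`-category structure on `A` whose hom-objects are those of `B` along `f`. -/
abbrev inducedVCat {A : Type v} {B : Type v'} [EnrichedCategory V B] (f : A → B) :
    EnrichedCategory V A where
  Hom a b := f a ⟶[V] f b
  id a := eId V (f a)
  comp a b c := eComp V (f a) (f b) (f c)
  id_comp _ _ := e_id_comp ..
  comp_id _ _ := e_comp_id ..
  assoc _ _ _ _ := e_assoc ..

end Induced

section
variable {V : Type w} [Category.{u} V] [MonoidalCategory V] [SymmetricCategory V]
  [MonoidalClosed V] [HasLimits V]

lemma curry_comp {X Y Z H K : V} (f : X ⊗ H ⟶ Y) (g : Y ⊗ K ⟶ Z) :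
    (curry f ⊗ₘ curry g) ≫ MonoidalClosed.comp X Y Z = curry ((α_ _ _ _).inv ≫ f ▷ K ≫ g) := by
  apply uncurry_injective
  rw [MonoidalClosed.comp_eq, uncurry_natural_left, uncurry_curry, uncurry_curry,
    compTranspose_eq, MonoidalCategory.tensorHom_def, MonoidalCategory.whiskerLeft_comp_assoc,
    associator_inv_naturality_right_assoc, MonoidalCategory.whisker_exchange_assoc,
    associator_inv_naturality_middle_assoc, ← comp_whiskerRight_assoc, ← uncurry_eq, uncurry_curry]
  have hg : Y ◁ curry g ≫ (ihom.ev Y).app Z = g := by rw [← uncurry_eq, uncurry_curry]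
  exact congrArg (fun t => (α_ _ _ _).inv ≫ f ▷ K ≫ t) hg

/-- The evaluation of families at an index, as a `V`-functor to `V`. -/
def Act.evF {J I : Type u} (s t : I → J) (K : I → V) (j : J) :
    EnrichedFunctor V (Act V s t K) V where
  obj P := P.obj j
  map P Q := curry (Act.ev P Q j)
  map_id P := by
    apply uncurry_injective
    rw [uncurry_natural_left, uncurry_curry]
    exact (Act.idm_ev P j).trans (by simp [enrichedCategorySelf_id, MonoidalClosed.id])
  map_comp P Q R := ((curry_natural_left _ _).symm.trans
    (congrArg curry (Act.compm_ev P Q R j))).trans (curry_comp _ _).symm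

/-- The operations on a profunctor: the two actions. -/
def Prof.toAct {C D : Type u} [EnrichedCategory V C] [EnrichedCategory V D] (P : Prof V C D) :
    Act V (J := D × C) (I := (D × D × C) ⊕ (D × C × C))
      (Sum.elim (fun i => (i.2.1, i.2.2)) (fun i => (i.1, i.2.1)))
      (Sum.elim (fun i => (i.1, i.2.2)) (fun i => (i.1, i.2.2)))
      (Sum.elim (fun i => i.1 ⟶[V] i.2.1) (fun i => i.2.1 ⟶[V] i.2.2)) where
  obj j := P.obj j.1 j.2
  act
    | Sum.inl i => (β_ _ _).hom ≫ P.lact i.1 i.2.1 i.2.2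
    | Sum.inr i => P.ract i.1 i.2.1 i.2.2

/-- The `V`-category of profunctors `C ⇸ D`; its hom-objects are the ends of `[P(d, c), Q(d, c)]`. -/
instance profVCat {C D : Type u} [EnrichedCategory V C] [EnrichedCategory V D] :
    EnrichedCategory V (Prof V C D) := inducedVCat Prof.toAct

namespace Prof
variable {A B C D : Type u} [EnrichedCategory V A] [EnrichedCategory V B] [EnrichedCategory V C]
  [EnrichedCategory V D]

/-- The evaluation of a family of maps of profunctors. -/
def ev (P Q : Prof V C D) (d : D) (c : C) : P.obj d c ⊗ (P ⟶[V] Q) ⟶ Q.obj d c :=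
  Act.ev P.toAct Q.toAct (d, c)

/-- The evaluation at `(d, c)`, as a `V`-functor to `V`. -/
def evF (d : D) (c : C) : EnrichedFunctor V (Prof V C D) V where
  obj P := P.obj d c
  map P Q := curry (ev P Q d c)
  map_id P := (Act.evF _ _ _ (d, c)).map_id P.toAct
  map_comp P Q R := (Act.evF _ _ _ (d, c)).map_comp P.toAct Q.toAct R.toAct

lemma lact_ev (P Q : Prof V C D) (d d' : D) (c : C) :
    P.lact d d' c ▷ (P ⟶[V] Q) ≫ ev P Q d c =
      (α_ _ _ _).hom ≫ (d ⟶[V] d') ◁ ev P Q d' c ≫ Q.lact d d' c := by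
  have h : ((β_ _ _).hom ≫ P.lact d d' c) ▷ (P ⟶[V] Q) ≫ ev P Q d c =
      rs _ _ _ ≫ ev P Q d' c ▷ _ ≫ (β_ _ _).hom ≫ Q.lact d d' c :=
    Act.act_ev P.toAct Q.toAct (Sum.inl (d, d', c))
  rw [← cancel_epi ((β_ _ _).hom ▷ _), ← comp_whiskerRight_assoc, h, rs_braid]

lemma ract_ev (P Q : Prof V C D) (d : D) (c c' : C) :
    P.ract d c c' ▷ (P ⟶[V] Q) ≫ ev P Q d c' = rs _ _ _ ≫ ev P Q d c ▷ _ ≫ Q.ract d c c' :=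
  Act.act_ev P.toAct Q.toAct (Sum.inr (d, c, c'))

/-- The universal property of the hom-objects. -/
def lift {P Q : Prof V C D} {X : V} (φ : ∀ d c, P.obj d c ⊗ X ⟶ Q.obj d c)
    (hl : ∀ d d' c, P.lact d d' c ▷ X ≫ φ d c =
      (α_ _ _ _).hom ≫ (d ⟶[V] d') ◁ φ d' c ≫ Q.lact d d' c)
    (hr : ∀ d c c', P.ract d c c' ▷ X ≫ φ d c' = rs _ _ _ ≫ φ d c ▷ _ ≫ Q.ract d c c') :
    X ⟶ (P ⟶[V] Q) :=
  Act.lift (P := P.toAct) (Q := Q.toAct) (fun j => φ j.1 j.2) (by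
    rintro (⟨d, d', c⟩ | ⟨d, c, c'⟩)
    · change ((β_ _ _).hom ≫ P.lact d d' c) ▷ X ≫ φ d c =
        rs _ _ _ ≫ φ d' c ▷ _ ≫ (β_ _ _).hom ≫ Q.lact d d' c
      rw [comp_whiskerRight_assoc, hl, rs_braid]
    · exact hr d c c')

lemma lift_ev {P Q : Prof V C D} {X : V} (φ : ∀ d c, P.obj d c ⊗ X ⟶ Q.obj d c) (hl) (hr)
    (d : D) (c : C) : P.obj d c ◁ lift φ hl hr ≫ ev P Q d c = φ d c :=
  Act.lift_ev (P := P.toAct) (Q := Q.toAct) (fun j => φ j.1 j.2) _ (d, c)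

lemma hom_ext {P Q : Prof V C D} {X : V} {f g : X ⟶ (P ⟶[V] Q)}
    (h : ∀ d c, P.obj d c ◁ f ≫ ev P Q d c = P.obj d c ◁ g ≫ ev P Q d c) : f = g :=
  Act.hom_ext (P := P.toAct) (Q := Q.toAct) fun j => h j.1 j.2

lemma id_ev (P : Prof V C D) (d : D) (c : C) :
    P.obj d c ◁ eId V P ≫ ev P P d c = (ρ_ _).hom := Act.idm_ev P.toAct (d, c)

lemma comp_ev (P Q R : Prof V C D) (d : D) (c : C) :
    P.obj d c ◁ eComp V P Q R ≫ ev P R d c = (α_ _ _ _).inv ≫ ev P Q d c ▷ _ ≫ ev Q R d c :=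
  Act.compm_ev P.toAct Q.toAct R.toAct (d, c)

/-- A `V`-functor to a `V`-category of profunctors, from its action on components. -/
def mkF {E : Type v} [EnrichedCategory V E] (obj : E → Prof V C D)
    (app : ∀ X Y d c, (obj X).obj d c ⊗ (X ⟶[V] Y) ⟶ (obj Y).obj d c)
    (hl : ∀ X Y d d' c, (obj X).lact d d' c ▷ _ ≫ app X Y d c =
      (α_ _ _ _).hom ≫ (d ⟶[V] d') ◁ app X Y d' c ≫ (obj Y).lact d d' c)
    (hr : ∀ X Y d c c', (obj X).ract d c c' ▷ _ ≫ app X Y d c' =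
      rs _ _ _ ≫ app X Y d c ▷ _ ≫ (obj Y).ract d c c')
    (hid : ∀ X d c, (obj X).obj d c ◁ eId V X ≫ app X X d c = (ρ_ _).hom)
    (hcomp : ∀ X Y Z d c, (obj X).obj d c ◁ eComp V X Y Z ≫ app X Z d c =
      (α_ _ _ _).inv ≫ app X Y d c ▷ _ ≫ app Y Z d c) :
    EnrichedFunctor V E (Prof V C D) where
  obj := obj
  map X Y := lift (app X Y) (hl X Y) (hr X Y)
  map_id X := hom_ext fun d c => by
    rw [MonoidalCategory.whiskerLeft_comp_assoc, lift_ev, hid, id_ev]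
  map_comp X Y Z := hom_ext fun d c => by
    rw [MonoidalCategory.whiskerLeft_comp_assoc, lift_ev, hcomp,
      MonoidalCategory.whiskerLeft_comp_assoc, comp_ev, MonoidalCategory.tensorHom_def]
    simp only [MonoidalCategory.whiskerLeft_comp, Category.assoc]
    rw [associator_inv_naturality_right_assoc, MonoidalCategory.whisker_exchange_assoc, lift_ev,
      associator_inv_naturality_middle_assoc, ← comp_whiskerRight_assoc, lift_ev]

end Prof

end

namespace Prof
variable {V : Type w} [Category.{u} V] [MonoidalCategory V] [SymmetricCategory V]
  [MonoidalClosed V] [HasLimits V] [HasColimits V]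
variable {A B C D : Type u} [EnrichedCategory V A] [EnrichedCategory V B] [EnrichedCategory V C]
  [EnrichedCategory V D]

/-- The components of the `V`-functor `G • -`. -/
def postApp (G : Prof V B C) (P Q : Prof V A B) (c : C) (a : A) :
    compObj G P c a ⊗ (P ⟶[V] Q) ⟶ compObj G Q c a :=
  coend.descR (fun b => (α_ _ _ _).hom ≫ _ ◁ ev P Q b a ≫ compι G Q c b a)
    (fun b b' => by
      rw [associator_naturality_left_assoc, ← MonoidalCategory.whisker_exchange_assoc, compι_w,
        associator_naturality_middle_assoc, ← MonoidalCategory.whiskerLeft_comp_assoc, lact_ev]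
      monoidal)

lemma compι_postApp (G : Prof V B C) (P Q : Prof V A B) (c : C) (b : B) (a : A) :
    compι G P c b a ▷ _ ≫ postApp G P Q c a = (α_ _ _ _).hom ≫ _ ◁ ev P Q b a ≫ compι G Q c b a :=
  coend.ι_descR ..

lemma comp_ext_right2 {G : Prof V B C} {F : Prof V A B} {c : C} {a : A} {K L X : V}
    {f g : (compObj G F c a ⊗ K) ⊗ L ⟶ X}
    (h : ∀ b, compι G F c b a ▷ K ▷ L ≫ f = compι G F c b a ▷ K ▷ L ≫ g) : f = g := by
  rw [← cancel_epi (α_ _ _ _).inv]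
  refine comp_ext_right fun b => ?_
  rw [associator_inv_naturality_left_assoc, associator_inv_naturality_left_assoc, h]

lemma postApp_lact (G : Prof V B C) (P Q : Prof V A B) (c c' : C) (a : A) :
    compL G P c c' a ▷ (P ⟶[V] Q) ≫ postApp G P Q c a =
      (α_ _ _ _).hom ≫ (c ⟶[V] c') ◁ postApp G P Q c' a ≫ compL G Q c c' a :=
  comp_ext_mid fun b => by
    rw [← comp_whiskerRight_assoc, compι_compL, associator_naturality_middle_assoc,
      ← MonoidalCategory.whiskerLeft_comp_assoc, compι_postApp]
    simp only [MonoidalCategory.whiskerLeft_comp, comp_whiskerRight, Category.assoc, compι_compL,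
      compι_postApp]
    rw [associator_naturality_left_assoc, ← MonoidalCategory.whisker_exchange_assoc]
    monoidal

lemma postApp_ract (G : Prof V B C) (P Q : Prof V A B) (c : C) (a a' : A) :
    compR G P c a a' ▷ (P ⟶[V] Q) ≫ postApp G P Q c a' =
      rs _ _ _ ≫ postApp G P Q c a ▷ _ ≫ compR G Q c a a' :=
  comp_ext_right2 fun b => by
    rw [← comp_whiskerRight_assoc, compι_compR, reassoc_of% rs_nat_left,
      ← comp_whiskerRight_assoc, compι_postApp]
    simp only [comp_whiskerRight, Category.assoc, compι_postApp, compι_compR]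
    rw [associator_naturality_middle_assoc, ← MonoidalCategory.whiskerLeft_comp_assoc, ract_ev,
      associator_naturality_middle_assoc, ← MonoidalCategory.whiskerLeft_comp_assoc]
    simp only [rs]
    monoidal

lemma postApp_id (G : Prof V B C) (P : Prof V A B) (c : C) (a : A) :
    compObj G P c a ◁ eId V P ≫ postApp G P P c a = (ρ_ _).hom := by
  rw [← cancel_epi (ρ_ _).inv]
  refine comp_ext fun b => ?_
  rw [rightUnitor_inv_naturality_assoc, ← MonoidalCategory.whisker_exchange_assoc, compι_postApp,
    associator_naturality_right_assoc, ← MonoidalCategory.whiskerLeft_comp_assoc, id_ev]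
  monoidal

lemma postApp_comp (G : Prof V B C) (P Q R : Prof V A B) (c : C) (a : A) :
    compObj G P c a ◁ eComp V P Q R ≫ postApp G P R c a =
      (α_ _ _ _).inv ≫ postApp G P Q c a ▷ _ ≫ postApp G Q R c a :=
  comp_ext_right fun b => by
    rw [← MonoidalCategory.whisker_exchange_assoc, compι_postApp,
      associator_naturality_right_assoc, ← MonoidalCategory.whiskerLeft_comp_assoc, comp_ev,
      associator_inv_naturality_left_assoc, ← comp_whiskerRight_assoc, compι_postApp]
    simp only [comp_whiskerRight, Category.assoc, compι_postApp]
    monoidal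

/-- Postcomposition with a profunctor, as a `V`-functor `P ↦ G • P`. -/
def postF (A : Type u) [EnrichedCategory V A] (G : Prof V B C) :
    EnrichedFunctor V (Prof V A B) (Prof V A C) :=
  mkF (fun P => comp G P) (fun P Q c a => postApp G P Q c a) (postApp_lact G) (postApp_ract G)
    (postApp_id G) (postApp_comp G)

/-- The components of the `V`-functor `- • F`. -/
def preApp (F : Prof V A B) (P Q : Prof V B C) (c : C) (a : A) :
    compObj P F c a ⊗ (P ⟶[V] Q) ⟶ compObj Q F c a :=
  coend.descR (fun b => rs _ _ _ ≫ ev P Q c b ▷ _ ≫ compι Q F c b a)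
    (fun b b' => by
      rw [reassoc_of% rs_nat_left, reassoc_of% rs_nat_mid, ← comp_whiskerRight_assoc, ract_ev,
        MonoidalCategory.whisker_exchange_assoc]
      simp only [comp_whiskerRight, Category.assoc]
      rw [compι_w]
      simp only [rs, braiding_tensor_left_hom]
      monoidal)

lemma compι_preApp (F : Prof V A B) (P Q : Prof V B C) (c : C) (b : B) (a : A) :
    compι P F c b a ▷ _ ≫ preApp F P Q c a = rs _ _ _ ≫ ev P Q c b ▷ _ ≫ compι Q F c b a :=
  coend.ι_descR ..

lemma preApp_lact (F : Prof V A B) (P Q : Prof V B C) (c c' : C) (a : A) :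
    compL P F c c' a ▷ (P ⟶[V] Q) ≫ preApp F P Q c a =
      (α_ _ _ _).hom ≫ (c ⟶[V] c') ◁ preApp F P Q c' a ≫ compL Q F c c' a :=
  comp_ext_mid fun b => by
    rw [← comp_whiskerRight_assoc, compι_compL, associator_naturality_middle_assoc,
      ← MonoidalCategory.whiskerLeft_comp_assoc, compι_preApp]
    simp only [MonoidalCategory.whiskerLeft_comp, comp_whiskerRight, Category.assoc, compι_compL,
      compι_preApp]
    rw [reassoc_of% rs_nat_left, ← comp_whiskerRight_assoc, lact_ev]
    simp only [rs]
    monoidal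

lemma preApp_ract (F : Prof V A B) (P Q : Prof V B C) (c : C) (a a' : A) :
    compR P F c a a' ▷ (P ⟶[V] Q) ≫ preApp F P Q c a' =
      rs _ _ _ ≫ preApp F P Q c a ▷ _ ≫ compR Q F c a a' :=
  comp_ext_right2 fun b => by
    rw [← comp_whiskerRight_assoc, compι_compR, reassoc_of% rs_nat_left,
      ← comp_whiskerRight_assoc, compι_preApp]
    simp only [comp_whiskerRight, Category.assoc, compι_preApp, compι_compR]
    rw [reassoc_of% rs_nat_mid, MonoidalCategory.whisker_exchange_assoc]
    simp only [rs, braiding_tensor_left_hom]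
    monoidal

lemma preApp_id (F : Prof V A B) (P : Prof V B C) (c : C) (a : A) :
    compObj P F c a ◁ eId V P ≫ preApp F P P c a = (ρ_ _).hom := by
  rw [← cancel_epi (ρ_ _).inv]
  refine comp_ext fun b => ?_
  rw [rightUnitor_inv_naturality_assoc, ← MonoidalCategory.whisker_exchange_assoc, compι_preApp,
    reassoc_of% rs_nat_right, ← comp_whiskerRight_assoc, id_ev, rs_unit]
  monoidal

lemma preApp_comp (F : Prof V A B) (P Q R : Prof V B C) (c : C) (a : A) :
    compObj P F c a ◁ eComp V P Q R ≫ preApp F P R c a =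
      (α_ _ _ _).inv ≫ preApp F P Q c a ▷ _ ≫ preApp F Q R c a :=
  comp_ext_right fun b => by
    rw [← MonoidalCategory.whisker_exchange_assoc, compι_preApp,
      reassoc_of% rs_nat_right, ← comp_whiskerRight_assoc, comp_ev,
      associator_inv_naturality_left_assoc, ← comp_whiskerRight_assoc, compι_preApp]
    simp only [comp_whiskerRight, Category.assoc, compι_preApp]
    rw [reassoc_of% rs_nat_left, rs_tensor]
    monoidal

/-- Precomposition with a profunctor, as a `V`-functor `P ↦ P • F`. -/
def preF (C : Type u) [EnrichedCategory V C] (F : Prof V A B) :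
    EnrichedFunctor V (Prof V B C) (Prof V A C) :=
  mkF (fun P => comp P F) (fun P Q c a => preApp F P Q c a) (preApp_lact F) (preApp_ract F)
    (preApp_id F) (preApp_comp F)

/-- The components of the `V`-functor `Id_C ⊗ -`. -/
def idTensorApp (C : Type u) [EnrichedCategory V C] (P Q : Prof V A B) (q : C × B) (p : C × A) :
    ((q.1 ⟶[V] p.1) ⊗ P.obj q.2 p.2) ⊗ (P ⟶[V] Q) ⟶ (q.1 ⟶[V] p.1) ⊗ Q.obj q.2 p.2 :=
  (α_ _ _ _).hom ≫ _ ◁ ev P Q q.2 p.2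

lemma tensorμ_coh₁ (X Y Z W H : V) :
    tensorμ X Y Z W ▷ H ≫ (α_ _ _ _).hom ≫ _ ◁ (α_ _ _ _).hom =
      (α_ _ _ _).hom ≫ _ ◁ (α_ _ _ _).hom ≫ tensorμ X Y Z (W ⊗ H) := by
  simp only [tensorμ]
  monoidal

lemma tensorμ_coh₂ (X Y Z W H : V) :
    tensorμ X Y Z W ▷ H ≫ (α_ _ _ _).hom ≫ _ ◁ rs Y W H =
      rs _ _ _ ≫ (α_ _ _ _).hom ▷ _ ≫ tensorμ X (Y ⊗ H) Z W := by
  symm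
  calc
    _ = 𝟙 _ ⊗≫ (X ⊗ Y ⊗ Z) ◁ (β_ W H).hom ⊗≫ (X ⊗ Y) ◁ ((β_ Z H).hom ≫ (β_ H Z).hom) ▷ W ⊗≫
        (X ◁ (β_ Y Z).hom) ▷ (H ⊗ W) ⊗≫ 𝟙 _ := by
      simp only [tensorμ, rs, braiding_tensor_left_hom]
      monoidal
    _ = 𝟙 _ ⊗≫ ((X ⊗ Y ⊗ Z) ◁ (β_ W H).hom ≫ (X ◁ (β_ Y Z).hom) ▷ (H ⊗ W)) ⊗≫ 𝟙 _ := by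
      rw [SymmetricCategory.symmetry]
      monoidal
    _ = _ := by
      rw [MonoidalCategory.whisker_exchange]
      simp only [tensorμ, rs]
      monoidal

lemma tensor_whisker {X X' Y Y' Z H : V} (f : X ⟶ X') (g : Y ⟶ Y') (k : Y' ⊗ H ⟶ Z) :
    (f ⊗ₘ g) ▷ H ≫ (α_ _ _ _).hom ≫ _ ◁ k = (α_ _ _ _).hom ≫ (f ⊗ₘ (g ▷ H ≫ k)) := by
  simp only [MonoidalCategory.tensorHom_def]
  monoidal

lemma idTensorApp_lact (P Q : Prof V A B) (q q' : C × B) (p : C × A) :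
    (tensorμ _ _ _ _ ≫ (eComp V q.1 q'.1 p.1 ⊗ₘ P.lact q.2 q'.2 p.2)) ▷ (P ⟶[V] Q) ≫
      idTensorApp C P Q q p =
    (α_ _ _ _).hom ≫ _ ◁ idTensorApp C P Q q' p ≫
      tensorμ _ _ _ _ ≫ (eComp V q.1 q'.1 p.1 ⊗ₘ Q.lact q.2 q'.2 p.2) := by
  simp only [idTensorApp, comp_whiskerRight, MonoidalCategory.whiskerLeft_comp, Category.assoc]
  rw [tensor_whisker, lact_ev, ← id_tensorHom (q'.1 ⟶[V] p.1) (ev P Q q'.2 p.2), tensorμ_natural_right_assoc,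
    ← reassoc_of% tensorμ_coh₁, tensorHom_comp_tensorHom, MonoidalCategory.whiskerLeft_id,
    Category.id_comp, ← id_tensorHom _ (α_ _ _ _).hom, tensorHom_comp_tensorHom, Category.id_comp]

lemma idTensorApp_ract (P Q : Prof V A B) (q : C × B) (p p' : C × A) :
    (tensorμ _ _ _ _ ≫ (eComp V q.1 p.1 p'.1 ⊗ₘ P.ract q.2 p.2 p'.2)) ▷ (P ⟶[V] Q) ≫
      idTensorApp C P Q q p' =
    rs _ _ _ ≫ idTensorApp C P Q q p ▷ _ ≫
      tensorμ _ _ _ _ ≫ (eComp V q.1 p.1 p'.1 ⊗ₘ Q.ract q.2 p.2 p'.2) := by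
  simp only [idTensorApp, comp_whiskerRight, Category.assoc]
  rw [tensor_whisker, ract_ev, ← id_tensorHom (q.1 ⟶[V] p.1) (ev P Q q.2 p.2), tensorμ_natural_left_assoc,
    ← reassoc_of% tensorμ_coh₂, tensorHom_comp_tensorHom, id_whiskerRight,
    Category.id_comp, ← id_tensorHom _ (rs _ _ _), tensorHom_comp_tensorHom, Category.id_comp]

/-- Tensoring with the identity profunctor, as a `V`-functor `P ↦ Id_C ⊗ P`. -/
def idTensorF (C : Type u) [EnrichedCategory V C] :
    EnrichedFunctor V (Prof V A B) (Prof V (C × A) (C × B)) :=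
  mkF (fun P => tensor (Prof.id C) P) (fun P Q q p => idTensorApp C P Q q p)
    idTensorApp_lact idTensorApp_ract
    (fun P q p => by
      change _ ≫ (α_ _ _ _).hom ≫ _ ◁ ev P P q.2 p.2 = _
      erw [associator_naturality_right_assoc, ← MonoidalCategory.whiskerLeft_comp, id_ev]
      monoidal)
    (fun P Q R q p => by
      change _ ≫ (α_ _ _ _).hom ≫ _ ◁ ev P R q.2 p.2 = _
      erw [associator_naturality_right_assoc, ← MonoidalCategory.whiskerLeft_comp, comp_ev]
      simp only [idTensorApp]
      monoidal)

end Prof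

section Inserter
variable {V : Type w} [Category.{u} V] [MonoidalCategory V] [HasLimits V]
variable {E : Type v} {E' : Type v'} [EnrichedCategory V E] [EnrichedCategory V E']

/-- An object of the inserter of two `V`-functors `S` and `R`. -/
structure Inserter (S R : EnrichedFunctor V E E') where
  X : E
  φ : 𝟙_ V ⟶ (S.obj X ⟶[V] R.obj X)

namespace Inserter

variable {S R : EnrichedFunctor V E E'}

/-- The hom-objects of the inserter. -/
def hom (P Q : Inserter S R) : V :=
  equalizer (S.map P.X Q.X ≫ post _ Q.φ) (R.map P.X Q.X ≫ pre _ P.φ)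

/-- The inclusion of the hom-objects of the inserter. -/
def ι (P Q : Inserter S R) : hom P Q ⟶ (P.X ⟶[V] Q.X) := equalizer.ι _ _

lemma w (P Q : Inserter S R) :
    ι P Q ≫ S.map P.X Q.X ≫ post _ Q.φ = ι P Q ≫ R.map P.X Q.X ≫ pre _ P.φ :=
  equalizer.condition _ _

/-- The universal property of the hom-objects of the inserter. -/
def lift {P Q : Inserter S R} {K : V} (f : K ⟶ (P.X ⟶[V] Q.X))
    (h : f ≫ S.map P.X Q.X ≫ post _ Q.φ = f ≫ R.map P.X Q.X ≫ pre _ P.φ) : K ⟶ hom P Q :=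
  equalizer.lift f h

lemma lift_ι {P Q : Inserter S R} {K : V} (f : K ⟶ (P.X ⟶[V] Q.X)) (h) :
    lift f h ≫ ι P Q = f := equalizer.lift_ι _ _

lemma hom_ext {P Q : Inserter S R} {K : V} {f g : K ⟶ hom P Q} (h : f ≫ ι P Q = g ≫ ι P Q) :
    f = g := equalizer.hom_ext h

/-- Identities. -/
def idm (P : Inserter S R) : 𝟙_ V ⟶ hom P P :=
  lift (eId V P.X) (by
    rw [← Category.assoc, S.map_id, ← Category.assoc, R.map_id, ← cmp_eq_post, ← cmp_eq_pre]
    simp only [cmp_eq_pre, pre_id, Category.comp_id]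
    rw [← cmp_eq_pre, cmp_eq_post, post_id, Category.comp_id])

/-- Composition. -/
def compm (P Q T : Inserter S R) : hom P Q ⊗ hom Q T ⟶ hom P T :=
  lift ((ι P Q ⊗ₘ ι Q T) ≫ eComp V _ _ _) (by
    rw [Category.assoc, Category.assoc, reassoc_of% S.map_comp, reassoc_of% R.map_comp, comp_post,
      comp_pre]
    calc
      _ = ((ι P Q ≫ S.map _ _) ⊗ₘ (ι Q T ≫ S.map _ _ ≫ post _ T.φ)) ≫ eComp V _ _ _ := by
        simp [MonoidalCategory.tensorHom_def, MonoidalCategory.whisker_exchange_assoc]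
      _ = ((ι P Q ≫ S.map _ _) ⊗ₘ (ι Q T ≫ R.map _ _)) ≫ _ ◁ pre _ Q.φ ≫ eComp V _ _ _ := by
        rw [w]
        simp [MonoidalCategory.tensorHom_def, MonoidalCategory.whisker_exchange_assoc]
      _ = ((ι P Q ≫ S.map _ _ ≫ post _ Q.φ) ⊗ₘ (ι Q T ≫ R.map _ _)) ≫ eComp V _ _ _ := by
        rw [← post_pre_comp]
        simp [MonoidalCategory.tensorHom_def, MonoidalCategory.whisker_exchange_assoc]
      _ = _ := by
        rw [w]
        simp [MonoidalCategory.tensorHom_def, MonoidalCategory.whisker_exchange_assoc])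

lemma compm_ι (P Q T : Inserter S R) :
    compm P Q T ≫ ι P T = (ι P Q ⊗ₘ ι Q T) ≫ eComp V _ _ _ := lift_ι _ _

lemma idm_ι (P : Inserter S R) : idm P ≫ ι P P = eId V P.X := lift_ι _ _

instance : EnrichedCategory V (Inserter S R) where
  Hom := hom
  id := idm
  comp := compm
  id_comp P Q := hom_ext (by
    rw [Category.assoc, Category.assoc, compm_ι, Category.id_comp, MonoidalCategory.tensorHom_def,
      Category.assoc, ← comp_whiskerRight_assoc, idm_ι, ← MonoidalCategory.whisker_exchange_assoc,
      ← leftUnitor_inv_naturality_assoc, e_id_comp, Category.comp_id])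
  comp_id P Q := hom_ext (by
    rw [Category.assoc, Category.assoc, compm_ι, Category.id_comp, MonoidalCategory.tensorHom_def',
      Category.assoc, ← MonoidalCategory.whiskerLeft_comp_assoc, idm_ι,
      MonoidalCategory.whisker_exchange_assoc, ← rightUnitor_inv_naturality_assoc, e_comp_id,
      Category.comp_id])
  assoc P Q T U := hom_ext (by
    rw [Category.assoc, Category.assoc, Category.assoc, compm_ι, compm_ι,
      whiskerRight_comp_tensorHom_assoc, whiskerLeft_comp_tensorHom_assoc, compm_ι, compm_ι,
      ← tensorHom_comp_whiskerRight_assoc, ← tensorHom_comp_whiskerLeft_assoc, ← e_assoc,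
      associator_inv_naturality_assoc])

/-- The forgetful `V`-functor of an inserter. -/
def forget (S R : EnrichedFunctor V E E') : EnrichedFunctor V (Inserter S R) E where
  obj P := P.X
  map P Q := ι P Q
  map_id P := lift_ι _ _
  map_comp P Q T := lift_ι _ _

end Inserter
end Inserter

section Bifunctor
variable {V : Type w} [Category.{u} V] [MonoidalCategory V] [SymmetricCategory V]
variable {A B D : Type u} [EnrichedCategory V A] [EnrichedCategory V B] [EnrichedCategory V D]

/-- The action of a `V`-functor of two variables on the second variable. -/
def bl (T : EnrichedFunctor V (A × B) D) (a : A) (b b' : B) :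
    (b ⟶[V] b') ⟶ (T.obj (a, b) ⟶[V] T.obj (a, b')) :=
  (λ_ _).inv ≫ eId V a ▷ _ ≫ T.map (a, b) (a, b')

/-- The action of a `V`-functor of two variables on the first variable. -/
def br (T : EnrichedFunctor V (A × B) D) (b : B) (a a' : A) :
    (a ⟶[V] a') ⟶ (T.obj (a, b) ⟶[V] T.obj (a', b)) :=
  (ρ_ _).inv ≫ _ ◁ eId V b ≫ T.map (a, b) (a', b)

lemma unit_mid₁ {X Y E E' X' Y' : V} (e : 𝟙_ V ⟶ E) (e' : 𝟙_ V ⟶ E') (f : X ⊗ E' ⟶ X')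
    (g : E ⊗ Y ⟶ Y') :
    (((ρ_ X).inv ≫ X ◁ e) ⊗ₘ ((λ_ Y).inv ≫ e' ▷ Y)) ≫ tensorμ _ _ _ _ ≫ (f ⊗ₘ g) =
      ((ρ_ X).inv ≫ X ◁ e' ≫ f) ⊗ₘ ((λ_ Y).inv ≫ e ▷ Y ≫ g) := by
  have h : ((ρ_ X).inv ⊗ₘ (λ_ Y).inv) ≫ tensorμ X (𝟙_ V) (𝟙_ V) Y = (ρ_ X).inv ⊗ₘ (λ_ Y).inv := by
    simp only [tensorμ, braiding_tensorUnit_right]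
    monoidal
  rw [← tensorHom_comp_tensorHom, Category.assoc, ← id_tensorHom, ← tensorHom_id,
    tensorμ_natural_assoc, reassoc_of% h]
  simp only [tensorHom_comp_tensorHom, id_tensorHom, tensorHom_id]

lemma unit_mid₂ {X Y E E' X' Y' : V} (e : 𝟙_ V ⟶ E) (e' : 𝟙_ V ⟶ E') (f : E ⊗ X ⟶ X')
    (g : Y ⊗ E' ⟶ Y') :
    (((λ_ Y).inv ≫ e ▷ Y) ⊗ₘ ((ρ_ X).inv ≫ X ◁ e')) ≫ tensorμ _ _ _ _ ≫ (f ⊗ₘ g) =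
      (β_ Y X).hom ≫ (((λ_ X).inv ≫ e ▷ X ≫ f) ⊗ₘ ((ρ_ Y).inv ≫ Y ◁ e' ≫ g)) := by
  have h : ((λ_ Y).inv ⊗ₘ (ρ_ X).inv) ≫ tensorμ (𝟙_ V) Y X (𝟙_ V) =
      (β_ Y X).hom ≫ ((λ_ X).inv ⊗ₘ (ρ_ Y).inv) := by
    simp only [tensorμ]
    monoidal
  rw [← tensorHom_comp_tensorHom, Category.assoc, ← id_tensorHom, ← tensorHom_id,
    tensorμ_natural_assoc, reassoc_of% h]
  simp only [tensorHom_comp_tensorHom, id_tensorHom, tensorHom_id]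

variable (T : EnrichedFunctor V (A × B) D)

lemma map_pair (p q r : A × B) :
    tensorμ _ _ _ _ ≫ (eComp V p.1 q.1 r.1 ⊗ₘ eComp V p.2 q.2 r.2) ≫ T.map p r =
      (T.map p q ⊗ₘ T.map q r) ≫ eComp V _ _ _ := by
  rw [← T.map_comp, ← Category.assoc]
  rfl

lemma br_bl (a a' : A) (b b' : B) :
    (br T b a a' ⊗ₘ bl T a' b b') ≫ eComp V _ _ _ = T.map (a, b) (a', b') := by
  have h := map_pair T (a, b) (a', b) (a', b')
  have h' := unit_mid₁ (eId V b) (eId V a') (eComp V a a' a') (eComp V b b b')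
  rw [e_comp_id, e_id_comp, id_tensorHom_id] at h'
  rw [br, bl, ← Category.assoc, ← Category.assoc (λ_ _).inv, ← tensorHom_comp_tensorHom,
    Category.assoc, ← h, reassoc_of% h']

lemma bl_br (a a' : A) (b b' : B) :
    (bl T a b b' ⊗ₘ br T b' a a') ≫ eComp V _ _ _ = (β_ _ _).hom ≫ T.map (a, b) (a', b') := by
  have h := map_pair T (a, b) (a, b') (a', b')
  have h' := unit_mid₂ (eId V a) (eId V b') (eComp V a a a') (eComp V b b' b')
  rw [e_comp_id, e_id_comp, id_tensorHom_id, Category.comp_id] at h'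
  rw [br, bl, ← Category.assoc, ← Category.assoc (ρ_ _).inv, ← tensorHom_comp_tensorHom,
    Category.assoc, ← h, reassoc_of% h']

lemma el_id {C : Type v} [EnrichedCategory V C] (a : C) :
    (λ_ (𝟙_ V)).inv ≫ (eId V a ⊗ₘ eId V a) ≫ eComp V a a a = eId V a := by
  have := cmp_eq_post (V := V) (eId V a) (eId V a)
  rwa [post_id, Category.comp_id] at this

lemma unit_mid₃ {Y Z E E' X' Y' : V} (e : 𝟙_ V ⟶ E) (e' : 𝟙_ V ⟶ E') (f : E ⊗ E' ⟶ X')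
    (g : Y ⊗ Z ⟶ Y') :
    (((λ_ Y).inv ≫ e ▷ Y) ⊗ₘ ((λ_ Z).inv ≫ e' ▷ Z)) ≫ tensorμ _ _ _ _ ≫ (f ⊗ₘ g) =
      g ≫ (λ_ Y').inv ≫ ((λ_ _).inv ≫ (e ⊗ₘ e') ≫ f) ▷ Y' := by
  have h : ((λ_ Y).inv ⊗ₘ (λ_ Z).inv) ≫ tensorμ (𝟙_ V) Y (𝟙_ V) Z =
      (λ_ _).inv ≫ (λ_ _).inv ▷ (Y ⊗ Z) := by
    simp only [tensorμ, braiding_tensorUnit_right]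
    monoidal
  rw [← tensorHom_comp_tensorHom, Category.assoc, ← tensorHom_id, ← tensorHom_id,
    tensorμ_natural_assoc, reassoc_of% h, leftUnitor_inv_naturality_assoc]
  rw [id_tensorHom_id, tensorHom_id, MonoidalCategory.tensorHom_def f, comp_whiskerRight,
    comp_whiskerRight, MonoidalCategory.whisker_exchange_assoc,
    MonoidalCategory.whisker_exchange_assoc, MonoidalCategory.whisker_exchange]

lemma unit_mid₄ {Y Z E E' X' Y' : V} (e : 𝟙_ V ⟶ E) (e' : 𝟙_ V ⟶ E') (f : E ⊗ E' ⟶ X')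
    (g : Y ⊗ Z ⟶ Y') :
    (((ρ_ Y).inv ≫ Y ◁ e) ⊗ₘ ((ρ_ Z).inv ≫ Z ◁ e')) ≫ tensorμ _ _ _ _ ≫ (g ⊗ₘ f) =
      g ≫ (ρ_ Y').inv ≫ Y' ◁ ((λ_ _).inv ≫ (e ⊗ₘ e') ≫ f) := by
  have h : ((ρ_ Y).inv ⊗ₘ (ρ_ Z).inv) ≫ tensorμ Y (𝟙_ V) Z (𝟙_ V) =
      (ρ_ _).inv ≫ (Y ⊗ Z) ◁ (λ_ _).inv := by
    simp only [tensorμ, braiding_tensorUnit_left]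
    monoidal
  rw [← tensorHom_comp_tensorHom, Category.assoc, ← id_tensorHom, ← id_tensorHom,
    tensorμ_natural_assoc, reassoc_of% h, rightUnitor_inv_naturality_assoc]
  simp only [MonoidalCategory.whiskerLeft_comp, id_tensorHom_id, tensorHom_id]
  rw [← MonoidalCategory.whisker_exchange_assoc, ← MonoidalCategory.whisker_exchange_assoc]
  simp [MonoidalCategory.tensorHom_def, MonoidalCategory.whisker_exchange]

lemma bl_comp (a : A) (b b' b'' : B) :
    eComp V b b' b'' ≫ bl T a b b'' = (bl T a b b' ⊗ₘ bl T a b' b'') ≫ eComp V _ _ _ := by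
  have h := map_pair T (a, b) (a, b') (a, b'')
  have h' := unit_mid₃ (eId V a) (eId V a) (eComp V a a a) (eComp V b b' b'')
  rw [el_id] at h'
  rw [bl, bl, bl, ← Category.assoc (λ_ (b ⟶[V] b')).inv, ← Category.assoc (λ_ (b' ⟶[V] b'')).inv,
    ← tensorHom_comp_tensorHom, Category.assoc, ← h, reassoc_of% h']

lemma br_comp (b : B) (a a' a'' : A) :
    eComp V a a' a'' ≫ br T b a a'' = (br T b a a' ⊗ₘ br T b a' a'') ≫ eComp V _ _ _ := by
  have h := map_pair T (a, b) (a', b) (a'', b)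
  have h' := unit_mid₄ (eId V b) (eId V b) (eComp V b b b) (eComp V a a' a'')
  rw [el_id] at h'
  rw [br, br, br, ← Category.assoc (ρ_ (a ⟶[V] a')).inv, ← Category.assoc (ρ_ (a' ⟶[V] a'')).inv,
    ← tensorHom_comp_tensorHom, Category.assoc, ← h, reassoc_of% h']

lemma bl_id (a : A) (b : B) : eId V b ≫ bl T a b b = eId V _ := by
  have := T.map_id (a, b)
  rw [← this]
  change _ = ((λ_ _).inv ≫ (eId V a ⊗ₘ eId V b)) ≫ T.map (a, b) (a, b)
  rw [bl, leftUnitor_inv_naturality_assoc, MonoidalCategory.tensorHom_def', Category.assoc,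
    Category.assoc]

lemma br_id (a : A) (b : B) : eId V a ≫ br T b a a = eId V _ := by
  have := T.map_id (a, b)
  rw [← this]
  change _ = ((λ_ _).inv ≫ (eId V a ⊗ₘ eId V b)) ≫ T.map (a, b) (a, b)
  rw [br, rightUnitor_inv_naturality_assoc, MonoidalCategory.tensorHom_def, Category.assoc,
    Category.assoc, unitors_inv_equal]

lemma pair_id (a : A) (b : B) :
    (λ_ _).inv ≫ (eId V a ⊗ₘ eId V b) ≫ T.map (a, b) (a, b) = eId V (T.obj (a, b)) :=
  (Category.assoc _ _ _).symm.trans (T.map_id (a, b))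

lemma el_bl (a : A) {b b' : B} (g : 𝟙_ V ⟶ (b ⟶[V] b')) :
    mapEl T (pairEl (p := (a, b)) (q := (a, b')) (eId V a) g) = g ≫ bl T a b b' := by
  rw [bl, leftUnitor_inv_naturality_assoc, mapEl, pairEl, MonoidalCategory.tensorHom_def']
  simp only [Category.assoc]

lemma el_br (b : B) {a a' : A} (f : 𝟙_ V ⟶ (a ⟶[V] a')) :
    mapEl T (pairEl (p := (a, b)) (q := (a', b)) f (eId V b)) = f ≫ br T b a a' := by
  rw [br, rightUnitor_inv_naturality_assoc, mapEl, pairEl, MonoidalCategory.tensorHom_def,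
    unitors_inv_equal]
  simp only [Category.assoc]

end Bifunctor

section Calculus
variable {V : Type w} [Category.{u} V] [MonoidalCategory V]
variable {C : Type v} [EnrichedCategory V C] {a b c d : C}

lemma cmp_id (e : 𝟙_ V ⟶ (a ⟶[V] b)) : cmp e (eId V b) = e := by
  rw [cmp_eq_post, post_id, Category.comp_id]

lemma id_cmp (e : 𝟙_ V ⟶ (a ⟶[V] b)) : cmp (eId V a) e = e := by
  rw [cmp_eq_pre, pre_id, Category.comp_id]

lemma cmp_assoc (e : 𝟙_ V ⟶ (a ⟶[V] b)) (f : 𝟙_ V ⟶ (b ⟶[V] c)) (g : 𝟙_ V ⟶ (c ⟶[V] d)) :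
    cmp (cmp e f) g = cmp e (cmp f g) := by
  rw [cmp_eq_post e f, cmp_eq_post, cmp_eq_post e, Category.assoc, post_post]

lemma VIso.post_hom_inv (e : VIso V a b) : post c e.hom ≫ post c e.inv = 𝟙 _ := by
  rw [post_post, e.hom_inv, post_id]

lemma VIso.post_inv_hom (e : VIso V a b) : post c e.inv ≫ post c e.hom = 𝟙 _ := by
  rw [post_post, e.inv_hom, post_id]

lemma VIso.pre_hom_inv (e : VIso V a b) : pre c e.hom ≫ pre c e.inv = 𝟙 _ := by
  rw [pre_pre, e.inv_hom, pre_id]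

lemma VIso.pre_inv_hom (e : VIso V a b) : pre c e.inv ≫ pre c e.hom = 𝟙 _ := by
  rw [pre_pre, e.hom_inv, pre_id]

lemma nat_inv {a' b' : C} {X : V} {F : X ⟶ (a ⟶[V] b)} {G : X ⟶ (a' ⟶[V] b')}
    (e : VIso V a a') (e' : VIso V b b') (h : F ≫ post _ e'.hom = G ≫ pre _ e.hom) :
    F ≫ pre _ e.inv = G ≫ post _ e'.inv := by
  rw [← Category.comp_id (F ≫ _), ← e'.post_hom_inv, Category.assoc, reassoc_of% pre_post,
    reassoc_of% h, reassoc_of% e.pre_hom_inv]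

end Calculus

section Module
variable {V : Type w} [Category.{u} V] [MonoidalCategory V] [SymmetricCategory V]
variable {C M : Type u} [EnrichedCategory V C] [MonoidalVCat V C] [EnrichedCategory V M]
  [LeftModule V C M]

variable (V C M) in
/-- The action functor of a module. -/
abbrev actF : EnrichedFunctor V (C × M) M := LeftModule.act

variable (V) in
/-- The action on objects. -/
abbrev sm (x : C) (m : M) : M := (actF V C M).obj (x, m)

variable (V) in
/-- The associator of a module. -/
abbrev aM (x y : C) (m : M) : VIso V (sm V (tmul V x y) m) (sm V x (sm V y m)) :=
  LeftModule.assoc x y m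

variable (V C) in
/-- The unitor of a module. -/
abbrev uM (m : M) : VIso V (sm V (tone V C) m) m := LeftModule.unit m

lemma ins₁ {X Y Z W W' : V} (e : 𝟙_ V ⟶ Y) (e' : 𝟙_ V ⟶ Z) (F : X ⊗ Y ⟶ W) (F' : Y ⊗ Z ⟶ W') :
    ((ρ_ X).inv ≫ ((ρ_ X).inv ≫ X ◁ e) ▷ _ ≫ _ ◁ e') ≫ F ▷ Z =
        ((ρ_ X).inv ≫ X ◁ e ≫ F) ≫ (ρ_ W).inv ≫ W ◁ e' ∧
      ((ρ_ X).inv ≫ ((ρ_ X).inv ≫ X ◁ e) ▷ _ ≫ _ ◁ e') ≫ (α_ _ _ _).hom ≫ X ◁ F' =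
        (ρ_ X).inv ≫ X ◁ (((λ_ _).inv ≫ (e ⊗ₘ e')) ≫ F') := by
  constructor
  · simp only [Category.assoc, MonoidalCategory.whisker_exchange, rightUnitor_inv_naturality_assoc,
      comp_whiskerRight]
  · simp only [MonoidalCategory.tensorHom_def]
    monoidal

lemma ins₂ {X Y Z W W' : V} (e : 𝟙_ V ⟶ X) (e' : 𝟙_ V ⟶ Z) (F : X ⊗ Y ⟶ W) (F' : Y ⊗ Z ⟶ W') :
    ((ρ_ Y).inv ≫ ((λ_ Y).inv ≫ e ▷ Y) ▷ _ ≫ _ ◁ e') ≫ F ▷ Z =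
        ((λ_ Y).inv ≫ e ▷ Y ≫ F) ≫ (ρ_ W).inv ≫ W ◁ e' ∧
      ((ρ_ Y).inv ≫ ((λ_ Y).inv ≫ e ▷ Y) ▷ _ ≫ _ ◁ e') ≫ (α_ _ _ _).hom ≫ X ◁ F' =
        ((ρ_ Y).inv ≫ Y ◁ e' ≫ F') ≫ (λ_ W').inv ≫ e ▷ W' := by
  constructor
  · simp only [Category.assoc, MonoidalCategory.whisker_exchange, rightUnitor_inv_naturality_assoc,
      comp_whiskerRight]
  · simp only [Category.assoc, leftUnitor_inv_naturality_assoc, MonoidalCategory.whisker_exchange]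
    monoidal

lemma ins₃ {X Y Z W W' : V} (e : 𝟙_ V ⟶ X) (e' : 𝟙_ V ⟶ Y) (F : X ⊗ Y ⟶ W) (F' : Y ⊗ Z ⟶ W') :
    ((λ_ Z).inv ≫ ((λ_ _).inv ≫ (e ⊗ₘ e')) ▷ Z) ≫ F ▷ Z =
        (λ_ Z).inv ≫ (((λ_ _).inv ≫ (e ⊗ₘ e')) ≫ F) ▷ Z ∧
      ((λ_ Z).inv ≫ ((λ_ _).inv ≫ (e ⊗ₘ e')) ▷ Z) ≫ (α_ _ _ _).hom ≫ X ◁ F' =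
        ((λ_ Z).inv ≫ e' ▷ Z ≫ F') ≫ (λ_ W').inv ≫ e ▷ W' := by
  constructor
  · simp only [Category.assoc, comp_whiskerRight]
  · simp only [Category.assoc, leftUnitor_inv_naturality_assoc, MonoidalCategory.whisker_exchange,
      MonoidalCategory.tensorHom_def']
    monoidal

lemma assoc_nat₁ (x x' y : C) (m : M) :
    br (mulF V C) y x x' ≫ br (actF V C M) m _ _ ≫ post _ (aM V x' y m).hom =
      br (actF V C M) (sm V y m) x x' ≫ pre _ (aM V x y m).hom := by
  have h := congrArg (fun t => ((ρ_ _).inv ≫ ((ρ_ _).inv ≫ _ ◁ eId V y) ▷ _ ≫ _ ◁ eId V m) ≫ t)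
    (LeftModule.assoc_natural (V := V) x x' y y m m)
  simp only [Category.assoc] at h
  have i := ins₁ (X := (x ⟶[V] x')) (eId V y) (eId V m) ((mulF V C).map (x, y) (x', y))
    ((actF V C M).map (y, m) (y, m))
  simp only [Category.assoc] at i
  rw [reassoc_of% i.1, reassoc_of% i.2, pair_id] at h
  simp only [br, Category.assoc]
  exact h

lemma assoc_nat₂ (x y y' : C) (m : M) :
    bl (mulF V C) x y y' ≫ br (actF V C M) m _ _ ≫ post _ (aM V x y' m).hom =
      br (actF V C M) m y y' ≫ bl (actF V C M) x _ _ ≫ pre _ (aM V x y m).hom := by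
  have h := congrArg (fun t => ((ρ_ _).inv ≫ ((λ_ _).inv ≫ eId V x ▷ _) ▷ _ ≫ _ ◁ eId V m) ≫ t)
    (LeftModule.assoc_natural (V := V) x x y y' m m)
  simp only [Category.assoc] at h
  have i := ins₂ (Y := (y ⟶[V] y')) (eId V x) (eId V m) ((mulF V C).map (x, y) (x, y'))
    ((actF V C M).map (y, m) (y', m))
  simp only [Category.assoc] at i
  rw [reassoc_of% i.1, reassoc_of% i.2] at h
  simp only [br, bl, Category.assoc]
  exact h

lemma assoc_nat₃ (x y : C) (m m' : M) :
    bl (actF V C M) (tmul V x y) m m' ≫ post _ (aM V x y m').hom =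
      bl (actF V C M) y m m' ≫ bl (actF V C M) x _ _ ≫ pre _ (aM V x y m).hom := by
  have h := congrArg (fun t => ((λ_ _).inv ≫ ((λ_ _).inv ≫ (eId V x ⊗ₘ eId V y)) ▷ _) ≫ t)
    (LeftModule.assoc_natural (V := V) x x y y m m')
  simp only [Category.assoc] at h
  have i := ins₃ (Z := (m ⟶[V] m')) (eId V x) (eId V y) ((mulF V C).map (x, y) (x, y))
    ((actF V C M).map (y, m) (y, m'))
  simp only [Category.assoc] at i
  rw [reassoc_of% i.1, reassoc_of% i.2, pair_id] at h
  simp only [bl, Category.assoc]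
  exact h

lemma unit_nat (m m' : M) :
    bl (actF V C M) (tone V C) m m' ≫ post _ (uM V C m').hom = pre _ (uM V C m).hom := by
  rw [bl, Category.assoc, Category.assoc]
  exact LeftModule.unit_natural m m'

end Module

section Module
variable {V : Type w} [Category.{u} V] [MonoidalCategory V] [SymmetricCategory V]

lemma cmp_bl {A B D : Type u} [EnrichedCategory V A] [EnrichedCategory V B] [EnrichedCategory V D]
    (T : EnrichedFunctor V (A × B) D) (a : A) {b b' b'' : B} (e : 𝟙_ V ⟶ (b ⟶[V] b'))
    (f : 𝟙_ V ⟶ (b' ⟶[V] b'')) :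
    cmp e f ≫ bl T a b b'' = cmp (e ≫ bl T a b b') (f ≫ bl T a b' b'') := by
  simp only [cmp, Category.assoc, bl_comp, tensorHom_comp_tensorHom_assoc]

lemma cmp_br {A B D : Type u} [EnrichedCategory V A] [EnrichedCategory V B] [EnrichedCategory V D]
    (T : EnrichedFunctor V (A × B) D) (b : B) {a a' a'' : A} (e : 𝟙_ V ⟶ (a ⟶[V] a'))
    (f : 𝟙_ V ⟶ (a' ⟶[V] a'')) :
    cmp e f ≫ br T b a a'' = cmp (e ≫ br T b a a') (f ≫ br T b a' a'') := by
  simp only [cmp, Category.assoc, br_comp, tensorHom_comp_tensorHom_assoc]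

lemma post_bl {A B D : Type u} [EnrichedCategory V A] [EnrichedCategory V B] [EnrichedCategory V D]
    (T : EnrichedFunctor V (A × B) D) (a : A) {b b' b'' : B} (e : 𝟙_ V ⟶ (b' ⟶[V] b'')) :
    post b e ≫ bl T a b b'' = bl T a b b' ≫ post _ (e ≫ bl T a b' b'') := by
  rw [post, post, Category.assoc, Category.assoc, bl_comp, rightUnitor_inv_naturality_assoc,
    MonoidalCategory.tensorHom_def, MonoidalCategory.whiskerLeft_comp]
  simp only [Category.assoc]
  rw [MonoidalCategory.whisker_exchange_assoc]

lemma pre_bl {A B D : Type u} [EnrichedCategory V A] [EnrichedCategory V B] [EnrichedCategory V D]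
    (T : EnrichedFunctor V (A × B) D) (a : A) {b b' b'' : B} (e : 𝟙_ V ⟶ (b ⟶[V] b')) :
    pre b'' e ≫ bl T a b b'' = bl T a b' b'' ≫ pre _ (e ≫ bl T a b b') := by
  rw [pre, pre, Category.assoc, Category.assoc, bl_comp, leftUnitor_inv_naturality_assoc,
    MonoidalCategory.tensorHom_def', MonoidalCategory.comp_whiskerRight]
  simp only [Category.assoc]
  rw [← MonoidalCategory.whisker_exchange_assoc]

variable {C M : Type u} [EnrichedCategory V C] [MonoidalVCat V C] [EnrichedCategory V M]
  [LeftModule V C M]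

lemma triC (x y : C) :
    cmp (MonoidalVCat.assoc x (tone V C) y).hom
      ((MonoidalVCat.lunit y).hom ≫ bl (mulF V C) x _ _) =
      (MonoidalVCat.runit x).hom ≫ br (mulF V C) y _ _ := by
  rw [← el_bl, ← el_br]
  exact MonoidalVCat.triangle x y

lemma triM (x : C) (m : M) :
    cmp (aM V x (tone V C) m).hom ((uM V C m).hom ≫ bl (actF V C M) x _ _) =
      (MonoidalVCat.runit x).hom ≫ br (actF V C M) m _ _ := by
  rw [← el_bl, ← el_br]
  exact LeftModule.triangle x m

lemma pentM (x y z : C) (m : M) :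
    cmp ((MonoidalVCat.assoc (V := V) x y z).hom ≫ br (actF V C M) m _ _)
      (cmp (aM V x (tmul V y z) m).hom ((aM V y z m).hom ≫ bl (actF V C M) x _ _)) =
    cmp (aM V (tmul V x y) z m).hom (aM V x y (sm V z m)).hom := by
  rw [← el_bl, ← el_br]
  exact LeftModule.pentagon x y z m

lemma cmp_cancel {a b c : M} (e : VIso V a b) {f g : 𝟙_ V ⟶ (b ⟶[V] c)}
    (h : cmp e.hom f = cmp e.hom g) : f = g := by
  have := congrArg (fun t => cmp e.inv t) h
  simpa only [← cmp_assoc, e.inv_hom, id_cmp] using this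

/-- The associator `(x ⊗ y) ⊗ z ⟶ x ⊗ (y ⊗ z)` acting on an object of a module. -/
def brIso (m : M) {x y : C} (e : VIso V x y) : VIso V (sm V x m) (sm V y m) where
  hom := e.hom ≫ br (actF V C M) m _ _
  inv := e.inv ≫ br (actF V C M) m _ _
  hom_inv := by rw [← cmp_br, e.hom_inv, br_id]
  inv_hom := by rw [← cmp_br, e.inv_hom, br_id]

lemma one_faithful {m m' : M} {e f : 𝟙_ V ⟶ (m ⟶[V] m')}
    (h : e ≫ bl (actF V C M) (tone V C) m m' = f ≫ bl (actF V C M) (tone V C) m m') : e = f := by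
  have := congrArg (fun t => t ≫ post _ (uM V C m').hom ≫ pre _ (uM V C m).inv) h
  simp only [Category.assoc, reassoc_of% (unit_nat (V := V) (C := C) m m'), VIso.pre_hom_inv,
    Category.comp_id] at this
  exact this

lemma unit_law (x : C) (m : M) :
    cmp (aM V (tone V C) x m).hom (uM V C (sm V x m)).hom =
      (MonoidalVCat.lunit x).hom ≫ br (actF V C M) m _ _ := by
  apply one_faithful (C := C)
  apply cmp_cancel (aM V (tone V C) (tmul V (tone V C) x) m)
  apply cmp_cancel (brIso m (MonoidalVCat.assoc (V := V) (tone V C) (tone V C) x))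
  have n₁ : cmp (((MonoidalVCat.runit (V := V) (tone V C)).hom ≫ br (mulF V C) x _ _) ≫
      br (actF V C M) m _ _) (aM V (tone V C) x m).hom =
      cmp (aM V _ x m).hom ((MonoidalVCat.runit (V := V) (tone V C)).hom ≫
        br (actF V C M) (sm V x m) _ _) := by
    rw [cmp_eq_post, cmp_eq_pre, Category.assoc, Category.assoc, Category.assoc, assoc_nat₁]
  have n₂ : cmp (((MonoidalVCat.lunit (V := V) x).hom ≫ bl (mulF V C) (tone V C) _ _) ≫
      br (actF V C M) m _ _) (aM V (tone V C) x m).hom =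
      cmp (aM V (tone V C) _ m).hom (((MonoidalVCat.lunit (V := V) x).hom ≫
        br (actF V C M) m _ _) ≫ bl (actF V C M) (tone V C) _ _) := by
    rw [cmp_eq_post, cmp_eq_pre, Category.assoc, Category.assoc, Category.assoc, Category.assoc,
      assoc_nat₂]
  rw [← n₂, cmp_bl]
  change cmp (_ ≫ _) _ = cmp (_ ≫ _) _
  rw [← cmp_assoc, ← cmp_assoc, cmp_assoc _ (aM V _ _ m).hom, pentM, cmp_assoc, triM, ← n₁,
    ← triC, cmp_br, cmp_assoc]

/-- Composition `M(m₁, x m₂) ⊗ M(m₂, y m₃) ⟶ M(m₁, (x y) m₃)`. -/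
def gcomp (x y : C) (m₁ m₂ m₃ : M) :
    (m₁ ⟶[V] sm V x m₂) ⊗ (m₂ ⟶[V] sm V y m₃) ⟶ (m₁ ⟶[V] sm V (tmul V x y) m₃) :=
  _ ◁ bl (actF V C M) x _ _ ≫ eComp V _ _ _ ≫ post _ (aM V x y m₃).inv

/-- The action `M(m₁, x m₂) ⊗ C(x, x') ⟶ M(m₁, x' m₂)`. -/
def gact (m₁ m₂ : M) (x x' : C) :
    (m₁ ⟶[V] sm V x m₂) ⊗ (x ⟶[V] x') ⟶ (m₁ ⟶[V] sm V x' m₂) :=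
  _ ◁ br (actF V C M) m₂ _ _ ≫ eComp V _ _ _

/-- Composition `M(x m₂, m₁) ⊗ M(y m₃, m₂) ⟶ M((x y) m₃, m₁)`. -/
def hcomp (x y : C) (m₁ m₂ m₃ : M) :
    (sm V x m₂ ⟶[V] m₁) ⊗ (sm V y m₃ ⟶[V] m₂) ⟶ (sm V (tmul V x y) m₃ ⟶[V] m₁) :=
  (β_ _ _).hom ≫ bl (actF V C M) x _ _ ▷ _ ≫ eComp V _ _ _ ≫ pre _ (aM V x y m₃).hom

/-- The action `C(x, x') ⊗ M(x' m₂, m₁) ⟶ M(x m₂, m₁)`. -/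
def hact (m₁ m₂ : M) (x x' : C) :
    (x ⟶[V] x') ⊗ (sm V x' m₂ ⟶[V] m₁) ⟶ (sm V x m₂ ⟶[V] m₁) :=
  br (actF V C M) m₂ _ _ ▷ _ ≫ eComp V _ _ _

lemma nat₁' (x x' y : C) (m : M) :
    br (mulF V C) y x x' ≫ br (actF V C M) m _ _ ≫ pre _ (aM V x y m).inv =
      br (actF V C M) (sm V y m) x x' ≫ post _ (aM V x' y m).inv := by
  rw [← Category.assoc]
  apply nat_inv
  rw [Category.assoc]
  exact assoc_nat₁ x x' y m

lemma nat₂' (x y y' : C) (m : M) :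
    bl (mulF V C) x y y' ≫ br (actF V C M) m _ _ ≫ pre _ (aM V x y m).inv =
      br (actF V C M) m y y' ≫ bl (actF V C M) x _ _ ≫ post _ (aM V x y' m).inv := by
  rw [← Category.assoc, ← Category.assoc (br _ _ _ _)]
  apply nat_inv
  rw [Category.assoc, Category.assoc]
  exact assoc_nat₂ x y y' m

lemma nat₃' (x y : C) (m m' : M) :
    bl (actF V C M) (tmul V x y) m m' ≫ pre _ (aM V x y m).inv =
      bl (actF V C M) y m m' ≫ bl (actF V C M) x _ _ ≫ post _ (aM V x y m').inv := by
  rw [← Category.assoc (bl _ _ _ _)]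
  apply nat_inv
  rw [Category.assoc]
  exact assoc_nat₃ x y m m'

lemma unit_nat' (m m' : M) :
    bl (actF V C M) (tone V C) m m' ≫ pre _ (uM V C m).inv = post _ (uM V C m').inv := by
  have := nat_inv (F := bl (actF V C M) (tone V C) m m') (G := 𝟙 (m ⟶[V] m')) (uM V C m)
    (uM V C m') (by rw [unit_nat, Category.id_comp])
  rw [this, Category.id_comp]

lemma comp_two {W Y Z : V} {a b c d : M} (h : W ⟶ (a ⟶[V] b)) (f : Y ⟶ (b ⟶[V] c))
    (g : Z ⟶ (c ⟶[V] d)) :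
    (h ▷ Y ≫ _ ◁ f ≫ eComp V _ _ _) ▷ Z ≫ _ ◁ g ≫ eComp V _ _ _ =
      (α_ _ _ _).hom ≫ h ▷ _ ≫ _ ◁ ((f ⊗ₘ g) ≫ eComp V _ _ _) ≫ eComp V _ _ _ := by
  rw [comp_whiskerRight, comp_whiskerRight, Category.assoc, Category.assoc,
    ← MonoidalCategory.whisker_exchange_assoc, ← e_assoc']
  simp only [MonoidalCategory.tensorHom_def, MonoidalCategory.whiskerLeft_comp, Category.assoc]
  monoidal

lemma mid_move {W Z : V} {a b c d : M} (P : W ⟶ (a ⟶[V] b)) (e : 𝟙_ V ⟶ (b ⟶[V] c))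
    (g : Z ⟶ (c ⟶[V] d)) :
    (P ≫ post a e) ▷ Z ≫ _ ◁ g ≫ eComp V _ _ _ =
      P ▷ Z ≫ _ ◁ (g ≫ pre d e) ≫ eComp V _ _ _ := by
  rw [comp_whiskerRight, Category.assoc, ← MonoidalCategory.whisker_exchange_assoc, post_pre_comp,
    MonoidalCategory.whiskerLeft_comp, Category.assoc]

lemma end_move {W : V} {a b c d : M} (g : W ⟶ (b ⟶[V] c)) (e : 𝟙_ V ⟶ (c ⟶[V] d)) :
    (a ⟶[V] b) ◁ (g ≫ post b e) ≫ eComp V _ _ _ = _ ◁ g ≫ eComp V _ _ _ ≫ post a e := by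
  rw [MonoidalCategory.whiskerLeft_comp, Category.assoc, ← comp_post]

lemma gcomp_eq (x y : C) (m₁ m₂ m₃ : M) : gcomp (V := V) x y m₁ m₂ m₃ =
    ((𝟙 _) ▷ _ ≫ _ ◁ bl (actF V C M) x _ _ ≫ eComp V _ _ _) ≫ post _ (aM V x y m₃).inv := by
  rw [gcomp]; simp only [id_whiskerRight, Category.id_comp, Category.assoc]

lemma gact_eq (m₁ m₂ : M) (x x' : C) : gact (V := V) m₁ m₂ x x' =
    (𝟙 _) ▷ _ ≫ _ ◁ br (actF V C M) m₂ _ _ ≫ eComp V _ _ _ := by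
  rw [gact]; simp only [id_whiskerRight, Category.id_comp]

lemma gact_gcomp (x x' y : C) (m₁ m₂ m₃ : M) :
    gact m₁ m₂ x x' ▷ _ ≫ gcomp (V := V) x' y m₁ m₂ m₃ =
      rs _ _ _ ≫ gcomp x y m₁ m₂ m₃ ▷ _ ≫ _ ◁ br (mulF V C) y x x' ≫ gact m₁ m₃ _ _ := by
  have hx := bl_br (V := V) (actF V C M) x x' m₂ (sm V y m₃)
  have hy := br_bl (V := V) (actF V C M) x x' m₂ (sm V y m₃)
  rw [← hy] at hx
  have h₁ := comp_two (𝟙 (m₁ ⟶[V] sm V x m₂)) (br (actF V C M) m₂ x x')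
    (bl (actF V C M) x' m₂ (sm V y m₃))
  have h₂ := comp_two (𝟙 (m₁ ⟶[V] sm V x m₂)) (bl (actF V C M) x m₂ (sm V y m₃))
    (br (actF V C M) (sm V y m₃) x x')
  rw [gcomp, gact_eq, reassoc_of% h₁, gcomp_eq, gact.eq_1 m₁ m₃,
    ← MonoidalCategory.whiskerLeft_comp_assoc, mid_move, Category.assoc, nat₁', end_move,
    reassoc_of% h₂, hx, rs]
  simp only [Category.assoc, Iso.inv_hom_id_assoc, id_whiskerRight, Category.id_comp,
    ← MonoidalCategory.whiskerLeft_comp_assoc, SymmetricCategory.symmetry_assoc]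

lemma gact_gcomp' (x y y' : C) (m₁ m₂ m₃ : M) :
    _ ◁ gact m₂ m₃ y y' ≫ gcomp (V := V) x y' m₁ m₂ m₃ =
      (α_ _ _ _).inv ≫ gcomp x y m₁ m₂ m₃ ▷ _ ≫ _ ◁ bl (mulF V C) x y y' ≫ gact m₁ m₃ _ _ := by
  have h₂ := comp_two (𝟙 (m₁ ⟶[V] sm V x m₂)) (bl (actF V C M) x m₂ (sm V y m₃))
    (br (actF V C M) m₃ y y' ≫ bl (actF V C M) x _ _)
  rw [gcomp_eq x y, gact.eq_1 m₁ m₃, ← MonoidalCategory.whiskerLeft_comp_assoc, mid_move,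
    Category.assoc, nat₂', ← Category.assoc (br _ _ _ _), end_move,
    reassoc_of% h₂, Iso.inv_hom_id_assoc, gcomp, gact, ← MonoidalCategory.whiskerLeft_comp_assoc,
    Category.assoc, bl_comp]
  simp only [MonoidalCategory.tensorHom_def', Category.assoc, id_whiskerRight, Category.id_comp,
    MonoidalCategory.whiskerLeft_comp]

lemma pentM' (x y z : C) (m : M) :
    cmp (cmp (aM V x y (sm V z m)).inv (aM V (tmul V x y) z m).inv)
      ((MonoidalVCat.assoc (V := V) x y z).hom ≫ br (actF V C M) m _ _) =
    cmp ((aM V y z m).inv ≫ bl (actF V C M) x _ _) (aM V x (tmul V y z) m).inv := by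
  have h := pentM (V := V) x y z m
  have k : cmp ((aM V y z m).hom ≫ bl (actF V C M) x _ _)
    ((aM V y z m).inv ≫ bl (actF V C M) x _ _) = eId V _ := by
      rw [← cmp_bl, VIso.hom_inv, bl_id]
  have h' := congrArg (fun t => cmp (cmp (aM V x y (sm V z m)).inv (aM V (tmul V x y) z m).inv)
    (cmp t (cmp ((aM V y z m).inv ≫ bl (actF V C M) x _ _) (aM V x (tmul V y z) m).inv))) h
  simp only [cmp_assoc] at h'
  rw [← cmp_assoc _ _ (aM V x (tmul V y z) m).inv, k, id_cmp, VIso.hom_inv, cmp_id,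
    ← cmp_assoc (aM V (tmul V x y) z m).inv, VIso.inv_hom, id_cmp,
    ← cmp_assoc (aM V x y (sm V z m)).inv (aM V x y (sm V z m)).hom, VIso.inv_hom, id_cmp] at h'
  exact (cmp_assoc _ _ _).trans h'

lemma gcomp_assoc (x y z : C) (m₁ m₂ m₃ m₄ : M) :
    gcomp (V := V) x y m₁ m₂ m₃ ▷ _ ≫ gcomp (tmul V x y) z m₁ m₃ m₄ ≫
        post _ ((MonoidalVCat.assoc x y z).hom ≫ br (actF V C M) m₄ _ _) =
      (α_ _ _ _).hom ≫ _ ◁ gcomp y z m₂ m₃ m₄ ≫ gcomp x (tmul V y z) m₁ m₂ m₄ := by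
  have h₂ := comp_two (𝟙 (m₁ ⟶[V] sm V x m₂)) (bl (actF V C M) x m₂ (sm V y m₃))
    (bl (actF V C M) y m₃ (sm V z m₄) ≫ bl (actF V C M) x _ _)
  have k : gcomp (V := V) y z m₂ m₃ m₄ ≫ bl (actF V C M) x _ _ =
      ((bl (actF V C M) x _ _ ⊗ₘ (bl (actF V C M) y _ _ ≫ bl (actF V C M) x _ _)) ≫
        eComp V _ _ _) ≫ post _ ((aM V y z m₄).inv ≫ bl (actF V C M) x _ _) := by
    rw [gcomp, Category.assoc, Category.assoc, post_bl, reassoc_of% bl_comp]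
    simp only [MonoidalCategory.tensorHom_def', Category.assoc, MonoidalCategory.whiskerLeft_comp]
  have h₁ := mid_move (𝟙 (m₁ ⟶[V] sm V x m₂) ▷ _ ≫ _ ◁ bl (actF V C M) x _ _ ≫ eComp V _ _ _) (aM V x y m₃).inv
    (bl (actF V C M) (tmul V x y) m₃ (sm V z m₄))
  simp only [Category.assoc] at h₁
  rw [gcomp_eq x y, gcomp.eq_1 (tmul V x y)]
  simp only [Category.assoc]
  rw [reassoc_of% h₁, nat₃', ← Category.assoc (bl _ _ _ _) (bl _ _ _ _),
    reassoc_of% end_move, reassoc_of% h₂, post_post, post_post,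
    ← cmp_assoc (aM V x y (sm V z m₄)).inv, pentM', gcomp.eq_1 x,
    ← MonoidalCategory.whiskerLeft_comp_assoc, k, reassoc_of% end_move, post_post]
  simp only [id_whiskerRight, Category.id_comp]

lemma unit_gcomp (y : C) (m₁ m₂ m₃ : M) :
    post m₁ (uM V C m₂).inv ▷ (m₂ ⟶[V] sm V y m₃) ≫ gcomp (V := V) (tone V C) y m₁ m₂ m₃ ≫
        post _ ((MonoidalVCat.lunit y).hom ≫ br (actF V C M) m₃ _ _) = eComp V _ _ _ := by
  have h := mid_move (𝟙 (m₁ ⟶[V] m₂)) (uM V C m₂).inv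
    (bl (actF V C M) (tone V C) m₂ (sm V y m₃))
  rw [Category.id_comp, id_whiskerRight, Category.id_comp, unit_nat'] at h
  rw [gcomp, Category.assoc, Category.assoc, reassoc_of% h, ← reassoc_of% comp_post, post_post,
    post_post, ← unit_law, ← cmp_assoc (aM V (tone V C) y m₃).inv, VIso.inv_hom, id_cmp,
    VIso.inv_hom, post_id, Category.comp_id]

lemma gcomp_unit (x : C) (m₁ m₂ : M) :
    (ρ_ _).inv ≫ _ ◁ (uM V C m₂).inv ≫ gcomp (V := V) x (tone V C) m₁ m₂ m₂ ≫
        post _ ((MonoidalVCat.runit x).hom ≫ br (actF V C M) m₂ _ _) = 𝟙 _ := by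
  have h : (ρ_ _).inv ≫ _ ◁ (uM V C m₂).inv ≫ _ ◁ bl (actF V C M) x _ _ ≫ eComp V m₁ _ _ =
      post _ ((uM V C m₂).inv ≫ bl (actF V C M) x _ _) := by
    rw [post, MonoidalCategory.whiskerLeft_comp, Category.assoc]
  have k : cmp ((uM V C m₂).inv ≫ bl (actF V C M) x m₂ (sm V (tone V C) m₂))
    ((uM V C m₂).hom ≫ bl (actF V C M) x _ _) = eId V _ := by
      rw [← cmp_bl, VIso.inv_hom, bl_id]
  rw [gcomp, Category.assoc, Category.assoc, reassoc_of% h, post_post, ← triM, post_post,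
    ← cmp_assoc (aM V x (tone V C) m₂).inv, VIso.inv_hom, id_cmp, k, post_id]

/-- The composition `hcomp` with the arguments in the opposite order. -/
def hcomp0 (x y : C) (m₁ m₂ m₃ : M) :
    (sm V y m₃ ⟶[V] m₂) ⊗ (sm V x m₂ ⟶[V] m₁) ⟶ (sm V (tmul V x y) m₃ ⟶[V] m₁) :=
  bl (actF V C M) x _ _ ▷ _ ≫ eComp V _ _ _ ≫ pre _ (aM V x y m₃).hom

lemma comp_two' {W Y Z : V} {a b c d : M} (h : W ⟶ (c ⟶[V] d)) (f : Y ⟶ (b ⟶[V] c))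
    (g : Z ⟶ (a ⟶[V] b)) :
    Z ◁ (Y ◁ h ≫ f ▷ _ ≫ eComp V _ _ _) ≫ g ▷ _ ≫ eComp V _ _ _ =
      (α_ _ _ _).inv ≫ _ ◁ h ≫ ((g ⊗ₘ f) ≫ eComp V _ _ _) ▷ _ ≫ eComp V _ _ _ := by
  rw [MonoidalCategory.whiskerLeft_comp, MonoidalCategory.whiskerLeft_comp, Category.assoc,
    Category.assoc, MonoidalCategory.whisker_exchange_assoc, ← e_assoc]
  simp only [MonoidalCategory.tensorHom_def', comp_whiskerRight, Category.assoc]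
  monoidal

lemma mid_move' {W Z : V} {a b c d : M} (P : W ⟶ (c ⟶[V] d)) (e : 𝟙_ V ⟶ (b ⟶[V] c))
    (g : Z ⟶ (a ⟶[V] b)) :
    Z ◁ (P ≫ pre d e) ≫ g ▷ _ ≫ eComp V _ _ _ =
      Z ◁ P ≫ (g ≫ post a e) ▷ _ ≫ eComp V _ _ _ := by
  rw [MonoidalCategory.whiskerLeft_comp, Category.assoc, MonoidalCategory.whisker_exchange_assoc,
    ← post_pre_comp, comp_whiskerRight, Category.assoc]

lemma end_move' {W : V} {a b c d : M} (g : W ⟶ (b ⟶[V] c)) (e : 𝟙_ V ⟶ (a ⟶[V] b)) :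
    (g ≫ pre c e) ▷ (c ⟶[V] d) ≫ eComp V _ _ _ = g ▷ _ ≫ eComp V _ _ _ ≫ pre d e := by
  rw [comp_whiskerRight, Category.assoc, ← comp_pre]

lemma hcomp0_eq (x y : C) (m₁ m₂ m₃ : M) : hcomp0 (V := V) x y m₁ m₂ m₃ =
    (_ ◁ (𝟙 _) ≫ bl (actF V C M) x _ _ ▷ _ ≫ eComp V _ _ _) ≫ pre _ (aM V x y m₃).hom := by
  rw [hcomp0]; simp only [whiskerLeft_id, Category.id_comp, Category.assoc]

lemma hact_eq (m₁ m₂ : M) (x x' : C) : hact (V := V) m₁ m₂ x x' =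
    _ ◁ (𝟙 _) ≫ br (actF V C M) m₂ _ _ ▷ _ ≫ eComp V _ _ _ := by
  rw [hact]; simp only [whiskerLeft_id, Category.id_comp]

lemma hact_hcomp0 (x x' y : C) (m₁ m₂ m₃ : M) :
    _ ◁ hact m₁ m₂ x x' ≫ hcomp0 (V := V) x y m₁ m₂ m₃ =
      (α_ _ _ _).inv ≫ (β_ _ _).hom ▷ _ ≫ (α_ _ _ _).hom ≫
        _ ◁ hcomp0 x' y m₁ m₂ m₃ ≫ br (mulF V C) y x x' ▷ _ ≫ hact m₁ m₃ _ _ := by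
  have hx := bl_br (V := V) (actF V C M) x x' (sm V y m₃) m₂
  have hy := br_bl (V := V) (actF V C M) x x' (sm V y m₃) m₂
  rw [← hy] at hx
  have h₁ := comp_two' (𝟙 (sm V x' m₂ ⟶[V] m₁)) (br (actF V C M) m₂ x x')
    (bl (actF V C M) x (sm V y m₃) m₂)
  have h₂ := comp_two' (𝟙 (sm V x' m₂ ⟶[V] m₁)) (bl (actF V C M) x' (sm V y m₃) m₂)
    (br (actF V C M) (sm V y m₃) x x')
  rw [hcomp0, hact_eq, reassoc_of% h₁, hcomp0_eq, hact.eq_1 m₁ m₃,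
    ← MonoidalCategory.comp_whiskerRight_assoc, mid_move', Category.assoc, assoc_nat₁, end_move',
    reassoc_of% h₂, hx]
  simp only [comp_whiskerRight, Category.assoc, whiskerLeft_id, Category.id_comp,
    Iso.hom_inv_id_assoc]

lemma hact_hcomp0' (x y y' : C) (m₁ m₂ m₃ : M) :
    hact m₂ m₃ y y' ▷ _ ≫ hcomp0 (V := V) x y m₁ m₂ m₃ =
      (α_ _ _ _).hom ≫ _ ◁ hcomp0 x y' m₁ m₂ m₃ ≫ bl (mulF V C) x y y' ▷ _ ≫ hact m₁ m₃ _ _ := by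
  have h₂ := comp_two' (𝟙 (sm V x m₂ ⟶[V] m₁)) (bl (actF V C M) x (sm V y' m₃) m₂)
    (br (actF V C M) m₃ y y' ≫ bl (actF V C M) x _ _)
  rw [hcomp0_eq x y', hact.eq_1 m₁ m₃, ← MonoidalCategory.comp_whiskerRight_assoc, mid_move',
    Category.assoc, assoc_nat₂, ← Category.assoc (br _ _ _ _), end_move',
    reassoc_of% h₂, Iso.hom_inv_id_assoc, hcomp0, hact, ← MonoidalCategory.comp_whiskerRight_assoc,
    Category.assoc, bl_comp]
  simp only [MonoidalCategory.tensorHom_def, Category.assoc, whiskerLeft_id, Category.id_comp,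
    MonoidalCategory.comp_whiskerRight]

lemma hcomp0_assoc (x y z : C) (m₁ m₂ m₃ m₄ : M) :
    _ ◁ hcomp0 (V := V) x y m₁ m₂ m₃ ≫ hcomp0 (tmul V x y) z m₁ m₃ m₄ =
      (α_ _ _ _).inv ≫ hcomp0 y z m₂ m₃ m₄ ▷ _ ≫ hcomp0 x (tmul V y z) m₁ m₂ m₄ ≫
        pre _ ((MonoidalVCat.assoc x y z).hom ≫ br (actF V C M) m₄ _ _) := by
  have h₂ := comp_two' (𝟙 (sm V x m₂ ⟶[V] m₁)) (bl (actF V C M) x (sm V y m₃) m₂)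
    (bl (actF V C M) y (sm V z m₄) m₃ ≫ bl (actF V C M) x _ _)
  have k : hcomp0 (V := V) y z m₂ m₃ m₄ ≫ bl (actF V C M) x _ _ =
      (((bl (actF V C M) y _ _ ≫ bl (actF V C M) x _ _) ⊗ₘ bl (actF V C M) x _ _) ≫
        eComp V _ _ _) ≫ pre _ ((aM V y z m₄).hom ≫ bl (actF V C M) x _ _) := by
    rw [hcomp0, Category.assoc, Category.assoc, pre_bl, reassoc_of% bl_comp]
    simp only [MonoidalCategory.tensorHom_def, Category.assoc, MonoidalCategory.comp_whiskerRight]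
  have h₁ := mid_move' (_ ◁ 𝟙 (sm V x m₂ ⟶[V] m₁) ≫ bl (actF V C M) x _ _ ▷ _ ≫ eComp V _ _ _)
    (aM V x y m₃).hom (bl (actF V C M) (tmul V x y) (sm V z m₄) m₃)
  simp only [Category.assoc] at h₁
  rw [hcomp0_eq x y, hcomp0.eq_1 (tmul V x y)]
  simp only [Category.assoc]
  rw [reassoc_of% h₁, assoc_nat₃, ← Category.assoc (bl _ _ _ _) (bl _ _ _ _),
    reassoc_of% end_move', reassoc_of% h₂, pre_pre, ← pentM, hcomp0.eq_1 x]
  simp only [Category.assoc]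
  rw [← MonoidalCategory.comp_whiskerRight_assoc, k]
  simp only [Category.assoc]
  rw [← Category.assoc (_ ⊗ₘ _), reassoc_of% end_move', pre_pre, pre_pre]
  simp only [whiskerLeft_id, Category.id_comp, cmp_assoc, Category.assoc]

lemma hcomp_eq (x y : C) (m₁ m₂ m₃ : M) :
    hcomp (V := V) x y m₁ m₂ m₃ = (β_ _ _).hom ≫ hcomp0 x y m₁ m₂ m₃ := rfl

lemma hact_hcomp (x x' y : C) (m₁ m₂ m₃ : M) :
    hact m₁ m₂ x x' ▷ _ ≫ hcomp (V := V) x y m₁ m₂ m₃ =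
      (α_ _ _ _).hom ≫ _ ◁ hcomp x' y m₁ m₂ m₃ ≫ br (mulF V C) y x x' ▷ _ ≫ hact m₁ m₃ _ _ := by
  simp only [hcomp_eq, BraidedCategory.braiding_naturality_left_assoc, hact_hcomp0,
    BraidedCategory.braiding_tensor_left_hom, MonoidalCategory.whiskerLeft_comp, Category.assoc,
    Iso.hom_inv_id_assoc, Iso.inv_hom_id_assoc, ← comp_whiskerRight_assoc,
    SymmetricCategory.symmetry, id_whiskerRight, Category.id_comp]

lemma hact_hcomp' (x y y' : C) (m₁ m₂ m₃ : M) :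
    _ ◁ hact m₂ m₃ y y' ≫ hcomp (V := V) x y m₁ m₂ m₃ =
      (α_ _ _ _).inv ≫ (β_ _ _).hom ▷ _ ≫ (α_ _ _ _).hom ≫ _ ◁ hcomp x y' m₁ m₂ m₃ ≫
        bl (mulF V C) x y y' ▷ _ ≫ hact m₁ m₃ _ _ := by
  simp only [hcomp_eq, BraidedCategory.braiding_naturality_right_assoc, hact_hcomp0',
    BraidedCategory.braiding_tensor_right_hom, MonoidalCategory.whiskerLeft_comp, Category.assoc,
    Iso.inv_hom_id_assoc]

lemma hcomp_assoc (x y z : C) (m₁ m₂ m₃ m₄ : M) :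
    hcomp (V := V) x y m₁ m₂ m₃ ▷ _ ≫ hcomp (tmul V x y) z m₁ m₃ m₄ =
      (α_ _ _ _).hom ≫ _ ◁ hcomp y z m₂ m₃ m₄ ≫ hcomp x (tmul V y z) m₁ m₂ m₄ ≫
        pre _ ((MonoidalVCat.assoc x y z).hom ≫ br (actF V C M) m₄ _ _) := by
  simp only [hcomp_eq, comp_whiskerRight, Category.assoc, MonoidalCategory.whiskerLeft_comp,
    BraidedCategory.braiding_naturality_right_assoc,
    BraidedCategory.braiding_naturality_left_assoc, hcomp0_assoc,
    BraidedCategory.braiding_tensor_right_hom, BraidedCategory.braiding_tensor_left_hom]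
  rw [← BraidedCategory.yang_baxter_assoc, Iso.hom_inv_id_assoc, Iso.hom_inv_id_assoc]

lemma unit_hcomp (y : C) (m₁ m₂ m₃ : M) :
    pre m₁ (uM V C m₂).hom ▷ (sm V y m₃ ⟶[V] m₂) ≫ hcomp (V := V) (tone V C) y m₁ m₂ m₃ =
      (β_ _ _).hom ≫ eComp V _ _ _ ≫
        pre _ ((MonoidalVCat.lunit y).hom ≫ br (actF V C M) m₃ _ _) := by
  have h := mid_move' (𝟙 (m₂ ⟶[V] m₁)) (uM V C m₂).hom
    (bl (actF V C M) (tone V C) (sm V y m₃) m₂)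
  rw [Category.id_comp, whiskerLeft_id, Category.id_comp, unit_nat] at h
  rw [hcomp, BraidedCategory.braiding_naturality_left_assoc, reassoc_of% h, ← reassoc_of% comp_pre,
    pre_pre, unit_law]

lemma hcomp_unit (x : C) (m₁ m₂ : M) :
    (ρ_ _).inv ≫ _ ◁ (uM V C m₂).hom ≫ hcomp (V := V) x (tone V C) m₁ m₂ m₂ =
      pre _ ((MonoidalVCat.runit x).hom ≫ br (actF V C M) m₂ _ _) := by
  have h : (λ_ _).inv ≫ (uM V C m₂).hom ▷ _ ≫ bl (actF V C M) x _ _ ▷ _ ≫ eComp V _ _ m₁ =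
      pre _ ((uM V C m₂).hom ≫ bl (actF V C M) x _ _) := by
    rw [pre, MonoidalCategory.comp_whiskerRight, Category.assoc]
  rw [hcomp, BraidedCategory.braiding_naturality_right_assoc, braiding_tensorUnit_right]
  simp only [Category.assoc, Iso.inv_hom_id_assoc]
  rw [reassoc_of% h, pre_pre, triM]

end Module

section Coh
variable {V : Type w} [Category.{u} V] [MonoidalCategory V] [SymmetricCategory V]

lemma tensorμ_bal₁ (G H F G' F' : V) :
    tensorμ (G ⊗ H) F G' F' ≫ rs G H G' ▷ (F ⊗ F') ≫ (α_ _ _ _).hom =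
      (α_ G H F).hom ▷ (G' ⊗ F') ≫ tensorμ G (H ⊗ F) G' F' ≫ _ ◁ (α_ H F F').hom := by
  simp only [tensorμ, rs, BraidedCategory.braiding_tensor_left_hom,
    MonoidalCategory.whiskerLeft_comp, comp_whiskerRight, Category.assoc]
  monoidal

lemma tensorμ_bal₂ (G F G' H F' : V) :
    tensorμ G F (G' ⊗ H) F' ≫ (α_ _ _ _).inv ▷ _ ≫ (α_ _ _ _).hom =
      (G ⊗ F) ◁ (α_ G' H F').hom ≫ tensorμ G F G' (H ⊗ F') ≫
        _ ◁ ((α_ F H F').inv ≫ (β_ F H).hom ▷ F' ≫ (α_ H F F').hom) := by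
  simp only [tensorμ, BraidedCategory.braiding_tensor_right_hom,
    MonoidalCategory.whiskerLeft_comp, comp_whiskerRight, Category.assoc]
  monoidal

lemma wc_aux {A P K Q' P' Q X H F : V} (gc : A ⟶ P) (b : H ⟶ K) (hc' : F ⟶ Q')
    (R : P ⊗ K ⟶ P') (L : K ⊗ Q' ⟶ Q) (i' : P' ⊗ Q' ⟶ X) (i : P ⊗ Q ⟶ X)
    (w : R ▷ Q' ≫ i' = (α_ _ _ _).hom ≫ P ◁ L ≫ i) :
    ((gc ▷ H ≫ P ◁ b ≫ R) ⊗ₘ hc') ≫ i' =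
      (α_ A H F).hom ≫ (gc ⊗ₘ (H ◁ hc' ≫ b ▷ _ ≫ L)) ≫ i := by
  rw [MonoidalCategory.tensorHom_def', MonoidalCategory.tensorHom_def']
  simp only [comp_whiskerRight, Category.assoc, w, MonoidalCategory.whiskerLeft_comp]
  conv_lhs => rw [MonoidalCategory.whisker_exchange_assoc]
  conv_rhs => rw [MonoidalCategory.whisker_exchange_assoc,
    MonoidalCategory.whisker_exchange_assoc, MonoidalCategory.whisker_exchange_assoc]
  monoidal

lemma wc_aux₁ {G H F G' F' G₁ F₁ P P' Q Q' K X : V} (r : G ⊗ H ⟶ G₁) (l : H ⊗ F ⟶ F₁)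
    (gc' : G₁ ⊗ G' ⟶ P') (gc : G ⊗ G' ⟶ P) (hc' : F ⊗ F' ⟶ Q') (hc : F₁ ⊗ F' ⟶ Q)
    (b : H ⟶ K) (R : P ⊗ K ⟶ P') (L : K ⊗ Q' ⟶ Q) (i' : P' ⊗ Q' ⟶ X) (i : P ⊗ Q ⟶ X)
    (e₁ : r ▷ G' ≫ gc' = rs G H G' ≫ gc ▷ H ≫ P ◁ b ≫ R)
    (e₂ : l ▷ F' ≫ hc = (α_ _ _ _).hom ≫ H ◁ hc' ≫ b ▷ Q' ≫ L)
    (w : R ▷ Q' ≫ i' = (α_ _ _ _).hom ≫ P ◁ L ≫ i) :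
    r ▷ F ▷ (G' ⊗ F') ≫ tensorμ _ _ _ _ ≫ (gc' ⊗ₘ hc') ≫ i' =
      (α_ _ _ _).hom ▷ _ ≫ (G ◁ l) ▷ _ ≫ tensorμ _ _ _ _ ≫ (gc ⊗ₘ hc) ≫ i := by
  have h := tensorμ_bal₁ G H F G' F'
  have n₁ : r ▷ F ▷ (G' ⊗ F') ≫ tensorμ G₁ F G' F' =
      tensorμ (G ⊗ H) F G' F' ≫ ((r ▷ G') ⊗ₘ 𝟙 _) := by
    have := tensorμ_natural_left r (𝟙 F) G' F'
    simpa only [tensorHom_id, id_whiskerRight] using this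
  have n₂ : (G ◁ l) ▷ (G' ⊗ F') ≫ tensorμ G F₁ G' F' =
      tensorμ G (H ⊗ F) G' F' ≫ (𝟙 _ ⊗ₘ (l ▷ F')) := by
    have := tensorμ_natural_left (𝟙 G) l G' F'
    simpa only [id_tensorHom, id_whiskerRight] using this
  rw [reassoc_of% n₁, reassoc_of% n₂, tensorHom_comp_tensorHom_assoc,
    tensorHom_comp_tensorHom_assoc, e₁, e₂, Category.id_comp, Category.id_comp]
  have k := wc_aux (A := G ⊗ G') gc b hc' R L i' i w
  have k₁ : ((rs G H G' ≫ gc ▷ H ≫ P ◁ b ≫ R) ⊗ₘ hc') =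
    rs G H G' ▷ _ ≫ ((gc ▷ H ≫ P ◁ b ≫ R) ⊗ₘ hc') := by
      simp [MonoidalCategory.tensorHom_def]
  have k₂ : (gc ⊗ₘ ((α_ H F F').hom ≫ H ◁ hc' ≫ b ▷ Q' ≫ L)) =
    _ ◁ (α_ H F F').hom ≫ (gc ⊗ₘ (H ◁ hc' ≫ b ▷ Q' ≫ L)) := by
      simp [MonoidalCategory.tensorHom_def']
  rw [k₁, k₂, Category.assoc, k, reassoc_of% h, Category.assoc]

lemma wc_aux₂ {G H F G' F' G₁ F₁ P P' Q Q' K X : V} (r : G' ⊗ H ⟶ G₁) (l : H ⊗ F' ⟶ F₁)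
    (gc' : G ⊗ G₁ ⟶ P') (gc : G ⊗ G' ⟶ P) (hc' : F ⊗ F' ⟶ Q') (hc : F ⊗ F₁ ⟶ Q)
    (b : H ⟶ K) (R : P ⊗ K ⟶ P') (L : K ⊗ Q' ⟶ Q) (i' : P' ⊗ Q' ⟶ X) (i : P ⊗ Q ⟶ X)
    (e₁ : G ◁ r ≫ gc' = (α_ _ _ _).inv ≫ gc ▷ H ≫ P ◁ b ≫ R)
    (e₂ : F ◁ l ≫ hc = (α_ _ _ _).inv ≫ (β_ _ _).hom ▷ _ ≫ (α_ _ _ _).hom ≫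
      H ◁ hc' ≫ b ▷ Q' ≫ L)
    (w : R ▷ Q' ≫ i' = (α_ _ _ _).hom ≫ P ◁ L ≫ i) :
    (G ⊗ F) ◁ r ▷ F' ≫ tensorμ _ _ _ _ ≫ (gc' ⊗ₘ hc') ≫ i' =
      _ ◁ (α_ _ _ _).hom ≫ _ ◁ (G' ◁ l) ≫ tensorμ _ _ _ _ ≫ (gc ⊗ₘ hc) ≫ i := by
  have h := tensorμ_bal₂ G F G' H F'
  have n₁ : (G ⊗ F) ◁ r ▷ F' ≫ tensorμ G F G₁ F' =
      tensorμ G F (G' ⊗ H) F' ≫ ((G ◁ r) ⊗ₘ 𝟙 _) := by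
    have := tensorμ_natural_right G F r (𝟙 F')
    simpa only [tensorHom_id, MonoidalCategory.whiskerLeft_id] using this
  have n₂ : (G ⊗ F) ◁ G' ◁ l ≫ tensorμ G F G' F₁ =
      tensorμ G F G' (H ⊗ F') ≫ (𝟙 _ ⊗ₘ (F ◁ l)) := by
    have := tensorμ_natural_right G F (𝟙 G') l
    simpa only [id_tensorHom, MonoidalCategory.whiskerLeft_id] using this
  rw [reassoc_of% n₁, reassoc_of% n₂, tensorHom_comp_tensorHom_assoc,
    tensorHom_comp_tensorHom_assoc, e₁, e₂, Category.id_comp, Category.id_comp]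
  have k := wc_aux (A := G ⊗ G') gc b hc' R L i' i w
  have k₁ : (((α_ G G' H).inv ≫ gc ▷ H ≫ P ◁ b ≫ R) ⊗ₘ hc') =
    (α_ G G' H).inv ▷ _ ≫ ((gc ▷ H ≫ P ◁ b ≫ R) ⊗ₘ hc') := by
      simp [MonoidalCategory.tensorHom_def]
  have k₂ : (gc ⊗ₘ ((α_ F H F').inv ≫ (β_ F H).hom ▷ F' ≫ (α_ H F F').hom ≫
      H ◁ hc' ≫ b ▷ Q' ≫ L)) =
    _ ◁ ((α_ F H F').inv ≫ (β_ F H).hom ▷ F' ≫ (α_ H F F').hom) ≫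
      (gc ⊗ₘ (H ◁ hc' ≫ b ▷ Q' ≫ L)) := by
      simp [MonoidalCategory.tensorHom_def']
  rw [k₁, k₂, Category.assoc, k, reassoc_of% h, Category.assoc]

end Coh

section W
variable {V : Type w} [Category.{u} V] [MonoidalCategory V] [SymmetricCategory V]
  [MonoidalClosed V] [HasLimits V] [HasColimits V]
variable {C M N : Type u} [EnrichedCategory V C] [MonoidalVCat V C] [EnrichedCategory V M]
  [LeftModule V C M] [EnrichedCategory V N] [LeftModule V C N]

variable (V C) in
/-- The object `∫^x N(n, x n') ⊗ M(x m', m)`. -/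
def wObj (m : M) (n : N) (m' : M) (n' : N) : V :=
  coend (D := C) (H := fun x x' => (x ⟶[V] x')) (G := fun x => n ⟶[V] sm V x n')
    (F := fun x => sm V x m' ⟶[V] m) (gact n n') (hact m m')

/-- The coprojection. -/
def wι (x : C) (m : M) (n : N) (m' : M) (n' : N) :
    (n ⟶[V] sm V x n') ⊗ (sm V x m' ⟶[V] m) ⟶ wObj V C m n m' n' :=
  coend.ι (gact n n') (hact m m') x

lemma wι_w (x x' : C) (m : M) (n : N) (m' : M) (n' : N) :
    gact n n' x x' ▷ _ ≫ wι x' m n m' n' =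
      (α_ _ _ _).hom ≫ _ ◁ hact m m' x x' ≫ wι (V := V) x m n m' n' :=
  coend.w (gact n n') (hact m m') x x'

/-- Composition on generators. -/
def wc (x y : C) (m₁ : M) (n₁ : N) (m₂ : M) (n₂ : N) (m₃ : M) (n₃ : N) :
    ((n₁ ⟶[V] sm V x n₂) ⊗ (sm V x m₂ ⟶[V] m₁)) ⊗ ((n₂ ⟶[V] sm V y n₃) ⊗ (sm V y m₃ ⟶[V] m₂)) ⟶
      wObj V C m₁ n₁ m₃ n₃ :=
  tensorμ _ _ _ _ ≫ (gcomp x y n₁ n₂ n₃ ⊗ₘ hcomp x y m₁ m₂ m₃) ≫ wι (tmul V x y) m₁ n₁ m₃ n₃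

lemma wc_bal₁ (x x' y : C) (m₁ : M) (n₁ : N) (m₂ : M) (n₂ : N) (m₃ : M) (n₃ : N) :
    gact n₁ n₂ x x' ▷ _ ▷ _ ≫ wc (V := V) x' y m₁ n₁ m₂ n₂ m₃ n₃ =
      (α_ _ _ _).hom ▷ _ ≫ (_ ◁ hact m₁ m₂ x x') ▷ _ ≫ wc x y m₁ n₁ m₂ n₂ m₃ n₃ := by
  exact wc_aux₁ _ _ _ _ _ _ (br (mulF V C) y x x') _ _ _ _ (gact_gcomp x x' y n₁ n₂ n₃)
    (hact_hcomp x x' y m₁ m₂ m₃) (wι_w (tmul V x y) (tmul V x' y) m₁ n₁ m₃ n₃)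

lemma wc_bal₂ (x y y' : C) (m₁ : M) (n₁ : N) (m₂ : M) (n₂ : N) (m₃ : M) (n₃ : N) :
    _ ◁ gact n₂ n₃ y y' ▷ _ ≫ wc (V := V) x y' m₁ n₁ m₂ n₂ m₃ n₃ =
      _ ◁ (α_ _ _ _).hom ≫ _ ◁ (_ ◁ hact m₂ m₃ y y') ≫ wc x y m₁ n₁ m₂ n₂ m₃ n₃ := by
  exact wc_aux₂ _ _ _ _ _ _ (bl (mulF V C) x y y') _ _ _ _ (gact_gcomp' x y y' n₁ n₂ n₃)
    (hact_hcomp' x y y' m₁ m₂ m₃) (wι_w (tmul V x y) (tmul V x y') m₁ n₁ m₃ n₃)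

/-- Composition with a generator on the left. -/
def wcL (x : C) (m₁ : M) (n₁ : N) (m₂ : M) (n₂ : N) (m₃ : M) (n₃ : N) :
    ((n₁ ⟶[V] sm V x n₂) ⊗ (sm V x m₂ ⟶[V] m₁)) ⊗ wObj V C m₂ n₂ m₃ n₃ ⟶
      wObj V C m₁ n₁ m₃ n₃ :=
  coend.descL (fun y => wc x y m₁ n₁ m₂ n₂ m₃ n₃) (fun y y' => wc_bal₂ x y y' m₁ n₁ m₂ n₂ m₃ n₃)

lemma wι_wcL (x y : C) (m₁ : M) (n₁ : N) (m₂ : M) (n₂ : N) (m₃ : M) (n₃ : N) :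
    _ ◁ wι y m₂ n₂ m₃ n₃ ≫ wcL (V := V) x m₁ n₁ m₂ n₂ m₃ n₃ = wc x y m₁ n₁ m₂ n₂ m₃ n₃ :=
  coend.ι_descL ..

lemma wObj_ext {m : M} {n : N} {m' : M} {n' : N} {X : V} {f g : wObj V C m n m' n' ⟶ X}
    (h : ∀ x, wι x m n m' n' ≫ f = wι x m n m' n' ≫ g) : f = g :=
  coend.ext h

lemma wObj_ext_left {m : M} {n : N} {m' : M} {n' : N} {K X : V}
    {f g : K ⊗ wObj V C m n m' n' ⟶ X}
    (h : ∀ x, K ◁ wι x m n m' n' ≫ f = K ◁ wι x m n m' n' ≫ g) : f = g :=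
  coend.ext_left h

lemma wObj_ext_right {m : M} {n : N} {m' : M} {n' : N} {K X : V}
    {f g : wObj V C m n m' n' ⊗ K ⟶ X}
    (h : ∀ x, wι x m n m' n' ▷ K ≫ f = wι x m n m' n' ▷ K ≫ g) : f = g :=
  coend.ext_right h

lemma wObj_ext_mid {m : M} {n : N} {m' : M} {n' : N} {K L X : V}
    {f g : (K ⊗ wObj V C m n m' n') ⊗ L ⟶ X}
    (h : ∀ x, (K ◁ wι x m n m' n') ▷ L ≫ f = (K ◁ wι x m n m' n') ▷ L ≫ g) : f = g :=
  coend.ext_mid h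

/-- The composition. -/
def wComp (m₁ : M) (n₁ : N) (m₂ : M) (n₂ : N) (m₃ : M) (n₃ : N) :
    wObj V C m₁ n₁ m₂ n₂ ⊗ wObj V C m₂ n₂ m₃ n₃ ⟶ wObj V C m₁ n₁ m₃ n₃ :=
  coend.descR (fun x => wcL x m₁ n₁ m₂ n₂ m₃ n₃) (fun x x' => wObj_ext_left fun y => by
    rw [MonoidalCategory.whisker_exchange_assoc, wι_wcL, wc_bal₁,
      MonoidalCategory.whisker_exchange_assoc, MonoidalCategory.whisker_exchange_assoc, wι_wcL])

lemma wι_wComp (x : C) (m₁ : M) (n₁ : N) (m₂ : M) (n₂ : N) (m₃ : M) (n₃ : N) :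
    wι x m₁ n₁ m₂ n₂ ▷ _ ≫ wComp (V := V) m₁ n₁ m₂ n₂ m₃ n₃ = wcL x m₁ n₁ m₂ n₂ m₃ n₃ :=
  coend.ι_descR ..

lemma wι_wι_wComp (x y : C) (m₁ : M) (n₁ : N) (m₂ : M) (n₂ : N) (m₃ : M) (n₃ : N) :
    (wι x m₁ n₁ m₂ n₂ ⊗ₘ wι y m₂ n₂ m₃ n₃) ≫ wComp (V := V) m₁ n₁ m₂ n₂ m₃ n₃ =
      wc x y m₁ n₁ m₂ n₂ m₃ n₃ := by
  rw [MonoidalCategory.tensorHom_def', Category.assoc, wι_wComp, wι_wcL]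

variable (V C) in
/-- The identity. -/
def wId (m : M) (n : N) : 𝟙_ V ⟶ wObj V C m n m n :=
  (λ_ _).inv ≫ ((uM V C n).inv ⊗ₘ (uM V C m).hom) ≫ wι (tone V C) m n m n

lemma gact_el (n n' : N) {x y : C} (e : 𝟙_ V ⟶ (x ⟶[V] y)) :
    (ρ_ _).inv ≫ _ ◁ e ≫ gact n n' x y = post n (e ≫ br (actF V C N) n' x y) := by
  rw [gact, post, MonoidalCategory.whiskerLeft_comp, Category.assoc]

lemma hact_el (m m' : M) {x y : C} (e : 𝟙_ V ⟶ (x ⟶[V] y)) :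
    (λ_ _).inv ≫ e ▷ _ ≫ hact m m' x y = pre m (e ≫ br (actF V C M) m' x y) := by
  rw [hact, pre, MonoidalCategory.comp_whiskerRight, Category.assoc]

lemma wι_el (m : M) (n : N) (m' : M) (n' : N) {x y : C} (e : 𝟙_ V ⟶ (x ⟶[V] y)) :
    post n (e ≫ br (actF V C N) n' x y) ▷ _ ≫ wι y m n m' n' =
      _ ◁ pre m (e ≫ br (actF V C M) m' x y) ≫ wι (V := V) x m n m' n' := by
  rw [← gact_el, ← hact_el, comp_whiskerRight, comp_whiskerRight, Category.assoc, Category.assoc,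
    wι_w]
  monoidal

lemma wι_el' (m : M) (n : N) (m' : M) (n' : N) {x y : C} (e : VIso V x y) {A B : V}
    (f : A ⟶ (n ⟶[V] sm V x n')) (g : B ⟶ (sm V x m' ⟶[V] m)) :
    (f ⊗ₘ g) ≫ wι x m n m' n' =
      ((f ≫ post n (e.hom ≫ br (actF V C N) n' x y)) ⊗ₘ
        (g ≫ pre m (e.inv ≫ br (actF V C M) m' y x))) ≫ wι y m n m' n' := by
  have h := wι_el m n m' n' e.hom
  rw [← tensorHom_comp_tensorHom, MonoidalCategory.tensorHom_def' (post _ _), Category.assoc,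
    Category.assoc, h, ← MonoidalCategory.whiskerLeft_comp_assoc, pre_pre, ← cmp_br, e.hom_inv,
    br_id, pre_id, MonoidalCategory.whiskerLeft_id, Category.id_comp]

lemma wId_eq (m : M) (n : N) : wId V C m n =
    ((λ_ _).inv ≫ ((uM V C n).inv ⊗ₘ (uM V C m).hom)) ≫ wι (tone V C) m n m n :=
  (Category.assoc _ _ _).symm

lemma w_id_comp (m : M) (n : N) (m' : M) (n' : N) :
    (λ_ _).inv ≫ wId V C m n ▷ _ ≫ wComp m n m n m' n' = 𝟙 _ := wObj_ext fun y => by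
  have hA : (λ_ _).inv ≫ (uM V C n).inv ▷ _ ≫ gcomp (V := V) (tone V C) y n n n' ≫
      post _ ((MonoidalVCat.lunit y).hom ≫ br (actF V C N) n' _ _) = 𝟙 _ := by
    have := congrArg (fun t => (λ_ _).inv ≫ eId V n ▷ _ ≫ t) (unit_gcomp (V := V) y n n n')
    rwa [← comp_whiskerRight_assoc, ← cmp_eq_post, id_cmp, e_id_comp] at this
  have hB : (λ_ _).inv ≫ (uM V C m).hom ▷ _ ≫ hcomp (V := V) (tone V C) y m m m' =
      pre _ ((MonoidalVCat.lunit y).hom ≫ br (actF V C M) m' _ _) := by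
    have := congrArg (fun t => (λ_ _).inv ≫ eId V m ▷ _ ≫ t) (unit_hcomp (V := V) y m m m')
    rw [← comp_whiskerRight_assoc, ← cmp_eq_pre, cmp_id,
      BraidedCategory.braiding_naturality_left_assoc, braiding_tensorUnit_left] at this
    simpa only [Category.assoc, Iso.inv_hom_id_assoc, reassoc_of% e_comp_id] using this
  have h := tensor_left_unit (uM V C n).inv (uM V C m).hom (gcomp (V := V) (tone V C) y n n n')
    (hcomp (V := V) (tone V C) y m m m')
  rw [leftUnitor_inv_naturality_assoc, MonoidalCategory.whisker_exchange_assoc, wId_eq,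
    comp_whiskerRight, Category.assoc,
    ← MonoidalCategory.whisker_exchange_assoc, wι_wComp,
    wι_wcL, wc, reassoc_of% h, hB,
    wι_el' m n m' n' (MonoidalVCat.lunit y), Category.assoc, Category.assoc, hA, pre_pre,
    ← cmp_br, VIso.inv_hom, br_id, pre_id, id_tensorHom_id, Category.id_comp, Category.comp_id]

lemma w_comp_id (m : M) (n : N) (m' : M) (n' : N) :
    (ρ_ _).inv ≫ _ ◁ wId V C m' n' ≫ wComp m n m' n' m' n' = 𝟙 _ := wObj_ext fun y => by
  have hA := gcomp_unit (V := V) y n n'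
  have hB := hcomp_unit (V := V) y m m'
  have h := tensor_right_unit (uM V C n').inv (uM V C m').hom
    (gcomp (V := V) y (tone V C) n n' n') (hcomp (V := V) y (tone V C) m m' m')
  rw [rightUnitor_inv_naturality_assoc, ← MonoidalCategory.whisker_exchange_assoc, wι_wComp, wId,
    ← Category.assoc (λ_ _).inv, MonoidalCategory.whiskerLeft_comp, Category.assoc,
    wι_wcL, wc, reassoc_of% h, hB,
    wι_el' m n m' n' (MonoidalVCat.runit y), Category.assoc, Category.assoc, hA, pre_pre,
    ← cmp_br, VIso.inv_hom, br_id, pre_id, id_tensorHom_id, Category.id_comp, Category.comp_id]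

lemma w_ext₃ {m₁ : M} {n₁ : N} {m₂ : M} {n₂ : N} {m₃ : M} {n₃ : N} {m₄ : M} {n₄ : N} {X : V}
    {f g : (wObj V C m₁ n₁ m₂ n₂ ⊗ wObj V C m₂ n₂ m₃ n₃) ⊗ wObj V C m₃ n₃ m₄ n₄ ⟶ X}
    (h : ∀ x y z, ((wι x m₁ n₁ m₂ n₂ ⊗ₘ wι y m₂ n₂ m₃ n₃) ⊗ₘ wι z m₃ n₃ m₄ n₄) ≫ f =
      ((wι x m₁ n₁ m₂ n₂ ⊗ₘ wι y m₂ n₂ m₃ n₃) ⊗ₘ wι z m₃ n₃ m₄ n₄) ≫ g) : f = g := by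
  rw [← cancel_epi (α_ _ _ _).inv]
  refine wObj_ext_right fun x => ?_
  rw [associator_inv_naturality_left_assoc, associator_inv_naturality_left_assoc,
    cancel_epi (α_ _ _ _).inv]
  refine wObj_ext_mid fun y => wObj_ext_left fun z => ?_
  have := h x y z
  rw [MonoidalCategory.tensorHom_def', MonoidalCategory.tensorHom_def'] at this
  simpa only [comp_whiskerRight, Category.assoc] using this

lemma w_assoc (m₁ : M) (n₁ : N) (m₂ : M) (n₂ : N) (m₃ : M) (n₃ : N) (m₄ : M) (n₄ : N) :
    wComp (V := V) (C := C) m₁ n₁ m₂ n₂ m₃ n₃ ▷ _ ≫ wComp m₁ n₁ m₃ n₃ m₄ n₄ =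
      (α_ _ _ _).hom ≫ _ ◁ wComp m₂ n₂ m₃ n₃ m₄ n₄ ≫ wComp m₁ n₁ m₂ n₂ m₄ n₄ := by
  refine w_ext₃ fun x y z => ?_
  have hg := gcomp_assoc (V := V) x y z n₁ n₂ n₃ n₄
  have hh := hcomp_assoc (V := V) x y z m₁ m₂ m₃ m₄
  have hh' := congrArg (fun t => t ≫
    pre _ ((MonoidalVCat.assoc x y z).inv ≫ br (actF V C M) m₄ _ _)) hh
  simp only [Category.assoc, pre_pre, ← cmp_br, VIso.inv_hom, br_id, pre_id,
    Category.comp_id] at hh'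
  have key := tensor_assoc _ _ _ _ _ _ _ _ hg hh'
  have l : ((wι x m₁ n₁ m₂ n₂ ⊗ₘ wι y m₂ n₂ m₃ n₃) ⊗ₘ wι z m₃ n₃ m₄ n₄) ≫
      wComp (V := V) (C := C) m₁ n₁ m₂ n₂ m₃ n₃ ▷ _ ≫ wComp m₁ n₁ m₃ n₃ m₄ n₄ =
      (tensorμ _ _ _ _ ≫ (gcomp x y n₁ n₂ n₃ ⊗ₘ hcomp x y m₁ m₂ m₃)) ▷ _ ≫
        wc (tmul V x y) z m₁ n₁ m₃ n₃ m₄ n₄ := by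
    have w₁ := wι_wι_wComp (V := V) x y m₁ n₁ m₂ n₂ m₃ n₃
    have w₂ := wι_wι_wComp (V := V) (tmul V x y) z m₁ n₁ m₃ n₃ m₄ n₄
    rw [MonoidalCategory.tensorHom_def, Category.assoc, MonoidalCategory.whisker_exchange_assoc,
      ← comp_whiskerRight_assoc, w₁, wc, ← Category.assoc (tensorμ _ _ _ _), comp_whiskerRight,
      Category.assoc, ← w₂, MonoidalCategory.tensorHom_def (wι _ _ _ _ _), Category.assoc]
  have r : ((wι x m₁ n₁ m₂ n₂ ⊗ₘ wι y m₂ n₂ m₃ n₃) ⊗ₘ wι z m₃ n₃ m₄ n₄) ≫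
      (α_ _ _ _).hom ≫ _ ◁ wComp (V := V) (C := C) m₂ n₂ m₃ n₃ m₄ n₄ ≫ wComp m₁ n₁ m₂ n₂ m₄ n₄ =
      (α_ _ _ _).hom ≫ _ ◁ (tensorμ _ _ _ _ ≫ (gcomp y z n₂ n₃ n₄ ⊗ₘ hcomp y z m₂ m₃ m₄)) ≫
        wc x (tmul V y z) m₁ n₁ m₂ n₂ m₄ n₄ := by
    have w₁ := wι_wι_wComp (V := V) y z m₂ n₂ m₃ n₃ m₄ n₄
    have w₂ := wι_wι_wComp (V := V) x (tmul V y z) m₁ n₁ m₂ n₂ m₄ n₄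
    rw [associator_naturality_assoc, MonoidalCategory.tensorHom_def', Category.assoc,
      ← MonoidalCategory.whisker_exchange_assoc,
      ← MonoidalCategory.whiskerLeft_comp_assoc, w₁, wc, ← Category.assoc (tensorμ _ _ _ _),
      MonoidalCategory.whiskerLeft_comp, Category.assoc, ← w₂,
      MonoidalCategory.tensorHom_def' (wι _ _ _ _ _), Category.assoc]
  rw [l, r, wc, wc, wι_el' m₁ n₁ m₄ n₄ (MonoidalVCat.assoc x y z)]
  rw [reassoc_of% key]

end W

section ProfHom
variable {V : Type w} [Category.{u} V] [MonoidalCategory V]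
variable {C D : Type u} [EnrichedCategory V C] [EnrichedCategory V D]

/-- A homomorphism of profunctors: a family of maps commuting with both actions. -/
structure ProfHom (P Q : Prof V C D) where
  app (d : D) (c : C) : P.obj d c ⟶ Q.obj d c
  lact_app (d d' : D) (c : C) : P.lact d d' c ≫ app d c = _ ◁ app d' c ≫ Q.lact d d' c
  ract_app (d : D) (c c' : C) : P.ract d c c' ≫ app d c' = app d c ▷ _ ≫ Q.ract d c c'

/-- A homomorphism of profunctors as an element of the hom-object. -/
def ProfHom.el [SymmetricCategory V] [MonoidalClosed V] [HasLimits V] {P Q : Prof V C D}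
    (φ : ProfHom P Q) : 𝟙_ V ⟶ (P ⟶[V] Q) :=
  Prof.lift (fun d c => (ρ_ _).hom ≫ φ.app d c)
    (fun d d' c => by
      rw [rightUnitor_naturality_assoc, φ.lact_app]
      monoidal)
    (fun d c c' => by
      rw [rightUnitor_naturality_assoc, φ.ract_app, rs_unit]
      monoidal)

end ProfHom

namespace Prof
variable {V : Type w} [Category.{u} V] [MonoidalCategory V] [SymmetricCategory V]
  [MonoidalClosed V] [HasLimits V] [HasColimits V]
variable {A B C : Type u} [EnrichedCategory V A] [EnrichedCategory V B] [EnrichedCategory V C]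

/-- The universal property of the composite of profunctors. -/
def compDesc {G : Prof V B C} {F : Prof V A B} {c : C} {a : A} {X : V}
    (f : ∀ b, G.obj c b ⊗ F.obj b a ⟶ X)
    (h : ∀ b b', G.ract c b b' ▷ F.obj b' a ≫ f b' =
      (α_ _ _ _).hom ≫ G.obj c b ◁ F.lact b b' a ≫ f b) : compObj G F c a ⟶ X :=
  coend.desc f h

lemma compι_desc {G : Prof V B C} {F : Prof V A B} {c : C} {a : A} {X : V}
    (f : ∀ b, G.obj c b ⊗ F.obj b a ⟶ X) (h) (b : B) :
    compι G F c b a ≫ compDesc f h = f b := coend.ι_desc ..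

end Prof

section Promonad
variable (V : Type w) [Category.{u} V] [MonoidalCategory V] [SymmetricCategory V]
  [MonoidalClosed V] [HasLimits V] [HasColimits V]

/-- A promonad on `B`: a monad in the bicategory of profunctors. The multiplication
`T • T ⟶ T` is a homomorphism of profunctors, and so is determined by its components
`T(a, b) ⊗ T(b, c) ⟶ T(a, c)`; the associativity and unit laws are stated on these. -/
structure Promonad (B : Type u) [EnrichedCategory V B] where
  T : Prof V B B
  μ : ProfHom (T.comp T) T
  η : ProfHom (Prof.id B) T
  mul_assoc (a b c d : B) :
    (Prof.compι T T a b c ≫ μ.app a c) ▷ T.obj c d ≫ Prof.compι T T a c d ≫ μ.app a d =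
      (α_ _ _ _).hom ≫ T.obj a b ◁ (Prof.compι T T b c d ≫ μ.app b d) ≫
        Prof.compι T T a b d ≫ μ.app a d
  unit_mul (a b : B) :
    (λ_ _).inv ≫ (eId V a ≫ η.app a a) ▷ T.obj a b ≫ Prof.compι T T a a b ≫ μ.app a b = 𝟙 _
  mul_unit (a b : B) :
    (ρ_ _).inv ≫ T.obj a b ◁ (eId V b ≫ η.app b b) ≫ Prof.compι T T a b b ≫ μ.app a b = 𝟙 _

variable {V}

/-- The Eilenberg–Moore (or Kleisli) `V`-category of a promonad, with the objects of `B` and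
the hom-objects `T(a, b)`. -/
structure EM {B : Type u} [EnrichedCategory V B] (T : Promonad V B) where
  as : B

instance {B : Type u} [EnrichedCategory V B] (T : Promonad V B) : EnrichedCategory V (EM T) where
  Hom a b := T.T.obj a.as b.as
  id a := eId V a.as ≫ T.η.app a.as a.as
  comp a b c := Prof.compι T.T T.T a.as b.as c.as ≫ T.μ.app a.as c.as
  id_comp a b := T.unit_mul a.as b.as
  comp_id a b := T.mul_unit a.as b.as
  assoc a b c d := by
    rw [T.mul_assoc, Iso.inv_hom_id_assoc]

variable {B : Type u} [EnrichedCategory V B] {W : Type u} [EnrichedCategory V W]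

/-- The profunctor `T(a, b) = W(H a, H b)` of a `V`-functor `H`. -/
def Prof.ofFunctor (H : EnrichedFunctor V B W) : Prof V B B where
  obj a b := H.obj a ⟶[V] H.obj b
  lact a a' b := (conjoint H).lact a a' (H.obj b)
  ract a b b' := (companion H).ract (H.obj a) b b'
  lact_id a b := (conjoint H).lact_id a (H.obj b)
  ract_id a b := (companion H).ract_id (H.obj a) b
  lact_comp a a' a'' b := (conjoint H).lact_comp a a' a'' (H.obj b)
  ract_comp a b b' b'' := (companion H).ract_comp (H.obj a) b b' b''
  comm a a' b b' := by
    change (H.map a a' ▷ _ ≫ eComp V _ _ _) ▷ _ ≫ _ ◁ H.map b b' ≫ eComp V _ _ _ =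
      (α_ _ _ _).hom ≫ _ ◁ (_ ◁ H.map b b' ≫ eComp V _ _ _) ≫ H.map a a' ▷ _ ≫ eComp V _ _ _
    rw [← MonoidalCategory.whisker_exchange_assoc, comp_whiskerRight, Category.assoc, ← e_assoc',
      MonoidalCategory.whisker_exchange_assoc]
    simp only [tensor_whiskerLeft, MonoidalCategory.whiskerLeft_comp, Category.assoc,
      Iso.inv_hom_id_assoc]
    rw [associator_naturality_left_assoc, MonoidalCategory.whisker_exchange_assoc,
      MonoidalCategory.whisker_exchange_assoc]

/-- The multiplication of the promonad of a `V`-functor `H`: composition in `W`. -/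
def Prof.ofFunctorMul (H : EnrichedFunctor V B W) (a c : B) :
    compObj (ofFunctor H) (ofFunctor H) a c ⟶ (ofFunctor H).obj a c :=
  compDesc (fun b => eComp V (H.obj a) (H.obj b) (H.obj c)) (fun b b' => by
    change (_ ◁ H.map b b' ≫ eComp V _ _ _) ▷ _ ≫ eComp V _ _ _ =
      (α_ _ _ _).hom ≫ _ ◁ (H.map b b' ▷ _ ≫ eComp V _ _ _) ≫ eComp V _ _ _
    rw [comp_whiskerRight, Category.assoc, ← e_assoc']
    simp)

lemma Prof.compι_mul (H : EnrichedFunctor V B W) (a b c : B) :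
    compι (ofFunctor H) (ofFunctor H) a b c ≫ ofFunctorMul H a c =
      eComp V (H.obj a) (H.obj b) (H.obj c) :=
  compι_desc ..

lemma Prof.ofFunctorMul_lact (H : EnrichedFunctor V B W) (a a' c : B) :
    compL (ofFunctor H) (ofFunctor H) a a' c ≫ ofFunctorMul H a c =
      _ ◁ ofFunctorMul H a' c ≫ (ofFunctor H).lact a a' c := comp_ext_left fun b => by
  rw [reassoc_of% compι_compL, compι_mul, ← MonoidalCategory.whiskerLeft_comp_assoc, compι_mul]
  change (α_ _ _ _).inv ≫ (H.map a a' ▷ _ ≫ eComp V _ _ _) ▷ _ ≫ eComp V _ _ _ =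
    _ ◁ eComp V _ _ _ ≫ H.map a a' ▷ _ ≫ eComp V _ _ _
  rw [comp_whiskerRight, Category.assoc, ← e_assoc', MonoidalCategory.whisker_exchange_assoc]
  simp

lemma Prof.ofFunctorMul_ract (H : EnrichedFunctor V B W) (a c c' : B) :
    compR (ofFunctor H) (ofFunctor H) a c c' ≫ ofFunctorMul H a c' =
      ofFunctorMul H a c ▷ _ ≫ (ofFunctor H).ract a c c' := comp_ext_right fun b => by
  rw [reassoc_of% compι_compR, compι_mul, ← comp_whiskerRight_assoc, compι_mul]
  change (α_ _ _ _).hom ≫ _ ◁ (_ ◁ H.map c c' ≫ eComp V _ _ _) ≫ eComp V _ _ _ =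
    eComp V _ _ _ ▷ _ ≫ _ ◁ H.map c c' ≫ eComp V _ _ _
  rw [← MonoidalCategory.whisker_exchange_assoc, ← e_assoc']
  simp

/-- The promonad `T(a, b) = W(H a, H b)` of a `V`-functor `H`, with multiplication the
composition in `W` and unit given by `H`. -/
def Promonad.ofFunctor (H : EnrichedFunctor V B W) : Promonad V B where
  T := Prof.ofFunctor H
  μ :=
    { app := Prof.ofFunctorMul H
      lact_app := Prof.ofFunctorMul_lact H
      ract_app := Prof.ofFunctorMul_ract H }
  η :=
    { app := fun a b => H.map a b
      lact_app := fun a a' b => by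
        change eComp V _ _ _ ≫ H.map a b = _ ◁ H.map a' b ≫ H.map a a' ▷ _ ≫ eComp V _ _ _
        rw [H.map_comp, MonoidalCategory.tensorHom_def', Category.assoc]
      ract_app := fun a b b' => by
        change eComp V _ _ _ ≫ H.map a b' = H.map a b ▷ _ ≫ _ ◁ H.map b b' ≫ eComp V _ _ _
        rw [H.map_comp, MonoidalCategory.tensorHom_def, Category.assoc] }
  mul_assoc a b c d := by
    simp only [Prof.compι_mul]
    exact (e_assoc' ..).symm
  unit_mul a b := by
    rw [Prof.compι_mul]
    change (λ_ _).inv ≫ (eId V a ≫ H.map a a) ▷ _ ≫ eComp V _ _ _ = 𝟙 _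
    rw [H.map_id, e_id_comp]
  mul_unit a b := by
    rw [Prof.compι_mul]
    change (ρ_ _).inv ≫ _ ◁ (eId V b ≫ H.map b b) ≫ eComp V _ _ _ = 𝟙 _
    rw [H.map_id, e_comp_id]

end Promonad

/-- The objects of the `V`-category with hom-objects `∫^x N(n, x n') ⊗ M(x m', m)`: pairs of an
object of `M` and an object of `N`. -/
structure Optic (V : Type w) (C M N : Type u) where
  m : M
  n : N

section MHN
variable {V : Type w} [Category.{u} V] [MonoidalCategory V] [SymmetricCategory V]

lemma tensorμ_braid (A B A' B' : V) :
    tensorμ A B A' B' ≫ (β_ (A ⊗ A') (B ⊗ B')).hom =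
      ((β_ A B).hom ⊗ₘ (β_ A' B').hom) ≫ tensorμ B A B' A' := by
  calc
    _ = 𝟙 _ ⊗≫ A ◁ ((β_ B A').hom ≫ (β_ A' B).hom) ▷ B' ⊗≫ ((β_ A B).hom ▷ (A' ⊗ B') ≫
          (B ⊗ A) ◁ (β_ A' B').hom) ⊗≫ B ◁ (β_ A B').hom ▷ A' ⊗≫ 𝟙 _ := by
      simp only [tensorμ, braiding_tensor_left_hom, braiding_tensor_right_hom]
      monoidal
    _ = _ := by
      rw [SymmetricCategory.symmetry, MonoidalCategory.tensorHom_def]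
      simp only [tensorμ]
      monoidal

variable [MonoidalClosed V] [HasLimits V] [HasColimits V]
variable (V) (C M N : Type u) [EnrichedCategory V C] [MonoidalVCat V C] [EnrichedCategory V M]
  [LeftModule V C M] [EnrichedCategory V N] [LeftModule V C N]

instance : EnrichedCategory V (Optic V C M N) where
  Hom p q := wObj V C p.m p.n q.m q.n
  id p := wId V C p.m p.n
  comp p q r := wComp p.m p.n q.m q.n r.m r.n
  id_comp p q := w_id_comp p.m p.n q.m q.n
  comp_id p q := w_comp_id p.m p.n q.m q.n
  assoc p q r s := by
    rw [w_assoc, Iso.inv_hom_id_assoc]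

variable {V C M N}

lemma unit_comp_g (n₁ n₂ n₃ : N) :
    (post n₁ (uM V C n₂).inv ⊗ₘ post n₂ (uM V C n₃).inv) ≫
      gcomp (V := V) (tone V C) (tone V C) n₁ n₂ n₃ ≫
        post _ ((MonoidalVCat.lunit (tone V C)).hom ≫ br (actF V C N) n₃ _ _) =
      eComp V n₁ n₂ n₃ ≫ post _ (uM V C n₃).inv := by
  rw [MonoidalCategory.tensorHom_def', Category.assoc, unit_gcomp, ← comp_post]

lemma unit_comp_h (m₁ m₂ m₃ : M) :
    (pre m₁ (uM V C m₂).hom ⊗ₘ pre m₂ (uM V C m₃).hom) ≫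
      hcomp (V := V) (tone V C) (tone V C) m₁ m₂ m₃ ≫
        pre _ ((MonoidalVCat.lunit (tone V C)).inv ≫ br (actF V C M) m₃ _ _) =
      (β_ _ _).hom ≫ eComp V m₃ m₂ m₁ ≫ pre _ (uM V C m₃).hom := by
  rw [MonoidalCategory.tensorHom_def', Category.assoc, reassoc_of% unit_hcomp, pre_pre, ← cmp_br,
    VIso.inv_hom, br_id, pre_id, Category.comp_id, braiding_naturality_right_assoc, comp_pre]

variable (V C) in
/-- The map `M(m', m) ⊗ N(n, n') ⟶ ∫^x N(n, x n') ⊗ M(x m', m)` into the summand of the unit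
object, given by the unitors of the modules. -/
def wUnit (m : M) (n : N) (m' : M) (n' : N) :
    (m' ⟶[V] m) ⊗ (n ⟶[V] n') ⟶ wObj V C m n m' n' :=
  (β_ _ _).hom ≫ (post n (uM V C n').inv ⊗ₘ pre m (uM V C m').hom) ≫ wι (tone V C) m n m' n'

lemma wUnit_id (m : M) (n : N) :
    ((λ_ _).inv ≫ (eId V m ⊗ₘ eId V n)) ≫ wUnit V C m n m n = wId V C m n := by
  have h : (λ_ (𝟙_ V)).inv ≫ (β_ _ _).hom = (λ_ (𝟙_ V)).inv := by
    rw [braiding_tensorUnit_left, Iso.inv_hom_id_assoc, unitors_inv_equal]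
  rw [wUnit, Category.assoc, braiding_naturality_assoc, tensorHom_comp_tensorHom_assoc,
    ← cmp_eq_post, ← cmp_eq_pre, id_cmp, cmp_id, reassoc_of% h, wId]

lemma wUnit_comp (m₁ : M) (n₁ : N) (m₂ : M) (n₂ : N) (m₃ : M) (n₃ : N) :
    (tensorμ _ _ _ _ ≫ (((β_ _ _).hom ≫ eComp V m₃ m₂ m₁) ⊗ₘ eComp V n₁ n₂ n₃)) ≫
      wUnit V C m₁ n₁ m₃ n₃ =
    (wUnit V C m₁ n₁ m₂ n₂ ⊗ₘ wUnit V C m₂ n₂ m₃ n₃) ≫ wComp m₁ n₁ m₂ n₂ m₃ n₃ := by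
  have e : wUnit V C m₁ n₁ m₂ n₂ ⊗ₘ wUnit V C m₂ n₂ m₃ n₃ =
      ((β_ _ _).hom ⊗ₘ (β_ _ _).hom) ≫
        ((post n₁ (uM V C n₂).inv ⊗ₘ pre m₁ (uM V C m₂).hom) ⊗ₘ
          (post n₂ (uM V C n₃).inv ⊗ₘ pre m₂ (uM V C m₃).hom)) ≫
        (wι (tone V C) m₁ n₁ m₂ n₂ ⊗ₘ wι (tone V C) m₂ n₂ m₃ n₃) := by
    simp only [wUnit, tensorHom_comp_tensorHom]
  rw [e, Category.assoc, Category.assoc, Category.assoc, wι_wι_wComp, wc, tensorμ_natural_assoc,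
    wι_el' m₁ n₁ m₃ n₃ (MonoidalVCat.lunit (tone V C)), tensorHom_comp_tensorHom_assoc,
    unit_comp_g, unit_comp_h, ← reassoc_of% tensorμ_braid, wUnit,
    braiding_naturality_assoc, tensorHom_comp_tensorHom_assoc, Category.assoc]

variable (V C M N)

/-- The `V`-functor `Mᵒᵖ ⊗ N ⟶ W` given by the unitors of the modules. -/
def unitF : EnrichedFunctor V (Mᵒᵖ × N) (Optic V C M N) where
  obj p := ⟨p.1.unop, p.2⟩
  map p q := wUnit V C p.1.unop p.2 q.1.unop q.2
  map_id p := wUnit_id p.1.unop p.2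
  map_comp p q r := wUnit_comp p.1.unop p.2 q.1.unop q.2 r.1.unop r.2

/-- The promonad on `Mᵒᵖ ⊗ N` with `T((m, n), (m', n')) = ∫^x N(n, x n') ⊗ M(x m', m)`. Its
multiplication sends the summands of `x` and `y` to the summand of `x ⊗ y` through the actions on
hom-objects and the associators of the modules. Its unit is the inclusion of `M(m', m) ⊗ N(n, n')`
in the summand of the unit object. The actions of the hom-objects of `Mᵒᵖ ⊗ N` are the
composites of the unit and the multiplication. -/
def MHN : Promonad V (Mᵒᵖ × N) := Promonad.ofFunctor (unitF V C M N)

lemma MHN_obj (m m' : M) (n n' : N) :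
    (MHN V C M N).T.obj (op m, n) (op m', n') = wObj V C m n m' n' := rfl

/-- The hom-objects of the Eilenberg–Moore `V`-category of the promonad. -/
lemma EM_MHN_hom (m m' : M) (n n' : N) :
    ((⟨(op m, n)⟩ : EM (MHN V C M N)) ⟶[V] ⟨(op m', n')⟩) = wObj V C m n m' n' := rfl

end MHN

section Modules
variable {V : Type w} [Category.{u} V] [MonoidalCategory V] [SymmetricCategory V]
  [MonoidalClosed V] [HasLimits V] [HasColimits V]

/-- A left module over a promonad `T` on `B` from `A`: a profunctor `P : A ⇸ B` with a
homomorphism `T • P ⟶ P`. The associativity and unit laws are stated on the components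
`T(b, c) ⊗ P(c, a) ⟶ P(b, a)`. -/
structure LMod {B : Type u} [EnrichedCategory V B] (T : Promonad V B) (A : Type u)
    [EnrichedCategory V A] where
  P : Prof V A B
  κ : ProfHom (T.T.comp P) P
  assoc (b c d : B) (a : A) :
    (Prof.compι T.T T.T b c d ≫ T.μ.app b d) ▷ P.obj d a ≫ Prof.compι T.T P b d a ≫ κ.app b a =
      (α_ _ _ _).hom ≫ T.T.obj b c ◁ (Prof.compι T.T P c d a ≫ κ.app c a) ≫
        Prof.compι T.T P b c a ≫ κ.app b a
  unit (b : B) (a : A) :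
    (λ_ _).inv ≫ (eId V b ≫ T.η.app b b) ▷ P.obj b a ≫ Prof.compι T.T P b b a ≫ κ.app b a = 𝟙 _

namespace LMod
variable {B : Type u} [EnrichedCategory V B] {T : Promonad V B} {A : Type u}
    [EnrichedCategory V A]

/-- A module as an object of an inserter. -/
def toInserter (P : LMod T A) : Inserter (Prof.postF A T.T) (EnrichedFunctor.id V (Prof V A B)) :=
  ⟨P.P, P.κ.el⟩

/-- The `V`-category of left modules; the hom-object from `(P, κ)` to `(Q, κ')` is the equalizer of
the two maps from the object of homomorphisms `P ⟶ Q` to that of homomorphisms `T • P ⟶ Q`. -/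
instance : EnrichedCategory V (LMod T A) := inducedVCat toInserter

variable (T A) in
/-- The forgetful `V`-functor. -/
def forget : EnrichedFunctor V (LMod T A) (Prof V A B) where
  obj P := P.P
  map P Q := Inserter.ι P.toInserter Q.toInserter
  map_id P := (Inserter.forget _ _).map_id P.toInserter
  map_comp P Q R := (Inserter.forget _ _).map_comp P.toInserter Q.toInserter R.toInserter

end LMod

variable (V) (C M N : Type u) [EnrichedCategory V C] [MonoidalVCat V C] [EnrichedCategory V M]
  [LeftModule V C M] [EnrichedCategory V N] [LeftModule V C N]

/-- The `V`-functor `P ↦ ⊡_* • (Id_C ⊗ P)` on profunctors `M ⇸ N`, for the action `⊡` on `N`. -/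
def actPost : EnrichedFunctor V (Prof V M N) (Prof V (C × M) N) :=
  (Prof.idTensorF C).comp V (Prof.postF (C × M) (Prof.companion (actF V C N)))

/-- The `V`-functor `P ↦ P • ⊡_*` on profunctors `M ⇸ N`, for the action `⊡` on `M`. -/
def actPre : EnrichedFunctor V (Prof V M N) (Prof V (C × M) N) :=
  Prof.preF N (Prof.companion (actF V C M))

/-- The `V`-functor `P ↦ ⊡_* • (Id_C ⊗ P) • ⊡^*` on profunctors `M ⇸ N`, for the actions `⊡` on
`N` and on `M` respectively. -/
def actOmega : EnrichedFunctor V (Prof V M N) (Prof V M N) :=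
  (actPost V C M N).comp V (Prof.preF N (Prof.conjoint (actF V C M)))

variable {V C M N}

/-- The map `N(n, x n') ⊗ P(n', m) ⟶ (⊡_* • (Id_C ⊗ P))(n, (x, m))` given by the coprojection of
the coend and the identity of `x`. -/
def actPostι (P : Prof V M N) (x : C) (n n' : N) (m : M) :
    (n ⟶[V] sm V x n') ⊗ P.obj n' m ⟶ ((actPost V C M N).obj P).obj n (x, m) :=
  _ ◁ ((λ_ _).inv ≫ eId V x ▷ _) ≫
    Prof.compι (Prof.companion (actF V C N)) ((Prof.id C).tensor P) n (x, n') (x, m)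

/-- The map `N(n, x n') ⊗ P(n', m') ⊗ M(x m', m) ⟶ (⊡_* • (Id_C ⊗ P) • ⊡^*)(n, m)` given by the
coprojections of the coends and the identity of `x`. -/
def actOmegaι (P : Prof V M N) (x : C) (n n' : N) (m' m : M) :
    ((n ⟶[V] sm V x n') ⊗ P.obj n' m') ⊗ (sm V x m' ⟶[V] m) ⟶
      ((actOmega V C M N).obj P).obj n m :=
  actPostι P x n n' m' ▷ _ ≫
    Prof.compι ((actPost V C M N).obj P) (Prof.conjoint (actF V C M)) n (x, m') m

variable (V C M N) in
/-- A module over the renormalization algebra: a profunctor `P : M ⇸ N` with a homomorphism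
`⊡_* • (Id_C ⊗ P) • ⊡^* ⟶ P`, associative and unital. The laws are stated on the components
`N(n, x n') ⊗ P(n', m') ⊗ M(x m', m) ⟶ P(n, m)`. -/
structure OmegaMod where
  P : Prof V M N
  κ : ProfHom ((actOmega V C M N).obj P) P
  assoc (x y : C) (n n' n'' : N) (m'' m' m : M) :
    (_ ◁ (actOmegaι P y n' n'' m'' m' ≫ κ.app n' m')) ▷ _ ≫ actOmegaι P x n n' m' m ≫ κ.app n m =
      (α_ _ _ _).inv ▷ _ ≫ (α_ _ _ _).inv ▷ _ ▷ _ ≫ (α_ _ _ _).hom ≫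
        (gcomp x y n n' n'' ▷ P.obj n'' m'' ⊗ₘ hcomp0 x y m m' m'') ≫
          actOmegaι P (tmul V x y) n n'' m'' m ≫ κ.app n m
  unit (n : N) (m : M) :
    (λ_ _).inv ≫ (uM V C n).inv ▷ P.obj n m ≫ (ρ_ _).inv ≫ _ ◁ (uM V C m).hom ≫
      actOmegaι P (tone V C) n n m m ≫ κ.app n m = 𝟙 _

namespace OmegaMod

/-- A module as an object of an inserter. -/
def toInserter (P : OmegaMod V C M N) :
    Inserter (actOmega V C M N) (EnrichedFunctor.id V (Prof V M N)) :=
  ⟨P.P, P.κ.el⟩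

/-- The `V`-category of modules over the renormalization algebra, with hom-objects given by
equalizers. -/
instance : EnrichedCategory V (OmegaMod V C M N) := inducedVCat toInserter

variable (V C M N) in
/-- The forgetful `V`-functor. -/
def forget : EnrichedFunctor V (OmegaMod V C M N) (Prof V M N) where
  obj P := P.P
  map P Q := Inserter.ι P.toInserter Q.toInserter
  map_id P := (Inserter.forget _ _).map_id P.toInserter
  map_comp P Q R := (Inserter.forget _ _).map_comp P.toInserter Q.toInserter R.toInserter

end OmegaMod

/-- The action on a profunctor of an element of a hom-object. -/
def Prof.ractEl {A B : Type u} [EnrichedCategory V A] [EnrichedCategory V B] (P : Prof V A B)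
    (b : B) {a a' : A} (f : 𝟙_ V ⟶ (a ⟶[V] a')) : P.obj b a ⟶ P.obj b a' :=
  (ρ_ _).inv ≫ _ ◁ f ≫ P.ract b a a'

/-- The canonical isomorphism `(F • H_*)(c, a) ⟶ F(c, H a)`. -/
def Prof.collapse {A B D : Type u} [EnrichedCategory V A] [EnrichedCategory V B]
    [EnrichedCategory V D] (F : Prof V B D) (H : EnrichedFunctor V A B) (d : D) (a : A) :
    (F.comp (Prof.companion H)).obj d a ⟶ F.obj d (H.obj a) :=
  Prof.compDesc (G := F) (F := Prof.companion H) (fun b => F.ract d b (H.obj a))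
    (fun b b' => F.ract_comp d b b' (H.obj a))

/-- The component `N(n, x n') ⊗ F(n', m) ⟶ F(n, x m)` of a homomorphism
`⊡_* • (Id_C ⊗ F) ⟶ F • ⊡_*`. -/
def laxApp (F : Prof V M N)
    (φ : ProfHom ((actPost V C M N).obj F) ((actPre V C M N).obj F)) (x : C) (n n' : N) (m : M) :
    (n ⟶[V] sm V x n') ⊗ F.obj n' m ⟶ F.obj n (sm V x m) :=
  actPostι F x n n' m ≫ φ.app n (x, m) ≫ Prof.collapse F (actF V C M) n (x, m)

variable (V C M N) in
/-- A lax module profunctor: a profunctor `F : M ⇸ N` with a homomorphism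
`⊡_* • (Id_C ⊗ F) ⟶ F • ⊡_*` compatible with the associators and the unitors of the modules.
The laws are stated on the components `N(n, x n') ⊗ F(n', m) ⟶ F(n, x m)`. -/
structure LaxProf where
  F : Prof V M N
  φ : ProfHom ((actPost V C M N).obj F) ((actPre V C M N).obj F)
  assoc (x y : C) (n n' n'' : N) (m : M) :
    _ ◁ laxApp F φ y n' n'' m ≫ laxApp F φ x n n' (sm V y m) =
      (α_ _ _ _).inv ≫ gcomp x y n n' n'' ▷ F.obj n'' m ≫ laxApp F φ (tmul V x y) n n'' m ≫
        F.ractEl n (aM V x y m).hom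
  unit (n : N) (m : M) :
    (λ_ _).inv ≫ (uM V C n).inv ▷ F.obj n m ≫ laxApp F φ (tone V C) n n m ≫
      F.ractEl n (uM V C m).hom = 𝟙 _

namespace LaxProf

/-- A lax module profunctor as an object of an inserter. -/
def toInserter (F : LaxProf V C M N) : Inserter (actPost V C M N) (actPre V C M N) :=
  ⟨F.F, F.φ.el⟩

/-- The `V`-category of lax module profunctors, with hom-objects given by equalizers. -/
instance : EnrichedCategory V (LaxProf V C M N) := inducedVCat toInserter

variable (V C M N) in
/-- The forgetful `V`-functor. -/
def forget : EnrichedFunctor V (LaxProf V C M N) (Prof V M N) where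
  obj P := P.F
  map P Q := Inserter.ι P.toInserter Q.toInserter
  map_id P := (Inserter.forget _ _).map_id P.toInserter
  map_comp P Q R := (Inserter.forget _ _).map_comp P.toInserter Q.toInserter R.toInserter

end LaxProf

end Modules

section Presheaf
variable (V : Type w) [Category.{u} V] [MonoidalCategory V] [SymmetricCategory V]
  [MonoidalClosed V] [HasLimits V]

/-- A `V`-presheaf on `K`: a `V`-functor from `Kᵒᵖ` to the self-enriched category `V`. -/
structure Presheaf (K : Type u) [EnrichedCategory V K] where
  F : EnrichedFunctor V Kᵒᵖ V

variable {V}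
namespace Presheaf
variable {K : Type u} [EnrichedCategory V K]

/-- The operations `F(b) ⊗ K(a, b) ⟶ F(a)` of a presheaf. -/
def toAct (P : Presheaf V K) : Act V (J := K) (I := K × K) (fun i => i.2) (fun i => i.1)
    (fun i => i.1 ⟶[V] i.2) where
  obj a := P.F.obj (op a)
  act i := uncurry (P.F.map (op i.2) (op i.1))

/-- The presheaf `V`-category `[Kᵒᵖ, V]`; its hom-objects are the ends of `[P(a), Q(a)]`. -/
instance : EnrichedCategory V (Presheaf V K) := inducedVCat toAct

variable (V) in
/-- The evaluation at an object, as a `V`-functor to `V`. -/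
def evF (a : K) : EnrichedFunctor V (Presheaf V K) V where
  obj P := P.F.obj (op a)
  map P Q := curry (Act.ev P.toAct Q.toAct a)
  map_id P := (Act.evF _ _ _ a).map_id P.toAct
  map_comp P Q R := (Act.evF _ _ _ a).map_comp P.toAct Q.toAct R.toAct

end Presheaf
end Presheaf

end KK

end

open KK

/-! A presheaf on a `V`-category `K` is a family of objects `P(k)` with a unital and associative
left action `K(a, b) ⊗ P(b) ⟶ P(a)`, and the hom-object between two presheaves represents the
families of maps that commute with the actions. The theorem holds because each of the four
`V`-categories has this description for `K` the Eilenberg–Moore `V`-category of `MHN`.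
`exists_presheaf_equivalence` turns this into a criterion: it suffices to have evaluation functors
`U k` to `V`, an action of `K` on their values, the representability of equivariant families by the
hom-objects, and the realization of every left action. The functor it builds, followed by evaluation
at `k`, has the same objects and the same maps on hom-objects as `U k`, so compatibility with
evaluation needs no separate argument.

For profunctors out of the unit `V`-category, the right action is forced to be the right unitor, and
only a left action remains. A left module over a promonad `T` on `B` carries two actions, one of `B`
and one of `T`. Since the action of `T` is balanced over `B` and unital, the action of `B` is that
of `T` restricted along the unit (`LMod.lact_eq`). A module from the unit `V`-category is thus
nothing but a left action of the Eilenberg–Moore `V`-category.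

The other two cases pass through `OpticAct`: a family of maps `θ` from `N(n, x n') ⊗ P(n', m') ⊗ M(x
m', m)` to `P(n, m)`, dinatural in `x`, associative and unital. The hom-objects of `K` are coends
over `x`, and the tensor product preserves coends in each variable, so such a `θ` is the same as a
left action of `K`; this yields `exists_optic_equivalence`. No naturality in `n` or `m` is imposed
on `θ`. The actions of `N` and `M` are recovered from the summand of the unit object and the unitors
of the modules. That `θ` is compatible with them (`OpticAct.θ_lact`, `OpticAct.θ_ract`,
`OpticAct.lact_θ`, `OpticAct.ract_θ`) follows from associativity, with `I ⊠ x` and `x ⊠ I`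
identified with `x` by dinaturality along the unitors of `C`.

For modules over the renormalization algebra, the iterated coend defining the triple composite is
generated by the summands `N(n, x n') ⊗ P(n', m') ⊗ M(x m', m)`, the redundant hom-object of `C`
being removed by the co-Yoneda lemma (`postCompι_eq`). The structure map is then exactly a `θ`. For
lax module profunctors, the co-Yoneda lemma identifies `(F • ⊡_*)(n, (x, m))` with `F(n, x m)`, so
the structure map becomes a family `N(n, x n') ⊗ F(n', m) ⟶ F(n, x m)`. Following it by the right
action of `M` gives `θ`, and evaluating `θ` at the identity of `x m` gives it back. This is the
correspondence of mates for `⊡_*` and `⊡^*` in the bicategory of profunctors, which is why no duals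
in `C` are needed. -/

noncomputable section

namespace KK

/-! ### Presheaves as left actions, and a criterion for equivalence with a presheaf `V`-category. -/

section LeftAct
variable (V : Type w) [Category.{u} V] [MonoidalCategory V] [SymmetricCategory V]

/-- A family of objects with a unital and associative left action of the hom-objects of `K`. -/
structure LeftAct (K : Type u) [EnrichedCategory V K] where
  obj : K → V
  act (a b : K) : (a ⟶[V] b) ⊗ obj b ⟶ obj a
  act_id (a : K) : (λ_ _).inv ≫ eId V a ▷ _ ≫ act a a = 𝟙 _
  act_comp (a b c : K) :
    eComp V a b c ▷ _ ≫ act a c = (α_ _ _ _).hom ≫ _ ◁ act b c ≫ act a b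

variable {V}

/-- Both sides reverse the order of three factors; this is the Yang–Baxter equation. -/
lemma whiskerLeft_braid_braid (A B C : V) :
    A ◁ (β_ B C).hom ≫ (β_ A (C ⊗ B)).hom ≫ (α_ C B A).hom =
      (α_ A B C).inv ≫ (β_ A B).hom ▷ C ≫ (β_ (B ⊗ A) C).hom := by
  simpa [braiding_tensor_left_hom, braiding_tensor_right_hom] using (yang_baxter A B C).symm

/-- Functoriality on the opposite `V`-category is an associativity law with the hom-objects on the
right and in reversed order. It differs from the law of a left action by the reversal of three
tensor factors, which is invertible and can be cancelled. The two directions serve to pass from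
actions to presheaves and back. -/
lemma act_comp_braid_iff {P Q R B C D : V} (f : B ⊗ P ⟶ Q) (g : C ⊗ Q ⟶ R) (m : C ⊗ B ⟶ D)
    (h : D ⊗ P ⟶ R) :
    P ◁ ((β_ B C).hom ≫ m) ≫ (β_ P D).hom ≫ h =
        (α_ _ _ _).inv ≫ ((β_ P B).hom ≫ f) ▷ C ≫ (β_ Q C).hom ≫ g ↔
      m ▷ P ≫ h = (α_ _ _ _).hom ≫ C ◁ f ≫ g := by
  have e : (α_ P B C).inv ≫ ((β_ P B).hom ≫ f) ▷ C ≫ (β_ Q C).hom ≫ g =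
      P ◁ (β_ B C).hom ≫ (β_ P (C ⊗ B)).hom ≫ (α_ C B P).hom ≫ C ◁ f ≫ g := by
    rw [reassoc_of% whiskerLeft_braid_braid, comp_whiskerRight_assoc,
      braiding_naturality_left_assoc]
  rw [e, MonoidalCategory.whiskerLeft_comp, Category.assoc, braiding_naturality_right_assoc,
    cancel_epi, cancel_epi]

lemma LeftAct.act_id' {K : Type u} [EnrichedCategory V K] (P : LeftAct V K) (a : K) :
    eId V a ▷ _ ≫ P.act a a = (λ_ _).hom := by
  rw [← cancel_epi (λ_ _).inv, P.act_id, Iso.inv_hom_id]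

variable [MonoidalClosed V] [HasLimits V] {K : Type u} [EnrichedCategory V K]

/-- The presheaf of a family with a left action. -/
def LeftAct.toPresheaf (P : LeftAct V K) : Presheaf V K where
  F :=
    { obj := fun a => P.obj a.unop
      map := fun a b => curry ((β_ _ _).hom ≫ P.act b.unop a.unop)
      map_id := fun a => by
        apply uncurry_injective
        rw [uncurry_natural_left, uncurry_curry, braiding_naturality_right_assoc]
        erw [P.act_id']
        simp [enrichedCategorySelf_id, MonoidalClosed.id]
      map_comp := fun a b c => by
        refine Eq.trans ?_ (curry_comp _ _).symm
        rw [← curry_natural_left]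
        exact congrArg curry ((act_comp_braid_iff _ _ _ _).2 (P.act_comp c.unop b.unop a.unop)) }

/-- The left action on a presheaf. -/
def Presheaf.toLeftAct (P : Presheaf V K) : LeftAct V K where
  obj a := P.F.obj (op a)
  act a b := (β_ _ _).hom ≫ uncurry (P.F.map (op b) (op a))
  act_id a := by
    have h : eId V a ≫ P.F.map (op a) (op a) = _ := P.F.map_id (op a)
    rw [braiding_naturality_left_assoc, ← uncurry_natural_left, h]
    simp [enrichedCategorySelf_id, MonoidalClosed.id, braiding_tensorUnit_left]
  act_comp a b c := by
    have h := P.F.map_comp (op c) (op b) (op a)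
    have h' : P.F.map (op c) (op b) ⊗ₘ P.F.map (op b) (op a) =
      curry (uncurry (P.F.map (op c) (op b))) ⊗ₘ curry (uncurry (P.F.map (op b) (op a))) := by
        rw [curry_uncurry, curry_uncurry]
    have h₂ := congrArg uncurry (h.trans ((congrArg (· ≫ _) h').trans (curry_comp _ _)))
    rw [uncurry_curry, uncurry_natural_left] at h₂
    refine (act_comp_braid_iff _ _ _ _).1 ?_
    rw [SymmetricCategory.symmetry_assoc, SymmetricCategory.symmetry_assoc,
      SymmetricCategory.symmetry_assoc]
    exact h₂

/-- An element of a hom-object is a family of maps; composing elements composes these maps index by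
index. -/
lemma Act.cmp_ev {J I : Type u} {s t : I → J} {L : I → V} {P Q R : Act V s t L}
    (f : 𝟙_ V ⟶ (P ⟶[V] Q)) (g : 𝟙_ V ⟶ (Q ⟶[V] R)) (j : J) :
    P.obj j ◁ cmp f g ≫ Act.ev P R j =
      (P.obj j ◁ f ≫ Act.ev P Q j) ≫ (ρ_ _).inv ≫ Q.obj j ◁ g ≫ Act.ev Q R j := by
  have h : P.obj j ◁ eComp V P Q R ≫ Act.ev P R j =
      (α_ _ (P ⟶[V] Q) (Q ⟶[V] R)).inv ≫ Act.ev P Q j ▷ _ ≫ Act.ev Q R j := Act.compm_ev P Q R j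
  rw [cmp, MonoidalCategory.whiskerLeft_comp_assoc, MonoidalCategory.whiskerLeft_comp_assoc, h,
    MonoidalCategory.tensorHom_def, MonoidalCategory.whiskerLeft_comp_assoc,
    associator_inv_naturality_right_assoc, MonoidalCategory.whisker_exchange_assoc,
    associator_inv_naturality_middle_assoc, Category.assoc, rightUnitor_inv_naturality_assoc,
    rightUnitor_inv_naturality_assoc]
  simp [unitors_inv_equal]

/-- Isomorphisms of families which commute with the operations are isomorphisms in `Act`. -/
def Act.mkVIso {J I : Type u} {s t : I → J} {L : I → V} {P Q : Act V s t L}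
    (e : ∀ j, P.obj j ≅ Q.obj j)
    (h : ∀ i, P.act i ≫ (e (t i)).hom = (e (s i)).hom ▷ _ ≫ Q.act i) : VIso V P Q where
  hom := Act.lift (fun j => (ρ_ _).hom ≫ (e j).hom) (fun i => by
    rw [rightUnitor_naturality_assoc, h, rs_unit]
    simp)
  inv := Act.lift (fun j => (ρ_ _).hom ≫ (e j).inv) (fun i => by
    have : Q.act i ≫ (e (t i)).inv = (e (s i)).inv ▷ _ ≫ P.act i := by
      rw [Iso.comp_inv_eq, Category.assoc, h, ← comp_whiskerRight_assoc]
      simp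
    rw [rightUnitor_naturality_assoc, this, rs_unit]
    simp)
  hom_inv := Act.hom_ext fun j => by
    rw [Act.cmp_ev, Act.lift_ev, Act.lift_ev]
    exact (by simp : _ = (ρ_ _).hom).trans (Act.idm_ev P j).symm
  inv_hom := Act.hom_ext fun j => by
    rw [Act.cmp_ev, Act.lift_ev, Act.lift_ev]
    exact (by simp : _ = (ρ_ _).hom).trans (Act.idm_ev Q j).symm

/-- `V`-functors with the same objects and the same maps are isomorphic. -/
def VNatIso.ofMapEq {C D : Type*} [EnrichedCategory V C] [EnrichedCategory V D]
    {F : C → D} {m m' : ∀ a b : C, (a ⟶[V] b) ⟶ (F a ⟶[V] F b)} {i i' c c'}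
    (h : ∀ a b, m a b = m' a b) :
    VNatIso (EnrichedFunctor.mk F m i c) (EnrichedFunctor.mk F m' i' c') where
  iso a := ⟨eId V (F a), eId V (F a), cmp_id _, cmp_id _⟩
  naturality a b := by
    rw [post_id, pre_id]
    exact congrArg (· ≫ 𝟙 _) (h a b)

/-- The evaluation of a `V`-functor to `V`. -/
def uev {E : Type v} [EnrichedCategory V E] (U : EnrichedFunctor V E V) (P Q : E) :
    U.obj P ⊗ (P ⟶[V] Q) ⟶ U.obj Q := uncurry (U.map P Q)

section uev
variable {E : Type v} [EnrichedCategory V E] (U : EnrichedFunctor V E V)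

lemma whiskerLeft_uev {P Q : E} {X : V} (f : X ⟶ (P ⟶[V] Q)) :
    U.obj P ◁ f ≫ uev U P Q = uncurry (f ≫ U.map P Q) := (uncurry_natural_left _ _).symm

lemma uev_id (P : E) : U.obj P ◁ eId V P ≫ uev U P P = (ρ_ _).hom := by
  rw [whiskerLeft_uev, U.map_id]
  simp [enrichedCategorySelf_id, MonoidalClosed.id]

/-- This is the functoriality of `U`, transposed: composition in the self-enriched `V` corresponds
under currying to successive evaluation. -/
lemma uev_comp (P Q R : E) : U.obj P ◁ eComp V P Q R ≫ uev U P R =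
    (α_ _ _ _).inv ≫ uev U P Q ▷ _ ≫ uev U Q R := by
  have h' : U.map P Q ⊗ₘ U.map Q R = curry (uev U P Q) ⊗ₘ curry (uev U Q R) := by
    rw [uev, uev, curry_uncurry, curry_uncurry]
  have h₂ := congrArg uncurry
    ((U.map_comp P Q R).trans ((congrArg (· ≫ _) h').trans (curry_comp _ _)))
  rw [uncurry_curry] at h₂
  rw [whiskerLeft_uev, h₂]

end uev

namespace LeftAct

/-- The evaluation of a family of maps commuting with the actions. -/
def ev (P Q : LeftAct V K) (k : K) : P.obj k ⊗ (P.toPresheaf ⟶[V] Q.toPresheaf) ⟶ Q.obj k :=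
  Act.ev P.toPresheaf.toAct Q.toPresheaf.toAct k

lemma toPresheaf_act (P : LeftAct V K) (i : K × K) :
    P.toPresheaf.toAct.act i = (β_ (P.obj i.2) _).hom ≫ P.act i.1 i.2 := uncurry_curry _

/-- The end defining the hom-object of presheaves is stated for operations with the hom-object on
the right. Cancelling one braiding turns its condition into equivariance for the left action. -/
lemma act_braid_iff (P Q : LeftAct V K) {X : V} (φ : ∀ k, P.obj k ⊗ X ⟶ Q.obj k) (a b : K) :
    ((β_ _ _).hom ≫ P.act a b) ▷ X ≫ φ a = rs _ _ _ ≫ φ b ▷ _ ≫ (β_ _ _).hom ≫ Q.act a b ↔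
      P.act a b ▷ X ≫ φ a = (α_ _ _ _).hom ≫ _ ◁ φ b ≫ Q.act a b := by
  rw [rs_braid, comp_whiskerRight_assoc, cancel_epi]

lemma act_ev (P Q : LeftAct V K) (a b : K) :
    P.act a b ▷ _ ≫ ev P Q a = (α_ _ _ _).hom ≫ _ ◁ ev P Q b ≫ Q.act a b := by
  have h := Act.act_ev P.toPresheaf.toAct Q.toPresheaf.toAct (a, b)
  rw [toPresheaf_act, toPresheaf_act] at h
  exact (act_braid_iff P Q (ev P Q) a b).1 h

/-- The universal property of the hom-objects. -/
def lift {P Q : LeftAct V K} {X : V} (φ : ∀ k, P.obj k ⊗ X ⟶ Q.obj k)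
    (h : ∀ a b, P.act a b ▷ X ≫ φ a = (α_ _ _ _).hom ≫ _ ◁ φ b ≫ Q.act a b) :
    X ⟶ (P.toPresheaf ⟶[V] Q.toPresheaf) :=
  Act.lift (P := P.toPresheaf.toAct) (Q := Q.toPresheaf.toAct) φ (fun i => by
    rw [toPresheaf_act, toPresheaf_act]
    exact (act_braid_iff P Q φ i.1 i.2).2 (h i.1 i.2))

lemma lift_ev {P Q : LeftAct V K} {X : V} (φ : ∀ k, P.obj k ⊗ X ⟶ Q.obj k) (h) (k : K) :
    P.obj k ◁ lift φ h ≫ ev P Q k = φ k :=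
  Act.lift_ev (P := P.toPresheaf.toAct) (Q := Q.toPresheaf.toAct) φ _ k

lemma hom_ext {P Q : LeftAct V K} {X : V} {f g : X ⟶ (P.toPresheaf ⟶[V] Q.toPresheaf)}
    (h : ∀ k, P.obj k ◁ f ≫ ev P Q k = P.obj k ◁ g ≫ ev P Q k) : f = g :=
  Act.hom_ext (P := P.toPresheaf.toAct) (Q := Q.toPresheaf.toAct) h

lemma id_ev (P : LeftAct V K) (k : K) : P.obj k ◁ eId V P.toPresheaf ≫ ev P P k = (ρ_ _).hom :=
  Act.idm_ev P.toPresheaf.toAct k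

lemma comp_ev (P Q R : LeftAct V K) (k : K) :
    P.obj k ◁ eComp V P.toPresheaf Q.toPresheaf R.toPresheaf ≫ ev P R k =
      (α_ _ _ _).inv ≫ ev P Q k ▷ _ ≫ ev Q R k :=
  Act.compm_ev P.toPresheaf.toAct Q.toPresheaf.toAct R.toPresheaf.toAct k

/-- The left action of `Q` is its presheaf structure after a braiding, so an equivariant isomorphism
commutes with the original operations once the double braiding is removed by symmetry. -/
lemma nonempty_vIso (P : LeftAct V K) (Q : Presheaf V K) (e : ∀ k, P.obj k ≅ Q.toLeftAct.obj k)
    (h : ∀ a b, P.act a b ≫ (e a).hom = _ ◁ (e b).hom ≫ Q.toLeftAct.act a b) :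
    Nonempty (VIso V P.toPresheaf Q) := by
  have h' (i : K × K) : ((β_ (P.obj i.2) _).hom ≫ P.act i.1 i.2) ≫ (e i.1).hom =
      (e i.2).hom ▷ _ ≫ uncurry (Q.F.map (op i.2) (op i.1)) := by
    rw [Category.assoc, h, ← braiding_naturality_left_assoc]
    exact congrArg (_ ≫ ·) (SymmetricCategory.symmetry_assoc _ _ _)
  have i : VIso V P.toPresheaf.toAct Q.toAct := Act.mkVIso e (fun i => by
    rw [toPresheaf_act]
    exact h' i)
  exact ⟨⟨i.hom, i.inv, i.hom_inv, i.inv_hom⟩⟩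

end LeftAct

/-- A `V`-category with jointly faithful `V`-functors to `V`, whose values carry an action of the
hom-objects of `K` such that the hom-objects represent the families of maps commuting with this
action and such that all left actions of `K` arise, is equivalent to the presheaf `V`-category. -/
theorem exists_presheaf_equivalence {E : Type v} [EnrichedCategory V E]
    (U : K → EnrichedFunctor V E V)
    (act : ∀ (P : E) (a b : K), (a ⟶[V] b) ⊗ (U b).obj P ⟶ (U a).obj P)
    (act_id : ∀ P a, (λ_ _).inv ≫ eId V a ▷ _ ≫ act P a a = 𝟙 _)
    (act_comp : ∀ P a b c,
      eComp V a b c ▷ _ ≫ act P a c = (α_ _ _ _).hom ≫ _ ◁ act P b c ≫ act P a b)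
    (hom_ext : ∀ (P Q : E) (X : V) (f g : X ⟶ (P ⟶[V] Q)),
      (∀ k, (U k).obj P ◁ f ≫ uev (U k) P Q = (U k).obj P ◁ g ≫ uev (U k) P Q) → f = g)
    (act_ev : ∀ (P Q : E) (a b : K), act P a b ▷ (P ⟶[V] Q) ≫ uev (U a) P Q =
      (α_ _ _ _).hom ≫ _ ◁ uev (U b) P Q ≫ act Q a b)
    (lift : ∀ (P Q : E) (X : V) (φ : ∀ k, (U k).obj P ⊗ X ⟶ (U k).obj Q),
      (∀ a b, act P a b ▷ X ≫ φ a = (α_ _ _ _).hom ≫ _ ◁ φ b ≫ act Q a b) →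
      ∃ f : X ⟶ (P ⟶[V] Q), ∀ k, (U k).obj P ◁ f ≫ uev (U k) P Q = φ k)
    (ess : ∀ Q : LeftAct V K, ∃ (P : E) (e : ∀ k, (U k).obj P ≅ Q.obj k),
      ∀ a b, act P a b ≫ (e a).hom = _ ◁ (e b).hom ≫ Q.act a b) :
    ∃ F : EnrichedFunctor V E (Presheaf V K), IsVEquivalence F ∧
      ∀ k, Nonempty (VNatIso (F.comp V (Presheaf.evF V k)) (U k)) := by
  let A (P : E) : LeftAct V K := ⟨fun k => (U k).obj P, act P, act_id P, act_comp P⟩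
  let m (P Q : E) : (P ⟶[V] Q) ⟶ ((A P).toPresheaf ⟶[V] (A Q).toPresheaf) :=
    LeftAct.lift (P := A P) (Q := A Q) (fun k => uev (U k) P Q) (act_ev P Q)
  have m_ev (P Q : E) (k : K) : (A P).obj k ◁ m P Q ≫ LeftAct.ev (A P) (A Q) k =
      uev (U k) P Q := LeftAct.lift_ev (P := A P) (Q := A Q) _ _ k
  let F : EnrichedFunctor V E (Presheaf V K) :=
    { obj := fun P => (A P).toPresheaf
      map := m
      map_id := fun P => LeftAct.hom_ext fun k => by
        rw [LeftAct.id_ev, MonoidalCategory.whiskerLeft_comp_assoc, m_ev]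
        exact uev_id _ _
      map_comp := fun P Q R => LeftAct.hom_ext fun k => by
        rw [MonoidalCategory.whiskerLeft_comp_assoc, MonoidalCategory.whiskerLeft_comp_assoc,
          LeftAct.comp_ev, m_ev, MonoidalCategory.tensorHom_def,
          MonoidalCategory.whiskerLeft_comp_assoc, associator_inv_naturality_right_assoc,
          MonoidalCategory.whisker_exchange_assoc, m_ev, associator_inv_naturality_middle_assoc,
          ← comp_whiskerRight_assoc, m_ev]
        exact uev_comp _ _ _ _ }
  refine ⟨F, ⟨fun P Q => ?_, fun Q => ?_⟩, fun k => ⟨VNatIso.ofMapEq fun P Q => ?_⟩⟩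
  -- The hypothesis `lift`, applied to the universal equivariant family, produces the inverse of `m
  -- P Q`. Both composites are identities because they have the same evaluations.
  · obtain ⟨g, hg⟩ := lift P Q _ (LeftAct.ev (A P) (A Q)) (LeftAct.act_ev (A P) (A Q))
    refine ⟨g, hom_ext _ _ _ _ _ fun k => ?_, LeftAct.hom_ext fun k => ?_⟩
    · rw [MonoidalCategory.whiskerLeft_comp_assoc, hg, MonoidalCategory.whiskerLeft_id,
        Category.id_comp]
      exact m_ev P Q k
    · change (A P).obj k ◁ (g ≫ m P Q) ≫ _ = (A P).obj k ◁ 𝟙 _ ≫ _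
      rw [MonoidalCategory.whiskerLeft_comp_assoc, m_ev, MonoidalCategory.whiskerLeft_id,
        Category.id_comp]
      exact hg k
  · obtain ⟨P, e, he⟩ := ess Q.toLeftAct
    exact ⟨P, LeftAct.nonempty_vIso (A P) Q e he⟩
  -- The two functors agree on objects by construction, so equality on hom-objects gives an
  -- isomorphism with identity components.
  · have h : m P Q ≫ curry (LeftAct.ev (A P) (A Q) k) = (U k).map P Q := by
      rw [← curry_natural_left, m_ev, uev, curry_uncurry]
    exact h

end LeftAct

/-! ### The inserter condition for functors into profunctors, read on components. -/

section InserterProf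
variable {V : Type w} [Category.{u} V] [MonoidalCategory V] [SymmetricCategory V]
  [MonoidalClosed V] [HasLimits V] [HasColimits V]
variable {A B : Type u} [EnrichedCategory V A] [EnrichedCategory V B]

lemma uev_evF (P Q : Prof V A B) (b : B) (a : A) : uev (Prof.evF b a) P Q = Prof.ev P Q b a :=
  uncurry_curry _

/-- The components of the maps of a `V`-functor to a `V`-category of profunctors. -/
def mapEv {E : Type v} [EnrichedCategory V E] (S : EnrichedFunctor V E (Prof V A B))
    (P Q : E) (b : B) (a : A) : (S.obj P).obj b a ⊗ (P ⟶[V] Q) ⟶ (S.obj Q).obj b a :=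
  (S.obj P).obj b a ◁ S.map P Q ≫ Prof.ev _ _ b a

lemma uev_comp_evF {E : Type v} [EnrichedCategory V E] (S : EnrichedFunctor V E (Prof V A B))
    (P Q : E) (b : B) (a : A) :
    uev (S.comp V (Prof.evF b a)) P Q = mapEv S P Q b a := by
  rw [mapEv, ← uev_evF]
  exact (whiskerLeft_uev (Prof.evF b a) (S.map P Q)).symm

lemma Prof.whiskerLeft_el {P Q : Prof V A B} (φ : ProfHom P Q) (b : B) (a : A) :
    P.obj b a ◁ φ.el ≫ ev P Q b a = (ρ_ _).hom ≫ φ.app b a := lift_ev ..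

lemma Prof.post_el_ev {P Q R : Prof V A B} (φ : ProfHom Q R) (b : B) (a : A) :
    P.obj b a ◁ post P φ.el ≫ ev P R b a = ev P Q b a ≫ φ.app b a := by
  rw [post, MonoidalCategory.whiskerLeft_comp_assoc, MonoidalCategory.whiskerLeft_comp_assoc,
    comp_ev, associator_inv_naturality_right_assoc, MonoidalCategory.whisker_exchange_assoc,
    whiskerLeft_el]
  simp

lemma Prof.pre_el_ev {P Q R : Prof V A B} (φ : ProfHom P Q) (b : B) (a : A) :
    P.obj b a ◁ pre R φ.el ≫ ev P R b a = φ.app b a ▷ _ ≫ ev Q R b a := by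
  rw [pre, MonoidalCategory.whiskerLeft_comp_assoc, MonoidalCategory.whiskerLeft_comp_assoc,
    comp_ev, associator_inv_naturality_middle_assoc, ← comp_whiskerRight_assoc, whiskerLeft_el]
  simp

/-- Maps into a hom-object of profunctors are detected by their evaluations, and composing with the
element of a homomorphism composes with its components. The equalizer condition thus becomes one
commuting square for each pair `(b, a)`. -/
lemma inserter_iff {E : Type v} [EnrichedCategory V E] {S R : EnrichedFunctor V E (Prof V A B)}
    {P Q : E} (φ : ProfHom (S.obj P) (R.obj P)) (ψ : ProfHom (S.obj Q) (R.obj Q)) {X : V}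
    (f : X ⟶ (P ⟶[V] Q)) :
    f ≫ S.map P Q ≫ post _ ψ.el = f ≫ R.map P Q ≫ pre _ φ.el ↔
      ∀ b a, (S.obj P).obj b a ◁ f ≫ mapEv S P Q b a ≫ ψ.app b a =
        φ.app b a ▷ X ≫ (R.obj P).obj b a ◁ f ≫ mapEv R P Q b a := by
  have h₁ (b : B) (a : A) : (S.obj P).obj b a ◁ (f ≫ S.map P Q ≫ post _ ψ.el) ≫ Prof.ev _ _ b a =
      (S.obj P).obj b a ◁ f ≫ mapEv S P Q b a ≫ ψ.app b a := by
    rw [MonoidalCategory.whiskerLeft_comp_assoc, MonoidalCategory.whiskerLeft_comp_assoc,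
      Prof.post_el_ev, mapEv, Category.assoc]
  have h₂ (b : B) (a : A) : (S.obj P).obj b a ◁ (f ≫ R.map P Q ≫ pre _ φ.el) ≫ Prof.ev _ _ b a =
      φ.app b a ▷ X ≫ (R.obj P).obj b a ◁ f ≫ mapEv R P Q b a := by
    rw [MonoidalCategory.whiskerLeft_comp_assoc, MonoidalCategory.whiskerLeft_comp_assoc,
      Prof.pre_el_ev, mapEv, MonoidalCategory.whisker_exchange_assoc,
      MonoidalCategory.whisker_exchange_assoc]
  constructor
  · intro h b a
    rw [← h₁, h, h₂]
  · intro h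
    refine Prof.hom_ext fun b a => ?_
    rw [h₁, h, h₂]

lemma mapEv_postF {C : Type u} [EnrichedCategory V C] (G : Prof V B C) (P Q : Prof V A B)
    (c : C) (a : A) : mapEv (Prof.postF A G) P Q c a = Prof.postApp G P Q c a :=
  Prof.lift_ev (P := G.comp P) (Q := G.comp Q) _ (Prof.postApp_lact G P Q)
    (Prof.postApp_ract G P Q) c a

lemma mapEv_preF {C : Type u} [EnrichedCategory V C] (F : Prof V A B) (P Q : Prof V B C)
    (c : C) (a : A) : mapEv (Prof.preF C F) P Q c a = Prof.preApp F P Q c a :=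
  Prof.lift_ev (P := P.comp F) (Q := Q.comp F) _ (Prof.preApp_lact F P Q)
    (Prof.preApp_ract F P Q) c a

lemma mapEv_id (P Q : Prof V A B) (b : B) (a : A) :
    mapEv (EnrichedFunctor.id V (Prof V A B)) P Q b a = Prof.ev P Q b a :=
  (congrArg (· ≫ _) (MonoidalCategory.whiskerLeft_id _ _)).trans (Category.id_comp _)

lemma mapEv_comp {C D : Type u} [EnrichedCategory V C] [EnrichedCategory V D] {E : Type v}
    [EnrichedCategory V E] (S : EnrichedFunctor V E (Prof V A B))
    (R : EnrichedFunctor V (Prof V A B) (Prof V C D)) (P Q : E) (d : D) (c : C) :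
    mapEv (S.comp V R) P Q d c = (R.obj (S.obj P)).obj d c ◁ S.map P Q ≫ mapEv R _ _ d c :=
  MonoidalCategory.whiskerLeft_comp_assoc ..

end InserterProf

/-! ### Profunctors from the unit `V`-category. -/

section UnitProf
variable {V : Type w} [Category.{u} V] [MonoidalCategory V] [SymmetricCategory V]
variable {K : Type u} [EnrichedCategory V K]

/-- The hom-object of the unit `V`-category is the tensor unit and its identity element is an
identity map, so the unit law of the right action determines it completely. -/
lemma Prof.ract_unit (P : Prof V PUnit.{u + 1} K) (k : K) (c c' : PUnit.{u + 1}) :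
    P.ract k c c' = (ρ_ _).hom := by
  have h : (ρ_ _).inv ≫ _ ◁ (𝟙 (𝟙_ V)) ≫ P.ract k c c = 𝟙 _ := P.ract_id k c
  rw [MonoidalCategory.whiskerLeft_id, Category.id_comp] at h
  exact ((Iso.inv_comp_eq _).1 h).trans (Category.comp_id _)

/-- A left action as a profunctor from the unit `V`-category. -/
def LeftAct.toProf (Q : LeftAct V K) : Prof V PUnit.{u + 1} K where
  obj k _ := Q.obj k
  lact a b _ := Q.act a b
  ract _ _ _ := (ρ_ _).hom
  lact_id a _ := Q.act_id a
  ract_id a _ := by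
    change (ρ_ _).inv ≫ _ ◁ (𝟙 (𝟙_ V)) ≫ (ρ_ _).hom = 𝟙 _
    simp
  lact_comp a b c _ := Q.act_comp a b c
  ract_comp a _ _ _ := by
    change (ρ_ _).hom ▷ 𝟙_ V ≫ (ρ_ _).hom = (α_ _ _ _).hom ≫ _ ◁ (λ_ (𝟙_ V)).hom ≫ (ρ_ _).hom
    simp
  comm a b _ _ := by
    change _ ▷ 𝟙_ V ≫ (ρ_ _).hom = (α_ _ _ _).hom ≫ _ ◁ (ρ_ _).hom ≫ _
    simp

variable [MonoidalClosed V] [HasLimits V] [HasColimits V]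

variable (V K) in
-- A profunctor out of the unit `V`-category has no structure beyond its left action, so the
-- criterion applies directly.
theorem exists_prof_unit_equivalence :
    ∃ F : EnrichedFunctor V (Prof V PUnit.{u + 1} K) (Presheaf V K), IsVEquivalence F ∧
      ∀ k, Nonempty (VNatIso (F.comp V (Presheaf.evF V k)) (Prof.evF k PUnit.unit)) := by
  refine exists_presheaf_equivalence (fun k => Prof.evF k PUnit.unit)
    (fun P a b => P.lact a b PUnit.unit) (fun P a => P.lact_id a _)
    (fun P a b c => P.lact_comp a b c _) (fun P Q X f g h => Prof.hom_ext fun d c => ?_)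
    (fun P Q a b => ?_) (fun P Q X φ h => ⟨Prof.lift (fun d _ => φ d) (fun a b _ => h a b)
      (fun d c c' => ?_), fun k => ?_⟩)
    (fun Q => ⟨Q.toProf, fun k => Iso.refl _, fun a b => ?_⟩)
  · have := h d
    rwa [uev_evF] at this
  · rw [uev_evF, uev_evF]
    exact P.lact_ev Q a b _
  -- Compatibility with the right actions is automatic, both being right unitors.
  · rw [Prof.ract_unit, Prof.ract_unit]
    change (ρ_ _).hom ▷ X ≫ φ d = rs _ (𝟙_ V) _ ≫ φ d ▷ 𝟙_ V ≫ (ρ_ _).hom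
    rw [rightUnitor_naturality]
    simp only [rs, braiding_tensorUnit_left]
    monoidal
  · rw [uev_evF]
    exact Prof.lift_ev ..
  · exact (Category.comp_id _).trans
      ((congrArg (· ≫ _) (MonoidalCategory.whiskerLeft_id _ _)).trans (Category.id_comp _)).symm

end UnitProf

/-! ### Left modules over a promonad as left actions of its Eilenberg–Moore `V`-category. -/

section LMod
variable {V : Type w} [Category.{u} V] [MonoidalCategory V] [SymmetricCategory V]
  [MonoidalClosed V] [HasLimits V] [HasColimits V]
variable {B : Type u} [EnrichedCategory V B]

namespace Promonad
variable (T : Promonad V B)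

/-- The components `B(a, b) ⟶ T(a, b)` of the unit. -/
def unitMap (a b : B) : (a ⟶[V] b) ⟶ T.T.obj a b := T.η.app a b

/-- The multiplication as a map from the coend. -/
def μapp (a c : B) : Prof.compObj T.T T.T a c ⟶ T.T.obj a c := T.μ.app a c

/-- The components `T(a, b) ⊗ T(b, c) ⟶ T(a, c)` of the multiplication. -/
def mul (a b c : B) : T.T.obj a b ⊗ T.T.obj b c ⟶ T.T.obj a c :=
  Prof.compι T.T T.T a b c ≫ T.μapp a c

lemma comp_unitMap_eq_ract (a b c : B) :
    eComp V a b c ≫ T.unitMap a c = T.unitMap a b ▷ _ ≫ T.T.ract a b c := T.η.ract_app a b c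

lemma comp_unitMap_eq_lact (a b c : B) :
    eComp V a b c ≫ T.unitMap a c = _ ◁ T.unitMap b c ≫ T.T.lact a b c := T.η.lact_app a b c

lemma mul_id (a b : B) : (ρ_ _).inv ≫ _ ◁ eId V b ≫ _ ◁ T.unitMap b b ≫ T.mul a b b = 𝟙 _ := by
  rw [← MonoidalCategory.whiskerLeft_comp_assoc]
  exact T.mul_unit a b

/-- The multiplication is defined on a coend over `B`, so it is balanced. -/
lemma ract_mul (a b c d : B) : T.T.ract a b c ▷ _ ≫ T.mul a c d =
    (α_ _ _ _).hom ≫ _ ◁ T.T.lact b c d ≫ T.mul a b d := by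
  rw [mul, mul, reassoc_of% Prof.compι_w]

lemma unitMap_eq_ract (b b' : B) :
    T.unitMap b b' = (λ_ _).inv ≫ eId V b ▷ _ ≫ T.unitMap b b ▷ _ ≫ T.T.ract b b b' := by
  rw [← comp_unitMap_eq_ract, reassoc_of% e_id_comp]

lemma unitMap_eq_lact (b b' : B) :
    T.unitMap b b' = (ρ_ _).inv ≫ _ ◁ eId V b' ≫ _ ◁ T.unitMap b' b' ≫ T.T.lact b b' b' := by
  rw [← comp_unitMap_eq_lact, reassoc_of% e_comp_id]

/-- Multiply the result of the right action by the unit of `T` on the right. Balancing moves the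
arrow of `B` onto that unit, where by the homomorphism property of the unit it becomes the image of
the arrow. -/
lemma ract_eq (b c c' : B) : T.T.ract b c c' = _ ◁ T.unitMap c c' ≫ T.mul b c c' := by
  rw [T.unitMap_eq_lact]
  simp only [MonoidalCategory.whiskerLeft_comp, Category.assoc]
  have h := (Iso.inv_comp_eq _).2 (T.ract_mul b c c' c')
  rw [← h]
  conv_lhs => rw [← Category.comp_id (T.T.ract b c c'), ← T.mul_id]
  rw [rightUnitor_inv_naturality_assoc, ← MonoidalCategory.whisker_exchange_assoc,
    ← MonoidalCategory.whisker_exchange_assoc]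
  monoidal

end Promonad

variable {T : Promonad V B} {A : Type u} [EnrichedCategory V A]

namespace LMod

/-- The action of a left module as a map from the coend. -/
def κapp (P : LMod T A) (b : B) (a : A) : Prof.compObj T.T P.P b a ⟶ P.P.obj b a := P.κ.app b a

/-- The action of a left module on components. -/
def act (P : LMod T A) (b c : B) (a : A) : T.T.obj b c ⊗ P.P.obj c a ⟶ P.P.obj b a :=
  Prof.compι T.T P.P b c a ≫ P.κapp b a

lemma id_act (P : LMod T A) (b : B) (a : A) :
    (λ_ _).inv ≫ eId V b ▷ _ ≫ T.unitMap b b ▷ _ ≫ P.act b b a = 𝟙 _ := by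
  rw [← comp_whiskerRight_assoc]
  exact P.unit b a

lemma ract_act (P : LMod T A) (b c d : B) (a : A) : T.T.ract b c d ▷ _ ≫ P.act b d a =
    (α_ _ _ _).hom ≫ _ ◁ P.P.lact c d a ≫ P.act b c a := by
  rw [act, act, reassoc_of% Prof.compι_w]

/-- The action of `B` is no extra datum. Acting afterwards by the unit of `T` changes nothing, and
balancing moves the arrow of `B` onto that unit, where it becomes its image in `T`. -/
lemma lact_eq (P : LMod T A) (b b' : B) (a : A) :
    P.P.lact b b' a = T.unitMap b b' ▷ _ ≫ P.act b b' a := by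
  rw [T.unitMap_eq_ract]
  simp only [MonoidalCategory.comp_whiskerRight, Category.assoc]
  rw [ract_act]
  conv_lhs => rw [← Category.comp_id (P.P.lact b b' a), ← P.id_act]
  rw [leftUnitor_inv_naturality_assoc, MonoidalCategory.whisker_exchange_assoc,
    MonoidalCategory.whisker_exchange_assoc]
  monoidal

end LMod

variable (T) in
/-- A promonad as a left module over itself. -/
def Promonad.self : LMod T B := ⟨T.T, T.μ, T.mul_assoc, T.unit_mul⟩

/-- The statement for modules, applied to `T` acting on itself. -/
lemma Promonad.lact_eq (b b' c : B) : T.T.lact b b' c = T.unitMap b b' ▷ _ ≫ T.mul b b' c :=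
  (Promonad.self T).lact_eq b b' c

/-- The unit of `T` preserves composition, so actions of the Eilenberg–Moore `V`-category can be
restricted along it to actions of `B`. -/
lemma Promonad.comp_unitMap (a b c : B) : eComp V a b c ≫ T.unitMap a c =
    _ ◁ T.unitMap b c ≫ T.unitMap a b ▷ _ ≫ T.mul a b c := by
  rw [T.comp_unitMap_eq_lact, Promonad.lact_eq]

namespace LeftAct
variable (Q : LeftAct V (EM T))

/-- A left action of the Eilenberg–Moore `V`-category on components. -/
def actEM (b c : B) : T.T.obj b c ⊗ Q.obj ⟨c⟩ ⟶ Q.obj ⟨b⟩ := Q.act ⟨b⟩ ⟨c⟩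

lemma id_actEM (b : B) :
    (λ_ _).inv ≫ eId V b ▷ _ ≫ T.unitMap b b ▷ _ ≫ Q.actEM b b = 𝟙 _ := by
  rw [← comp_whiskerRight_assoc]
  exact Q.act_id ⟨b⟩

lemma mul_actEM (b c d : B) :
    T.mul b c d ▷ _ ≫ Q.actEM b d = (α_ _ _ _).hom ≫ _ ◁ Q.actEM c d ≫ Q.actEM b c :=
  Q.act_comp ⟨b⟩ ⟨c⟩ ⟨d⟩

/-- The underlying profunctor of a left action of the Eilenberg–Moore `V`-category. -/
def toProfEM : Prof V PUnit.{u + 1} B where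
  obj b _ := Q.obj ⟨b⟩
  lact b b' _ := T.unitMap b b' ▷ _ ≫ Q.actEM b b'
  ract _ _ _ := (ρ_ _).hom
  lact_id b _ := Q.id_actEM b
  ract_id b _ := by
    change (ρ_ _).inv ≫ _ ◁ (𝟙 (𝟙_ V)) ≫ (ρ_ _).hom = 𝟙 _
    simp
  lact_comp a b c _ := by
    rw [← comp_whiskerRight_assoc, Promonad.comp_unitMap]
    simp only [comp_whiskerRight, Category.assoc, mul_actEM, MonoidalCategory.whiskerLeft_comp]
    rw [associator_naturality_left_assoc, ← MonoidalCategory.whisker_exchange_assoc]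
    monoidal
  ract_comp a _ _ _ := by
    change (ρ_ _).hom ▷ 𝟙_ V ≫ (ρ_ _).hom = (α_ _ _ _).hom ≫ _ ◁ (λ_ (𝟙_ V)).hom ≫ (ρ_ _).hom
    simp
  comm a b _ _ := by
    change _ ▷ 𝟙_ V ≫ (ρ_ _).hom = (α_ _ _ _).hom ≫ _ ◁ (ρ_ _).hom ≫ _
    rw [rightUnitor_naturality]
    monoidal

/-- This is the balancing needed to descend the action to the coend. By `Promonad.ract_eq` it is an
instance of associativity, one of the two arrows being the image of an arrow of `B`. -/
lemma ract_actEM (b c d : B) : T.T.ract b c d ▷ _ ≫ Q.actEM b d =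
    (α_ _ _ _).hom ≫ _ ◁ Q.toProfEM.lact c d PUnit.unit ≫ Q.actEM b c := by
  change _ = (α_ _ _ _).hom ≫ _ ◁ (T.unitMap c d ▷ _ ≫ Q.actEM c d) ≫ Q.actEM b c
  rw [T.ract_eq, comp_whiskerRight_assoc, mul_actEM]
  monoidal

/-- The action map of a left action of the Eilenberg–Moore `V`-category. -/
def κEM (b : B) (a : PUnit.{u + 1}) : Prof.compObj T.T Q.toProfEM b a ⟶ Q.toProfEM.obj b a :=
  Prof.compDesc (G := T.T) (F := Q.toProfEM) (fun c => Q.actEM b c) (fun c d => Q.ract_actEM b c d)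

lemma compι_κEM (b c : B) (a : PUnit.{u + 1}) :
    Prof.compι T.T Q.toProfEM b c a ≫ Q.κEM b a = Q.actEM b c := Prof.compι_desc ..

/-- The module of a left action of the Eilenberg–Moore `V`-category. -/
def toLMod : LMod T PUnit.{u + 1} where
  P := Q.toProfEM
  κ :=
    { app := Q.κEM
      lact_app := fun b b' a => Prof.comp_ext_left fun c => by
        -- The left action of `B` on `T` is multiplication by the image of the arrow, so
        -- compatibility with it is again associativity.
        have h : _ ◁ Q.actEM b' c ≫ Q.toProfEM.lact b b' a =
            (α_ _ _ _).inv ≫ T.T.lact b b' c ▷ _ ≫ Q.actEM b c := by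
          change _ ◁ Q.actEM b' c ≫ (T.unitMap b b' ▷ _ ≫ Q.actEM b b') = _
          rw [T.lact_eq, comp_whiskerRight_assoc, mul_actEM,
            MonoidalCategory.whisker_exchange_assoc]
          monoidal
        change _ ≫ Prof.compL T.T Q.toProfEM b b' a ≫ Q.κEM b a = _ ≫ _ ◁ Q.κEM b' a ≫ _
        rw [reassoc_of% Prof.compι_compL, compι_κEM, ← MonoidalCategory.whiskerLeft_comp_assoc,
          compι_κEM]
        exact h.symm
      ract_app := fun b a a' => Prof.comp_ext_right fun c => by
        change _ ≫ Prof.compR T.T Q.toProfEM b a a' ≫ Q.κEM b a' = _ ≫ Q.κEM b a ▷ _ ≫ _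
        rw [reassoc_of% Prof.compι_compR, compι_κEM, ← MonoidalCategory.comp_whiskerRight_assoc,
          compι_κEM]
        change (α_ _ _ (𝟙_ V)).hom ≫ _ ◁ (ρ_ _).hom ≫ Q.actEM b c = Q.actEM b c ▷ 𝟙_ V ≫ (ρ_ _).hom
        rw [rightUnitor_naturality]
        monoidal }
  assoc b c d a := by
    rw [compι_κEM, compι_κEM, compι_κEM]
    exact Q.mul_actEM b c d
  unit b a := by
    rw [compι_κEM]
    exact Q.act_id ⟨b⟩

lemma toLMod_act (b c : B) (a : PUnit.{u + 1}) : Q.toLMod.act b c a = Q.actEM b c :=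
  Q.compι_κEM b c a

end LeftAct

namespace LMod

lemma uev_forget (P Q : LMod T A) (b : B) (a : A) :
    uev ((LMod.forget T A).comp V (Prof.evF b a)) P Q =
      P.P.obj b a ◁ Inserter.ι P.toInserter Q.toInserter ≫ Prof.ev P.P Q.P b a :=
  uev_comp_evF (LMod.forget T A) P Q b a

/-- The square at `(b, a)` starts at a coend tensored with `X`. Tested on the summands `T(b, c) ⊗
P(c, a)`, it says that the family underlying `f` commutes with the actions of `T`. -/
lemma inserter_condition_iff (P Q : LMod T A) {X : V} (f : X ⟶ (P.P ⟶[V] Q.P)) :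
    f ≫ (Prof.postF A T.T).map P.P Q.P ≫ post _ Q.κ.el =
        f ≫ (EnrichedFunctor.id V (Prof V A B)).map P.P Q.P ≫ pre _ P.κ.el ↔
      ∀ b c a, P.act b c a ▷ X ≫ P.P.obj b a ◁ f ≫ Prof.ev P.P Q.P b a =
        (α_ _ _ _).hom ≫ _ ◁ (P.P.obj c a ◁ f ≫ Prof.ev P.P Q.P c a) ≫ Q.act b c a := by
  have h₁ (b c a) : Prof.compι T.T P.P b c a ▷ X ≫ Prof.compObj T.T P.P b a ◁ f ≫
      Prof.postApp T.T P.P Q.P b a ≫ Q.κapp b a =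
      (α_ _ _ _).hom ≫ _ ◁ (P.P.obj c a ◁ f ≫ Prof.ev P.P Q.P c a) ≫ Q.act b c a := by
    rw [← MonoidalCategory.whisker_exchange_assoc, reassoc_of% Prof.compι_postApp, act]
    monoidal
  have h₂ (b a) : (Prof.compObj T.T P.P b a ◁ f ≫ Prof.postApp T.T P.P Q.P b a ≫ Q.κapp b a =
      P.κapp b a ▷ X ≫ P.P.obj b a ◁ f ≫ Prof.ev P.P Q.P b a) ↔ 
      ∀ c, P.act b c a ▷ X ≫ P.P.obj b a ◁ f ≫ Prof.ev P.P Q.P b a =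
        (α_ _ _ _).hom ≫ _ ◁ (P.P.obj c a ◁ f ≫ Prof.ev P.P Q.P c a) ≫ Q.act b c a := by
    constructor
    · intro h c
      rw [← h₁, h, act, comp_whiskerRight_assoc]
    · intro h
      refine Prof.comp_ext_right fun c => ?_
      rw [h₁, ← h, act, comp_whiskerRight_assoc]
  refine (inserter_iff (S := Prof.postF A T.T) (R := EnrichedFunctor.id V (Prof V A B)) P.κ Q.κ
    f).trans ?_
  simp only [mapEv_postF, mapEv_id]
  exact ⟨fun h b c a => (h₂ b a).1 (h b a) c, fun h b a => (h₂ b a).2 fun c => h b c a⟩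

lemma act_uev (P Q : LMod T A) (b c : B) (a : A) :
    P.act b c a ▷ (P ⟶[V] Q) ≫ uev ((LMod.forget T A).comp V (Prof.evF b a)) P Q =
      (α_ _ _ _).hom ≫ _ ◁ uev ((LMod.forget T A).comp V (Prof.evF c a)) P Q ≫ Q.act b c a := by
  rw [uev_forget, uev_forget]
  exact (inserter_condition_iff P Q _).1 (Inserter.w P.toInserter Q.toInserter) b c a

lemma exists_lift (P Q : LMod T PUnit.{u + 1}) {X : V}
    (φ : ∀ b, P.P.obj b PUnit.unit ⊗ X ⟶ Q.P.obj b PUnit.unit)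
    (h : ∀ b c, P.act b c _ ▷ X ≫ φ b = (α_ _ _ _).hom ≫ _ ◁ φ c ≫ Q.act b c _) :
    ∃ f : X ⟶ (P ⟶[V] Q), ∀ b, P.P.obj b PUnit.unit ◁ f ≫
      uev ((LMod.forget T PUnit.{u + 1}).comp V (Prof.evF b PUnit.unit)) P Q = φ b := by
  let f₀ : X ⟶ (P.P ⟶[V] Q.P) := Prof.lift (fun b _ => φ b)
    (fun b c _ => by
      -- A family commuting with the action of `T` commutes with that of `B`, which is its
      -- restriction along the unit.
      rw [lact_eq, lact_eq, comp_whiskerRight_assoc, h]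
      rw [associator_naturality_left_assoc, ← MonoidalCategory.whisker_exchange_assoc])
    (fun b a a' => by
      rw [Prof.ract_unit, Prof.ract_unit]
      change (ρ_ _).hom ▷ X ≫ φ b = rs _ (𝟙_ V) _ ≫ φ b ▷ 𝟙_ V ≫ (ρ_ _).hom
      rw [rightUnitor_naturality]
      simp only [rs, braiding_tensorUnit_left]
      monoidal)
  have hf (b : B) (a) : P.P.obj b a ◁ f₀ ≫ Prof.ev P.P Q.P b a = φ b := Prof.lift_ev ..
  have hf' := (inserter_condition_iff P Q f₀).2 fun b c a => by rw [hf, hf]; exact h b c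
  refine ⟨Inserter.lift (P := P.toInserter) (Q := Q.toInserter) f₀ hf', fun b => ?_⟩
  rw [uev_forget]
  refine (MonoidalCategory.whiskerLeft_comp_assoc ..).symm.trans (Eq.trans ?_ (hf b PUnit.unit))
  exact congrArg (fun t => _ ◁ t ≫ _)
    (Inserter.lift_ι (P := P.toInserter) (Q := Q.toInserter) f₀ hf')

end LMod

variable (T) in
-- The module laws are word for word those of a left action of the Eilenberg–Moore `V`-category. The
-- content lies in `LMod.lact_eq`, by which commuting with this action is all that is asked of a map
-- of modules.
theorem exists_lmod_equivalence :
    ∃ F : EnrichedFunctor V (LMod T PUnit.{u + 1}) (Presheaf V (EM T)), IsVEquivalence F ∧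
      ∀ k : EM T, Nonempty (VNatIso (F.comp V (Presheaf.evF V k))
        ((LMod.forget T PUnit.{u + 1}).comp V (Prof.evF k.as PUnit.unit))) := by
  refine exists_presheaf_equivalence
    (fun k : EM T => (LMod.forget T PUnit.{u + 1}).comp V (Prof.evF k.as PUnit.unit))
    (fun P a b => P.act a.as b.as PUnit.unit) (fun P a => P.unit a.as _)
    (fun P a b c => P.assoc a.as b.as c.as _)
    (fun P Q X f g h => Inserter.hom_ext (Prof.hom_ext fun d c => ?_))
    (fun P Q a b => LMod.act_uev P Q a.as b.as _)
    (fun P Q X φ h => ?_)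
    (fun Q => ⟨Q.toLMod, fun k => Iso.refl _, fun a b => ?_⟩)
  · refine (MonoidalCategory.whiskerLeft_comp_assoc ..).trans (Eq.trans ?_
      (MonoidalCategory.whiskerLeft_comp_assoc ..).symm)
    have := h ⟨d⟩
    rw [LMod.uev_forget] at this
    exact this
  · obtain ⟨f, hf⟩ := LMod.exists_lift P Q (fun b => φ ⟨b⟩) (fun b c => h ⟨b⟩ ⟨c⟩)
    exact ⟨f, fun k => hf k.as⟩
  · rw [LeftAct.toLMod_act]
    exact (Category.comp_id _).trans
      ((congrArg (· ≫ _) (MonoidalCategory.whiskerLeft_id _ _)).trans (Category.id_comp _)).symm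

end LMod

/-! ### Passing between the orders `(G ⊗ F) ⊗ P` and `(G ⊗ P) ⊗ F` of the tensor factors. -/

section Perm
variable {V : Type w} [Category.{u} V] [MonoidalCategory V] [SymmetricCategory V]

lemma rs_rs (A B C : V) : rs A B C ≫ rs A C B = 𝟙 _ := by
  simp only [rs, Category.assoc, Iso.inv_hom_id_assoc]
  rw [← MonoidalCategory.whiskerLeft_comp_assoc, SymmetricCategory.symmetry]
  simp

instance (A B C : V) : IsIso (rs A B C) := ⟨rs A C B, rs_rs A B C, rs_rs A C B⟩

lemma rs_tensor_left (G H F P : V) :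
    rs (G ⊗ H) F P ≫ rs G H P ▷ F ≫ (α_ _ _ _).hom = (α_ G H F).hom ▷ P ≫ rs G (H ⊗ F) P := by
  simp only [rs, braiding_tensor_left_hom]
  monoidal

/-- Both sides bring two nested layers `(G, F)` and `(G', F')` around `P` to the same order. The
crossing of `F` with `F'` on the left accounts for the braiding by which `hcomp` differs from
`hcomp0`. -/
lemma rs_tensorμ (G F G' F' P : V) :
    tensorμ G F G' F' ▷ P ≫ rs (G ⊗ G') (F ⊗ F') P ≫ ((G ⊗ G') ⊗ P) ◁ (β_ F F').hom =
      (α_ _ _ _).hom ≫ (G ⊗ F) ◁ rs G' F' P ≫ rs G F ((G' ⊗ P) ⊗ F') ≫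
        (α_ _ _ _).inv ▷ F ≫ (α_ _ _ _).inv ▷ F' ▷ F ≫ (α_ _ _ _).hom := by
  calc
    _ = 𝟙 _ ⊗≫ ((G ◁ (β_ F G').hom) ▷ (F' ⊗ P) ≫ (G ⊗ G' ⊗ F) ◁ (β_ F' P).hom) ⊗≫
        (G ⊗ G') ◁ (β_ F P).hom ▷ F' ⊗≫ ((G ⊗ G') ⊗ P) ◁ (β_ F F').hom := by
      simp only [tensorμ, rs, braiding_tensor_left_hom]
      monoidal
    _ = _ := by
      rw [← MonoidalCategory.whisker_exchange]
      simp only [rs, braiding_tensor_right_hom]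
      monoidal

/-- A hom-object of optics keeps its two factors together, whereas the components of a module have
`P` between them. This lemma and the next three transport dinaturality, associativity, the unit law
and equivariance between the two conventions. -/
lemma perm_dinat_iff {G H F G₁ F₁ P Q : V} (r : G ⊗ H ⟶ G₁) (l : H ⊗ F ⟶ F₁)
    (t : (G₁ ⊗ P) ⊗ F ⟶ Q) (t' : (G ⊗ P) ⊗ F₁ ⟶ Q) :
    r ▷ F ▷ P ≫ rs _ _ _ ≫ t = (α_ _ _ _).hom ▷ P ≫ (G ◁ l) ▷ P ≫ rs _ _ _ ≫ t' ↔
      r ▷ P ▷ F ≫ t = rs _ _ _ ▷ F ≫ (α_ _ _ _).hom ≫ _ ◁ l ≫ t' := by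
  rw [reassoc_of% rs_nat_left, reassoc_of% rs_nat_mid, ← reassoc_of% rs_tensor_left, cancel_epi]

/-- Here `g` and `h` stand for `gcomp` and `hcomp0`. The first equation is associativity of an
action of optics on generators, the second is the associativity of `θ`; they differ by an invertible
permutation. -/
lemma perm_assoc_iff {G F G' F' P P₁ Q G₂ F₂ : V} (g : G ⊗ G' ⟶ G₂) (h : F' ⊗ F ⟶ F₂)
    (t : (G ⊗ P₁) ⊗ F ⟶ Q) (t' : (G' ⊗ P) ⊗ F' ⟶ P₁) (t₂ : (G₂ ⊗ P) ⊗ F₂ ⟶ Q) :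
    (tensorμ _ _ _ _ ≫ (g ⊗ₘ ((β_ _ _).hom ≫ h))) ▷ P ≫ rs _ _ _ ≫ t₂ =
        (α_ _ _ _).hom ≫ _ ◁ (rs _ _ _ ≫ t') ≫ rs _ _ _ ≫ t ↔
      (G ◁ t') ▷ F ≫ t = (α_ _ _ _).inv ▷ _ ≫ (α_ _ _ _).inv ▷ _ ▷ _ ≫ (α_ _ _ _).hom ≫
        (g ▷ P ⊗ₘ h) ≫ t₂ := by
  have e : (tensorμ _ _ _ _ ≫ (g ⊗ₘ ((β_ _ _).hom ≫ h))) ▷ P ≫ rs _ _ _ ≫ t₂ =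
      (α_ _ _ _).hom ≫ (G ⊗ F) ◁ rs G' F' P ≫ rs G F ((G' ⊗ P) ⊗ F') ≫
        (α_ _ _ _).inv ▷ _ ≫ (α_ _ _ _).inv ▷ _ ▷ _ ≫ (α_ _ _ _).hom ≫ (g ▷ P ⊗ₘ h) ≫ t₂ := by
    rw [← reassoc_of% rs_tensorμ, MonoidalCategory.tensorHom_def', MonoidalCategory.tensorHom_def']
    simp only [comp_whiskerRight, MonoidalCategory.whiskerLeft_comp, Category.assoc]
    rw [reassoc_of% rs_nat_left, reassoc_of% rs_nat_mid, reassoc_of% rs_nat_mid]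
  rw [e, MonoidalCategory.whiskerLeft_comp, Category.assoc, cancel_epi, cancel_epi,
    reassoc_of% rs_nat_right, cancel_epi]
  exact eq_comm

lemma perm_unit {G F P Q : V} (g : 𝟙_ V ⟶ G) (h : 𝟙_ V ⟶ F) (t : (G ⊗ P) ⊗ F ⟶ Q) :
    (λ_ _).inv ≫ ((λ_ _).inv ≫ (g ⊗ₘ h)) ▷ P ≫ rs _ _ _ ≫ t =
      (λ_ _).inv ≫ g ▷ P ≫ (ρ_ _).inv ≫ _ ◁ h ≫ t := by
  rw [MonoidalCategory.tensorHom_def']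
  simp only [comp_whiskerRight, Category.assoc]
  rw [reassoc_of% rs_nat_left, reassoc_of% rs_nat_mid]
  have e : (λ_ P).inv ≫ (λ_ (𝟙_ V)).inv ▷ P ≫ rs _ _ _ = (λ_ _).inv ≫ (ρ_ _).inv := by
    simp only [rs, braiding_tensorUnit_left]
    monoidal
  rw [reassoc_of% e, MonoidalCategory.whisker_exchange_assoc, ← rightUnitor_inv_naturality_assoc]

lemma perm_hom_iff {G F P Q X P₁ Q₁ : V} (t : (G ⊗ P) ⊗ F ⟶ Q) (t₁ : (G ⊗ P₁) ⊗ F ⟶ Q₁)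
    (φ : P ⊗ X ⟶ P₁) (ψ : Q ⊗ X ⟶ Q₁) :
    (rs _ _ _ ≫ t) ▷ X ≫ ψ = (α_ _ _ _).hom ≫ (G ⊗ F) ◁ φ ≫ rs _ _ _ ≫ t₁ ↔
      t ▷ X ≫ ψ = rs _ _ _ ≫ (α_ _ _ _).hom ▷ _ ≫ (G ◁ φ) ▷ F ≫ t₁ := by
  have e : (α_ (G ⊗ F) P X).hom ≫ rs G F (P ⊗ X) =
      rs G F P ▷ X ≫ rs (G ⊗ P) F X ≫ (α_ G P X).hom ▷ F := by
    rw [rs_tensor]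
    simp
  rw [reassoc_of% rs_nat_right, reassoc_of% e, comp_whiskerRight_assoc, cancel_epi]

end Perm

/-! ### Optic actions are left actions of the Eilenberg–Moore `V`-category. -/

section OpticAct
variable (V : Type w) [Category.{u} V] [MonoidalCategory V] [SymmetricCategory V]
variable (C M N : Type u) [EnrichedCategory V C] [MonoidalVCat V C] [EnrichedCategory V M]
  [LeftModule V C M] [EnrichedCategory V N] [LeftModule V C N]

/-- A family of objects with maps `N(n, x n') ⊗ P(n', m') ⊗ M(x m', m) ⟶ P(n, m)`, dinatural in
`x`, associative and unital. -/
structure OpticAct where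
  obj (n : N) (m : M) : V
  θ (x : C) (n n' : N) (m' m : M) :
    ((n ⟶[V] sm V x n') ⊗ obj n' m') ⊗ (sm V x m' ⟶[V] m) ⟶ obj n m
  dinat (x x' : C) (n n' : N) (m' m : M) :
    gact n n' x x' ▷ _ ▷ _ ≫ θ x' n n' m' m =
      rs _ _ _ ▷ _ ≫ (α_ _ _ _).hom ≫ _ ◁ hact m m' x x' ≫ θ x n n' m' m
  assoc (x y : C) (n n' n'' : N) (m'' m' m : M) :
    (_ ◁ θ y n' n'' m'' m') ▷ _ ≫ θ x n n' m' m =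
      (α_ _ _ _).inv ▷ _ ≫ (α_ _ _ _).inv ▷ _ ▷ _ ≫ (α_ _ _ _).hom ≫
        (gcomp x y n n' n'' ▷ _ ⊗ₘ hcomp0 x y m m' m'') ≫ θ (tmul V x y) n n'' m'' m
  unit (n : N) (m : M) :
    (λ_ _).inv ≫ (uM V C n).inv ▷ _ ≫ (ρ_ _).inv ≫ _ ◁ (uM V C m).hom ≫
      θ (tone V C) n n m m = 𝟙 _

variable {V C M N} [MonoidalClosed V] [HasLimits V] [HasColimits V]

namespace LeftAct
variable (Q : LeftAct V (EM (MHN V C M N)))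

/-- A left action of the Eilenberg–Moore `V`-category as maps out of coends. -/
def actW (m : M) (n : N) (m' : M) (n' : N) :
    wObj V C m n m' n' ⊗ Q.obj ⟨(op m', n')⟩ ⟶ Q.obj ⟨(op m, n)⟩ :=
  Q.act ⟨(op m, n)⟩ ⟨(op m', n')⟩

lemma wId_actW (m : M) (n : N) : (λ_ _).inv ≫ wId V C m n ▷ _ ≫ Q.actW m n m n = 𝟙 _ := by
  rw [← wUnit_id]
  exact Q.act_id ⟨(op m, n)⟩

lemma wComp_actW (m₁ : M) (n₁ : N) (m₂ : M) (n₂ : N) (m₃ : M) (n₃ : N) :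
    wComp m₁ n₁ m₂ n₂ m₃ n₃ ▷ _ ≫ Q.actW m₁ n₁ m₃ n₃ =
      (α_ _ _ _).hom ≫ _ ◁ Q.actW m₂ n₂ m₃ n₃ ≫ Q.actW m₁ n₁ m₂ n₂ := by
  have h := Q.act_comp ⟨(op m₁, n₁)⟩ ⟨(op m₂, n₂)⟩ ⟨(op m₃, n₃)⟩
  -- Composition in the Eilenberg–Moore `V`-category is a coprojection followed by the
  -- multiplication; for the promonad of the `V`-functor `unitF` this is composition of optics.
  have e : eComp V (⟨(op m₁, n₁)⟩ : EM (MHN V C M N)) ⟨(op m₂, n₂)⟩ ⟨(op m₃, n₃)⟩ =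
      wComp m₁ n₁ m₂ n₂ m₃ n₃ :=
    Prof.compι_mul (unitF V C M N) (op m₁, n₁) (op m₂, n₂) (op m₃, n₃)
  rw [e] at h
  exact h

/-- The optic action of a left action of the Eilenberg–Moore `V`-category. -/
def toOpticAct : OpticAct V C M N where
  obj n m := Q.obj ⟨(op m, n)⟩
  θ x n n' m' m := rs _ _ _ ≫ wι x m n m' n' ▷ _ ≫ Q.actW m n m' n'
  dinat x x' n n' m' m := by
    refine (perm_dinat_iff _ _ _ _).1 ?_
    rw [reassoc_of% rs_rs, reassoc_of% rs_rs, ← comp_whiskerRight_assoc, wι_w]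
    simp only [comp_whiskerRight, Category.assoc]
  assoc x y n n' n'' m'' m' m := by
    refine (perm_assoc_iff _ _ _ _ _).1 ?_
    rw [reassoc_of% rs_rs, reassoc_of% rs_rs, reassoc_of% rs_rs,
      MonoidalCategory.whiskerLeft_comp_assoc, MonoidalCategory.whisker_exchange_assoc]
    have h := congrArg (fun t => (wι x m n m' n' ⊗ₘ wι y m' n' m'' n'') ▷ _ ≫ t)
      (Q.wComp_actW m n m' n' m'' n'')
    simp only [← comp_whiskerRight_assoc, wι_wι_wComp, wc] at h
    rw [← comp_whiskerRight_assoc]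
    refine Eq.trans ?_ (h.trans ?_)
    · simp only [Category.assoc]
      rfl
    · rw [MonoidalCategory.tensorHom_def']
      simp only [comp_whiskerRight, Category.assoc]
      rw [associator_naturality_left_assoc, associator_naturality_middle_assoc]
  unit n m := by
    rw [← perm_unit, reassoc_of% rs_rs, ← comp_whiskerRight_assoc, ← wId_eq, wId_actW]

end LeftAct

namespace OpticAct
variable (P : OpticAct V C M N)

/-- The maps of an optic action, as maps out of coends. -/
def actW (m : M) (n : N) (m' : M) (n' : N) : wObj V C m n m' n' ⊗ P.obj n' m' ⟶ P.obj n m :=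
  coend.descR (fun x => rs _ _ _ ≫ P.θ x n n' m' m)
    (fun x x' => (perm_dinat_iff _ _ _ _).2 (P.dinat x x' n n' m' m))

lemma wι_actW (x : C) (m : M) (n : N) (m' : M) (n' : N) :
    wι x m n m' n' ▷ _ ≫ P.actW m n m' n' = rs _ _ _ ≫ P.θ x n n' m' m := coend.ι_descR ..

lemma wId_actW (m : M) (n : N) : (λ_ _).inv ≫ wId V C m n ▷ _ ≫ P.actW m n m n = 𝟙 _ := by
  rw [wId_eq, comp_whiskerRight_assoc, wι_actW, perm_unit, P.unit]

/-- Both hom-objects of optics are coends, and tensoring preserves these, so it suffices to compare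
on the summands of `x` and `y`. There the equation is the associativity of `θ`, up to the order of
the factors. -/
lemma wComp_actW (m₁ : M) (n₁ : N) (m₂ : M) (n₂ : N) (m₃ : M) (n₃ : N) :
    wComp m₁ n₁ m₂ n₂ m₃ n₃ ▷ _ ≫ P.actW m₁ n₁ m₃ n₃ =
      (α_ _ _ _).hom ≫ _ ◁ P.actW m₂ n₂ m₃ n₃ ≫ P.actW m₁ n₁ m₂ n₂ := by
  rw [← cancel_epi (α_ _ _ _).inv]
  refine wObj_ext_right fun x => ?_
  rw [associator_inv_naturality_left_assoc, associator_inv_naturality_left_assoc,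
    cancel_epi (α_ _ _ _).inv]
  refine wObj_ext_mid fun y => ?_
  have h := (perm_assoc_iff _ _ _ _ _).2 (P.assoc x y n₁ n₂ n₃ m₃ m₂ m₁)
  have w := wι_wι_wComp (V := V) x y m₁ n₁ m₂ n₂ m₃ n₃
  rw [MonoidalCategory.tensorHom_def', Category.assoc] at w
  rw [← comp_whiskerRight_assoc, ← comp_whiskerRight_assoc, Category.assoc, w, wc,
    ← Category.assoc (tensorμ _ _ _ _), comp_whiskerRight_assoc, wι_actW]
  refine Eq.trans h ?_
  rw [associator_naturality_left_assoc, associator_naturality_middle_assoc,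
    ← MonoidalCategory.whisker_exchange_assoc, wι_actW, ← MonoidalCategory.whiskerLeft_comp_assoc,
    wι_actW]

/-- The left action of the Eilenberg–Moore `V`-category given by an optic action. -/
def toLeftAct : LeftAct V (EM (MHN V C M N)) where
  obj k := P.obj k.as.2 k.as.1.unop
  act k l := P.actW k.as.1.unop k.as.2 l.as.1.unop l.as.2
  act_id k := by
    have h := P.wId_actW k.as.1.unop k.as.2
    rw [← wUnit_id] at h
    exact h
  act_comp k l o := by
    have h := P.wComp_actW k.as.1.unop k.as.2 l.as.1.unop l.as.2 o.as.1.unop o.as.2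
    have e : eComp V k l o = wComp k.as.1.unop k.as.2 l.as.1.unop l.as.2 o.as.1.unop o.as.2 :=
      Prof.compι_mul (unitF V C M N) k.as l.as o.as
    rw [e]
    exact h

lemma actW_iso (Q : LeftAct V (EM (MHN V C M N)))
    (e : ∀ n m, P.obj n m ≅ Q.obj ⟨(op m, n)⟩)
    (h : ∀ x n n' m' m, P.θ x n n' m' m ≫ (e n m).hom =
      (_ ◁ (e n' m').hom) ▷ _ ≫ rs _ _ _ ≫ wι x m n m' n' ▷ _ ≫ Q.actW m n m' n')
    (m : M) (n : N) (m' : M) (n' : N) :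
    P.actW m n m' n' ≫ (e n m).hom = _ ◁ (e n' m').hom ≫ Q.actW m n m' n' := by
  refine wObj_ext_right fun x => ?_
  rw [reassoc_of% wι_actW, h, reassoc_of% rs_nat_mid, reassoc_of% rs_rs,
    MonoidalCategory.whisker_exchange_assoc]

/-- The summands of the coend are jointly epimorphic, also after tensoring, so equivariance for
optics is equivariance for each component of `θ`. -/
lemma actW_hom_iff (Q : OpticAct V C M N) {X : V} (φ : ∀ n m, P.obj n m ⊗ X ⟶ Q.obj n m)
    (m : M) (n : N) (m' : M) (n' : N) :
    P.actW m n m' n' ▷ X ≫ φ n m = (α_ _ _ _).hom ≫ _ ◁ φ n' m' ≫ Q.actW m n m' n' ↔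
      ∀ x, P.θ x n n' m' m ▷ X ≫ φ n m =
        rs _ _ _ ≫ (α_ _ _ _).hom ▷ _ ≫ (_ ◁ φ n' m') ▷ _ ≫ Q.θ x n n' m' m := by
  have h₁ (x : C) : wι x m n m' n' ▷ _ ▷ X ≫ P.actW m n m' n' ▷ X ≫ φ n m =
      (rs _ _ _ ≫ P.θ x n n' m' m) ▷ X ≫ φ n m := by
    rw [← comp_whiskerRight_assoc, wι_actW]
  have h₂ (x : C) : wι x m n m' n' ▷ _ ▷ X ≫
      (α_ _ _ _).hom ≫ _ ◁ φ n' m' ≫ Q.actW m n m' n' =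
      (α_ _ _ _).hom ≫ _ ◁ φ n' m' ≫ rs _ _ _ ≫ Q.θ x n n' m' m := by
    rw [associator_naturality_left_assoc, ← MonoidalCategory.whisker_exchange_assoc, wι_actW]
  constructor
  · intro h x
    rw [← perm_hom_iff, ← h₁, h, h₂]
  · intro h
    rw [← cancel_epi (α_ _ _ _).inv]
    refine wObj_ext_right fun x => ?_
    rw [associator_inv_naturality_left_assoc, associator_inv_naturality_left_assoc, h₁, h₂,
      (perm_hom_iff _ _ _ _).2 (h x)]

end OpticAct

/-- A `V`-category with jointly faithful `V`-functors to `V`, whose values carry maps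
`N(n, x n') ⊗ P(n', m') ⊗ M(x m', m) ⟶ P(n, m)`, such that the hom-objects represent the families
of maps commuting with these and such that all families of such maps arise, is equivalent to the
presheaf `V`-category on the Eilenberg–Moore `V`-category. -/
theorem exists_optic_equivalence {E : Type v} [EnrichedCategory V E]
    (U : N → M → EnrichedFunctor V E V)
    (θ : ∀ (P : E) (x : C) (n n' : N) (m' m : M),
      ((n ⟶[V] sm V x n') ⊗ (U n' m').obj P) ⊗ (sm V x m' ⟶[V] m) ⟶ (U n m).obj P)
    (dinat : ∀ P x x' n n' m' m, gact n n' x x' ▷ _ ▷ _ ≫ θ P x' n n' m' m =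
      rs _ _ _ ▷ _ ≫ (α_ _ _ _).hom ≫ _ ◁ hact m m' x x' ≫ θ P x n n' m' m)
    (assoc : ∀ P x y n n' n'' m'' m' m, (_ ◁ θ P y n' n'' m'' m') ▷ _ ≫ θ P x n n' m' m =
      (α_ _ _ _).inv ▷ _ ≫ (α_ _ _ _).inv ▷ _ ▷ _ ≫ (α_ _ _ _).hom ≫
        (gcomp x y n n' n'' ▷ _ ⊗ₘ hcomp0 x y m m' m'') ≫ θ P (tmul V x y) n n'' m'' m)
    (unit : ∀ P n m, (λ_ _).inv ≫ (uM V C n).inv ▷ _ ≫ (ρ_ _).inv ≫ _ ◁ (uM V C m).hom ≫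
      θ P (tone V C) n n m m = 𝟙 _)
    (hom_ext : ∀ (P Q : E) (X : V) (f g : X ⟶ (P ⟶[V] Q)), (∀ n m, (U n m).obj P ◁ f ≫
      uev (U n m) P Q = (U n m).obj P ◁ g ≫ uev (U n m) P Q) → f = g)
    (θ_ev : ∀ P Q x n n' m' m, θ P x n n' m' m ▷ (P ⟶[V] Q) ≫ uev (U n m) P Q =
      rs _ _ _ ≫ (α_ _ _ _).hom ▷ _ ≫ (_ ◁ uev (U n' m') P Q) ▷ _ ≫ θ Q x n n' m' m)
    (lift : ∀ (P Q : E) (X : V) (φ : ∀ n m, (U n m).obj P ⊗ X ⟶ (U n m).obj Q),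
      (∀ x n n' m' m, θ P x n n' m' m ▷ X ≫ φ n m =
        rs _ _ _ ≫ (α_ _ _ _).hom ▷ _ ≫ (_ ◁ φ n' m') ▷ _ ≫ θ Q x n n' m' m) →
      ∃ f : X ⟶ (P ⟶[V] Q), ∀ n m, (U n m).obj P ◁ f ≫ uev (U n m) P Q = φ n m)
    (ess : ∀ Q : OpticAct V C M N, ∃ (P : E) (e : ∀ n m, (U n m).obj P ≅ Q.obj n m),
      ∀ x n n' m' m, θ P x n n' m' m ≫ (e n m).hom =
        (_ ◁ (e n' m').hom) ▷ _ ≫ Q.θ x n n' m' m) :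
    ∃ F : EnrichedFunctor V E (Presheaf V (EM (MHN V C M N))), IsVEquivalence F ∧
      ∀ m n, Nonempty (VNatIso (F.comp V (Presheaf.evF V ⟨(op m, n)⟩)) (U n m)) := by
  let A (P : E) : OpticAct V C M N :=
    ⟨fun n m => (U n m).obj P, θ P, dinat P, assoc P, unit P⟩
  -- Every hypothesis of the criterion is stated for the hom-objects of optics and is checked on
  -- generators, where it becomes the corresponding hypothesis on `θ`.
  obtain ⟨F, hF, hF'⟩ := exists_presheaf_equivalence
    (fun k : EM (MHN V C M N) => U k.as.2 k.as.1.unop) (fun P => (A P).toLeftAct.act)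
    (fun P => (A P).toLeftAct.act_id) (fun P => (A P).toLeftAct.act_comp)
    (fun P Q X f g h => hom_ext P Q X f g fun n m => h ⟨(op m, n)⟩)
    (fun P Q a b => ((A P).actW_hom_iff (A Q) (fun n m => uev (U n m) P Q) _ _ _ _).2
      fun x => θ_ev P Q x _ _ _ _)
    (fun P Q X φ h => by
      obtain ⟨f, hf⟩ := lift P Q X (fun n m => φ ⟨(op m, n)⟩) fun x n n' m' m =>
        ((A P).actW_hom_iff (A Q) (fun n m => φ ⟨(op m, n)⟩) _ _ _ _).1
          (h ⟨(op m, n)⟩ ⟨(op m', n')⟩) x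
      exact ⟨f, fun k => hf k.as.2 k.as.1.unop⟩)
    (fun Q => by
      obtain ⟨P, e, he⟩ := ess Q.toOpticAct
      exact ⟨P, fun k => e k.as.2 k.as.1.unop, fun a b => (A P).actW_iso Q e he _ _ _ _⟩)
  exact ⟨F, hF, fun m n => hF' ⟨(op m, n)⟩⟩

end OpticAct

/-! ### The associativity law of an optic action with one hom-object specialised to an element. -/

section Two
variable {V : Type w} [Category.{u} V] [MonoidalCategory V]
variable {K K' K'' P P' P'' R R' R'' : V} {b : (K ⊗ P') ⊗ R ⟶ P''} {b' : (K' ⊗ P) ⊗ R' ⟶ P'}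
  {b'' : (K'' ⊗ P) ⊗ R'' ⟶ P''} {cK : K ⊗ K' ⟶ K''} {cR : R' ⊗ R ⟶ R''}

/-- In these four lemmas `b` is the outer and `b'` the inner operation, and `h` is associativity. An
element is inserted in one hom-object of the outer or of the inner operation; the suffix records the
side that stays free, so that what remains is a one-sided action composed with a full operation. -/
lemma two_outer_left (h : (K ◁ b') ▷ R ≫ b = (α_ _ _ _).inv ▷ _ ≫ (α_ _ _ _).inv ▷ _ ▷ _ ≫
      (α_ _ _ _).hom ≫ (cK ▷ P ⊗ₘ cR) ≫ b'') (i : 𝟙_ V ⟶ R) :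
    K ◁ b' ≫ (ρ_ _).inv ≫ _ ◁ i ≫ b =
      (α_ _ _ _).inv ≫ (α_ _ _ _).inv ▷ _ ≫ (cK ▷ P ⊗ₘ ((ρ_ _).inv ≫ R' ◁ i ≫ cR)) ≫ b'' := by
  rw [rightUnitor_inv_naturality_assoc, ← MonoidalCategory.whisker_exchange_assoc, h,
    MonoidalCategory.tensorHom_def', MonoidalCategory.tensorHom_def']
  simp only [MonoidalCategory.whiskerLeft_comp, Category.assoc]
  monoidal

lemma two_outer_right (h : (K ◁ b') ▷ R ≫ b = (α_ _ _ _).inv ▷ _ ≫ (α_ _ _ _).inv ▷ _ ▷ _ ≫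
      (α_ _ _ _).hom ≫ (cK ▷ P ⊗ₘ cR) ≫ b'') (i : 𝟙_ V ⟶ K) :
    b' ▷ R ≫ ((λ_ _).inv ≫ i ▷ _) ▷ R ≫ b =
      (α_ _ _ _).hom ≫ (((λ_ _).inv ≫ i ▷ _ ≫ cK) ▷ P ⊗ₘ cR) ≫ b'' := by
  rw [← comp_whiskerRight_assoc, leftUnitor_inv_naturality_assoc,
    MonoidalCategory.whisker_exchange, comp_whiskerRight_assoc, comp_whiskerRight_assoc, h,
    MonoidalCategory.tensorHom_def, MonoidalCategory.tensorHom_def]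
  simp only [comp_whiskerRight, Category.assoc]
  monoidal

lemma two_inner_left (h : (K ◁ b') ▷ R ≫ b = (α_ _ _ _).inv ▷ _ ≫ (α_ _ _ _).inv ▷ _ ▷ _ ≫
      (α_ _ _ _).hom ≫ (cK ▷ P ⊗ₘ cR) ≫ b'') (i : 𝟙_ V ⟶ R') :
    (K ◁ ((ρ_ _).inv ≫ _ ◁ i ≫ b')) ▷ R ≫ b =
      (α_ _ _ _).inv ▷ R ≫ (cK ▷ P ⊗ₘ ((λ_ _).inv ≫ i ▷ R ≫ cR)) ≫ b'' := by
  simp only [MonoidalCategory.whiskerLeft_comp, comp_whiskerRight, Category.assoc]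
  rw [h, MonoidalCategory.tensorHom_def', MonoidalCategory.tensorHom_def']
  simp only [MonoidalCategory.whiskerLeft_comp, Category.assoc]
  monoidal

lemma two_inner_right (h : (K ◁ b') ▷ R ≫ b = (α_ _ _ _).inv ▷ _ ≫ (α_ _ _ _).inv ▷ _ ▷ _ ≫
      (α_ _ _ _).hom ≫ (cK ▷ P ⊗ₘ cR) ≫ b'') (i : 𝟙_ V ⟶ K') :
    (K ◁ (((λ_ _).inv ≫ i ▷ _) ▷ R' ≫ b')) ▷ R ≫ b =
      (α_ _ _ _).inv ▷ R ≫ (α_ _ _ _).hom ≫ (((ρ_ _).inv ≫ K ◁ i ≫ cK) ▷ P ⊗ₘ cR) ≫ b'' := by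
  simp only [MonoidalCategory.whiskerLeft_comp, comp_whiskerRight, Category.assoc]
  rw [h, MonoidalCategory.tensorHom_def, MonoidalCategory.tensorHom_def]
  simp only [comp_whiskerRight, Category.assoc]
  monoidal

end Two

/-! ### Unit laws for the compositions `gcomp` and `hcomp0`. -/

section Module
variable {V : Type w} [Category.{u} V] [MonoidalCategory V] [SymmetricCategory V]
variable {C M : Type u} [EnrichedCategory V C] [MonoidalVCat V C] [EnrichedCategory V M]
  [LeftModule V C M]

lemma id_post {m m' : M} (e : 𝟙_ V ⟶ (m ⟶[V] m')) : eId V m ≫ post m e = e := by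
  rw [← cmp_eq_post, id_cmp]

lemma id_pre {m m' : M} (e : 𝟙_ V ⟶ (m ⟶[V] m')) : eId V m' ≫ pre m' e = e := by
  rw [← cmp_eq_pre, cmp_id]

/-- When the first object of `C` is the unit object and the hom-object is entered through the unitor
of the module, the composition is that of `M`, up to the left unitor of `C`. It is `unit_hcomp` with
the braiding cancelled. -/
lemma one_hcomp0 (y : C) (m₁ m₂ m₃ : M) :
    _ ◁ pre m₁ (uM V C m₂).hom ≫ hcomp0 (V := V) (tone V C) y m₁ m₂ m₃ =
      eComp V _ _ _ ≫ pre _ ((MonoidalVCat.lunit y).hom ≫ br (actF V C M) m₃ _ _) := by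
  rw [← cancel_epi (β_ _ _).hom, ← unit_hcomp, hcomp_eq, braiding_naturality_left_assoc]

lemma one_hcomp0_id (y : C) (m m₃ : M) :
    (ρ_ _).inv ≫ _ ◁ (uM V C m).hom ≫ hcomp0 (V := V) (tone V C) y m m m₃ =
      pre _ ((MonoidalVCat.lunit y).hom ≫ br (actF V C M) m₃ _ _) := by
  rw [← id_pre (uM V C m).hom, MonoidalCategory.whiskerLeft_comp_assoc, one_hcomp0,
    reassoc_of% e_comp_id]

lemma one_gcomp_id (y : C) (m m₃ : M) :
    (λ_ _).inv ≫ (uM V C m).inv ▷ _ ≫ gcomp (V := V) (tone V C) y m m m₃ ≫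
      post _ ((MonoidalVCat.lunit y).hom ≫ br (actF V C M) m₃ _ _) = 𝟙 _ := by
  rw [← id_post (uM V C m).inv, comp_whiskerRight_assoc, unit_gcomp, e_id_comp]

/-- With the unit object as second factor, what is left is the action of `x` on an arrow followed by
composition. The triangle identity `triM` matches the unitor of the module with the right unitor of
`C`. -/
lemma gcomp_one (x : C) (m₁ m₂ m₃ : M) :
    _ ◁ post m₂ (uM V C m₃).inv ≫ gcomp (V := V) x (tone V C) m₁ m₂ m₃ ≫
        post _ ((MonoidalVCat.runit x).hom ≫ br (actF V C M) m₃ _ _) =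
      _ ◁ bl (actF V C M) x _ _ ≫ eComp V _ _ _ := by
  have k : cmp ((uM V C m₃).inv ≫ bl (actF V C M) x m₃ (sm V (tone V C) m₃))
    ((uM V C m₃).hom ≫ bl (actF V C M) x _ _) = eId V _ := by
      rw [← cmp_bl, VIso.inv_hom, bl_id]
  rw [gcomp, Category.assoc, Category.assoc, ← MonoidalCategory.whiskerLeft_comp_assoc, post_bl,
    MonoidalCategory.whiskerLeft_comp_assoc, ← reassoc_of% comp_post, post_post, ← triM, post_post,
    ← cmp_assoc (aM V x (tone V C) m₃).inv, VIso.inv_hom, id_cmp, k, post_id, Category.comp_id]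

lemma hcomp0_one (x : C) (m₁ m₂ m₃ : M) :
    pre m₂ (uM V C m₃).hom ▷ _ ≫ hcomp0 (V := V) x (tone V C) m₁ m₂ m₃ =
      bl (actF V C M) x _ _ ▷ _ ≫ eComp V _ _ _ ≫
        pre _ ((MonoidalVCat.runit x).hom ≫ br (actF V C M) m₃ _ _) := by
  rw [hcomp0, ← comp_whiskerRight_assoc, pre_bl, comp_whiskerRight_assoc, ← reassoc_of% comp_pre,
    pre_pre, triM]

lemma hcomp0_one_id (x : C) (m₁ m : M) :
    (λ_ _).inv ≫ (uM V C m).hom ▷ _ ≫ hcomp0 (V := V) x (tone V C) m₁ m m =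
      pre _ ((MonoidalVCat.runit x).hom ≫ br (actF V C M) m _ _) := by
  rw [← id_pre (uM V C m).hom, comp_whiskerRight_assoc, hcomp0_one, ← comp_whiskerRight_assoc,
    bl_id, reassoc_of% e_id_comp]

end Module

/-! ### The profunctor underlying an optic action. -/

section OpticAct
variable {V : Type w} [Category.{u} V] [MonoidalCategory V] [SymmetricCategory V]
  [MonoidalClosed V] [HasLimits V] [HasColimits V]
variable {C M N : Type u} [EnrichedCategory V C] [MonoidalVCat V C] [EnrichedCategory V M]
  [LeftModule V C M] [EnrichedCategory V N] [LeftModule V C N]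

namespace OpticAct
variable (P : OpticAct V C M N)

/-- Dinaturality along a single arrow of `C`: it may be moved from the hom-object of `N` to that of
`M`. It is used for the unitors of `C`, to identify the summand of `I ⊠ x` or `x ⊠ I` with that of
`x`. -/
lemma dinat_el {x x' : C} (e : 𝟙_ V ⟶ (x ⟶[V] x')) (n n' : N) (m' m : M) :
    post n (e ≫ br (actF V C N) n' x x') ▷ _ ▷ _ ≫ P.θ x' n n' m' m =
      _ ◁ pre m (e ≫ br (actF V C M) m' x x') ≫ P.θ x n n' m' m := by
  have k {G P F H : V} (i : 𝟙_ V ⟶ H) : (ρ_ G).inv ▷ P ▷ F ≫ (G ◁ i) ▷ P ▷ F ≫ rs _ _ _ ▷ F ≫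
      (α_ _ _ _).hom = (G ⊗ P) ◁ (λ_ _).inv ≫ (G ⊗ P) ◁ i ▷ F := by
    rw [← comp_whiskerRight_assoc ((G ◁ i) ▷ P), rs_nat_mid]
    simp only [rs, braiding_tensorUnit_left]
    monoidal
  rw [← gact_el, ← hact_el]
  simp only [comp_whiskerRight, Category.assoc, MonoidalCategory.whiskerLeft_comp, P.dinat]
  rw [reassoc_of% k e]

/-- The left action of the hom-objects of `N`. -/
def lact (n n' : N) (m : M) : (n ⟶[V] n') ⊗ P.obj n' m ⟶ P.obj n m :=
  (ρ_ _).inv ≫ _ ◁ (uM V C m).hom ≫ post n (uM V C n').inv ▷ _ ▷ _ ≫ P.θ (tone V C) n n' m m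

/-- The right action of the hom-objects of `M`. -/
def ract (n : N) (m m' : M) : P.obj n m ⊗ (m ⟶[V] m') ⟶ P.obj n m' :=
  ((λ_ _).inv ≫ (uM V C n).inv ▷ _) ▷ _ ≫ _ ◁ pre m' (uM V C m).hom ≫ P.θ (tone V C) n n m m'

/-- The left action is `θ` at the unit object, so this is associativity with `I` as the outer
object. On the side of `M` only the left unitor of `C` remains; dinaturality moves it to the side of
`N`, where the unit law of `gcomp` leaves ordinary composition. -/
lemma θ_lact (x : C) (n₀ n n' : N) (m' m : M) :
    (n₀ ⟶[V] n) ◁ P.θ x n n' m' m ≫ P.lact n₀ n m =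
      (α_ _ _ _).inv ≫ (α_ _ _ _).inv ▷ _ ≫ eComp V _ _ _ ▷ _ ▷ _ ≫ P.θ x n₀ n' m' m := by
  have h : ((n₀ ⟶[V] n) ◁ P.θ x n n' m' m) ▷ _ ≫
      post n₀ (uM V C n).inv ▷ _ ▷ _ ≫ P.θ (tone V C) n₀ n m m =
      (α_ _ _ _).inv ▷ _ ≫ (α_ _ _ _).inv ▷ _ ▷ _ ≫ (α_ _ _ _).hom ≫
        ((post n₀ (uM V C n).inv ▷ _ ≫ gcomp (tone V C) x n₀ n n') ▷ _ ⊗ₘ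
          hcomp0 (tone V C) x m m m') ≫ P.θ (tmul V (tone V C) x) n₀ n' m' m := by
    rw [← comp_whiskerRight_assoc, MonoidalCategory.whisker_exchange, comp_whiskerRight_assoc,
      P.assoc, MonoidalCategory.tensorHom_def, MonoidalCategory.tensorHom_def]
    simp only [comp_whiskerRight, Category.assoc]
    monoidal
  rw [lact, two_outer_left h, one_hcomp0_id, MonoidalCategory.tensorHom_def, Category.assoc,
    ← dinat_el]
  have u := congrArg (fun t => t ▷ P.obj n' m' ▷ (sm V x m' ⟶[V] m))
    (unit_gcomp (V := V) (C := C) x n₀ n n')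
  simp only [comp_whiskerRight] at u
  simp only [comp_whiskerRight, Category.assoc]
  rw [reassoc_of% u]

/-- The mirror case, with the outer arrow on the side of `M`: composition appears there, and the
left unitor of `C` is moved to the side of `N` and disappears. -/
lemma θ_ract (x : C) (n n' : N) (m' m m₁ : M) :
    P.θ x n n' m' m ▷ _ ≫ P.ract n m m₁ =
      (α_ _ _ _).hom ≫ _ ◁ eComp V _ _ _ ≫ P.θ x n n' m' m₁ := by
  have h : ((n ⟶[V] sm V (tone V C) n) ◁ P.θ x n n' m' m) ▷ _ ≫
      _ ◁ pre m₁ (uM V C m).hom ≫ P.θ (tone V C) n n m m₁ =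
      (α_ _ _ _).inv ▷ _ ≫ (α_ _ _ _).inv ▷ _ ▷ _ ≫ (α_ _ _ _).hom ≫
        (gcomp (tone V C) x n n n' ▷ _ ⊗ₘ (_ ◁ pre m₁ (uM V C m).hom ≫
          hcomp0 (tone V C) x m₁ m m')) ≫ P.θ (tmul V (tone V C) x) n n' m' m₁ := by
    rw [← MonoidalCategory.whisker_exchange_assoc,
      P.assoc, MonoidalCategory.tensorHom_def', MonoidalCategory.tensorHom_def']
    simp only [MonoidalCategory.whiskerLeft_comp, Category.assoc]
    monoidal
  rw [ract, two_outer_right h, one_hcomp0, MonoidalCategory.tensorHom_def,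
    MonoidalCategory.whiskerLeft_comp, Category.assoc, Category.assoc, ← dinat_el,
    MonoidalCategory.whisker_exchange_assoc, ← comp_whiskerRight_assoc, ← comp_whiskerRight,
    Category.assoc, Category.assoc, one_gcomp_id]
  simp

/-- Now the unit object is the inner one, and dinaturality is applied to the right unitor of `C`.
The arrow of `N` is acted on by `x` before it is composed. These identities are what lets `θ`
descend to the coend over `N`. -/
lemma lact_θ (x : C) (n n' n'' : N) (m' m : M) :
    (_ ◁ P.lact n' n'' m') ▷ _ ≫ P.θ x n n' m' m =
      (α_ _ _ _).inv ▷ _ ≫ (_ ◁ bl (actF V C N) x _ _ ≫ eComp V _ _ _) ▷ _ ▷ _ ≫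
        P.θ x n n'' m' m := by
  have h : (_ ◁ (post n' (uM V C n'').inv ▷ _ ▷ _ ≫ P.θ (tone V C) n' n'' m' m')) ▷ _ ≫
      P.θ x n n' m' m = 
      (α_ _ _ _).inv ▷ _ ≫ (α_ _ _ _).inv ▷ _ ▷ _ ≫ (α_ _ _ _).hom ≫
        ((_ ◁ post n' (uM V C n'').inv ≫ gcomp x (tone V C) n n' n'') ▷ _ ⊗ₘ
          hcomp0 x (tone V C) m m' m') ≫ P.θ (tmul V x (tone V C)) n n'' m' m := by
    rw [MonoidalCategory.whiskerLeft_comp, comp_whiskerRight_assoc, P.assoc,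
      MonoidalCategory.tensorHom_def, MonoidalCategory.tensorHom_def]
    simp only [comp_whiskerRight, Category.assoc]
    monoidal
  rw [lact, two_inner_left h, hcomp0_one_id, MonoidalCategory.tensorHom_def, Category.assoc,
    ← dinat_el]
  have u := congrArg (fun t => t ▷ P.obj n'' m' ▷ (sm V x m' ⟶[V] m))
    (gcomp_one (V := V) (C := C) x n n' n'')
  simp only [comp_whiskerRight] at u
  simp only [comp_whiskerRight, Category.assoc]
  rw [reassoc_of% u]

/-- The mirror case for an arrow of `M` acting inside. It gives the balancing of `θ` over the
variable in `M`. -/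
lemma ract_θ (x : C) (n n' : N) (m'' m' m : M) :
    (_ ◁ P.ract n' m'' m') ▷ _ ≫ P.θ x n n' m' m =
      (α_ _ _ _).inv ▷ _ ≫ (α_ _ _ _).hom ≫ _ ◁ (bl (actF V C M) x _ _ ▷ _ ≫ eComp V _ _ _) ≫
        P.θ x n n' m'' m := by
  have h : (_ ◁ (_ ◁ pre m' (uM V C m'').hom ≫ P.θ (tone V C) n' n' m'' m')) ▷ _ ≫
      P.θ x n n' m' m = 
      (α_ _ _ _).inv ▷ _ ≫ (α_ _ _ _).inv ▷ _ ▷ _ ≫ (α_ _ _ _).hom ≫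
        (gcomp x (tone V C) n n' n' ▷ _ ⊗ₘ (pre m' (uM V C m'').hom ▷ _ ≫
          hcomp0 x (tone V C) m m' m'')) ≫ P.θ (tmul V x (tone V C)) n n' m'' m := by
    rw [MonoidalCategory.whiskerLeft_comp, comp_whiskerRight_assoc, P.assoc,
      MonoidalCategory.tensorHom_def', MonoidalCategory.tensorHom_def']
    simp only [MonoidalCategory.whiskerLeft_comp, Category.assoc]
    monoidal
  rw [ract, two_inner_right h, hcomp0_one, MonoidalCategory.tensorHom_def, Category.assoc,
    ← Category.assoc _ _ (pre _ _), MonoidalCategory.whiskerLeft_comp, Category.assoc,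
    ← dinat_el, MonoidalCategory.whisker_exchange_assoc, ← comp_whiskerRight_assoc,
    ← comp_whiskerRight, Category.assoc, Category.assoc, gcomp_unit]
  simp

/-- The underlying profunctor of an optic action. -/
def toProf : Prof V M N where
  obj := P.obj
  lact := P.lact
  ract := P.ract
  lact_id n m := by
    rw [lact, ← P.unit n m, MonoidalCategory.whisker_exchange_assoc,
      rightUnitor_inv_naturality_assoc, ← comp_whiskerRight_assoc, ← comp_whiskerRight, id_post,
      ← rightUnitor_inv_naturality_assoc]
  ract_id n m := by
    rw [ract, ← P.unit n m, MonoidalCategory.whisker_exchange_assoc,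
      ← MonoidalCategory.whiskerLeft_comp_assoc, id_pre, ← rightUnitor_inv_naturality_assoc,
      Category.assoc]
  lact_comp n n' n'' m := by
    -- The inner action is itself a component of `θ`, so the outer one is absorbed by `θ_lact` as a
    -- composition in `N`. The right action is treated in the same way with `θ_ract`.
    rw [lact.eq_1 P n' n'' m]
    simp only [MonoidalCategory.whiskerLeft_comp, Category.assoc]
    rw [θ_lact, lact, rightUnitor_inv_naturality_assoc, ← MonoidalCategory.whisker_exchange_assoc,
      ← comp_whiskerRight_assoc (eComp V n n' n'' ▷ _), ← comp_whiskerRight, comp_post]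
    simp only [comp_whiskerRight]
    monoidal
  ract_comp n m m' m'' := by
    rw [ract.eq_1 P n m m', comp_whiskerRight_assoc, comp_whiskerRight_assoc, θ_ract,
      associator_naturality_middle_assoc, ← MonoidalCategory.whiskerLeft_comp_assoc, ← comp_pre,
      ract]
    simp only [MonoidalCategory.whiskerLeft_comp, Category.assoc]
    rw [associator_naturality_left_assoc, MonoidalCategory.whisker_exchange_assoc]
  comm n n' m m' := by
    -- Both orders of acting give `θ` at the unit object with an arrow of `N` on the left and one of
    -- `M` on the right, by `θ_ract` and `θ_lact` respectively.
    have h : (ρ_ _).inv ▷ _ ≫ (_ ◁ (uM V C m).hom) ▷ _ ≫ (α_ _ _ _).hom ≫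
        ((n ⟶[V] n') ⊗ P.obj n' m) ◁ eComp V _ m m' = _ ◁ pre m' (uM V C m).hom := by
      rw [pre]
      monoidal
    rw [lact.eq_1 P n n' m, ract.eq_1 P n' m m', comp_whiskerRight_assoc, comp_whiskerRight_assoc,
      comp_whiskerRight_assoc, θ_ract, associator_naturality_left_assoc,
      ← MonoidalCategory.whisker_exchange_assoc, reassoc_of% h,
      ← MonoidalCategory.whisker_exchange_assoc, MonoidalCategory.whiskerLeft_comp_assoc,
      MonoidalCategory.whiskerLeft_comp_assoc, θ_lact, post]
    monoidal

end OpticAct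
end OpticAct

/-! ### Rewriting with elements inserted in tensor products. -/

section Unit
variable {V : Type w} [Category.{u} V] [MonoidalCategory V]

/-- If `p` is given on a summand by `t`, then restricting the parameters of `p` along `i` replaces
`t` by its restriction `e`. It serves for composites of functors on profunctors, where the outer
functor is known on summands. -/
lemma whiskerRight_app_aux {A A₁ A₂ B B' H X : V} (ι : A ⊗ A₁ ⟶ B) (ι' : A ⊗ A₂ ⟶ B') (i : X ⟶ H)
    (p : B ⊗ H ⟶ B') (t : A₁ ⊗ H ⟶ A₂) (e : A₁ ⊗ X ⟶ A₂)
    (h₁ : ι ▷ H ≫ p = (α_ _ _ _).hom ≫ A ◁ t ≫ ι') (h₂ : A₁ ◁ i ≫ t = e) :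
    ι ▷ X ≫ B ◁ i ≫ p = (α_ _ _ _).hom ≫ A ◁ e ≫ ι' := by
  rw [← MonoidalCategory.whisker_exchange_assoc, h₁, associator_naturality_right_assoc,
    ← MonoidalCategory.whiskerLeft_comp_assoc, h₂]

variable [SymmetricCategory V]

lemma unit_tensorμ_right {X Y Z E X' Y' : V} (e : 𝟙_ V ⟶ E) (f : X ⊗ Z ⟶ X') (g : Y ⊗ E ⟶ Y') :
    (X ⊗ Y) ◁ ((ρ_ Z).inv ≫ Z ◁ e) ≫ tensorμ _ _ _ _ ≫ (f ⊗ₘ g) =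
      rs _ _ _ ≫ (f ⊗ₘ ((ρ_ Y).inv ≫ Y ◁ e ≫ g)) := by
  have h : (X ⊗ Y) ◁ (ρ_ Z).inv ≫ tensorμ X Y Z (𝟙_ V) = rs _ _ _ ≫ _ ◁ (ρ_ Y).inv := by
    simp only [tensorμ, rs]
    monoidal
  rw [MonoidalCategory.whiskerLeft_comp_assoc, ← id_tensorHom Z e, tensorμ_natural_right_assoc,
    reassoc_of% h, ← id_tensorHom]
  simp only [tensorHom_comp_tensorHom, MonoidalCategory.whiskerLeft_id, Category.id_comp]

lemma unit_tensorμ_left {Y Z T E X' Y' : V} (e : 𝟙_ V ⟶ E) (f : E ⊗ Z ⟶ X') (g : Y ⊗ T ⟶ Y') :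
    ((λ_ Y).inv ≫ e ▷ Y) ▷ (Z ⊗ T) ≫ tensorμ _ _ _ _ ≫ (f ⊗ₘ g) =
      (α_ _ _ _).inv ≫ (β_ _ _).hom ▷ _ ≫ (α_ _ _ _).hom ≫
        (((λ_ Z).inv ≫ e ▷ Z ≫ f) ⊗ₘ g) := by
  have h : (λ_ Y).inv ▷ (Z ⊗ T) ≫ tensorμ (𝟙_ V) Y Z T =
      (α_ _ _ _).inv ≫ (β_ _ _).hom ▷ _ ≫ (α_ _ _ _).hom ≫ (λ_ Z).inv ▷ _ := by
    simp only [tensorμ]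
    monoidal
  rw [comp_whiskerRight_assoc, ← tensorHom_id e Y, tensorμ_natural_left_assoc,
    reassoc_of% h, ← tensorHom_id (λ_ Z).inv]
  simp only [tensorHom_comp_tensorHom, id_whiskerRight, Category.id_comp]

end Unit

/-! ### The composite `⊡_* • (Id_C ⊗ P)` as a coend over the objects of `N` alone. -/

section Post
variable {V : Type w} [Category.{u} V] [MonoidalCategory V] [SymmetricCategory V]
  [MonoidalClosed V] [HasLimits V] [HasColimits V]
variable {C M N : Type u} [EnrichedCategory V C] [MonoidalVCat V C] [EnrichedCategory V M]
  [LeftModule V C M] [EnrichedCategory V N] [LeftModule V C N]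

variable (V C N) in
/-- The right action of the hom-objects of `C ⊗ N` on the profunctor represented by the action. -/
def ractN (n : N) (x x' : C) (n' n'' : N) :
    (n ⟶[V] sm V x n') ⊗ ((x ⟶[V] x') ⊗ (n' ⟶[V] n'')) ⟶ (n ⟶[V] sm V x' n'') :=
  _ ◁ (actF V C N).map (x, n') (x', n'') ≫ eComp V _ _ _

lemma ractN_comp (n : N) (x x' x'' : C) (n₁ n₂ n₃ : N) :
    ractN V C N n x x' n₁ n₂ ▷ _ ≫ ractN V C N n x' x'' n₂ n₃ =
      (α_ _ _ _).hom ≫ _ ◁ (tensorμ _ _ _ _ ≫ (eComp V x x' x'' ⊗ₘ eComp V n₁ n₂ n₃)) ≫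
        ractN V C N n x x'' n₁ n₃ :=
  (Prof.companion (actF V C N)).ract_comp n (x, n₁) (x', n₂) (x'', n₃)

lemma ractN_eq_gact (n : N) (x x' : C) (n' : N) :
    _ ◁ ((ρ_ _).inv ≫ _ ◁ eId V n') ≫ ractN V C N n x x' n' n' = gact n n' x x' := by
  rw [ractN, gact, br, ← MonoidalCategory.whiskerLeft_comp_assoc, Category.assoc]

/-- The joint action of an arrow of `C` and one of `N` factors through the two one-variable actions,
by bifunctoriality. -/
lemma gact_bl (n : N) (x x' : C) (n' n'' : N) :
    gact n n' x x' ▷ _ ≫ _ ◁ bl (actF V C N) x' n' n'' ≫ eComp V _ _ _ =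
      (α_ _ _ _).hom ≫ ractN V C N n x x' n' n'' := by
  rw [ractN, gact, ← br_bl, MonoidalCategory.whiskerLeft_comp_assoc, ← e_assoc,
    comp_whiskerRight_assoc, ← MonoidalCategory.whisker_exchange_assoc,
    MonoidalCategory.tensorHom_def]
  monoidal

/-- Reorders a joint action followed by one of `C`: the two arrows of `C` are composed and applied
first, and the arrow of `N` last. This separates the balancing in `C` from the balancing in `N`. -/
lemma ractN_gact (n : N) (x x' x'' : C) (n' n'' : N) :
    ractN V C N n x x' n' n'' ▷ _ ≫ gact n n'' x' x'' =
      (α_ _ _ _).hom ≫ _ ◁ rs _ _ _ ≫ (α_ _ _ _).inv ≫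
        (_ ◁ eComp V x x' x'' ≫ gact n n' x x'') ▷ _ ≫
          _ ◁ bl (actF V C N) x'' n' n'' ≫ eComp V _ _ _ := by
  rw [← ractN_eq_gact, ← MonoidalCategory.whisker_exchange_assoc, ractN_comp,
    comp_whiskerRight_assoc,
    gact_bl, associator_naturality_right_assoc, ← MonoidalCategory.whiskerLeft_comp_assoc,
    unit_tensorμ_right, e_comp_id, tensorHom_id]
  monoidal

variable (P : Prof V M N)

/-- The object `(⊡_* • (Id_C ⊗ P))(n, (x, m))`. -/
def postObj (n : N) (x : C) (m : M) : V :=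
  Prof.compObj (Prof.companion (actF V C N)) ((Prof.id C).tensor P) n (x, m)

/-- The coprojection. -/
def postCompι (n : N) (x : C) (n' : N) (y : C) (m : M) :
    (n ⟶[V] sm V x n') ⊗ ((x ⟶[V] y) ⊗ P.obj n' m) ⟶ postObj P n y m :=
  Prof.compι (Prof.companion (actF V C N)) ((Prof.id C).tensor P) n (x, n') (y, m)

lemma postCompι_w (n : N) (x x' : C) (n' n'' : N) (y : C) (m : M) :
    ractN V C N n x x' n' n'' ▷ _ ≫ postCompι P n x' n'' y m =
      (α_ _ _ _).hom ≫ _ ◁ (tensorμ _ _ _ _ ≫ (eComp V x x' y ⊗ₘ P.lact n' n'' m)) ≫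
        postCompι P n x n' y m :=
  Prof.compι_w (Prof.companion (actF V C N)) ((Prof.id C).tensor P) n (x, n') (x', n'') (y, m)

/-- The map `N(n, x n') ⊗ P(n', m) ⟶ (⊡_* • (Id_C ⊗ P))(n, (x, m))`. -/
def postι (x : C) (n n' : N) (m : M) : (n ⟶[V] sm V x n') ⊗ P.obj n' m ⟶ postObj P n x m :=
  actPostι P x n n' m

lemma postι_eq (x : C) (n n' : N) (m : M) :
    postι P x n n' m = _ ◁ ((λ_ _).inv ≫ eId V x ▷ _) ≫ postCompι P n x n' x m := rfl

/-- The co-Yoneda lemma in the variable of `C`: an element of the summand at `x` equals its image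
under the arrow `x ⟶ y`, paired with the identity of `y`. The summands `postι` with the identity
inserted therefore generate. -/
lemma postCompι_eq (n : N) (x : C) (n' : N) (y : C) (m : M) :
    postCompι P n x n' y m = (α_ _ _ _).inv ≫ gact n n' x y ▷ _ ≫ postι P y n n' m := by
  have h := unit_mid₁ (eId V n') (eId V y) (eComp V x y y) (P.lact n' n' m)
  rw [e_comp_id, P.lact_id, id_tensorHom_id] at h
  rw [postι_eq, ← ractN_eq_gact, comp_whiskerRight_assoc,
    ← MonoidalCategory.whisker_exchange_assoc, postCompι_w]
  have k : (α_ _ _ _).inv ≫ ((n ⟶[V] sm V x n') ◁ ((ρ_ (x ⟶[V] y)).inv ≫ _ ◁ eId V n')) ▷ _ ≫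
      _ ◁ ((λ_ (P.obj n' m)).inv ≫ eId V y ▷ _) ≫ (α_ _ _ _).hom =
      _ ◁ (((ρ_ (x ⟶[V] y)).inv ≫ _ ◁ eId V n') ⊗ₘ ((λ_ (P.obj n' m)).inv ≫ eId V y ▷ _)) := by
    rw [MonoidalCategory.tensorHom_def]
    monoidal
  rw [reassoc_of% k, ← MonoidalCategory.whiskerLeft_comp_assoc, h,
    MonoidalCategory.whiskerLeft_id, Category.id_comp]

variable {P}

lemma postObj_ext {n : N} {x : C} {m : M} {X : V} {f g : postObj P n x m ⟶ X}
    (h : ∀ n', postι P x n n' m ≫ f = postι P x n n' m ≫ g) : f = g :=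
  Prof.comp_ext fun p => by
    have k : postCompι P n p.1 p.2 x m ≫ f = postCompι P n p.1 p.2 x m ≫ g := by
      rw [postCompι_eq, Category.assoc, Category.assoc, h, Category.assoc, Category.assoc]
    exact k

lemma postObj_ext_left {n : N} {x : C} {m : M} {K X : V} {f g : K ⊗ postObj P n x m ⟶ X}
    (h : ∀ n', _ ◁ postι P x n n' m ≫ f = _ ◁ postι P x n n' m ≫ g) : f = g := by
  apply curry_injective
  refine postObj_ext fun n' => ?_
  rw [← curry_natural_left, ← curry_natural_left, h]

lemma postObj_ext_right {n : N} {x : C} {m : M} {K X : V} {f g : postObj P n x m ⊗ K ⟶ X}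
    (h : ∀ n', postι P x n n' m ▷ _ ≫ f = postι P x n n' m ▷ _ ≫ g) : f = g := by
  rw [← cancel_epi (β_ K _).hom]
  refine postObj_ext_left fun n' => ?_
  rw [braiding_naturality_right_assoc, braiding_naturality_right_assoc, h]

lemma postObj_ext_right2 {n : N} {x : C} {m : M} {K L X : V} {f g : (postObj P n x m ⊗ K) ⊗ L ⟶ X}
    (h : ∀ n', postι P x n n' m ▷ _ ▷ _ ≫ f = postι P x n n' m ▷ _ ▷ _ ≫ g) : f = g := by
  rw [← cancel_epi (α_ _ _ _).inv]
  refine postObj_ext_right fun n' => ?_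
  rw [associator_inv_naturality_left_assoc, associator_inv_naturality_left_assoc, h]

/-- The universal property of `(⊡_* • (Id_C ⊗ P))(n, (x, m))`. -/
def postDesc {n : N} {x : C} {m : M} {X : V} (f : ∀ n', (n ⟶[V] sm V x n') ⊗ P.obj n' m ⟶ X)
    (h : ∀ n' n'', (_ ◁ bl (actF V C N) x n' n'' ≫ eComp V _ _ _) ▷ _ ≫ f n'' =
      (α_ _ _ _).hom ≫ _ ◁ P.lact n' n'' m ≫ f n') : postObj P n x m ⟶ X :=
  Prof.compDesc (G := Prof.companion (actF V C N)) (F := (Prof.id C).tensor P)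
    (fun p => (α_ _ _ _).inv ≫ gact n p.2 p.1 x ▷ _ ≫ f p.2) (fun p p' => by
      -- Balancing over `C ⊗ N`: after `ractN_gact` the part in `C` holds by construction, and the
      -- part in `N` is the hypothesis `h`.
      have k : ractN V C N n p.1 p'.1 p.2 p'.2 ▷ ((p'.1 ⟶[V] x) ⊗ P.obj p'.2 m) ≫
          (α_ _ _ _).inv ≫ gact n p'.2 p'.1 x ▷ _ ≫ f p'.2 =
        (α_ _ _ _).hom ≫ _ ◁ (tensorμ _ _ _ _ ≫ (eComp V p.1 p'.1 x ⊗ₘ P.lact p.2 p'.2 m)) ≫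
          (α_ _ _ _).inv ≫ gact n p.2 p.1 x ▷ _ ≫ f p.2 := by
        rw [associator_inv_naturality_left_assoc, ← comp_whiskerRight_assoc, ractN_gact,
          comp_whiskerRight_assoc, comp_whiskerRight_assoc, comp_whiskerRight_assoc,
          comp_whiskerRight_assoc, h, comp_whiskerRight, comp_whiskerRight_assoc,
          associator_naturality_left_assoc, ← MonoidalCategory.whisker_exchange_assoc,
          MonoidalCategory.tensorHom_def]
        simp only [tensorμ, rs]
        monoidal
      exact k)

lemma postι_desc {n : N} {x : C} {m : M} {X : V} (f : ∀ n', (n ⟶[V] sm V x n') ⊗ P.obj n' m ⟶ X)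
    (h) (n' : N) : postι P x n n' m ≫ postDesc f h = f n' := by
  have k : postCompι P n x n' x m ≫ postDesc f h = (α_ _ _ _).inv ≫ gact n n' x x ▷ _ ≫ f n' :=
    Prof.compι_desc _ _ _
  -- The extension to all summands acts by the arrow of `C`; on the generating summands this arrow
  -- is an identity and drops out.
  have e : (ρ_ _).inv ≫ _ ◁ eId V x ≫ gact n n' x x = 𝟙 _ := by
    rw [gact, ← MonoidalCategory.whiskerLeft_comp_assoc, br_id, e_comp_id]
  rw [postι_eq, Category.assoc, k]
  conv_rhs => rw [← Category.id_comp (f n'), ← id_whiskerRight, ← e]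
  monoidal

/-- The universal property of `(⊡_* • (Id_C ⊗ P))(n, (x, m)) ⊗ K`. -/
def postDescR {n : N} {x : C} {m : M} {K X : V}
    (f : ∀ n', ((n ⟶[V] sm V x n') ⊗ P.obj n' m) ⊗ K ⟶ X)
    (h : ∀ n' n'', (_ ◁ bl (actF V C N) x n' n'' ≫ eComp V _ _ _) ▷ _ ▷ _ ≫ f n'' =
      (α_ _ _ _).hom ▷ _ ≫ (_ ◁ P.lact n' n'' m) ▷ _ ≫ f n') : postObj P n x m ⊗ K ⟶ X :=
  (β_ _ _).hom ≫ uncurry (postDesc (fun n' => curry ((β_ _ _).hom ≫ f n')) (fun n' n'' => by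
    rw [← curry_natural_left, ← curry_natural_left, ← curry_natural_left]
    simp only [braiding_naturality_right_assoc, h]))

lemma postι_descR {n : N} {x : C} {m : M} {K X : V}
    (f : ∀ n', ((n ⟶[V] sm V x n') ⊗ P.obj n' m) ⊗ K ⟶ X) (h) (n' : N) :
    postι P x n n' m ▷ _ ≫ postDescR f h = f n' := by
  rw [postDescR, braiding_naturality_left_assoc, ← uncurry_natural_left, postι_desc,
    uncurry_curry, SymmetricCategory.symmetry_assoc]

variable (P)

/-- The left action of the hom-objects of `N`. -/
def postL (n n' : N) (x : C) (m : M) : (n ⟶[V] n') ⊗ postObj P n' x m ⟶ postObj P n x m :=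
  Prof.compL (Prof.companion (actF V C N)) ((Prof.id C).tensor P) n n' (x, m)

/-- The right action of the hom-objects of `C ⊗ M`. -/
def postR (n : N) (x x' : C) (m m' : M) :
    postObj P n x m ⊗ ((x ⟶[V] x') ⊗ (m ⟶[V] m')) ⟶ postObj P n x' m' :=
  Prof.compR (Prof.companion (actF V C N)) ((Prof.id C).tensor P) n (x, m) (x', m')

lemma postι_postL (n₀ n : N) (x : C) (n' : N) (m : M) :
    _ ◁ postι P x n n' m ≫ postL P n₀ n x m =
      (α_ _ _ _).inv ≫ eComp V _ _ _ ▷ _ ≫ postι P x n₀ n' m := by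
  have h : (n₀ ⟶[V] n) ◁ postCompι P n x n' x m ≫ postL P n₀ n x m =
      (α_ _ _ _).inv ≫ eComp V _ _ _ ▷ _ ≫ postCompι P n₀ x n' x m := Prof.compι_compL ..
  rw [postι_eq, postι_eq, MonoidalCategory.whiskerLeft_comp_assoc, h,
    associator_inv_naturality_right_assoc, MonoidalCategory.whisker_exchange_assoc]

/-- The arrow of `C` composes with the identity stored in the summand and, by `postCompι_eq`, is
then pushed onto the hom-object of `N`. The arrow of `M` acts on `P`. -/
lemma postι_postR (n : N) (x x' : C) (n' : N) (m m' : M) :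
    postι P x n n' m ▷ _ ≫ postR P n x x' m m' =
      (α_ _ _ _).hom ≫ _ ◁ ((α_ _ _ _).inv ≫ (β_ _ _).hom ▷ _ ≫ (α_ _ _ _).hom) ≫
        (α_ _ _ _).inv ≫ (gact n n' x x' ⊗ₘ P.ract n' m m') ≫ postι P x' n n' m' := by
  have h : postCompι P n x n' x m ▷ _ ≫ postR P n x x' m m' =
      (α_ _ _ _).hom ≫ _ ◁ (tensorμ _ _ _ _ ≫ (eComp V x x x' ⊗ₘ P.ract n' m m')) ≫
        postCompι P n x n' x' m' :=
    Prof.compι_compR (Prof.companion (actF V C N)) ((Prof.id C).tensor P) n (x, n') (x, m) (x', m')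
  have k : ((λ_ _).inv ≫ eId V x ▷ P.obj n' m) ▷ ((x ⟶[V] x') ⊗ (m ⟶[V] m')) ≫
      tensorμ _ _ _ _ ≫ (eComp V x x x' ⊗ₘ P.ract n' m m') =
      (α_ _ _ _).inv ≫ (β_ _ _).hom ▷ _ ≫ (α_ _ _ _).hom ≫ _ ◁ P.ract n' m m' := by
    rw [unit_tensorμ_left, e_id_comp, id_tensorHom]
  rw [postι_eq, comp_whiskerRight_assoc, h, associator_naturality_middle_assoc,
    ← MonoidalCategory.whiskerLeft_comp_assoc, k, postCompι_eq, MonoidalCategory.tensorHom_def']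
  simp only [MonoidalCategory.whiskerLeft_comp, Category.assoc]
  monoidal

lemma mapEv_idTensorF {A B : Type u} [EnrichedCategory V A] [EnrichedCategory V B]
    (P Q : Prof V A B) (q : C × B) (p : C × A) :
    mapEv (Prof.idTensorF C) P Q q p = Prof.idTensorApp C P Q q p :=
  Prof.lift_ev (P := (Prof.id C).tensor P) (Q := (Prof.id C).tensor Q) _
    (Prof.idTensorApp_lact P Q) (Prof.idTensorApp_ract P Q) q p

/-- The components of the `V`-functor `P ↦ ⊡_* • (Id_C ⊗ P)`. -/
def postMap (P Q : Prof V M N) (n : N) (x : C) (m : M) :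
    postObj P n x m ⊗ (P ⟶[V] Q) ⟶ postObj Q n x m :=
  mapEv (actPost V C M N) P Q n (x, m)

/-- Both functors making up `actPost` act on a summand only through the factor `P(n', m)`, so on
generators the action on maps is evaluation there. -/
lemma postι_postMap (P Q : Prof V M N) (x : C) (n n' : N) (m : M) :
    postι P x n n' m ▷ _ ≫ postMap P Q n x m =
      (α_ _ _ _).hom ≫ _ ◁ Prof.ev P Q n' m ≫ postι Q x n n' m := by
  have h : postMap P Q n x m = postObj P n x m ◁ (Prof.idTensorF C).map P Q ≫
      Prof.postApp (Prof.companion (actF V C N)) ((Prof.id C).tensor P) ((Prof.id C).tensor Q)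
        n (x, m) :=
    (mapEv_comp (Prof.idTensorF C) (Prof.postF (C × M) (Prof.companion (actF V C N))) P Q n
      (x, m)).trans (congrArg (_ ≫ ·) (mapEv_postF _ _ _ _ _))
  have h₃ : postCompι P n x n' x m ▷ _ ≫ postMap P Q n x m =
      (α_ _ _ _).hom ≫ _ ◁ ((α_ _ _ _).hom ≫ _ ◁ Prof.ev P Q n' m) ≫ postCompι Q n x n' x m := by
    rw [h]
    exact whiskerRight_app_aux (postCompι P n x n' x m) (postCompι Q n x n' x m)
      ((Prof.idTensorF C).map P Q) _
      (Prof.ev ((Prof.id C).tensor P) ((Prof.id C).tensor Q) (x, n') (x, m)) _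
      (Prof.compι_postApp (Prof.companion (actF V C N)) ((Prof.id C).tensor P)
        ((Prof.id C).tensor Q) n (x, n') (x, m)) (mapEv_idTensorF P Q (x, n') (x, m))
  have h₄ : ((λ_ _).inv ≫ eId V x ▷ P.obj n' m) ▷ (P ⟶[V] Q) ≫ (α_ _ _ _).hom ≫
      _ ◁ Prof.ev P Q n' m = Prof.ev P Q n' m ≫ (λ_ _).inv ≫ eId V x ▷ _ := by
    rw [leftUnitor_inv_naturality_assoc, MonoidalCategory.whisker_exchange]
    monoidal
  rw [postι_eq, comp_whiskerRight_assoc, h₃, postι_eq, associator_naturality_middle_assoc,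
    ← MonoidalCategory.whiskerLeft_comp_assoc, h₄, MonoidalCategory.whiskerLeft_comp_assoc]

end Post

section Unit
variable {V : Type w} [Category.{u} V] [MonoidalCategory V] [SymmetricCategory V]

lemma unit_rs {A F : V} (i : 𝟙_ V ⟶ F) (X : V) :
    (ρ_ A).inv ▷ X ≫ (A ◁ i) ▷ X ≫ rs A F X = (ρ_ _).inv ≫ (A ⊗ X) ◁ i := by
  rw [rs_nat_mid, ← Category.assoc]
  simp only [rs, braiding_tensorUnit_left]
  monoidal

end Unit

/-! ### Maps commuting with an optic action commute with the derived profunctor actions. -/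

namespace OpticAct
variable {V : Type w} [Category.{u} V] [MonoidalCategory V] [SymmetricCategory V]
  [MonoidalClosed V] [HasLimits V] [HasColimits V]
variable {C M N : Type u} [EnrichedCategory V C] [MonoidalVCat V C] [EnrichedCategory V M]
  [LeftModule V C M] [EnrichedCategory V N] [LeftModule V C N]
variable (P Q : OpticAct V C M N)

/-- By the unit law, `θ` at the unit object is a split epimorphism, and stays so after tensoring.
This is how the actions derived from `θ` are shown to coincide with those of a given profunctor. -/
lemma θ_left_ext {n : N} {m : M} {K X : V} {f g : K ⊗ P.obj n m ⟶ X}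
    (h : K ◁ P.θ (tone V C) n n m m ≫ f = K ◁ P.θ (tone V C) n n m m ≫ g) : f = g := by
  have e := congrArg (fun t => K ◁ t) (P.unit n m)
  simp only [MonoidalCategory.whiskerLeft_comp, MonoidalCategory.whiskerLeft_id] at e
  rw [← Category.id_comp f, ← Category.id_comp g, ← e]
  simp only [Category.assoc, h]

lemma θ_right_ext {n : N} {m : M} {K X : V} {f g : P.obj n m ⊗ K ⟶ X}
    (h : P.θ (tone V C) n n m m ▷ K ≫ f = P.θ (tone V C) n n m m ▷ K ≫ g) : f = g := by
  have e := congrArg (fun t => t ▷ K) (P.unit n m)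
  simp only [comp_whiskerRight, id_whiskerRight] at e
  rw [← Category.id_comp f, ← Category.id_comp g, ← e]
  simp only [Category.assoc, h]

variable {P Q}

/-- The left action is `θ` with unitors inserted, and the unitors do not involve the object on which
`φ` acts. -/
lemma lact_hom {X : V} {φ : ∀ n m, P.obj n m ⊗ X ⟶ Q.obj n m}
    (h : ∀ x n n' m' m, P.θ x n n' m' m ▷ X ≫ φ n m =
      rs _ _ _ ≫ (α_ _ _ _).hom ▷ _ ≫ (_ ◁ φ n' m') ▷ _ ≫ Q.θ x n n' m' m) (n n' : N) (m : M) :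
    P.lact n n' m ▷ X ≫ φ n m = (α_ _ _ _).hom ≫ _ ◁ φ n' m ≫ Q.lact n n' m := by
  simp only [lact, comp_whiskerRight, Category.assoc, h]
  have e : post n (uM V C n').inv ▷ P.obj n' m ▷ X ≫ (α_ _ _ _).hom ≫ _ ◁ φ n' m =
      (α_ _ _ _).hom ≫ _ ◁ φ n' m ≫ post n (uM V C n').inv ▷ _ := by
    rw [associator_naturality_left_assoc, ← MonoidalCategory.whisker_exchange]
  have e' := congrArg (fun t => t ▷ (sm V (tone V C) m ⟶[V] m)) e
  simp only [comp_whiskerRight] at e'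
  rw [reassoc_of% rs_nat_left, reassoc_of% unit_rs, reassoc_of% e',
    MonoidalCategory.whisker_exchange_assoc, MonoidalCategory.whisker_exchange_assoc,
    ← rightUnitor_inv_naturality_assoc, ← rightUnitor_inv_naturality_assoc]

lemma ract_hom {X : V} {φ : ∀ n m, P.obj n m ⊗ X ⟶ Q.obj n m}
    (h : ∀ x n n' m' m, P.θ x n n' m' m ▷ X ≫ φ n m =
      rs _ _ _ ≫ (α_ _ _ _).hom ▷ _ ≫ (_ ◁ φ n' m') ▷ _ ≫ Q.θ x n n' m' m) (n : N) (m m' : M) :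
    P.ract n m m' ▷ X ≫ φ n m' = rs _ _ _ ≫ φ n m ▷ _ ≫ Q.ract n m m' := by
  simp only [ract, comp_whiskerRight, Category.assoc, h]
  have k {G R : V} (i : 𝟙_ V ⟶ G) : (λ_ (P.obj n m)).inv ▷ R ▷ X ≫ i ▷ _ ▷ R ▷ X ≫ rs _ R X ≫
      (α_ _ _ _).hom ▷ R ≫ (G ◁ φ n m) ▷ R =
      rs _ _ _ ≫ φ n m ▷ R ≫ (λ_ _).inv ▷ R ≫ i ▷ _ ▷ R := by
    have e : (λ_ (P.obj n m)).inv ▷ X ≫ i ▷ _ ▷ X ≫ (α_ _ _ _).hom ≫ G ◁ φ n m =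
        φ n m ≫ (λ_ _).inv ≫ i ▷ _ := by
      rw [associator_naturality_left_assoc, ← MonoidalCategory.whisker_exchange,
        leftUnitor_inv_naturality_assoc]
      monoidal
    have e' := congrArg (fun t => t ▷ R) e
    simp only [comp_whiskerRight] at e'
    rw [reassoc_of% rs_nat_left, reassoc_of% rs_nat_left, e']
  rw [reassoc_of% rs_nat_mid, MonoidalCategory.whisker_exchange_assoc,
    MonoidalCategory.whisker_exchange_assoc, reassoc_of% k]

end OpticAct

/-! ### Modules over the renormalization algebra. -/

section Omega
variable {V : Type w} [Category.{u} V] [MonoidalCategory V] [SymmetricCategory V]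
  [MonoidalClosed V] [HasLimits V] [HasColimits V]
variable {C M N : Type u} [EnrichedCategory V C] [MonoidalVCat V C] [EnrichedCategory V M]
  [LeftModule V C M] [EnrichedCategory V N] [LeftModule V C N]
variable (P : Prof V M N)

/-- Acting by an arrow of `C` inside a summand is the right action of that arrow paired with the
identity of `m`. This is the form to which the balancing of the outer coend applies. -/
lemma gact_postι (x x' : C) (n n' : N) (m : M) :
    gact n n' x x' ▷ _ ≫ postι P x' n n' m =
      rs _ _ _ ≫ postι P x n n' m ▷ _ ≫ _ ◁ ((ρ_ _).inv ≫ _ ◁ eId V m) ≫ postR P n x x' m m := by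
  have k {G A c r : V} (i : 𝟙_ V ⟶ r) : (G ⊗ A) ◁ ((ρ_ c).inv ≫ _ ◁ i) ≫ (α_ _ _ _).hom ≫
      G ◁ ((α_ _ _ _).inv ≫ (β_ _ _).hom ▷ _ ≫ (α_ _ _ _).hom) ≫ (α_ _ _ _).inv =
      rs _ _ _ ≫ _ ◁ ((ρ_ A).inv ≫ _ ◁ i) := by
    have e : A ◁ ((ρ_ c).inv ≫ c ◁ i) ≫ (α_ _ _ _).inv ≫ (β_ _ _).hom ▷ _ ≫ (α_ _ _ _).hom =
        (β_ A c).hom ≫ c ◁ ((ρ_ A).inv ≫ A ◁ i) := by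
      rw [MonoidalCategory.whiskerLeft_comp_assoc, associator_inv_naturality_right_assoc,
        MonoidalCategory.whisker_exchange_assoc]
      monoidal
    rw [associator_naturality_right_assoc, ← MonoidalCategory.whiskerLeft_comp_assoc, e, rs]
    simp only [MonoidalCategory.whiskerLeft_comp, Category.assoc]
    monoidal
  rw [← MonoidalCategory.whisker_exchange_assoc, postι_postR, reassoc_of% k, reassoc_of% rs_rs,
    MonoidalCategory.tensorHom_def', Category.assoc, ← MonoidalCategory.whiskerLeft_comp_assoc,
    Category.assoc, P.ract_id, MonoidalCategory.whiskerLeft_id, Category.id_comp]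

/-- The object `(⊡_* • (Id_C ⊗ P) • ⊡^*)(n, m)`. -/
def omegaObj (n : N) (m : M) : V :=
  Prof.compObj ((actPost V C M N).obj P) (Prof.conjoint (actF V C M)) n m

/-- The coprojection. -/
def omegaCompι (n : N) (x : C) (m' m : M) :
    postObj P n x m' ⊗ (sm V x m' ⟶[V] m) ⟶ omegaObj (C := C) P n m :=
  Prof.compι ((actPost V C M N).obj P) (Prof.conjoint (actF V C M)) n (x, m') m

variable (V C M) in
/-- The left action of the hom-objects of `C ⊗ M` on the profunctor corepresented by the action. -/
def hactM (m : M) (x x' : C) (m'' m' : M) :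
    ((x ⟶[V] x') ⊗ (m'' ⟶[V] m')) ⊗ (sm V x' m' ⟶[V] m) ⟶ (sm V x m'' ⟶[V] m) :=
  (actF V C M).map (x, m'') (x', m') ▷ _ ≫ eComp V _ _ _

lemma hactM_eq_hact (m : M) (x x' : C) (m' : M) :
    ((ρ_ _).inv ≫ _ ◁ eId V m') ▷ _ ≫ hactM V C M m x x' m' m' = hact m m' x x' := by
  rw [hactM, hact, br, ← comp_whiskerRight_assoc, Category.assoc]

lemma hactM_eq (m : M) (x x' : C) (m'' m' : M) :
    hactM V C M m x x' m'' m' = (α_ _ _ _).hom ≫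
      _ ◁ (bl (actF V C M) x' m'' m' ▷ _ ≫ eComp V _ _ _) ≫ hact m m'' x x' := by
  rw [hactM, hact, ← br_bl, comp_whiskerRight_assoc, MonoidalCategory.whiskerLeft_comp_assoc,
    MonoidalCategory.whisker_exchange_assoc, ← e_assoc, MonoidalCategory.tensorHom_def']
  monoidal

lemma omegaCompι_w (n : N) (x x' : C) (m'' m' m : M) :
    postR P n x x' m'' m' ▷ _ ≫ omegaCompι P n x' m' m =
      (α_ _ _ _).hom ≫ _ ◁ hactM V C M m x x' m'' m' ≫ omegaCompι P n x m'' m :=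
  Prof.compι_w ((actPost V C M N).obj P) (Prof.conjoint (actF V C M)) n (x, m'') (x', m') m

/-- The map `N(n, x n') ⊗ P(n', m') ⊗ M(x m', m) ⟶ (⊡_* • (Id_C ⊗ P) • ⊡^*)(n, m)`. -/
def omegaι (x : C) (n n' : N) (m' m : M) :
    ((n ⟶[V] sm V x n') ⊗ P.obj n' m') ⊗ (sm V x m' ⟶[V] m) ⟶ omegaObj (C := C) P n m :=
  actOmegaι P x n n' m' m

lemma omegaι_eq (x : C) (n n' : N) (m' m : M) :
    omegaι P x n n' m' m = postι P x n n' m' ▷ _ ≫ omegaCompι P n x m' m := rfl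

/-- The dinaturality in `x` required of an optic action is the balancing of the outer coend over `C
⊗ M`, with an identity as arrow of `M`. -/
lemma omegaι_dinat (x x' : C) (n n' : N) (m' m : M) :
    gact n n' x x' ▷ _ ▷ _ ≫ omegaι P x' n n' m' m =
      rs _ _ _ ▷ _ ≫ (α_ _ _ _).hom ≫ _ ◁ hact m m' x x' ≫ omegaι P x n n' m' m := by
  rw [omegaι_eq, ← comp_whiskerRight_assoc, gact_postι, comp_whiskerRight_assoc,
    comp_whiskerRight_assoc, comp_whiskerRight_assoc, omegaCompι_w, omegaι_eq,
    associator_naturality_middle_assoc, ← MonoidalCategory.whiskerLeft_comp_assoc, hactM_eq_hact,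
    associator_naturality_left_assoc, ← MonoidalCategory.whisker_exchange_assoc]

variable {P}

/-- The outer coend is tested on the pairs `(x, m')` and the inner one on the objects `n'`; the
latter suffices by the co-Yoneda reduction. -/
lemma omegaObj_ext {n : N} {m : M} {X : V} {f g : omegaObj (C := C) P n m ⟶ X}
    (h : ∀ x n' m', omegaι P x n n' m' m ≫ f = omegaι P x n n' m' m ≫ g) : f = g :=
  Prof.comp_ext fun p => postObj_ext_right fun n' => by
    have := h p.1 n' p.2
    rw [omegaι_eq, Category.assoc, Category.assoc] at this
    exact this

lemma omegaObj_ext_left {n : N} {m : M} {K X : V} {f g : K ⊗ omegaObj (C := C) P n m ⟶ X}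
    (h : ∀ x n' m', _ ◁ omegaι P x n n' m' m ≫ f = _ ◁ omegaι P x n n' m' m ≫ g) : f = g := by
  apply curry_injective
  refine omegaObj_ext fun x n' m' => ?_
  rw [← curry_natural_left, ← curry_natural_left, h]

lemma omegaObj_ext_right {n : N} {m : M} {K X : V} {f g : omegaObj (C := C) P n m ⊗ K ⟶ X}
    (h : ∀ x n' m', omegaι P x n n' m' m ▷ _ ≫ f = omegaι P x n n' m' m ▷ _ ≫ g) : f = g := by
  rw [← cancel_epi (β_ K _).hom]
  refine omegaObj_ext_left fun x n' m' => ?_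
  rw [braiding_naturality_right_assoc, braiding_naturality_right_assoc, h]

variable (P)

/-- The left action of the hom-objects of `N`. -/
def omegaL (n n' : N) (m : M) : (n ⟶[V] n') ⊗ omegaObj (C := C) P n' m ⟶ omegaObj (C := C) P n m :=
  Prof.compL ((actPost V C M N).obj P) (Prof.conjoint (actF V C M)) n n' m

/-- The right action of the hom-objects of `M`. -/
def omegaR (n : N) (m m' : M) : omegaObj (C := C) P n m ⊗ (m ⟶[V] m') ⟶ omegaObj (C := C) P n m' :=
  Prof.compR ((actPost V C M N).obj P) (Prof.conjoint (actF V C M)) n m m'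

lemma omegaι_omegaL (x : C) (n₀ n n' : N) (m' m : M) :
    _ ◁ omegaι P x n n' m' m ≫ omegaL P n₀ n m = (α_ _ _ _).inv ≫ (α_ _ _ _).inv ▷ _ ≫
      eComp V _ _ _ ▷ _ ▷ _ ≫ omegaι P x n₀ n' m' m := by
  have h : (n₀ ⟶[V] n) ◁ omegaCompι P n x m' m ≫ omegaL P n₀ n m =
      (α_ _ _ _).inv ≫ postL P n₀ n x m' ▷ _ ≫ omegaCompι P n₀ x m' m :=
    Prof.compι_compL ((actPost V C M N).obj P) (Prof.conjoint (actF V C M)) n₀ n (x, m') m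
  rw [omegaι_eq, omegaι_eq, MonoidalCategory.whiskerLeft_comp_assoc, h,
    associator_inv_naturality_middle_assoc, ← comp_whiskerRight_assoc, postι_postL]
  simp only [comp_whiskerRight, Category.assoc]

lemma omegaι_omegaR (x : C) (n n' : N) (m' m m₁ : M) :
    omegaι P x n n' m' m ▷ _ ≫ omegaR P n m m₁ =
      (α_ _ _ _).hom ≫ _ ◁ eComp V _ _ _ ≫ omegaι P x n n' m' m₁ := by
  have h : omegaCompι P n x m' m ▷ _ ≫ omegaR P n m m₁ =
      (α_ _ _ _).hom ≫ _ ◁ eComp V _ _ _ ≫ omegaCompι P n x m' m₁ :=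
    Prof.compι_compR ((actPost V C M N).obj P) (Prof.conjoint (actF V C M)) n (x, m') m m₁
  rw [omegaι_eq, omegaι_eq, comp_whiskerRight_assoc, h, associator_naturality_left_assoc,
    ← MonoidalCategory.whisker_exchange_assoc]

/-- The components of the `V`-functor `P ↦ ⊡_* • (Id_C ⊗ P) • ⊡^*`. -/
def omegaMap (P Q : Prof V M N) (n : N) (m : M) :
    omegaObj (C := C) P n m ⊗ (P ⟶[V] Q) ⟶ omegaObj (C := C) Q n m :=
  mapEv (actOmega V C M N) P Q n m

lemma rs_app_aux {B B' F O O' H X : V} (ι : B ⊗ F ⟶ O) (ι' : B' ⊗ F ⟶ O') (i : X ⟶ H)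
    (p : O ⊗ H ⟶ O') (t : B ⊗ H ⟶ B') (e : B ⊗ X ⟶ B')
    (h₁ : ι ▷ H ≫ p = rs _ _ _ ≫ t ▷ F ≫ ι') (h₂ : B ◁ i ≫ t = e) :
    ι ▷ X ≫ O ◁ i ≫ p = rs _ _ _ ≫ e ▷ F ≫ ι' := by
  rw [← MonoidalCategory.whisker_exchange_assoc, h₁, reassoc_of% rs_nat_right,
    ← comp_whiskerRight_assoc, h₂]

/-- On generators the functor `actOmega` touches only the middle factor `P(n', m')`; the permutation
brings the hom-object next to it. -/
lemma omegaι_omegaMap (P Q : Prof V M N) (x : C) (n n' : N) (m' m : M) :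
    omegaι P x n n' m' m ▷ _ ≫ omegaMap P Q n m =
      rs _ _ _ ≫ (α_ _ _ _).hom ▷ _ ≫ (_ ◁ Prof.ev P Q n' m') ▷ _ ≫ omegaι Q x n n' m' m := by
  have h : omegaMap (C := C) P Q n m = omegaObj P n m ◁ (actPost V C M N).map P Q ≫
      Prof.preApp (Prof.conjoint (actF V C M)) ((actPost V C M N).obj P)
        ((actPost V C M N).obj Q) n m :=
    (mapEv_comp (actPost V C M N) (Prof.preF N (Prof.conjoint (actF V C M))) P Q n m).trans
      (congrArg (_ ≫ ·) (mapEv_preF _ _ _ _ _))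
  have h₁ : omegaCompι P n x m' m ▷ _ ≫ omegaMap P Q n m =
      rs _ _ _ ≫ postMap P Q n x m' ▷ _ ≫ omegaCompι Q n x m' m := by
    rw [h]
    exact rs_app_aux (omegaCompι P n x m' m) (omegaCompι Q n x m' m) ((actPost V C M N).map P Q) _
      (Prof.ev ((actPost V C M N).obj P) ((actPost V C M N).obj Q) n (x, m')) _
      (Prof.compι_preApp (Prof.conjoint (actF V C M)) ((actPost V C M N).obj P)
        ((actPost V C M N).obj Q) n (x, m') m) rfl
  rw [omegaι_eq, comp_whiskerRight_assoc, h₁, reassoc_of% rs_nat_left, ← comp_whiskerRight_assoc,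
    postι_postMap, omegaι_eq]
  simp only [comp_whiskerRight, Category.assoc]

namespace OmegaMod

/-- The components of the action. -/
def κapp (P : OmegaMod V C M N) (n : N) (m : M) : omegaObj (C := C) P.P n m ⟶ P.P.obj n m :=
  P.κ.app n m

/-- The optic action of a module over the renormalization algebra. -/
def toOpticAct (P : OmegaMod V C M N) : OpticAct V C M N where
  obj := P.P.obj
  θ x n n' m' m := omegaι P.P x n n' m' m ≫ P.κapp n m
  dinat x x' n n' m' m := by rw [reassoc_of% omegaι_dinat]
  assoc := P.assoc
  unit := P.unit

lemma κapp_lact (P : OmegaMod V C M N) (n n' : N) (m : M) :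
    omegaL P.P n n' m ≫ P.κapp n m = _ ◁ P.κapp n' m ≫ P.P.lact n n' m := P.κ.lact_app n n' m

lemma κapp_ract (P : OmegaMod V C M N) (n : N) (m m' : M) :
    omegaR P.P n m m' ≫ P.κapp n m' = P.κapp n m ▷ _ ≫ P.P.ract n m m' := P.κ.ract_app n m m'

/-- The structure map is a homomorphism of profunctors, so the given left action satisfies the
formula `OpticAct.θ_lact` of the derived one. Since `θ` at the unit object is epimorphic, the two
agree. -/
lemma toOpticAct_lact (P : OmegaMod V C M N) (n n' : N) (m : M) :
    P.toOpticAct.lact n n' m = P.P.lact n n' m := by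
  have h : _ ◁ (omegaι P.P (tone V C) n' n' m m ≫ P.κapp n' m) ≫ P.P.lact n n' m =
      (α_ _ _ _).inv ≫ (α_ _ _ _).inv ▷ _ ≫ eComp V _ _ _ ▷ _ ▷ _ ≫
        omegaι P.P (tone V C) n n' m m ≫ P.κapp n m := by
    rw [MonoidalCategory.whiskerLeft_comp_assoc, ← κapp_lact, reassoc_of% omegaι_omegaL]
  exact P.toOpticAct.θ_left_ext ((P.toOpticAct.θ_lact ..).trans h.symm)

lemma toOpticAct_ract (P : OmegaMod V C M N) (n : N) (m m' : M) :
    P.toOpticAct.ract n m m' = P.P.ract n m m' := by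
  have h : (omegaι P.P (tone V C) n n m m ≫ P.κapp n m) ▷ _ ≫ P.P.ract n m m' =
      (α_ _ _ _).hom ≫ _ ◁ eComp V _ _ _ ≫ omegaι P.P (tone V C) n n m m' ≫ P.κapp n m' := by
    rw [comp_whiskerRight_assoc, ← κapp_ract, reassoc_of% omegaι_omegaR]
  exact P.toOpticAct.θ_right_ext ((P.toOpticAct.θ_ract ..).trans h.symm)

/-- The action on components. -/
def θ (P : OmegaMod V C M N) (x : C) (n n' : N) (m' m : M) :
    ((n ⟶[V] sm V x n') ⊗ P.P.obj n' m') ⊗ (sm V x m' ⟶[V] m) ⟶ P.P.obj n m :=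
  omegaι P.P x n n' m' m ≫ P.κapp n m

lemma uev_forget (P Q : OmegaMod V C M N) (n : N) (m : M) :
    uev ((OmegaMod.forget V C M N).comp V (Prof.evF n m)) P Q =
      P.P.obj n m ◁ Inserter.ι P.toInserter Q.toInserter ≫ Prof.ev P.P Q.P n m :=
  uev_comp_evF (OmegaMod.forget V C M N) P Q n m

/-- The square at `(n, m)` is tested on the generators `omegaι`, where it says that the family
underlying `f` commutes with `θ`. -/
lemma inserter_condition_iff (P Q : OmegaMod V C M N) {X : V} (f : X ⟶ (P.P ⟶[V] Q.P)) :
    f ≫ (actOmega V C M N).map P.P Q.P ≫ post _ Q.κ.el =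
        f ≫ (EnrichedFunctor.id V (Prof V M N)).map P.P Q.P ≫ pre _ P.κ.el ↔
      ∀ x n n' m' m, P.θ x n n' m' m ▷ X ≫ P.P.obj n m ◁ f ≫ Prof.ev P.P Q.P n m =
        rs _ _ _ ≫ (α_ _ _ _).hom ▷ _ ≫
          (_ ◁ (P.P.obj n' m' ◁ f ≫ Prof.ev P.P Q.P n' m')) ▷ _ ≫ Q.θ x n n' m' m := by
  have h₁ (x n n' m' m) : omegaι P.P x n n' m' m ▷ X ≫ omegaObj P.P n m ◁ f ≫
      omegaMap P.P Q.P n m ≫ Q.κapp n m = rs _ _ _ ≫ (α_ _ _ _).hom ▷ _ ≫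
          (_ ◁ (P.P.obj n' m' ◁ f ≫ Prof.ev P.P Q.P n' m')) ▷ _ ≫ Q.θ x n n' m' m := by
    rw [← MonoidalCategory.whisker_exchange_assoc, reassoc_of% omegaι_omegaMap, θ,
      reassoc_of% rs_nat_right, ← comp_whiskerRight_assoc, associator_naturality_right]
    simp only [comp_whiskerRight, MonoidalCategory.whiskerLeft_comp, Category.assoc]
  have h₂ (n m) : (omegaObj P.P n m ◁ f ≫ omegaMap P.P Q.P n m ≫ Q.κapp n m =
      P.κapp n m ▷ X ≫ P.P.obj n m ◁ f ≫ Prof.ev P.P Q.P n m) ↔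
      ∀ x n' m', P.θ x n n' m' m ▷ X ≫ P.P.obj n m ◁ f ≫ Prof.ev P.P Q.P n m =
        rs _ _ _ ≫ (α_ _ _ _).hom ▷ _ ≫
          (_ ◁ (P.P.obj n' m' ◁ f ≫ Prof.ev P.P Q.P n' m')) ▷ _ ≫ Q.θ x n n' m' m := by
    constructor
    · intro h x n' m'
      rw [← h₁, h, θ, comp_whiskerRight_assoc]
    · intro h
      refine omegaObj_ext_right fun x n' m' => ?_
      rw [h₁, ← h, θ, comp_whiskerRight_assoc]
  refine (inserter_iff (S := actOmega V C M N) (R := EnrichedFunctor.id V (Prof V M N)) P.κ Q.κ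
    f).trans ?_
  simp only [mapEv_id]
  exact ⟨fun h x n n' m' m => (h₂ n m).1 (h n m) x n' m',
    fun h n m => (h₂ n m).2 fun x n' m' => h x n n' m' m⟩

lemma θ_uev (P Q : OmegaMod V C M N) (x : C) (n n' : N) (m' m : M) :
    P.θ x n n' m' m ▷ (P ⟶[V] Q) ≫ uev ((OmegaMod.forget V C M N).comp V (Prof.evF n m)) P Q =
      rs _ _ _ ≫ (α_ _ _ _).hom ▷ _ ≫
        (_ ◁ uev ((OmegaMod.forget V C M N).comp V (Prof.evF n' m')) P Q) ▷ _ ≫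
          Q.θ x n n' m' m := by
  rw [uev_forget, uev_forget]
  exact (inserter_condition_iff P Q _).1 (Inserter.w P.toInserter Q.toInserter) x n n' m' m

lemma exists_lift (P Q : OmegaMod V C M N) {X : V} (φ : ∀ n m, P.P.obj n m ⊗ X ⟶ Q.P.obj n m)
    (h : ∀ x n n' m' m, P.θ x n n' m' m ▷ X ≫ φ n m =
      rs _ _ _ ≫ (α_ _ _ _).hom ▷ _ ≫ (_ ◁ φ n' m') ▷ _ ≫ Q.θ x n n' m' m) :
    ∃ f : X ⟶ (P ⟶[V] Q), ∀ n m, P.P.obj n m ◁ f ≫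
      uev ((OmegaMod.forget V C M N).comp V (Prof.evF n m)) P Q = φ n m := by
  -- The profunctor actions are those derived from `θ`, so a family commuting with `θ` is
  -- automatically a family of maps of profunctors.
  let f₀ : X ⟶ (P.P ⟶[V] Q.P) := Prof.lift φ
    (fun n n' m => by
      rw [← toOpticAct_lact, ← toOpticAct_lact]
      exact OpticAct.lact_hom (P := P.toOpticAct) (Q := Q.toOpticAct) h n n' m)
    (fun n m m' => by
      rw [← toOpticAct_ract, ← toOpticAct_ract]
      exact OpticAct.ract_hom (P := P.toOpticAct) (Q := Q.toOpticAct) h n m m')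
  have hf (n m) : P.P.obj n m ◁ f₀ ≫ Prof.ev P.P Q.P n m = φ n m := Prof.lift_ev ..
  have hf' := (inserter_condition_iff P Q f₀).2 fun x n n' m' m => by
    rw [hf, hf]
    exact h x n n' m' m
  refine ⟨Inserter.lift (P := P.toInserter) (Q := Q.toInserter) f₀ hf', fun n m => ?_⟩
  rw [uev_forget]
  refine (MonoidalCategory.whiskerLeft_comp_assoc ..).symm.trans (Eq.trans ?_ (hf n m))
  exact congrArg (fun t => _ ◁ t ≫ _)
    (Inserter.lift_ι (P := P.toInserter) (Q := Q.toInserter) f₀ hf')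

end OmegaMod

namespace OpticAct
variable (Q : OpticAct V C M N)

/-- The action as a map from the coend over the objects of `N`. -/
def κpost (n : N) (x : C) (m' m : M) :
    postObj Q.toProf n x m' ⊗ (sm V x m' ⟶[V] m) ⟶ Q.obj n m :=
  postDescR (P := Q.toProf) (fun n' => Q.θ x n n' m' m) fun n' n'' => by
    have h := Q.lact_θ x n n' n'' m' m
    rw [← cancel_epi ((α_ _ _ _).hom ▷ _), hom_inv_whiskerRight_assoc] at h
    exact h.symm

lemma postι_κpost (n n' : N) (x : C) (m' m : M) :
    postι Q.toProf x n n' m' ▷ _ ≫ Q.κpost n x m' m = Q.θ x n n' m' m := postι_descR ..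

/-- Balancing of `θ` over `C ⊗ M`, one variable at a time: `ract_θ` moves the arrow of `M` to the
last factor and dinaturality then moves the arrow of `C`. By `hactM_eq`, together they form the
joint left action. -/
lemma perm_θ (n n' : N) (x x' : C) (m'' m' m : M) :
    ((α_ _ _ _).hom ≫ _ ◁ ((α_ _ _ _).inv ≫ (β_ _ _).hom ▷ _ ≫ (α_ _ _ _).hom) ≫
      (α_ _ _ _).inv ≫ (gact n n' x x' ⊗ₘ Q.ract n' m'' m')) ▷ _ ≫ Q.θ x' n n' m' m =
      (α_ _ _ _).hom ≫ _ ◁ hactM V C M m x x' m'' m' ≫ Q.θ x n n' m'' m := by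
  have h : (gact n n' x x' ⊗ₘ Q.ract n' m'' m') ▷ _ ≫ Q.θ x' n n' m' m =
      (α_ _ _ _).inv ▷ _ ≫ (α_ _ _ _).hom ≫ _ ◁ (bl (actF V C M) x' _ _ ▷ _ ≫ eComp V _ _ _) ≫
        rs _ _ _ ▷ _ ≫ (α_ _ _ _).hom ≫ _ ◁ hact m m'' x x' ≫ Q.θ x n n' m'' m := by
    rw [MonoidalCategory.tensorHom_def, comp_whiskerRight_assoc, ract_θ, ← dinat,
      ← comp_whiskerRight_assoc, associator_inv_naturality_left, comp_whiskerRight_assoc,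
      associator_naturality_left_assoc, MonoidalCategory.whisker_exchange_assoc]
  have c {G A X R : V} : (α_ G A (X ⊗ R)).hom ≫ G ◁ ((α_ _ _ _).inv ≫ (β_ _ _).hom ▷ _ ≫
      (α_ _ _ _).hom) ≫ (α_ _ _ _).inv ≫ (α_ _ _ _).inv = (α_ _ _ _).inv ≫ rs _ _ _ ▷ _ := by
    simp only [rs]
    monoidal
  have c' {G A X R : V} (F : V) := congrArg (fun t => t ▷ F) (c (G := G) (A := A) (X := X) (R := R))
  simp only [comp_whiskerRight, Category.assoc] at c' ⊢
  rw [h, hactM_eq, reassoc_of% c', associator_naturality_left_assoc,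
    ← MonoidalCategory.whisker_exchange_assoc, ← comp_whiskerRight_assoc, rs_rs,
    id_whiskerRight, Category.id_comp]
  monoidal

lemma postR_κpost (n : N) (x x' : C) (m'' m' m : M) :
    postR Q.toProf n x x' m'' m' ▷ _ ≫ Q.κpost n x' m' m =
      (α_ _ _ _).hom ≫ _ ◁ hactM V C M m x x' m'' m' ≫ Q.κpost n x m'' m := by
  refine postObj_ext_right2 fun n' => ?_
  have e : postι Q.toProf x n n' m'' ▷ _ ≫ postR Q.toProf n x x' m'' m' =
      ((α_ _ _ _).hom ≫ _ ◁ ((α_ _ _ _).inv ≫ (β_ _ _).hom ▷ _ ≫ (α_ _ _ _).hom) ≫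
      (α_ _ _ _).inv ≫ (gact n n' x x' ⊗ₘ Q.toProf.ract n' m'' m')) ≫
        postι Q.toProf x' n n' m' := by
    rw [postι_postR]
    simp only [Category.assoc]
  rw [← comp_whiskerRight_assoc, e, comp_whiskerRight_assoc, postι_κpost,
    associator_naturality_left_assoc, ← MonoidalCategory.whisker_exchange_assoc, postι_κpost]
  exact Q.perm_θ n n' x x' m'' m' m

/-- The action as a map from the coend. -/
def κapp (n : N) (m : M) : omegaObj (C := C) Q.toProf n m ⟶ Q.obj n m :=
  Prof.compDesc (G := (actPost V C M N).obj Q.toProf) (F := Prof.conjoint (actF V C M))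
    (fun p => Q.κpost n p.1 p.2 m) (fun p p' => Q.postR_κpost n p.1 p'.1 p.2 p'.2 m)

lemma omegaι_κapp (x : C) (n n' : N) (m' m : M) :
    omegaι Q.toProf x n n' m' m ≫ Q.κapp n m = Q.θ x n n' m' m := by
  have h : omegaCompι Q.toProf n x m' m ≫ Q.κapp n m = Q.κpost n x m' m := Prof.compι_desc ..
  rw [omegaι_eq, Category.assoc, h, postι_κpost]

/-- On generators this is `θ_lact`; the next lemma is `θ_ract` in the same way. -/
lemma omegaL_κapp (n n' : N) (m : M) :
    omegaL Q.toProf n n' m ≫ Q.κapp n m = _ ◁ Q.κapp n' m ≫ Q.lact n n' m := by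
  refine omegaObj_ext_left fun x n'' m' => ?_
  rw [← MonoidalCategory.whiskerLeft_comp_assoc, omegaι_κapp, reassoc_of% omegaι_omegaL,
    omegaι_κapp]
  exact (Q.θ_lact ..).symm

lemma omegaR_κapp (n : N) (m m' : M) :
    omegaR Q.toProf n m m' ≫ Q.κapp n m' = Q.κapp n m ▷ _ ≫ Q.ract n m m' := by
  refine omegaObj_ext_right fun x n' m'' => ?_
  rw [← comp_whiskerRight_assoc, omegaι_κapp, reassoc_of% omegaι_omegaR, omegaι_κapp]
  exact (Q.θ_ract ..).symm

/-- The module over the renormalization algebra of an optic action. -/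
def toOmegaMod : OmegaMod V C M N where
  P := Q.toProf
  κ := ⟨Q.κapp, Q.omegaL_κapp, Q.omegaR_κapp⟩
  assoc x y n n' n'' m'' m' m := by
    have h := Q.assoc x y n n' n'' m'' m' m
    rw [← omegaι_κapp, ← omegaι_κapp, ← omegaι_κapp] at h
    exact h
  unit n m := by
    have h := Q.unit n m
    rw [← omegaι_κapp] at h
    exact h

lemma toOmegaMod_θ (x : C) (n n' : N) (m' m : M) :
    Q.toOmegaMod.θ x n n' m' m = Q.θ x n n' m' m := Q.omegaι_κapp x n n' m' m

end OpticAct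

variable (V C M N) in
-- On generators the module laws are those of an optic action, and conversely every optic action
-- descends to the composite coend through `OpticAct.κapp`.
theorem exists_omega_equivalence :
    ∃ F : EnrichedFunctor V (OmegaMod V C M N) (Presheaf V (EM (MHN V C M N))),
      IsVEquivalence F ∧ ∀ m n, Nonempty (VNatIso (F.comp V (Presheaf.evF V ⟨(op m, n)⟩))
        ((OmegaMod.forget V C M N).comp V (Prof.evF n m))) := by
  refine exists_optic_equivalence
    (fun n m => (OmegaMod.forget V C M N).comp V (Prof.evF n m))
    (fun P x n n' m' m => P.θ x n n' m' m)
    (fun P => P.toOpticAct.dinat) (fun P => P.assoc) (fun P => P.unit)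
    (fun P Q X f g h => Inserter.hom_ext (Prof.hom_ext fun n m => ?_))
    (fun P Q x n n' m' m => OmegaMod.θ_uev P Q x n n' m' m)
    (fun P Q X φ h => OmegaMod.exists_lift P Q φ h)
    (fun Q => ⟨Q.toOmegaMod, fun n m => Iso.refl _, fun x n n' m' m => ?_⟩)
  · refine (MonoidalCategory.whiskerLeft_comp_assoc ..).trans (Eq.trans ?_
      (MonoidalCategory.whiskerLeft_comp_assoc ..).symm)
    have := h n m
    rw [OmegaMod.uev_forget] at this
    exact this
  · rw [OpticAct.toOmegaMod_θ]
    refine (Category.comp_id _).trans (Eq.symm ?_)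
    refine (congrArg (fun t => t ▷ _ ≫ _) (MonoidalCategory.whiskerLeft_id _ _)).trans ?_
    exact (congrArg (· ≫ _) (id_whiskerRight _ _)).trans (Category.id_comp _)

end Omega

/-! ### The co-Yoneda isomorphism between `(F • H_*)(d, a)` and `F(d, H a)`. -/

section Collapse
variable {V : Type w} [Category.{u} V] [MonoidalCategory V] [SymmetricCategory V]
  [MonoidalClosed V] [HasLimits V] [HasColimits V]
variable {A B D : Type u} [EnrichedCategory V A] [EnrichedCategory V B] [EnrichedCategory V D]

namespace Prof

lemma ractEl_ract (F : Prof V B D) (d : D) {b b' : B} (e : 𝟙_ V ⟶ (b ⟶[V] b')) (c : B) :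
    F.ractEl d e ▷ _ ≫ F.ract d b' c = _ ◁ pre c e ≫ F.ract d b c := by
  simp only [ractEl, comp_whiskerRight, Category.assoc]
  rw [F.ract_comp, pre]
  monoidal

variable (F : Prof V B D) (H : EnrichedFunctor V A B)

/-- The object `(F • H_*)(d, a)`. -/
def preObj (d : D) (a : A) : V := compObj F (companion H) d a

/-- The coprojection. -/
def preι (d : D) (b : B) (a : A) : F.obj d b ⊗ (b ⟶[V] H.obj a) ⟶ F.preObj H d a :=
  compι F (companion H) d b a

lemma preι_w (d : D) (b b' : B) (a : A) :
    F.ract d b b' ▷ _ ≫ F.preι H d b' a = (α_ _ _ _).hom ≫ _ ◁ eComp V _ _ _ ≫ F.preι H d b a :=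
  compι_w F (companion H) d b b' a

/-- The canonical map `(F • H_*)(d, a) ⟶ F(d, H a)`. -/
def coll (d : D) (a : A) : F.preObj H d a ⟶ F.obj d (H.obj a) := F.collapse H d a

lemma preι_coll (d : D) (b : B) (a : A) : F.preι H d b a ≫ F.coll H d a = F.ract d b _ :=
  compι_desc (G := F) (F := companion H) (fun b => F.ract d b (H.obj a))
    (fun b b' => F.ract_comp d b b' (H.obj a)) b

/-- The inverse of the canonical map `(F • H_*)(d, a) ⟶ F(d, H a)`. -/
def collInv (d : D) (a : A) : F.obj d (H.obj a) ⟶ F.preObj H d a :=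
  (ρ_ _).inv ≫ _ ◁ eId V (H.obj a) ≫ F.preι H d (H.obj a) a

lemma collInv_coll (d : D) (a : A) : F.collInv H d a ≫ F.coll H d a = 𝟙 _ := by
  rw [collInv, Category.assoc, Category.assoc, preι_coll, F.ract_id]

/-- On the summand at `b`, balancing moves the arrow `b ⟶ H a` from `F` back to the second factor,
where it is composed with the identity of `H a`. -/
lemma coll_collInv (d : D) (a : A) : F.coll H d a ≫ F.collInv H d a = 𝟙 _ := by
  have h (b) : F.preι H d b a ≫ F.coll H d a ≫ F.collInv H d a = F.preι H d b a ≫ 𝟙 _ := by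
    rw [reassoc_of% preι_coll, collInv, rightUnitor_inv_naturality_assoc,
      ← MonoidalCategory.whisker_exchange_assoc, preι_w, Category.comp_id]
    conv_rhs => rw [← Category.id_comp (F.preι H d b a), ← MonoidalCategory.whiskerLeft_id,
      ← e_comp_id]
    monoidal
  exact comp_ext h

instance (d : D) (a : A) : IsIso (F.coll H d a) :=
  ⟨F.collInv H d a, F.coll_collInv H d a, F.collInv_coll H d a⟩

/-- The left action on `F • H_*`. -/
def preL (d d' : D) (a : A) : (d ⟶[V] d') ⊗ F.preObj H d' a ⟶ F.preObj H d a :=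
  compL F (companion H) d d' a

/-- The right action on `F • H_*`. -/
def preR (d : D) (a a' : A) : F.preObj H d a ⊗ (a ⟶[V] a') ⟶ F.preObj H d a' :=
  compR F (companion H) d a a'

lemma preL_coll (d d' : D) (a : A) :
    F.preL H d d' a ≫ F.coll H d a = _ ◁ F.coll H d' a ≫ F.lact d d' _ := by
  refine comp_ext_left fun b => ?_
  have h : (d ⟶[V] d') ◁ F.preι H d' b a ≫ F.preL H d d' a =
      (α_ _ _ _).inv ≫ F.lact d d' b ▷ _ ≫ F.preι H d b a :=
    compι_compL F (companion H) d d' b a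
  change (d ⟶[V] d') ◁ F.preι H d' b a ≫ _ = (d ⟶[V] d') ◁ F.preι H d' b a ≫ _
  rw [reassoc_of% h, preι_coll, ← MonoidalCategory.whiskerLeft_comp_assoc, preι_coll, F.comm']

lemma preR_coll (d : D) (a a' : A) :
    F.preR H d a a' ≫ F.coll H d a' = F.coll H d a ▷ _ ≫ _ ◁ H.map a a' ≫ F.ract d _ _ := by
  refine comp_ext_right fun b => ?_
  have h : F.preι H d b a ▷ (a ⟶[V] a') ≫ F.preR H d a a' =
      (α_ _ _ _).hom ≫ _ ◁ (_ ◁ H.map a a' ≫ eComp V _ _ _) ≫ F.preι H d b a' :=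
    compι_compR F (companion H) d b a a'
  change F.preι H d b a ▷ (a ⟶[V] a') ≫ _ = F.preι H d b a ▷ (a ⟶[V] a') ≫ _
  rw [reassoc_of% h, preι_coll, ← comp_whiskerRight_assoc, preι_coll,
    ← MonoidalCategory.whisker_exchange_assoc, F.ract_comp]
  monoidal

/-- Naturality of the collapse in the profunctor; on summands it is the compatibility of evaluation
with right actions. -/
lemma preApp_coll (P Q : Prof V B D) (d : D) (a : A) :
    mapEv (preF D (companion H)) P Q d a ≫ Q.coll H d a =
      P.coll H d a ▷ _ ≫ ev P Q d (H.obj a) := by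
  rw [mapEv_preF]
  refine comp_ext_right fun b => ?_
  have h (p : P.preObj H d a ⊗ (P ⟶[V] Q) ⟶ Q.preObj H d a)
      (hp : P.preι H d b a ▷ (P ⟶[V] Q) ≫ p = rs _ _ _ ≫ ev P Q d b ▷ _ ≫ Q.preι H d b a) :
      P.preι H d b a ▷ (P ⟶[V] Q) ≫ p ≫ Q.coll H d a =
        P.preι H d b a ▷ _ ≫ P.coll H d a ▷ _ ≫ ev P Q d (H.obj a) := by
    rw [reassoc_of% hp, preι_coll, ← comp_whiskerRight_assoc, preι_coll, ract_ev]
  exact h _ (compι_preApp (companion H) P Q d b a)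

variable {F H} in
/-- A homomorphism to `F • H_*` from maps to `F(d, H a)`. -/
def homOfColl {S : Prof V A D} (ψ : ∀ d a, S.obj d a ⟶ F.obj d (H.obj a))
    (hl : ∀ d d' a, S.lact d d' a ≫ ψ d a = _ ◁ ψ d' a ≫ F.lact d d' _)
    (hr : ∀ d a a', S.ract d a a' ≫ ψ d a' = ψ d a ▷ _ ≫ _ ◁ H.map a a' ≫ F.ract d _ _) :
    ProfHom S (F.comp (companion H)) where
  app d a := ψ d a ≫ F.collInv H d a
  lact_app d d' a := by
    have h : S.lact d d' a ≫ ψ d a ≫ F.collInv H d a =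
        _ ◁ (ψ d' a ≫ F.collInv H d' a) ≫ F.preL H d d' a := by
      rw [← cancel_mono (F.coll H d a)]
      simp only [Category.assoc, MonoidalCategory.whiskerLeft_comp]
      rw [collInv_coll, preL_coll, Category.comp_id,
        ← MonoidalCategory.whiskerLeft_comp_assoc _ (F.collInv ..),
        collInv_coll, MonoidalCategory.whiskerLeft_id, Category.id_comp, hl]
    exact h
  ract_app d a a' := by
    have h : S.ract d a a' ≫ ψ d a' ≫ F.collInv H d a' =
        (ψ d a ≫ F.collInv H d a) ▷ _ ≫ F.preR H d a a' := by
      rw [← cancel_mono (F.coll H d a')]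
      simp only [Category.assoc, comp_whiskerRight]
      rw [collInv_coll, preR_coll, Category.comp_id, ← comp_whiskerRight_assoc (F.collInv ..),
        collInv_coll, id_whiskerRight, Category.id_comp, hr]
    exact h

variable {F H} in
lemma homOfColl_coll {S : Prof V A D} (ψ : ∀ d a, S.obj d a ⟶ F.obj d (H.obj a)) (hl) (hr)
    (d : D) (a : A) : (homOfColl ψ hl hr).app d a ≫ F.collapse H d a = ψ d a := by
  have h : (ψ d a ≫ F.collInv H d a) ≫ F.coll H d a = ψ d a := by
    rw [Category.assoc, collInv_coll, Category.comp_id]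
  exact h

end Prof
end Collapse

/-! ### Pasting of commuting squares. -/

section Square
variable {V : Type w} [Category.{u} V]

lemma square_comp {A B B' C D E : V} {p : A ⟶ B} {q : B ⟶ C} {r : C ⟶ D} {s : A ⟶ B'} {t : B' ⟶ C}
    {i : B' ⟶ E} {j : E ⟶ D} {k : A ⟶ E} (h : p ≫ q = s ≫ t) (h' : t ≫ r = i ≫ j) (e : s ≫ i = k) :
    p ≫ q ≫ r = k ≫ j := by
  rw [← e, Category.assoc, ← h', reassoc_of% h]

lemma whisker_square [MonoidalCategory V] {A B B' D D' X H : V} (φ : A ⟶ B) (f : X ⟶ H)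
    {e : B ⊗ H ⟶ B'} {c' : B' ⟶ D'} {c : B ⟶ D} {v : D ⊗ H ⟶ D'} (h : e ≫ c' = c ▷ H ≫ v) :
    (φ ▷ X ≫ B ◁ f ≫ e) ≫ c' = (φ ≫ c) ▷ X ≫ D ◁ f ≫ v := by
  rw [Category.assoc, Category.assoc, h, MonoidalCategory.whisker_exchange_assoc,
    comp_whiskerRight_assoc]

end Square

/-! ### Lax module profunctors. -/

section Lax
variable {V : Type w} [Category.{u} V] [MonoidalCategory V] [SymmetricCategory V]
  [MonoidalClosed V] [HasLimits V] [HasColimits V]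
variable {C M N : Type u} [EnrichedCategory V C] [MonoidalVCat V C] [EnrichedCategory V M]
  [LeftModule V C M] [EnrichedCategory V N] [LeftModule V C N]

variable (V C M) in
/-- The action on hom-objects. -/
def mapM (x x' : C) (m m' : M) : (x ⟶[V] x') ⊗ (m ⟶[V] m') ⟶ (sm V x m ⟶[V] sm V x' m') :=
  (actF V C M).map (x, m) (x', m')

lemma mapM_eq (x x' : C) (m m' : M) :
    mapM V C M x x' m m' = (ρ_ _).inv ≫ _ ◁ eId V _ ≫ hactM V C M _ x x' m m' := by
  have h : hactM V C M (sm V x' m') x x' m m' = mapM V C M x x' m m' ▷ _ ≫ eComp V _ _ _ := rfl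
  rw [h, MonoidalCategory.whisker_exchange_assoc, ← rightUnitor_inv_naturality_assoc, e_comp_id,
    Category.comp_id]

variable (C) in
/-- The right action of the hom-objects of `C ⊗ M` on `F • ⊡_*`. -/
def ractM (F : Prof V M N) (n : N) (x x' : C) (m m' : M) :
    F.obj n (sm V x m) ⊗ ((x ⟶[V] x') ⊗ (m ⟶[V] m')) ⟶ F.obj n (sm V x' m') :=
  _ ◁ (actF V C M).map (x, m) (x', m') ≫ F.ract n _ _

lemma ractM_eq_br (F : Prof V M N) (n : N) (x x' : C) (m : M) :
    _ ◁ ((ρ_ _).inv ≫ _ ◁ eId V m) ≫ ractM C F n x x' m m =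
      _ ◁ br (actF V C M) m x x' ≫ F.ract n _ _ := by
  rw [ractM, br, ← MonoidalCategory.whiskerLeft_comp_assoc, Category.assoc]

lemma ractM_eq_bl (F : Prof V M N) (n : N) (x : C) (m m' : M) :
    _ ◁ ((λ_ _).inv ≫ eId V x ▷ _) ≫ ractM C F n x x m m' =
      _ ◁ bl (actF V C M) x m m' ≫ F.ract n _ _ := by
  rw [ractM, bl, ← MonoidalCategory.whiskerLeft_comp_assoc, Category.assoc]

/-- The counterpart of `gact_postι` in the variable of `M`: an arrow acting on `P` is the right
action of that arrow paired with the identity of `x`. -/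
lemma ract_postι (P : Prof V M N) (x : C) (n n' : N) (m m' : M) :
    _ ◁ P.ract n' m m' ≫ postι P x n n' m' = (α_ _ _ _).inv ≫ postι P x n n' m ▷ _ ≫
      _ ◁ ((λ_ _).inv ≫ eId V x ▷ _) ≫ postR P n x x m m' := by
  have e : _ ◁ eId V x ≫ gact n n' x x = (ρ_ _).hom := by
    rw [gact, ← MonoidalCategory.whiskerLeft_comp_assoc, br_id, ← cancel_epi (ρ_ _).inv,
      e_comp_id, Iso.inv_hom_id]
  have k {G A c r : V} (i : 𝟙_ V ⟶ c) : (G ⊗ A) ◁ ((λ_ r).inv ≫ i ▷ r) ≫ (α_ _ _ _).hom ≫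
      G ◁ ((α_ _ _ _).inv ≫ (β_ _ _).hom ▷ _ ≫ (α_ _ _ _).hom) ≫ (α_ _ _ _).inv =
      (α_ _ _ _).hom ≫ (ρ_ G).inv ▷ _ ≫ (G ◁ i) ▷ _ := by
    have e : A ◁ ((λ_ r).inv ≫ i ▷ r) ≫ (α_ _ _ _).inv ≫ (β_ _ _).hom ▷ _ ≫ (α_ _ _ _).hom =
        (λ_ _).inv ≫ i ▷ _ := by
      rw [MonoidalCategory.whiskerLeft_comp_assoc, associator_inv_naturality_middle_assoc,
        ← comp_whiskerRight_assoc, braiding_naturality_right, braiding_tensorUnit_right]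
      monoidal
    rw [associator_naturality_right_assoc, ← MonoidalCategory.whiskerLeft_comp_assoc, e]
    monoidal
  rw [← MonoidalCategory.whisker_exchange_assoc, postι_postR, reassoc_of% k,
    MonoidalCategory.tensorHom_def, Category.assoc, ← comp_whiskerRight_assoc (_ ◁ eId V x), e]
  simp

namespace LaxProf

/-- The structure map on components. -/
def lax (P : LaxProf V C M N) (x : C) (n n' : N) (m : M) :
    (n ⟶[V] sm V x n') ⊗ P.F.obj n' m ⟶ P.F.obj n (sm V x m) := laxApp P.F P.φ x n n' m

/-- The structure map on objects. -/
def φapp (P : LaxProf V C M N) (n : N) (x : C) (m : M) :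
    postObj P.F n x m ⟶ P.F.obj n (sm V x m) :=
  P.φ.app n (x, m) ≫ P.F.collapse (actF V C M) n (x, m)

lemma lax_eq (P : LaxProf V C M N) (x : C) (n n' : N) (m : M) :
    P.lax x n n' m = postι P.F x n n' m ≫ P.φapp n x m := rfl

lemma postL_φapp (P : LaxProf V C M N) (n n' : N) (x : C) (m : M) :
    postL P.F n n' x m ≫ P.φapp n x m = _ ◁ P.φapp n' x m ≫ P.F.lact n n' _ := by
  have h := P.F.preL_coll (actF V C M) n n' (x, m)
  have h' : postL P.F n n' x m ≫ P.φ.app n (x, m) =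
    (n ⟶[V] n') ◁ P.φ.app n' (x, m) ≫ P.F.preL (actF V C M) n n' (x, m) := P.φ.lact_app n n' (x, m)
  have e : postL P.F n n' x m ≫ P.φ.app n (x, m) ≫ P.F.coll (actF V C M) n (x, m) =
      (n ⟶[V] n') ◁ (P.φ.app n' (x, m) ≫ P.F.coll (actF V C M) n' (x, m)) ≫ P.F.lact n n' _ :=
    square_comp h' h (MonoidalCategory.whiskerLeft_comp ..).symm
  exact e

lemma postR_φapp (P : LaxProf V C M N) (n : N) (x x' : C) (m m' : M) :
    postR P.F n x x' m m' ≫ P.φapp n x' m' = P.φapp n x m ▷ _ ≫ ractM C P.F n x x' m m' := by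
  have h := P.F.preR_coll (actF V C M) n (x, m) (x', m')
  have h' : postR P.F n x x' m m' ≫ P.φ.app n (x', m') =
    P.φ.app n (x, m) ▷ _ ≫ P.F.preR (actF V C M) n (x, m) (x', m') :=
      P.φ.ract_app n (x, m) (x', m')
  have e : postR P.F n x x' m m' ≫ P.φ.app n (x', m') ≫ P.F.coll (actF V C M) n (x', m') =
      (P.φ.app n (x, m) ≫ P.F.coll (actF V C M) n (x, m)) ▷ _ ≫ ractM C P.F n x x' m m' :=
    square_comp h' h (comp_whiskerRight ..).symm
  exact e

/-- This and the next two lemmas split the homomorphism property of the structure map into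
naturality in `N`, in `C` and in `M`. -/
lemma lax_lact (P : LaxProf V C M N) (x : C) (n₀ n n' : N) (m : M) :
    _ ◁ P.lax x n n' m ≫ P.F.lact n₀ n _ =
      (α_ _ _ _).inv ≫ eComp V _ _ _ ▷ _ ≫ P.lax x n₀ n' m := by
  rw [lax_eq, MonoidalCategory.whiskerLeft_comp_assoc, ← postL_φapp, reassoc_of% postι_postL,
    lax_eq]

lemma gact_lax (P : LaxProf V C M N) (x x' : C) (n n' : N) (m : M) :
    gact n n' x x' ▷ _ ≫ P.lax x' n n' m =
      rs _ _ _ ≫ P.lax x n n' m ▷ _ ≫ _ ◁ br (actF V C M) m x x' ≫ P.F.ract n _ _ := by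
  rw [lax_eq, reassoc_of% gact_postι, postR_φapp, MonoidalCategory.whisker_exchange_assoc,
    ractM_eq_br, ← comp_whiskerRight_assoc, ← lax_eq]

lemma ract_lax (P : LaxProf V C M N) (x : C) (n n' : N) (m m' : M) :
    _ ◁ P.F.ract n' m m' ≫ P.lax x n n' m' =
      (α_ _ _ _).inv ≫ P.lax x n n' m ▷ _ ≫ _ ◁ bl (actF V C M) x m m' ≫ P.F.ract n _ _ := by
  rw [lax_eq, reassoc_of% ract_postι, postR_φapp, MonoidalCategory.whisker_exchange_assoc,
    ractM_eq_bl, ← comp_whiskerRight_assoc, ← lax_eq]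

lemma lax_lax (P : LaxProf V C M N) (x y : C) (n n' n'' : N) (m : M) :
    _ ◁ P.lax y n' n'' m ≫ P.lax x n n' (sm V y m) =
      (α_ _ _ _).inv ≫ gcomp x y n n' n'' ▷ _ ≫ P.lax (tmul V x y) n n'' m ≫
        P.F.ractEl n (aM V x y m).hom := P.assoc x y n n' n'' m

/-- The optic action on components. -/
def θ (P : LaxProf V C M N) (x : C) (n n' : N) (m' m : M) :
    ((n ⟶[V] sm V x n') ⊗ P.F.obj n' m') ⊗ (sm V x m' ⟶[V] m) ⟶ P.F.obj n m :=
  P.lax x n n' m' ▷ _ ≫ P.F.ract n _ _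

lemma θ_eq (P : LaxProf V C M N) (x : C) (n n' : N) (m' m : M) :
    P.θ x n n' m' m = P.lax x n n' m' ▷ _ ≫ P.F.ract n _ _ := rfl

lemma θ_ract (P : LaxProf V C M N) (x : C) (n n' : N) (m' m m₁ : M) :
    P.θ x n n' m' m ▷ _ ≫ P.F.ract n m m₁ =
      (α_ _ _ _).hom ≫ _ ◁ eComp V _ _ _ ≫ P.θ x n n' m' m₁ := by
  rw [θ, comp_whiskerRight_assoc, P.F.ract_comp, associator_naturality_left_assoc,
    ← MonoidalCategory.whisker_exchange_assoc, θ]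

lemma θ_lact (P : LaxProf V C M N) (x : C) (n₀ n n' : N) (m' m : M) :
    _ ◁ P.θ x n n' m' m ≫ P.F.lact n₀ n m = (α_ _ _ _).inv ≫ (α_ _ _ _).inv ▷ _ ≫
      eComp V _ _ _ ▷ _ ▷ _ ≫ P.θ x n₀ n' m' m := by
  rw [θ, MonoidalCategory.whiskerLeft_comp_assoc, P.F.comm',
    associator_inv_naturality_middle_assoc, ← comp_whiskerRight_assoc, lax_lact, θ]
  simp only [comp_whiskerRight, Category.assoc]

/-- The structure map is recovered from `θ` at the identity of `x m`, as in the Yoneda lemma. So `θ`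
and `lax` carry the same information. -/
lemma lax_eq_θ (P : LaxProf V C M N) (x : C) (n n' : N) (m : M) :
    P.lax x n n' m = (ρ_ _).inv ≫ _ ◁ eId V _ ≫ P.θ x n n' m _ := by
  rw [θ, MonoidalCategory.whisker_exchange_assoc, ← rightUnitor_inv_naturality_assoc, P.F.ract_id,
    Category.comp_id]

/-- By `gact_lax` an arrow of `C` passes through the structure map to a right action, and the
associativity of the right action absorbs it in the hom-object of `M`. -/
lemma θ_dinat (P : LaxProf V C M N) (x x' : C) (n n' : N) (m' m : M) :
    gact n n' x x' ▷ _ ▷ _ ≫ P.θ x' n n' m' m =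
      rs _ _ _ ▷ _ ≫ (α_ _ _ _).hom ≫ _ ◁ hact m m' x x' ≫ P.θ x n n' m' m := by
  rw [θ, ← comp_whiskerRight_assoc, gact_lax]
  simp only [comp_whiskerRight, Category.assoc]
  rw [P.F.ract_comp, θ, hact, MonoidalCategory.whisker_exchange_assoc]
  monoidal

lemma θ_assoc (P : LaxProf V C M N) (x y : C) (n n' n'' : N) (m'' m' m : M) :
    (_ ◁ P.θ y n' n'' m'' m') ▷ _ ≫ P.θ x n n' m' m =
      (α_ _ _ _).inv ▷ _ ≫ (α_ _ _ _).inv ▷ _ ▷ _ ≫ (α_ _ _ _).hom ≫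
        (gcomp x y n n' n'' ▷ _ ⊗ₘ hcomp0 x y m m' m'') ≫ P.θ (tmul V x y) n n'' m'' m := by
  -- Three successive right actions, by the associator, by an arrow acted on by `x`, and by the
  -- outer arrow, combine to the right action of their composite, which is `hcomp0`.
  have h : P.F.ractEl n (aM V x y m'').hom ▷ _ ▷ _ ≫
      (_ ◁ bl (actF V C M) x (sm V y m'') m' ≫ P.F.ract n _ _) ▷ _ ≫ P.F.ract n _ m =
      (α_ _ _ _).hom ≫ _ ◁ hcomp0 x y m m' m'' ≫ P.F.ract n _ _ := by
    rw [hcomp0, comp_whiskerRight_assoc, P.F.ract_comp, MonoidalCategory.whiskerLeft_comp_assoc,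
      MonoidalCategory.whiskerLeft_comp_assoc, ← P.F.ractEl_ract,
      MonoidalCategory.whisker_exchange_assoc, MonoidalCategory.whisker_exchange_assoc]
    monoidal
  -- Naturality in `M` pulls the right action of the inner `θ` out of the outer structure map, so
  -- that the two structure maps become adjacent and `lax_lax` applies.
  have e : _ ◁ P.θ y n' n'' m'' m' ≫ P.lax x n n' m' = (α_ _ _ _).inv ≫
      (_ ◁ P.lax y n' n'' m'' ≫ P.lax x n n' (sm V y m'')) ▷ _ ≫
        _ ◁ bl (actF V C M) x (sm V y m'') m' ≫ P.F.ract n _ _ := by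
    rw [θ, MonoidalCategory.whiskerLeft_comp_assoc, ract_lax,
      associator_inv_naturality_middle_assoc, ← comp_whiskerRight_assoc]
  rw [P.θ_eq x, ← comp_whiskerRight_assoc, e, lax_lax]
  simp only [comp_whiskerRight, Category.assoc] at h ⊢
  rw [h, associator_naturality_left_assoc, MonoidalCategory.tensorHom_def, θ, Category.assoc,
    MonoidalCategory.whisker_exchange_assoc, associator_naturality_left_assoc]

lemma θ_unit (P : LaxProf V C M N) (n : N) (m : M) :
    (λ_ _).inv ≫ (uM V C n).inv ▷ _ ≫ (ρ_ _).inv ≫ _ ◁ (uM V C m).hom ≫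
      P.θ (tone V C) n n m m = 𝟙 _ := by
  rw [θ, MonoidalCategory.whisker_exchange_assoc, ← rightUnitor_inv_naturality_assoc]
  exact P.unit n m

/-- The optic action of a lax module profunctor. -/
def toOpticAct (P : LaxProf V C M N) : OpticAct V C M N where
  obj := P.F.obj
  θ := P.θ
  dinat := P.θ_dinat
  assoc := P.θ_assoc
  unit := P.θ_unit

lemma toOpticAct_lact (P : LaxProf V C M N) (n n' : N) (m : M) :
    P.toOpticAct.lact n n' m = P.F.lact n n' m :=
  P.toOpticAct.θ_left_ext ((P.toOpticAct.θ_lact ..).trans (P.θ_lact ..).symm)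

lemma toOpticAct_ract (P : LaxProf V C M N) (n : N) (m m' : M) :
    P.toOpticAct.ract n m m' = P.F.ract n m m' :=
  P.toOpticAct.θ_right_ext ((P.toOpticAct.θ_ract ..).trans (P.θ_ract ..).symm)

lemma uev_forget (P Q : LaxProf V C M N) (n : N) (m : M) :
    uev ((LaxProf.forget V C M N).comp V (Prof.evF n m)) P Q =
      P.F.obj n m ◁ Inserter.ι P.toInserter Q.toInserter ≫ Prof.ev P.F Q.F n m :=
  uev_comp_evF (LaxProf.forget V C M N) P Q n m

/-- From `lax` to `θ`, follow by the right action, with which the evaluation of `f` commutes. In the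
other direction, insert the identity of `x m'`. -/
lemma lax_iff_θ (P Q : LaxProf V C M N) {X : V} (f : X ⟶ (P.F ⟶[V] Q.F)) (x : C) (n n' : N)
    (m' : M) : P.lax x n n' m' ▷ X ≫ P.F.obj n _ ◁ f ≫ Prof.ev P.F Q.F n _ =
        (α_ _ _ _).hom ≫ _ ◁ (P.F.obj n' m' ◁ f ≫ Prof.ev P.F Q.F n' m') ≫ Q.lax x n n' m' ↔
      ∀ m, P.θ x n n' m' m ▷ X ≫ P.F.obj n m ◁ f ≫ Prof.ev P.F Q.F n m =
        rs _ _ _ ≫ (α_ _ _ _).hom ▷ _ ≫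
          (_ ◁ (P.F.obj n' m' ◁ f ≫ Prof.ev P.F Q.F n' m')) ▷ _ ≫ Q.θ x n n' m' m := by
  constructor
  · intro h m
    have e := congrArg (fun t => rs _ _ _ ≫ t ▷ _ ≫ Q.F.ract n _ m) h
    simp only [comp_whiskerRight, Category.assoc] at e
    rw [θ, θ, comp_whiskerRight_assoc, ← MonoidalCategory.whisker_exchange_assoc, Prof.ract_ev,
      reassoc_of% rs_nat_right, reassoc_of% rs_nat_left]
    exact e
  · intro h
    rw [lax_eq_θ, comp_whiskerRight_assoc, comp_whiskerRight_assoc, h, reassoc_of% unit_rs,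
      lax_eq_θ, MonoidalCategory.whisker_exchange_assoc, MonoidalCategory.whisker_exchange_assoc,
      ← rightUnitor_inv_naturality_assoc, ← rightUnitor_inv_naturality_assoc]

lemma inserter_condition_iff (P Q : LaxProf V C M N) {X : V} (f : X ⟶ (P.F ⟶[V] Q.F)) :
    f ≫ (actPost V C M N).map P.F Q.F ≫ post _ Q.φ.el =
        f ≫ (actPre V C M N).map P.F Q.F ≫ pre _ P.φ.el ↔
      ∀ x n n' m' m, P.θ x n n' m' m ▷ X ≫ P.F.obj n m ◁ f ≫ Prof.ev P.F Q.F n m =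
        rs _ _ _ ≫ (α_ _ _ _).hom ▷ _ ≫
          (_ ◁ (P.F.obj n' m' ◁ f ≫ Prof.ev P.F Q.F n' m')) ▷ _ ≫ Q.θ x n n' m' m := by
  have h₁ (x n n' m) : postι P.F x n n' m ▷ X ≫ postObj P.F n x m ◁ f ≫
      postMap P.F Q.F n x m ≫ Q.φapp n x m =
      (α_ _ _ _).hom ≫ _ ◁ (P.F.obj n' m ◁ f ≫ Prof.ev P.F Q.F n' m) ≫ Q.lax x n n' m := by
    rw [← MonoidalCategory.whisker_exchange_assoc, reassoc_of% postι_postMap, lax_eq,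
      associator_naturality_right_assoc]
    simp only [MonoidalCategory.whiskerLeft_comp, Category.assoc]
  have h₂ (n x m) : (postObj P.F n x m ◁ f ≫ postMap P.F Q.F n x m ≫ Q.φapp n x m =
      P.φapp n x m ▷ X ≫ P.F.obj n _ ◁ f ≫ Prof.ev P.F Q.F n _) ↔
      ∀ n', P.lax x n n' m ▷ X ≫ P.F.obj n _ ◁ f ≫ Prof.ev P.F Q.F n _ =
        (α_ _ _ _).hom ≫ _ ◁ (P.F.obj n' m ◁ f ≫ Prof.ev P.F Q.F n' m) ≫ Q.lax x n n' m := by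
    constructor
    · intro h n'
      rw [← h₁, h, lax_eq, comp_whiskerRight_assoc]
    · intro h
      refine postObj_ext_right fun n' => ?_
      rw [h₁, ← h, lax_eq, comp_whiskerRight_assoc]
  -- The square for the structure homomorphism ends in `Q • ⊡_*`. Composing with the collapse, an
  -- isomorphism natural in the profunctor, moves it to `Q(n, x m)` without loss.
  have h₃ (n : N) (p : C × M) :
      (((actPost V C M N).obj P.F).obj n p ◁ f ≫ mapEv (actPost V C M N) P.F Q.F n p ≫
        Q.φ.app n p = P.φ.app n p ▷ X ≫ ((actPre V C M N).obj P.F).obj n p ◁ f ≫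
          mapEv (actPre V C M N) P.F Q.F n p) ↔
      postObj P.F n p.1 p.2 ◁ f ≫ postMap P.F Q.F n p.1 p.2 ≫ Q.φapp n p.1 p.2 =
        P.φapp n p.1 p.2 ▷ X ≫ P.F.obj n _ ◁ f ≫ Prof.ev P.F Q.F n _ := by
    refine (cancel_mono (Q.F.coll (actF V C M) n p)).symm.trans (Iff.of_eq (congrArg₂ Eq ?_ ?_))
    · exact (Category.assoc ..).trans (congrArg (_ ≫ ·) (Category.assoc ..))
    · exact whisker_square _ f (Prof.preApp_coll (actF V C M) P.F Q.F n p)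
  refine (inserter_iff (S := actPost V C M N) (R := actPre V C M N) P.φ Q.φ f).trans ?_
  exact ⟨fun h x n n' m => (lax_iff_θ P Q f x n n' m).1
      ((h₂ n x m).1 ((h₃ n (x, m)).1 (h n (x, m))) n'),
    fun h n p => (h₃ n p).2 ((h₂ n p.1 p.2).2 fun n' =>
      (lax_iff_θ P Q f _ _ _ _).2 (h p.1 n n' p.2))⟩

lemma θ_uev (P Q : LaxProf V C M N) (x : C) (n n' : N) (m' m : M) :
    P.θ x n n' m' m ▷ (P ⟶[V] Q) ≫ uev ((LaxProf.forget V C M N).comp V (Prof.evF n m)) P Q =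
      rs _ _ _ ≫ (α_ _ _ _).hom ▷ _ ≫
        (_ ◁ uev ((LaxProf.forget V C M N).comp V (Prof.evF n' m')) P Q) ▷ _ ≫
          Q.θ x n n' m' m := by
  rw [uev_forget, uev_forget]
  exact (inserter_condition_iff P Q _).1 (Inserter.w P.toInserter Q.toInserter) x n n' m' m

lemma exists_lift (P Q : LaxProf V C M N) {X : V} (φ : ∀ n m, P.F.obj n m ⊗ X ⟶ Q.F.obj n m)
    (h : ∀ x n n' m' m, P.θ x n n' m' m ▷ X ≫ φ n m =
      rs _ _ _ ≫ (α_ _ _ _).hom ▷ _ ≫ (_ ◁ φ n' m') ▷ _ ≫ Q.θ x n n' m' m) :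
    ∃ f : X ⟶ (P ⟶[V] Q), ∀ n m, P.F.obj n m ◁ f ≫
      uev ((LaxProf.forget V C M N).comp V (Prof.evF n m)) P Q = φ n m := by
  let f₀ : X ⟶ (P.F ⟶[V] Q.F) := Prof.lift φ
    (fun n n' m => by
      rw [← toOpticAct_lact, ← toOpticAct_lact]
      exact OpticAct.lact_hom (P := P.toOpticAct) (Q := Q.toOpticAct) h n n' m)
    (fun n m m' => by
      rw [← toOpticAct_ract, ← toOpticAct_ract]
      exact OpticAct.ract_hom (P := P.toOpticAct) (Q := Q.toOpticAct) h n m m')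
  have hf (n m) : P.F.obj n m ◁ f₀ ≫ Prof.ev P.F Q.F n m = φ n m := Prof.lift_ev ..
  have hf' := (inserter_condition_iff P Q f₀).2 fun x n n' m' m => by
    rw [hf, hf]
    exact h x n n' m' m
  refine ⟨Inserter.lift (P := P.toInserter) (Q := Q.toInserter) f₀ hf', fun n m => ?_⟩
  rw [uev_forget]
  refine (MonoidalCategory.whiskerLeft_comp_assoc ..).symm.trans (Eq.trans ?_ (hf n m))
  exact congrArg (fun t => _ ◁ t ≫ _)
    (Inserter.lift_ι (P := P.toInserter) (Q := Q.toInserter) f₀ hf')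

end LaxProf

namespace OpticAct
variable (Q : OpticAct V C M N)

/-- The component `N(n, x n') ⊗ Q(n', m) ⟶ Q(n, x m)` of an optic action. -/
def lax (x : C) (n n' : N) (m : M) : (n ⟶[V] sm V x n') ⊗ Q.obj n' m ⟶ Q.obj n (sm V x m) :=
  (ρ_ _).inv ≫ _ ◁ eId V (sm V x m) ≫ Q.θ x n n' m (sm V x m)

/-- The other half of the Yoneda correspondence: `θ` at an identity, followed by the right action,
is `θ` of the identity composed with the given arrow. -/
lemma lax_ract (x : C) (n n' : N) (m m₁ : M) :
    Q.lax x n n' m ▷ _ ≫ Q.ract n (sm V x m) m₁ = Q.θ x n n' m m₁ := by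
  simp only [lax, comp_whiskerRight, Category.assoc]
  rw [θ_ract]
  conv_rhs => rw [← Category.id_comp (Q.θ ..), ← MonoidalCategory.whiskerLeft_id, ← e_id_comp]
  monoidal

lemma lax_ractEl (x : C) (n n' : N) (m : M) {m₁ : M} (e : 𝟙_ V ⟶ (sm V x m ⟶[V] m₁)) :
    Q.lax x n n' m ≫ (ρ_ _).inv ≫ _ ◁ e ≫ Q.ract n _ _ = (ρ_ _).inv ≫ _ ◁ e ≫ Q.θ x n n' m m₁ := by
  rw [rightUnitor_inv_naturality_assoc, ← MonoidalCategory.whisker_exchange_assoc, lax_ract]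

lemma lax_lact (x : C) (n₀ n n' : N) (m : M) :
    _ ◁ Q.lax x n n' m ≫ Q.lact n₀ n _ =
      (α_ _ _ _).inv ≫ eComp V _ _ _ ▷ _ ≫ Q.lax x n₀ n' m := by
  rw [lax, MonoidalCategory.whiskerLeft_comp_assoc, MonoidalCategory.whiskerLeft_comp_assoc,
    θ_lact, lax, rightUnitor_inv_naturality_assoc, ← MonoidalCategory.whisker_exchange_assoc]
  monoidal

/-- This is `lact_θ` at the identity of `x m`, in the form needed to descend to the coend over `N`.
-/
lemma lact_lax (x : C) (n n' n'' : N) (m : M) :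
    (_ ◁ bl (actF V C N) x n' n'' ≫ eComp V _ _ _) ▷ _ ≫ Q.lax x n n'' m =
      (α_ _ _ _).hom ≫ _ ◁ Q.lact n' n'' m ≫ Q.lax x n n' m := by
  have h := Q.lact_θ x n n' n'' m (sm V x m)
  rw [← cancel_epi ((α_ _ _ _).hom ▷ _), hom_inv_whiskerRight_assoc] at h
  rw [lax, rightUnitor_inv_naturality_assoc, ← MonoidalCategory.whisker_exchange_assoc, ← h, lax,
    rightUnitor_inv_naturality_assoc, ← MonoidalCategory.whisker_exchange_assoc]
  monoidal

/-- This is `perm_θ` at the identity of `x' m'`: there the joint left action becomes the action on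
hom-objects, and `lax_ract` turns `θ` into `lax` followed by a right action. -/
lemma perm_lax (n n' : N) (x x' : C) (m m' : M) :
    (α_ _ _ _).hom ≫ _ ◁ ((α_ _ _ _).inv ≫ (β_ _ _).hom ▷ _ ≫ (α_ _ _ _).hom) ≫
      (α_ _ _ _).inv ≫ (gact n n' x x' ⊗ₘ Q.ract n' m m') ≫ Q.lax x' n n' m' =
      Q.lax x n n' m ▷ _ ≫ _ ◁ mapM V C M x x' m m' ≫ Q.ract n _ _ := by
  have h := Q.perm_θ n n' x x' m m' (sm V x' m')
  have e : ((n ⟶[V] sm V x n') ⊗ Q.obj n' m) ◁ mapM V C M x x' m m' =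
      (ρ_ _).inv ≫ _ ◁ eId V (sm V x' m') ≫ (α_ _ _ _).hom ≫
        _ ◁ hactM V C M (sm V x' m') x x' m m' := by
    rw [mapM_eq]
    monoidal
  rw [← MonoidalCategory.whisker_exchange_assoc, lax_ract, e]
  simp only [Category.assoc]
  rw [← h, MonoidalCategory.whisker_exchange_assoc, ← rightUnitor_inv_naturality_assoc, lax]
  simp only [Category.assoc]

/-- The structure map of the lax module profunctor. -/
def laxMap (n : N) (x : C) (m : M) : postObj Q.toProf n x m ⟶ Q.obj n (sm V x m) :=
  postDesc (P := Q.toProf) (fun n' => Q.lax x n n' m) (fun n' n'' => Q.lact_lax x n n' n'' m)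

lemma postι_laxMap (n n' : N) (x : C) (m : M) :
    postι Q.toProf x n n' m ≫ Q.laxMap n x m = Q.lax x n n' m := postι_desc ..

lemma postL_laxMap (n n' : N) (x : C) (m : M) :
    postL Q.toProf n n' x m ≫ Q.laxMap n x m = _ ◁ Q.laxMap n' x m ≫ Q.lact n n' _ := by
  refine postObj_ext_left fun n'' => ?_
  rw [reassoc_of% postι_postL, postι_laxMap, ← MonoidalCategory.whiskerLeft_comp_assoc,
    postι_laxMap]
  exact (Q.lax_lact ..).symm

lemma postR_laxMap (n : N) (x x' : C) (m m' : M) :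
    postR Q.toProf n x x' m m' ≫ Q.laxMap n x' m' =
      Q.laxMap n x m ▷ _ ≫ _ ◁ mapM V C M x x' m m' ≫ Q.ract n _ _ := by
  refine postObj_ext_right fun n' => ?_
  rw [reassoc_of% postι_postR, postι_laxMap]
  refine (Q.perm_lax n n' x x' m m').trans ?_
  rw [← postι_laxMap]
  exact comp_whiskerRight_assoc ..

/-- The structure homomorphism of the lax module profunctor. -/
def laxHom : ProfHom ((actPost V C M N).obj Q.toProf) ((actPre V C M N).obj Q.toProf) :=
  Prof.homOfColl (F := Q.toProf) (H := actF V C M) (S := (actPost V C M N).obj Q.toProf)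
    (fun n p => Q.laxMap n p.1 p.2) (fun n n' p => Q.postL_laxMap n n' p.1 p.2)
    (fun n p p' => Q.postR_laxMap n p.1 p'.1 p.2 p'.2)

lemma laxApp_laxHom (x : C) (n n' : N) (m : M) :
    laxApp Q.toProf Q.laxHom x n n' m = Q.lax x n n' m := by
  have h : Q.laxHom.app n (x, m) ≫ Q.toProf.collapse (actF V C M) n (x, m) = Q.laxMap n x m :=
    Prof.homOfColl_coll ..
  exact (congrArg (postι Q.toProf x n n' m ≫ ·) h).trans (Q.postι_laxMap n n' x m)

lemma lax_lax (x y : C) (n n' n'' : N) (m : M) :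
    _ ◁ Q.lax y n' n'' m ≫ Q.lax x n n' (sm V y m) =
      (α_ _ _ _).inv ≫ gcomp x y n n' n'' ▷ _ ≫ Q.lax (tmul V x y) n n'' m ≫
        (ρ_ _).inv ≫ _ ◁ (aM V x y m).hom ≫ Q.ract n _ _ := by
  -- Both sides are instances of `θ`; the associativity law at two identities produces `hcomp0` of
  -- these identities, which is the associator of the module.
  have e : eId V (sm V y m) ≫ (ρ_ _).inv ≫ _ ◁ eId V _ ≫ hcomp0 x y (sm V x (sm V y m)) _ m =
      (aM V x y m).hom := by
    rw [hcomp0, MonoidalCategory.whisker_exchange_assoc, ← rightUnitor_inv_naturality_assoc,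
      reassoc_of% e_comp_id, reassoc_of% bl_id, id_pre]
  rw [lax_ractEl, lax, lax, MonoidalCategory.whiskerLeft_comp_assoc,
    MonoidalCategory.whiskerLeft_comp_assoc, two_outer_left (Q.assoc x y n n' n'' m _ _), ← e,
    MonoidalCategory.tensorHom_def', Category.assoc,
    rightUnitor_inv_naturality_assoc (gcomp x y n n' n'' ▷ _),
    ← MonoidalCategory.whisker_exchange_assoc (gcomp x y n n' n'' ▷ _)]
  monoidal

/-- The lax module profunctor of an optic action. -/
def toLaxProf : LaxProf V C M N where
  F := Q.toProf
  φ := Q.laxHom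
  assoc x y n n' n'' m := by
    rw [laxApp_laxHom, laxApp_laxHom, laxApp_laxHom]
    exact Q.lax_lax x y n n' n'' m
  unit n m := by
    rw [laxApp_laxHom]
    refine Eq.trans ?_ (Q.unit n m)
    exact congrArg (fun t => (λ_ _).inv ≫ (uM V C n).inv ▷ _ ≫ t) (Q.lax_ractEl ..)

lemma toLaxProf_θ (x : C) (n n' : N) (m' m : M) :
    Q.toLaxProf.θ x n n' m' m = Q.θ x n n' m' m :=
  (congrArg (fun t => t ▷ _ ≫ Q.ract n _ m) (Q.laxApp_laxHom x n n' m')).trans (Q.lax_ract ..)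

end OpticAct

variable (V C M N) in
-- The criterion for optic actions applies to the mates `LaxProf.θ`. In the converse direction, the
-- profunctor and the structure homomorphism built from an optic action return the same `θ`.
theorem exists_lax_equivalence :
    ∃ F : EnrichedFunctor V (LaxProf V C M N) (Presheaf V (EM (MHN V C M N))),
      IsVEquivalence F ∧ ∀ m n, Nonempty (VNatIso (F.comp V (Presheaf.evF V ⟨(op m, n)⟩))
        ((LaxProf.forget V C M N).comp V (Prof.evF n m))) := by
  refine exists_optic_equivalence
    (fun n m => (LaxProf.forget V C M N).comp V (Prof.evF n m))
    (fun P x n n' m' m => P.θ x n n' m' m)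
    (fun P => P.θ_dinat) (fun P => P.θ_assoc) (fun P => P.θ_unit)
    (fun P Q X f g h => Inserter.hom_ext (Prof.hom_ext fun n m => ?_))
    (fun P Q x n n' m' m => LaxProf.θ_uev P Q x n n' m' m)
    (fun P Q X φ h => LaxProf.exists_lift P Q φ h)
    (fun Q => ⟨Q.toLaxProf, fun n m => Iso.refl _, fun x n n' m' m => ?_⟩)
  · refine (MonoidalCategory.whiskerLeft_comp_assoc ..).trans (Eq.trans ?_
      (MonoidalCategory.whiskerLeft_comp_assoc ..).symm)
    have := h n m
    rw [LaxProf.uev_forget] at this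
    exact this
  · rw [OpticAct.toLaxProf_θ]
    refine (Category.comp_id _).trans (Eq.symm ?_)
    refine (congrArg (fun t => t ▷ _ ≫ _) (MonoidalCategory.whiskerLeft_id _ _)).trans ?_
    exact (congrArg (· ≫ _) (id_whiskerRight _ _)).trans (Category.id_comp _)

end Lax

end KK

end

theorem mainTheorem6 {V : Type w} [Category.{u} V] [MonoidalCategory V] [SymmetricCategory V]
    [MonoidalClosed V] [HasLimits V] [HasColimits V]
    (C : Type u) [EnrichedCategory V C] [MonoidalVCat V C]
    (M : Type u) [EnrichedCategory V M] [LeftModule V C M]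
    (N : Type u) [EnrichedCategory V N] [LeftModule V C N] :
    (∃ E : EnrichedFunctor V (OmegaMod V C M N) (Presheaf V (EM (MHN V C M N))),
      IsVEquivalence E ∧
        ∀ (m : M) (n : N), Nonempty (VNatIso (E.comp V (Presheaf.evF V ⟨(op m, n)⟩))
          ((OmegaMod.forget V C M N).comp V (Prof.evF n m)))) ∧
    (∃ E : EnrichedFunctor V (LMod (MHN V C M N) PUnit.{u + 1})
        (Presheaf V (EM (MHN V C M N))),
      IsVEquivalence E ∧
        ∀ (m : M) (n : N), Nonempty (VNatIso (E.comp V (Presheaf.evF V ⟨(op m, n)⟩))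
          ((LMod.forget (MHN V C M N) PUnit.{u + 1}).comp V (Prof.evF (op m, n) PUnit.unit)))) ∧
    (∃ E : EnrichedFunctor V (LaxProf V C M N) (Presheaf V (EM (MHN V C M N))),
      IsVEquivalence E ∧
        ∀ (m : M) (n : N), Nonempty (VNatIso (E.comp V (Presheaf.evF V ⟨(op m, n)⟩))
          ((LaxProf.forget V C M N).comp V (Prof.evF n m)))) ∧
    (∃ E : EnrichedFunctor V (Prof V PUnit.{u + 1} (EM (MHN V C M N)))
        (Presheaf V (EM (MHN V C M N))),
      IsVEquivalence E ∧
        ∀ (m : M) (n : N), Nonempty (VNatIso (E.comp V (Presheaf.evF V ⟨(op m, n)⟩))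
          (Prof.evF ⟨(op m, n)⟩ PUnit.unit))) := by
  -- These two cases hold for every promonad and every small `V`-category respectively; they are
  -- specialised to `MHN` and to its Eilenberg–Moore `V`-category.
  obtain ⟨F, hF, h⟩ := exists_lmod_equivalence (MHN V C M N)
  obtain ⟨G, hG, k⟩ := exists_prof_unit_equivalence V (EM (MHN V C M N))
  exact ⟨exists_omega_equivalence V C M N, ⟨F, hF, fun m n => h ⟨(op m, n)⟩⟩,
    exists_lax_equivalence V C M N, G, hG, fun m n => k ⟨(op m, n)⟩⟩
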